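/- **Setting.** Let $L/K$ be a finite separable field extension, $\Gamma$ an archimedean totally ordered abelian group, $\nu:K\to\Gamma\cup\{\infty\}$ a non-trivial (hence rank one) valuation with valuation ring $R_\nu$, and $\nu':L\to\Gamma\cup\{\infty\}$ an extension of $\nu$. Let $L=K[x]$, let $f\in K[X]$ be the minimal polynomial of $x$ over $K$, $n=\deg f$, and assume $f=X^n+\sum_{i<n}a_iX^i$ with $\nu(a_i)>0$ for all $i<n$. Let $p$ be the characteristic exponent of the residue field of $\nu$ ($p=1$ if the residue characteristic is $0$). For $\beta\in\Gamma$ put $\mathbf P'_\beta=\{y\in L: \nu'(y)\ge\beta\}$, $\mathbf P'_{\beta+}=\{y\in L:\nu'(y)>\beta\}$ and $G_{\nu'}=\bigoplus_\beta \mathbf P'_\beta/\mathbf P'_{\beta+}$; define $G_\nu\subset G_{\nu'}$ in the same way from $K$. Let $\mathrm{in}\,y\in G_{\nu'}$ be the class of $y\ne0$ in degree $\nu'(y)$, and $\mathrm{in}\,0=0$. For a subalgebra $A\subset G_{\nu'}$ let $A^*$ be the set of fractions $g/h$ in $G_{\nu'}$ with $g,h\in A$, $h\ne0$ homogeneous.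 For $h\in K[X]$ write $\nu'(h)=\nu'(h(x))$ and $\mathrm{in}\,h=\mathrm{in}\,h(x)$. For a monic non-constant $q\in K[X]$, write $h=\sum_j d_jq^j$ with $\deg d_j<\deg q$. For a weight $b$, the $b$-initial form of $h$ with respect to $q$ is $\sum_j \mathrm{in}(d_j)\bar X^j$, summed over the $j$ for which $\nu'(d_j)+jb$ is minimal. Take $b=\nu'(q)$: denote that minimum by $\nu_q(h)$ and the initial form by $\mathrm{in}_q h$, and write $f=\sum_j a_jq^j$, $\delta_q=\deg \mathrm{in}_qf$ and $\nu_q^+=\min_{j>\delta_q}\nu'(a_jq^j)$ ($=\infty$ if $f$ has no such terms). **Key polynomials.** A *system of key polynomials* for $\nu'$ is a family $\mathbf Q=\{Q_i\}_{i<\lambda}$ of polynomials in $K[X]$ indexed by the ordinals below some $\lambda$, with $Q_0=X$, produced by the following rules. Suppose $Q_i$ is known for $i\le l$. If $Q_l(x)=0$, stop, with $\lambda=l+1$. Otherwise let $g$ be the monic minimal polynomial of $\mathrm{in}\,Q_l$ over $G_\nu[\mathrm{in}\,Q_i: i<l]^*$, and write $q=Q_l$, $\delta=\delta_q$. Call $l$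 *special* if $\deg g=1$ and $\mathrm{in}_{q}f=\mathrm{in}(a_\delta)\,g^{\delta}$. * If $l$ is not special, put $Q_{l+1}=q^{\alpha}+\sum_{j<\alpha}d_jq^j$ with $\alpha=\deg g$, where $\deg d_j<\deg q$ and $\mathrm{in}\,d_j$ is the coefficient of $\bar X^j$ in $g$. * If $l$ is special, let $T$ be the set of expressions $q+z_0+\dots+z_r$, $r\ge 0$, where $z_k\in K[X]$, $\deg z_k<\deg q$, $\nu'(q)=\nu'(z_0)<\nu'(z_1)<\dots<\nu'(z_r)$, such that: (i) if $a'_j$ are the coefficients of the expansion of $f$ in powers of $q+z_0+\dots+z_r$, then $\nu'(a'_\delta)+\delta\nu'(z_r)<\nu'(a'_j)+j\nu'(z_r)$ for all $j<\delta$; (ii) for every $k<r$, the $\nu'(z_k)$-initial form of $f$ with respect to $q+z_0+\dots+z_{k-1}$ is $\mathrm{in}(a''_\delta)(\bar X+\mathrm{in}\,z_k)^\delta$, where $a''_\delta$ is the $\delta$-th coefficient of the expansion of $f$ in powers of $q+z_0+\dots+z_{k-1}$. An element of $T$ precedes those obtained from it by adding further terms. Proceed by one of the following rules. Rules (b) and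 (c) are available if $p>1$ or $\nu_q^+=\infty$. (a) (Only if $p=1$.) Let $u=a_{\delta-1}(x)/(\delta a_\delta(x))$ and write $u=z_0(x)+\dots+z_{M-1}(x)+\phi+w\,(q(x)+u)$, where $\phi,w\in L$, $z_k\in K[X]$, $\deg z_k<\deg q$, $\nu'(u)=\nu'(z_0)<\dots<\nu'(z_{M-1})$, $\nu'(z_k)+\nu_q(f)<\nu_q^++\nu'(q)\le \nu_q(f)+\nu'(\phi)$ for all $k<M$, and $\nu'(w)>0$. Let $r<M$ be the largest index with $q+z_0+\dots+z_r\in T$, and put $Q_{l+k}=q+z_0+\dots+z_{k-1}$ for $1\le k\le r+1$. (b) Choose a maximal element $q+z_0+\dots+z_r$ of $T$, if there is one, and put $Q_{l+k}=q+z_0+\dots+z_{k-1}$ for $1\le k\le r+1$. (c) If $T$ has no maximal element, choose $z_0,z_1,\dots$ with $q+z_0+\dots+z_r\in T$ for all $r$ and such that the values $\nu'(q+z_0+\dots+z_r)$ are cofinal in $\{\nu'(Q'):Q'\in T\}$, and put $Q_{l+t}=q+z_0+\dots+z_{t-1}$ for $t\in\mathbb N$. If $p=1$ or these values are unbounded in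 $\Gamma$, stop, with $\lambda=l+\omega$. Otherwise choose a monic polynomial $Q_{l+\omega}$ of degree $p^{e}\deg q$, $e\ge1$, such that for some $t\in\mathbb N$ the expansion $Q_{l+\omega}=\sum_j c_jQ_{l+t}^j$, $\deg c_j<\deg Q_{l+t}$, has $c_j=0$ for all $j>0$ that are not powers of $p$, and such that $\nu'(Q_{l+\omega})>p^{e}\nu'(Q_{l+s})$ for all $s\in\mathbb N$, with $e$ as small as possible; continue with $l+\omega$. If these rules are applied infinitely often, through indices with supremum $\lambda$, stop with $\{Q_i\}_{i<\lambda}$ if $p=1$ or the values $\nu'(Q_i)$ are unbounded in $\Gamma$. **Theorem.** There exists a system of key polynomials for $\nu'$. Every system of key polynomials $\mathbf Q=\{Q_i\}_{i<\lambda}$ is a complete set of key polynomials for $\nu'$: for every $\beta\in\Gamma$ the $R_\nu$-module $\mathbf P'_\beta$ is generated by the monomials $c\prod_i Q_i(x)^{\gamma_i}$ ($c\in K$, $\gamma_i\in\mathbb N$, almost all $\gamma_i=0$) of value at least $\beta$. Moreover $G_{\nu'}=G_\nu[\mathrm{in}\,\mathbf Q]^*$: every element of $G_{\nu'}$ is a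 fraction $g/h$ with $g,h\in G_\nu[\mathrm{in}\,\mathbf Q]$, $h\neq0$ homogeneous, and all such fractions exist, uniquely, in $G_{\nu'}$. **Corollary.** The valuation $\nu'$ is determined by the data $\{Q_i,\beta_i\}_{i<\lambda}$, $\beta_i=\nu'(Q_i)$: if $\nu'':L\to\Gamma\cup\{\infty\}$ is an extension of $\nu$ with $\nu''(Q_i(x))=\beta_i$ for all $i<\lambda$, then $\nu''=\nu'$. -/

import Mathlib

open Polynomial

noncomputable section

namespace KeyPolynomials

/-! ### The graded algebra of a valuation -/

section Graded

variable {Γ : Type*} [AddCommGroup Γ] [LinearOrder Γ] [IsOrderedAddMonoid Γ]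
variable {F : Type*} [Field F]

/-- `P_β`, the elements of value at least `β`. -/
def atLeast (v : AddValuation F (WithTop Γ)) (β : Γ) : AddSubgroup F where
  carrier := {y | (β : WithTop Γ) ≤ v y}
  zero_mem' := by simp [AddValuation.map_zero]
  add_mem' ha hb := v.map_le_add ha hb
  neg_mem' {a} ha := by simpa [AddValuation.map_neg] using ha

/-- `P_{β+}`, the elements of value greater than `β`. -/
def moreThan (v : AddValuation F (WithTop Γ)) (β : Γ) : AddSubgroup F where
  carrier := {y | (β : WithTop Γ) < v y}
  zero_mem' := by simp [AddValuation.map_zero]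
  add_mem' ha hb := v.map_lt_add ha hb
  neg_mem' {a} ha := by simpa [AddValuation.map_neg] using ha

/-- The homogeneous component `P_β / P_{β+}` of degree `β`. -/
abbrev Component (v : AddValuation F (WithTop Γ)) (β : Γ) : Type _ :=
  atLeast v β ⧸ (moreThan v β).addSubgroupOf (atLeast v β)

/-- The class in `P_β / P_{β+}` of an element of `P_β`. -/
def cls (v : AddValuation F (WithTop Γ)) {β : Γ} (a : F) (ha : (β : WithTop Γ) ≤ v a) :
    Component v β :=
  QuotientAddGroup.mk (⟨a, ha⟩ : atLeast v β)

theorem mul_mem_atLeast (v : AddValuation F (WithTop Γ)) {i j : Γ} {a b : F}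
    (ha : (i : WithTop Γ) ≤ v a) (hb : (j : WithTop Γ) ≤ v b) :
    ((i + j : Γ) : WithTop Γ) ≤ v (a * b) := by
  rw [v.map_mul, WithTop.coe_add]
  exact add_le_add ha hb

/-- Multiplication by an element of `P_i`, as a map `P_j / P_{j+} → P_{i+j} / P_{(i+j)+}`. -/
def mulCls (v : AddValuation F (WithTop Γ)) (i j : Γ) (a : atLeast v i) :
    Component v j →+ Component v (i + j) :=
  QuotientAddGroup.map _ _
    (AddMonoidHom.mk' (fun b : atLeast v j =>
      (⟨a.1 * b.1, mul_mem_atLeast v a.2 b.2⟩ : atLeast v (i + j)))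
      (fun b c => Subtype.ext (mul_add a.1 b.1 c.1)))
    (by
      rintro ⟨b, hb⟩ hb'
      have hb'' : (j : WithTop Γ) < v b := hb'
      change ((i + j : Γ) : WithTop Γ) < v (a.1 * b)
      rw [v.map_mul, WithTop.coe_add]
      have ha : (i : WithTop Γ) ≤ v a.1 := a.2
      exact lt_of_lt_of_le (WithTop.add_lt_add_left WithTop.coe_ne_top hb'')
        (add_le_add_left ha _))

/-- The product `(P_i / P_{i+}) × (P_j / P_{j+}) → P_{i+j} / P_{(i+j)+}`. -/
def mulComponent (v : AddValuation F (WithTop Γ)) (i j : Γ) :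
    Component v i →+ Component v j →+ Component v (i + j) :=
  QuotientAddGroup.lift _
    (AddMonoidHom.mk' (mulCls v i j) (by
      rintro ⟨a, ha⟩ ⟨b, hb⟩
      ext ⟨c, hc⟩
      exact congrArg QuotientAddGroup.mk (Subtype.ext (add_mul a b c))))
    (by
      rintro ⟨a, ha⟩ ha'
      have ha'' : (i : WithTop Γ) < v a := ha'
      ext ⟨c, hc⟩
      refine (QuotientAddGroup.eq_zero_iff _).2 ?_
      change ((i + j : Γ) : WithTop Γ) < v (a * c)
      have hc' : (j : WithTop Γ) ≤ v c := hc
      rw [v.map_mul, WithTop.coe_add]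
      exact lt_of_lt_of_le (WithTop.add_lt_add_right WithTop.coe_ne_top ha'')
        (add_le_add_right hc' _))

theorem mulComponent_cls (v : AddValuation F (WithTop Γ)) {i j : Γ} {a b : F}
    (ha : (i : WithTop Γ) ≤ v a) (hb : (j : WithTop Γ) ≤ v b) :
    mulComponent v i j (cls v a ha) (cls v b hb) = cls v (a * b) (mul_mem_atLeast v ha hb) :=
  rfl

theorem exists_cls (v : AddValuation F (WithTop Γ)) {i : Γ} (y : Component v i) :
    ∃ (a : F) (ha : (i : WithTop Γ) ≤ v a), y = cls v a ha := by
  obtain ⟨⟨a, ha⟩, rfl⟩ := QuotientAddGroup.mk_surjective y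
  exact ⟨a, ha, rfl⟩

theorem mk_cls_congr (v : AddValuation F (WithTop Γ)) {i j : Γ} {a b : F}
    (ha : (i : WithTop Γ) ≤ v a) (hb : (j : WithTop Γ) ≤ v b) (hij : i = j) (hab : a = b) :
    (GradedMonoid.mk i (cls v a ha) : GradedMonoid (Component v)) =
      GradedMonoid.mk j (cls v b hb) := by
  subst hij; subst hab; rfl

theorem one_mem_atLeast (v : AddValuation F (WithTop Γ)) :
    ((0 : Γ) : WithTop Γ) ≤ v 1 := by
  simp [AddValuation.map_one]

instance gOne (v : AddValuation F (WithTop Γ)) : GradedMonoid.GOne (Component v) :=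
  ⟨cls v 1 (one_mem_atLeast v)⟩

instance gMul (v : AddValuation F (WithTop Γ)) : GradedMonoid.GMul (Component v) :=
  ⟨fun {i j} a b => mulComponent v i j a b⟩

instance gCommRing (v : AddValuation F (WithTop Γ)) : DirectSum.GCommRing (Component v) where
  __ := gMul v
  __ := gOne v
  mul_zero a := map_zero _
  zero_mul {i j} b := by
    change mulComponent v i j 0 b = 0
    rw [map_zero]; rfl
  mul_add a b c := map_add _ _ _
  add_mul {i j} a b c := by
    change mulComponent v i j (a + b) c = mulComponent v i j a c + mulComponent v i j b c
    rw [map_add]; rfl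
  one_mul := by
    rintro ⟨i, a⟩
    obtain ⟨a, ha, rfl⟩ := exists_cls v a
    exact mk_cls_congr v _ _ (zero_add i) (one_mul a)
  mul_one := by
    rintro ⟨i, a⟩
    obtain ⟨a, ha, rfl⟩ := exists_cls v a
    exact mk_cls_congr v _ _ (add_zero i) (mul_one a)
  mul_assoc := by
    rintro ⟨i, a⟩ ⟨j, b⟩ ⟨k, c⟩
    obtain ⟨a, ha, rfl⟩ := exists_cls v a
    obtain ⟨b, hb, rfl⟩ := exists_cls v b
    obtain ⟨c, hc, rfl⟩ := exists_cls v c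
    exact mk_cls_congr v _ _ (add_assoc i j k) (mul_assoc a b c)
  mul_comm := by
    rintro ⟨i, a⟩ ⟨j, b⟩
    obtain ⟨a, ha, rfl⟩ := exists_cls v a
    obtain ⟨b, hb, rfl⟩ := exists_cls v b
    exact mk_cls_congr v _ _ (add_comm i j) (mul_comm a b)
  natCast n := n • cls v 1 (one_mem_atLeast v)
  natCast_zero := zero_nsmul _
  natCast_succ n := succ_nsmul _ n
  intCast n := n • cls v 1 (one_mem_atLeast v)
  intCast_ofNat n := natCast_zsmul _ n
  intCast_negSucc_ofNat n := negSucc_zsmul _ n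

/-- The graded algebra `G_v = ⨁_β P_β / P_{β+}`. -/
abbrev Gr (v : AddValuation F (WithTop Γ)) : Type _ := DirectSum Γ (Component v)

open Classical in
/-- The initial form `in_v y` of `y`: the class of `y` in degree `v y`; `in_v 0 = 0`. -/
def initial (v : AddValuation F (WithTop Γ)) (y : F) : Gr v :=
  if h : v y = ⊤ then 0
  else DirectSum.of (Component v) ((v y).untop h) (cls v y (by rw [WithTop.coe_untop]))

variable {K : Type*} [Field K]

/-- The degree `β` part of the map of graded algebras induced by a field extension. -/
def mapComponent (e : K →+* F) (v : AddValuation F (WithTop Γ)) (β : Γ) :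
    Component (v.comap e) β →+ Component v β :=
  QuotientAddGroup.map _ _
    (AddMonoidHom.mk' (fun b : atLeast (v.comap e) β => (⟨e b.1, b.2⟩ : atLeast v β))
      (fun b c => Subtype.ext (map_add e b.1 c.1)))
    (by
      rintro ⟨b, hb⟩ hb'
      exact hb')

/-- The natural homomorphism of graded algebras from the graded algebra of the restriction of `v`
to a subfield to the graded algebra of `v`. -/
def grMap (e : K →+* F) (v : AddValuation F (WithTop Γ)) : Gr (v.comap e) →+* Gr v :=
  DirectSum.toSemiring
    (fun β => (DirectSum.of (Component v) β).comp (mapComponent e v β))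
    (by
      refine DirectSum.of_eq_of_gradedMonoid_eq ?_
      exact mk_cls_congr v _ _ rfl (map_one e))
    (by
      intro i j a b
      obtain ⟨a, ha, rfl⟩ := exists_cls _ a
      obtain ⟨b, hb, rfl⟩ := exists_cls _ b
      simp only [AddMonoidHom.comp_apply, DirectSum.of_mul_of]
      refine DirectSum.of_eq_of_gradedMonoid_eq ?_
      exact mk_cls_congr v (a := e (a * b)) (b := e a * e b) _ _ rfl (map_mul e a b))

end Graded

/-! ### Newton polygons and initial forms -/

section Newton

variable {K L Γ : Type*} [Field K] [Field L] [Algebra K L]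
  [AddCommGroup Γ] [LinearOrder Γ] [IsOrderedAddMonoid Γ]
  (ν' : AddValuation L (WithTop Γ)) (x : L)

/-- `ν'(h)`, the value of `h(x)`. -/
def val (h : K[X]) : WithTop Γ := ν' (aeval x h)

/-- The coefficient `d_j` in the `q`-adic expansion `h = ∑ d_j q ^ j`, `deg d_j < deg q`, of `h`
with respect to a monic polynomial `q`. -/
def digit (q h : K[X]) (j : ℕ) : K[X] := (h /ₘ q ^ j) %ₘ q

/-- The minimum over `j` of `ν'(d_j) + j b`, where `h = ∑ d_j q ^ j` is the `q`-adic expansion. -/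
def newtonVal (q : K[X]) (b : WithTop Γ) (h : K[X]) : WithTop Γ :=
  (Finset.range (h.natDegree + 1)).inf fun j => val ν' x (digit q h j) + j • b

open Classical in
/-- The sum of `in(d_j) Xʲ` over those `j` for which `ν'(d_j) + j b` is minimal: the initial form
of `h = ∑ d_j q ^ j` when the weight `b` is assigned to `q`. -/
def initialForm (q : K[X]) (b : WithTop Γ) (h : K[X]) : (Gr ν')[X] :=
  ∑ j ∈ (Finset.range (h.natDegree + 1)).filter
      (fun j => val ν' x (digit q h j) + j • b = newtonVal ν' x q b h),
    monomial j (initial ν' (aeval x (digit q h j)))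

/-- `δ(h)`, the ordinate of the pivotal vertex of the Newton polygon of `h` with respect to `q`. -/
def pivot (q h : K[X]) : ℕ := (initialForm ν' x q (val ν' x q) h).natDegree

/-- `ν⁺(h)`, the minimum of `ν'(d_j q ^ j)` over `j > δ(h)`; it is `⊤` if there are no such terms. -/
def valAbove (q h : K[X]) : WithTop Γ :=
  (Finset.Ioc (pivot ν' x q h) h.natDegree).inf fun j =>
    val ν' x (digit q h j) + j • val ν' x q

variable (K) in
/-- The subalgebra of `G_{ν'}` generated over (the image of) the graded algebra of `ν' ∣ K` by the
initial forms of the elements of `S`. -/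
def gradedAdjoin (S : Set L) : Subring (Gr ν') :=
  Subring.closure (Set.range (grMap (algebraMap K L) ν') ∪ initial ν' '' S)

variable {ν'} in
/-- The fractions `g / h` which lie in `G_{ν'}`, where `g, h ∈ A` and `h` is homogeneous and
nonzero. -/
def saturation (A : Subring (Gr ν')) : Set (Gr ν') :=
  {y | ∃ h ∈ A, (∃ β c, h = DirectSum.of (Component ν') β c) ∧ h ≠ 0 ∧ h * y ∈ A}

variable {ν'} in
/-- `g` is a minimal monic relation satisfied by `y` with coefficients in `A`: no nonzero polynomial
of smaller degree with coefficients in `A` vanishes at `y`. -/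
def IsMinimalRelation (A : Set (Gr ν')) (y : Gr ν') (g : (Gr ν')[X]) : Prop :=
  g.Monic ∧ (∀ j, g.coeff j ∈ A) ∧ g.eval y = 0 ∧
    ∀ g' : (Gr ν')[X], g' ≠ 0 → (∀ j, g'.coeff j ∈ A) → g'.eval y = 0 →
      g.natDegree ≤ g'.natDegree

end Newton

/-! ### The construction of key polynomials -/

section Construction

variable {K L Γ : Type*} [Field K] [Field L] [Algebra K L]
  [AddCommGroup Γ] [LinearOrder Γ] [IsOrderedAddMonoid Γ]
  (ν' : AddValuation L (WithTop Γ)) (x : L) (p : ℕ)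

/-- `G_ν[in Q_i, i < l]^*`. -/
def gradedBelow (Q : Ordinal.{0} → K[X]) (l : Ordinal.{0}) : Set (Gr ν') :=
  saturation (gradedAdjoin K ν' ((fun i => aeval x (Q i)) '' Set.Iio l))

/-- The special case: the minimal relation `g` of `in Q_l` over `G_ν[in Q_i, i < l]^*` is linear,
and the initial form of the minimal polynomial `f` of `x` is `in(a_δ) g ^ δ`. -/
def Special (Q : Ordinal.{0} → K[X]) (l : Ordinal.{0}) : Prop :=
  ∃ g : (Gr ν')[X], IsMinimalRelation (gradedBelow ν' x Q l) (initial ν' (aeval x (Q l))) g ∧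
    g.natDegree = 1 ∧
    initialForm ν' x (Q l) (val ν' x (Q l)) (minpoly K x) =
      C (initial ν' (aeval x
          (digit (Q l) (minpoly K x) (pivot ν' x (Q l) (minpoly K x))))) *
        g ^ pivot ν' x (Q l) (minpoly K x)

/-- `Q_{l+1}` is a lifting of the minimal relation of `in Q_l` over `G_ν[in Q_i, i < l]^*`. -/
def LiftStep (Q : Ordinal.{0} → K[X]) (l : Ordinal.{0}) : Prop :=
  ∃ (g : (Gr ν')[X]) (d : ℕ → K[X]),
    IsMinimalRelation (gradedBelow ν' x Q l) (initial ν' (aeval x (Q l))) g ∧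
    (∀ j < g.natDegree, (d j).degree < (Q l).degree ∧
      initial ν' (aeval x (d j)) = g.coeff j) ∧
    Q (l + 1) = Q l ^ g.natDegree + ∑ j ∈ Finset.range g.natDegree, d j * Q l ^ j

/-- `q + z_0 + ⋯ + z_{k-1}`. -/
def partialSum (q : K[X]) (z : ℕ → K[X]) (k : ℕ) : K[X] := q + ∑ i ∈ Finset.range k, z i

/-- `q + z_0 + ⋯ + z_r` belongs to the set `T`. Here `δ` is the pivotal ordinate of the minimal
polynomial `f` of `x` with respect to `q`. The values of the `z_k` increase, starting with `ν'(q)`;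
the side of the Newton polygon of `f` with respect to `q + z_0 + ⋯ + z_r` whose upper endpoint has
ordinate `δ` is determined by an element of `Γ` greater than `ν'(z_r)`; for `k < r`, the initial
form of `f` along the corresponding side for `q + z_0 + ⋯ + z_{k-1}` is
`in(a_δ) (X + in z_k) ^ δ`. -/
def MemT (q : K[X]) (z : ℕ → K[X]) (r : ℕ) : Prop :=
  (∀ k ≤ r, (z k).degree < q.degree) ∧
  val ν' x (z 0) = val ν' x q ∧
  (∀ k < r, val ν' x (z k) < val ν' x (z (k + 1))) ∧
  (∀ j < pivot ν' x q (minpoly K x),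
    val ν' x (digit (partialSum q z (r + 1)) (minpoly K x) (pivot ν' x q (minpoly K x))) +
        pivot ν' x q (minpoly K x) • val ν' x (z r) <
      val ν' x (digit (partialSum q z (r + 1)) (minpoly K x) j) + j • val ν' x (z r)) ∧
  ∀ k < r, initialForm ν' x (partialSum q z k) (val ν' x (z k)) (minpoly K x) =
    C (initial ν' (aeval x
        (digit (partialSum q z k) (minpoly K x) (pivot ν' x q (minpoly K x))))) *
      (X + C (initial ν' (aeval x (z k)))) ^ pivot ν' x q (minpoly K x)

/-- `q + z_0 + ⋯ + z_r` is a maximal element of `T`. -/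
def MaximalT (q : K[X]) (z : ℕ → K[X]) (r : ℕ) : Prop :=
  MemT ν' x q z r ∧
    ∀ (z' : ℕ → K[X]) (r' : ℕ), r < r' → (∀ k ≤ r, z' k = z k) → ¬ MemT ν' x q z' r'

/-- The rule in residue characteristic zero. With `f = ∑ a_j q ^ j` and `u = a_{δ-1} / (δ a_δ)`,
one has `u = z_0 + ⋯ + z_{M-1} + φ + w (q + u)` in `L`, where the `z_k` have increasing values
smaller than `ν⁺(f) - ν_q(f) + ν'(q)`, the value of `φ` is at least this bound and `w` has positive
value; `r < M` is the largest index for which `q + z_0 + ⋯ + z_r` is in `T`. -/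
def TschirnhausBlock (q : K[X]) (z : ℕ → K[X]) (r : ℕ) : Prop :=
  ∃ (M : ℕ) (u φ w : L), r < M ∧
    u = aeval x (digit q (minpoly K x) (pivot ν' x q (minpoly K x) - 1)) /
      ((pivot ν' x q (minpoly K x) : L) *
        aeval x (digit q (minpoly K x) (pivot ν' x q (minpoly K x)))) ∧
    (∀ k < M, (z k).degree < q.degree) ∧
    val ν' x (z 0) = ν' u ∧
    (∀ k, k + 1 < M → val ν' x (z k) < val ν' x (z (k + 1))) ∧
    (∀ k < M, val ν' x (z k) + newtonVal ν' x q (val ν' x q) (minpoly K x) <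
      valAbove ν' x q (minpoly K x) + val ν' x q) ∧
    u = (∑ k ∈ Finset.range M, aeval x (z k)) + φ + w * (aeval x q + u) ∧
    valAbove ν' x q (minpoly K x) + val ν' x q ≤
      newtonVal ν' x q (val ν' x q) (minpoly K x) + ν' φ ∧
    0 < ν' w ∧
    MemT ν' x q z r ∧
    ∀ k, r < k → k < M → ¬ MemT ν' x q z k

/-- The rule governed by the set `T` is applied unless the residue characteristic is zero and there
are terms above the pivotal vertex. -/
def UsesT (q : K[X]) : Prop := p ≠ 1 ∨ valAbove ν' x q (minpoly K x) = ⊤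

/-- In the special case, `Q_{l+1}, …, Q_{l+m}` are defined simultaneously. -/
def FiniteBlock (Q : Ordinal.{0} → K[X]) (l : Ordinal.{0}) (m : ℕ) : Prop :=
  ∃ (z : ℕ → K[X]) (r : ℕ), m = r + 1 ∧
    (∀ k ≤ m, Q (l + (k : Ordinal.{0})) = partialSum (Q l) z k) ∧
    ((p = 1 ∧ TschirnhausBlock ν' x (Q l) z r) ∨
      (UsesT ν' x p (Q l) ∧ MaximalT ν' x (Q l) z r))

/-- In the special case, if `T` has no maximal element, `Q_{l+t}` is defined simultaneously for all
natural numbers `t`, the values being cofinal in the set of values of the elements of `T`. -/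
def InfiniteBlock (Q : Ordinal.{0} → K[X]) (l : Ordinal.{0}) : Prop :=
  UsesT ν' x p (Q l) ∧
  (¬ ∃ z r, MaximalT ν' x (Q l) z r) ∧
  ∃ z : ℕ → K[X], (∀ r, MemT ν' x (Q l) z r) ∧
    (∀ t : ℕ, Q (l + (t : Ordinal.{0})) = partialSum (Q l) z t) ∧
    ∀ z' r', MemT ν' x (Q l) z' r' →
      ∃ t : ℕ, val ν' x (partialSum (Q l) z' (r' + 1)) ≤ val ν' x (Q (l + (t : Ordinal.{0})))

/-- `h` is monic of degree `p ^ e` in `q` and all its `q`-adic coefficients `d_j`, `j > 0`, vanish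
unless `j` is a power of `p`. -/
def IsWeaklyAffine (q : K[X]) (e : ℕ) (h : K[X]) : Prop :=
  h.Monic ∧ h.natDegree = p ^ e * q.natDegree ∧
    ∀ j, 0 < j → digit q h j ≠ 0 → ∃ i : ℕ, j = p ^ i

/-- `h` is a weakly affine expansion of degree `p ^ e`, `e ≥ 1`, in one of the `Q_{l+t}`, such that
`p ^ e ν'(Q_{l+s}) < ν'(h)` for all `s`. -/
def IsLimitPolynomial (Q : Ordinal.{0} → K[X]) (l : Ordinal.{0}) (e : ℕ) (h : K[X]) : Prop :=
  1 ≤ e ∧ (∃ t : ℕ, IsWeaklyAffine p (Q (l + (t : Ordinal.{0}))) e h) ∧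
    ∀ s : ℕ, p ^ e • val ν' x (Q (l + (s : Ordinal.{0}))) < val ν' x h

/-- The key polynomial `Q_{l+ω}` after a sequence `Q_{l+t}`, `t ∈ ℕ`, with bounded values. -/
def LimitStep (Q : Ordinal.{0} → K[X]) (l : Ordinal.{0}) : Prop :=
  p ≠ 1 ∧
  (∃ b : Γ, ∀ t : ℕ, val ν' x (Q (l + (t : Ordinal.{0}))) ≤ b) ∧
  ∃ e, IsLimitPolynomial ν' x p Q l e (Q (l + Ordinal.omega0)) ∧
    ∀ e' h, IsLimitPolynomial ν' x p Q l e' h → e ≤ e'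

/-- `Step l l'`: the key polynomials `Q_i` with `i ≤ l` being known, those with `l < i ≤ l'` are
obtained by one application of the rules of construction. -/
inductive Step (Q : Ordinal.{0} → K[X]) : Ordinal.{0} → Ordinal.{0} → Prop
  | lift (l : Ordinal.{0}) : aeval x (Q l) ≠ 0 → ¬ Special ν' x Q l → LiftStep ν' x Q l →
      Step Q l (l + 1)
  | block (l : Ordinal.{0}) (m : ℕ) : aeval x (Q l) ≠ 0 → Special ν' x Q l →
      FiniteBlock ν' x p Q l m → Step Q l (l + (m : Ordinal.{0}))
  | limit (l : Ordinal.{0}) : aeval x (Q l) ≠ 0 → Special ν' x Q l →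
      InfiniteBlock ν' x p Q l → LimitStep ν' x p Q l → Step Q l (l + Ordinal.omega0)

/-- The values `ν'(Q_i)`, `i < lam`, are unbounded in `Γ`. -/
def Unbounded (Q : Ordinal.{0} → K[X]) (lam : Ordinal.{0}) : Prop :=
  ∀ b : Γ, ∃ i < lam, (b : WithTop Γ) < val ν' x (Q i)

/-- `{Q_i}_{i < lam}` is a well-ordered set of key polynomials produced by the construction, which
starts with `Q_0 = X` and stops when `Q_l(x) = 0`, or after an infinite sequence of key polynomials
if the residue characteristic is zero or the values tend to infinity. -/
def IsKeyPolynomialSystem (lam : Ordinal.{0}) (Q : Ordinal.{0} → K[X]) : Prop :=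
  Q 0 = X ∧
  ((∃ l, Relation.ReflTransGen (Step ν' x p Q) 0 l ∧ aeval x (Q l) = 0 ∧ lam = l + 1) ∨
   (∃ l, Relation.ReflTransGen (Step ν' x p Q) 0 l ∧ aeval x (Q l) ≠ 0 ∧ Special ν' x Q l ∧
      InfiniteBlock ν' x p Q l ∧ lam = l + Ordinal.omega0 ∧ (p = 1 ∨ Unbounded ν' x Q lam)) ∨
   (∃ c : ℕ → Ordinal.{0}, Relation.ReflTransGen (Step ν' x p Q) 0 (c 0) ∧
      (∀ k, Step ν' x p Q (c k) (c (k + 1))) ∧ IsLUB (Set.range c) lam ∧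
      (p = 1 ∨ Unbounded ν' x Q lam)))

end Construction

/-! ### Complete sets -/

section Complete

variable {K L Γ : Type*} [Field K] [Field L] [Algebra K L]
  [AddCommGroup Γ] [LinearOrder Γ] [IsOrderedAddMonoid Γ]

/-- The valuation ring `R_ν`. -/
abbrev ringOf (ν : AddValuation K (WithTop Γ)) : Subring K :=
  (AddValuation.toValuation ν).integer

/-- The characteristic exponent of the residue field of `ν`. -/
def residueExpChar (ν : AddValuation K (WithTop Γ)) : ℕ :=
  ringExpChar (IsLocalRing.ResidueField (AddValuation.toValuation ν).valuationSubring)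

/-- The monomials `c ∏ q_i ^ γ_i`, `c ∈ K`, of value at least `β`. -/
def monomialsAtLeast (K : Type*) [Field K] [Algebra K L] (ν' : AddValuation L (WithTop Γ))
    {I : Type*} (q : I → L) (β : Γ) : Set L :=
  {y | ∃ (c : K) (γ : I →₀ ℕ), y = algebraMap K L c * γ.prod (fun i n => q i ^ n) ∧
    (β : WithTop Γ) ≤ ν' y}

/-- For every `β ∈ Γ`, the `R_ν`-module `P'_β` of all elements of value at least `β` is generated by
the monomials in the `q_i`, with coefficients in `K`, of value at least `β`. -/
def IsComplete (ν : AddValuation K (WithTop Γ)) (ν' : AddValuation L (WithTop Γ))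
    {I : Type*} (q : I → L) : Prop :=
  ∀ β : Γ, (Submodule.span (ringOf ν) (monomialsAtLeast K ν' q β) : Set L) = atLeast ν' β

/-- `G_{ν'} = G_ν[in q]^*`: the elements of `G_{ν'}` are exactly the fractions `g / h`, where `g` and
`h` belong to `G_ν[in q]` and `h` is homogeneous and nonzero. -/
def IsGradedComplete (K : Type*) [Field K] [Algebra K L] (ν' : AddValuation L (WithTop Γ))
    {I : Type*} (q : I → L) : Prop :=
  saturation (gradedAdjoin K ν' (Set.range q)) = Set.univ ∧
  ∀ g ∈ gradedAdjoin K ν' (Set.range q), ∀ h ∈ gradedAdjoin K ν' (Set.range q),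
    (∃ β c, h = DirectSum.of (Component ν') β c) → h ≠ 0 → ∃! y, h * y = g

end Complete

end KeyPolynomials

end

/-! A monic `q` is a key polynomial of weight `β ≤ v(q(x))` when, in a product of two polynomials of
degree less than `deg q`, the part carried over to the first power of `q` has greater value than the
product minus `β` (`IsKey`). Carries being negligible, passing to `q`-adic expansions is
multiplicative up to terms of higher weight (`IsKey.expand_mul`), and replacing `q` by `q + z` is,
up to such terms, a translation of the variable (`IsKey.expand_translate`). Polynomials of degree
less than `deg q` have approximate inverses (`IsKey.exists_inverse`), so their classes already form
the algebra of fractions `G_ν[in Q_i, i < l]^*` (`IsKey.saturation_eq_classGroup`). Conditions on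
initial forms thereby become strict inequalities between weights.

One invariant, `IsState`, is carried through the construction: `Q l` is a key polynomial, and
polynomials of smaller degree evaluate, without loss of value, to sums of monomials in the earlier
`Q i`. Every rule preserves it (`Step.isState`). For a lifted minimal relation, minimality says that
value and weight agree for polynomials of degree below that of the lifting; division by the lifting
lowers the weight by less than its value (`IsLift.isKey`). Inside a block the degree is constant,
and membership in `T` reduces to one vertex for the last weight, because `f(x) = 0` forbids a single
dominant term at the value of the key polynomial (`memT_iff`).

In a bounded infinite block the values form a Cauchy sequence, `Γ` being archimedean. A polynomial
whose value exceeds its weight for all members yields a monic one, of degree `μ deg q`, of value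
above all `μ v(Q_s)` (`IsKeySeq.exists_monic`). If `μ` is minimal, the Hasse derivatives of such a
limit lie below the critical degree, so their values are read off an expansion; whenever some
binomial coefficient is a unit, this improves the bound on a Taylor coefficient. It follows that `μ`
is a power of `p` and that the digits whose index is not a power of `p` can be dropped
(`IsKeySeq.exists_isWeaklyAffine`). Cofinality excludes `μ = 1`, so bounded infinite blocks do not
occur for `p = 1`.

An infinite sequence of steps eventually has constant degree and constant pivot of `f`. Only the
rule of residue characteristic zero survives this, and it raises the value by a fixed amount each
time (`TschirnhausBlock.add_le`, `unbounded_of_steps`). So either some `Q l` vanishes at `x`, and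
every element of `L` is a polynomial of smaller degree in `x`, or there are key polynomials of one
degree with unbounded values, and the expansion in a late one loses no value
(`IsState.mem_of_unbounded`). In all cases an element of value at least `γ` is a sum of monomials of
value at least `γ`; the statement on `G_{ν'}` and the corollary are formal consequences.

Existence rests on `exists_step`: a finite construction that has not stopped can be continued or
completed. Endless continuation forces `p = 1`, where it is itself a system. In residue
characteristic zero the point is to decompose `u`; failure would produce a bounded sequence with no
limit of its own degree, which is impossible for `p = 1`. -/

noncomputable section

namespace KeyPolynomials

/-! ### Weighted thresholds for polynomials over a valued field -/

section Weight

variable {Γ : Type*} [AddCommGroup Γ] [LinearOrder Γ] [IsOrderedAddMonoid Γ]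
variable {L : Type*} [Field L]

/-- Every coefficient of `G`, taken with its power of the variable of weight `b`, has value at
least `t`. -/
def WeightGE (v : AddValuation L (WithTop Γ)) (b t : Γ) (G : L[X]) : Prop :=
  ∀ j : ℕ, ((t - j • b : Γ) : WithTop Γ) ≤ v (G.coeff j)

/-- Every coefficient of `G`, taken with its power of the variable of weight `b`, has value greater
than `t`. -/
def WeightGT (v : AddValuation L (WithTop Γ)) (b t : Γ) (G : L[X]) : Prop :=
  ∀ j : ℕ, ((t - j • b : Γ) : WithTop Γ) < v (G.coeff j)

variable {v : AddValuation L (WithTop Γ)} {b t s : Γ} {G H : L[X]}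

theorem map_eq_top_iff [Nontrivial Γ] {y : L} : v y = ⊤ ↔ y = 0 := v.top_iff

theorem exists_coe_eq [Nontrivial Γ] {y : L} (hy : y ≠ 0) : ∃ γ : Γ, v y = γ := by
  have h : v y ≠ ⊤ := fun h => hy (map_eq_top_iff.1 h)
  exact ⟨(v y).untop h, (WithTop.coe_untop _ h).symm⟩

theorem ne_zero_of_le_coe {y : L} {γ : Γ} (h : v y ≤ γ) : y ≠ 0 := by
  rintro rfl
  rw [v.map_zero] at h
  exact absurd (top_le_iff.1 h) WithTop.coe_ne_top

theorem zero_le_natCast (v : AddValuation L (WithTop Γ)) (n : ℕ) : 0 ≤ v (n : L) := by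
  induction n with
  | zero => simp
  | succ n ih =>
    rw [Nat.cast_succ]
    exact v.map_le_add ih (by simp)

theorem lt_mul_of_lt_of_le {a c : L} (ha : (s : WithTop Γ) < v a) (hc : (t : WithTop Γ) ≤ v c) :
    ((s + t : Γ) : WithTop Γ) < v (a * c) := by
  rw [v.map_mul]
  cases h1 : v a with
  | top => simp
  | coe α =>
    cases h2 : v c with
    | top => simp
    | coe γ =>
      rw [h1] at ha; rw [h2] at hc
      norm_cast at *
      exact add_lt_add_of_lt_of_le ha hc

theorem le_nsmul_mul {a : L} (n : ℕ) (ha : (s : WithTop Γ) ≤ v a) :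
    (s : WithTop Γ) ≤ v ((n : L) * a) := by
  have := mul_mem_atLeast v (i := 0) (zero_le_natCast v n) ha
  rwa [zero_add] at this

theorem le_pow {a : L} (n : ℕ) (ha : (s : WithTop Γ) ≤ v a) :
    ((n • s : Γ) : WithTop Γ) ≤ v (a ^ n) := by
  induction n with
  | zero => simp
  | succ n ih =>
    rw [pow_succ, succ_nsmul]
    exact mul_mem_atLeast v ih ha

theorem map_pow_coe {a : L} (n : ℕ) (ha : v a = s) : v (a ^ n) = ((n • s : Γ) : WithTop Γ) := by
  rw [v.map_pow, ha, WithTop.coe_nsmul]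

theorem map_mul_coe {a c : L} (ha : v a = s) (hc : v c = t) :
    v (a * c) = ((s + t : Γ) : WithTop Γ) := by
  rw [v.map_mul, ha, hc, WithTop.coe_add]

theorem map_inv_coe {a : L} (ha : v a = s) : v a⁻¹ = ((-s : Γ) : WithTop Γ) := by
  have h0 : a ≠ 0 := ne_zero_of_le_coe ha.le
  have h := v.map_mul a a⁻¹
  rw [mul_inv_cancel₀ h0, v.map_one, ha] at h
  cases hi : v a⁻¹ with
  | top => rw [hi] at h; simp at h
  | coe γ =>
    rw [hi] at h
    norm_cast at h ⊢
    exact (neg_eq_of_add_eq_zero_right h).symm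

theorem eq_of_lt_sub {a c : L} (ha : v a = s) (h : (s : WithTop Γ) < v (c - a)) : v c = s := by
  rw [← ha] at h ⊢
  exact v.map_eq_of_lt_sub h

theorem lt_map_sub {a c : L} (ha : (s : WithTop Γ) < v a) (hc : (s : WithTop Γ) < v c) :
    (s : WithTop Γ) < v (a - c) :=
  lt_of_lt_of_le (lt_min ha hc) (v.map_sub a c)

theorem WeightGE.eval (hG : WeightGE v b t G) {y : L} (hy : (b : WithTop Γ) ≤ v y) :
    (t : WithTop Γ) ≤ v (G.eval y) := by
  rw [eval_eq_sum_range]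
  refine v.map_le_sum fun j _ => ?_
  have := mul_mem_atLeast v (hG j) (le_pow j hy)
  rwa [sub_add_cancel] at this

theorem WeightGT.ge (hG : WeightGT v b t G) : WeightGE v b t G := fun j => (hG j).le

theorem WeightGE.mono (hG : WeightGE v b t G) (h : s ≤ t) : WeightGE v b s G := fun j =>
  le_trans (WithTop.coe_le_coe.2 (sub_le_sub_right h _)) (hG j)

theorem WeightGT.mono (hG : WeightGT v b t G) (h : s ≤ t) : WeightGT v b s G := fun j =>
  lt_of_le_of_lt (WithTop.coe_le_coe.2 (sub_le_sub_right h _)) (hG j)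

/-- Only finitely many coefficients are nonzero, so the strict inequalities share a positive margin
even when `Γ` is dense. The coefficients are treated one at a time. -/
theorem WeightGT.exists_ge [Nontrivial Γ] (hG : WeightGT v b t G) :
    ∃ t' > t, WeightGE v b t' G := by
  have key : ∀ N : ℕ, ∃ t' > t, ∀ j < N, ((t' - j • b : Γ) : WithTop Γ) ≤ v (G.coeff j) := by
    intro N
    induction N with
    | zero => exact (exists_gt t).imp fun t' h => ⟨h, by simp⟩
    | succ N ih =>
      obtain ⟨t₁, h₁, h₂⟩ := ih
      have hN := hG N
      cases hv : v (G.coeff N) with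
      | top =>
        refine ⟨t₁, h₁, fun j hj => ?_⟩
        rcases Nat.lt_succ_iff_lt_or_eq.1 hj with hj | rfl
        · exact h₂ j hj
        · rw [hv]; exact le_top
      | coe γ =>
        rw [hv] at hN
        norm_cast at hN
        refine ⟨min t₁ (γ + N • b), lt_min h₁ (sub_lt_iff_lt_add.1 hN), fun j hj => ?_⟩
        rcases Nat.lt_succ_iff_lt_or_eq.1 hj with hj | rfl
        · exact le_trans (WithTop.coe_le_coe.2 (sub_le_sub_right (min_le_left _ _) _)) (h₂ j hj)
        · rw [hv]
          norm_cast
          exact sub_le_iff_le_add.2 (min_le_right _ _)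
  obtain ⟨t', h', hN⟩ := key (G.natDegree + 1)
  refine ⟨t', h', fun j => ?_⟩
  rcases lt_or_ge j (G.natDegree + 1) with hj | hj
  · exact hN j hj
  · rw [coeff_eq_zero_of_natDegree_lt hj, v.map_zero]; exact le_top

theorem exists_weightGE [Nontrivial Γ] (v : AddValuation L (WithTop Γ)) (b : Γ) (G : L[X]) :
    ∃ t, WeightGE v b t G := by
  have key : ∀ N : ℕ, ∃ t : Γ, ∀ j < N, ((t - j • b : Γ) : WithTop Γ) ≤ v (G.coeff j) := by
    intro N
    induction N with
    | zero => exact ⟨0, by simp⟩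
    | succ N ih =>
      obtain ⟨t₁, h₂⟩ := ih
      cases hv : v (G.coeff N) with
      | top =>
        refine ⟨t₁, fun j hj => ?_⟩
        rcases Nat.lt_succ_iff_lt_or_eq.1 hj with hj | rfl
        · exact h₂ j hj
        · rw [hv]; exact le_top
      | coe γ =>
        refine ⟨min t₁ (γ + N • b), fun j hj => ?_⟩
        rcases Nat.lt_succ_iff_lt_or_eq.1 hj with hj | rfl
        · exact le_trans (WithTop.coe_le_coe.2 (sub_le_sub_right (min_le_left _ _) _)) (h₂ j hj)
        · rw [hv]
          norm_cast
          exact sub_le_iff_le_add.2 (min_le_right _ _)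
  obtain ⟨t', hN⟩ := key (G.natDegree + 1)
  refine ⟨t', fun j => ?_⟩
  rcases lt_or_ge j (G.natDegree + 1) with hj | hj
  · exact hN j hj
  · rw [coeff_eq_zero_of_natDegree_lt hj, v.map_zero]; exact le_top

/-- A nonzero polynomial has a threshold which is attained; the last place where it is. -/
theorem exists_weight_attained [Nontrivial Γ] (v : AddValuation L (WithTop Γ)) (b : Γ)
    (hG : G ≠ 0) :
    ∃ (t : Γ) (δ : ℕ), WeightGE v b t G ∧ v (G.coeff δ) = ((t - δ • b : Γ) : WithTop Γ) ∧
      ∀ j, δ < j → ((t - j • b : Γ) : WithTop Γ) < v (G.coeff j) := by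
  have key : ∀ N : ℕ, (∀ j < N, G.coeff j = 0) ∨ ∃ (t : Γ) (δ : ℕ),
      (∀ j < N, ((t - j • b : Γ) : WithTop Γ) ≤ v (G.coeff j)) ∧
      v (G.coeff δ) = ((t - δ • b : Γ) : WithTop Γ) ∧
      ∀ j < N, δ < j → ((t - j • b : Γ) : WithTop Γ) < v (G.coeff j) := by
    intro N
    induction N with
    | zero => left; simp
    | succ N ih =>
      by_cases hz : G.coeff N = 0
      · refine ih.imp (fun h j hj => ?_) ?_
        · rcases Nat.lt_succ_iff_lt_or_eq.1 hj with hj | rfl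
          exacts [h j hj, hz]
        · rintro ⟨t, δ, h1, h2, h3⟩
          refine ⟨t, δ, fun j hj => ?_, h2, fun j hj => ?_⟩ <;>
            rcases Nat.lt_succ_iff_lt_or_eq.1 hj with hj | rfl
          · exact h1 j hj
          · rw [hz, v.map_zero]; exact le_top
          · exact h3 j hj
          · intro _; rw [hz, v.map_zero]; exact WithTop.coe_lt_top _
      · right
        obtain ⟨γ, hγ⟩ := exists_coe_eq (v := v) hz
        have new : (∀ j < N, ((γ + N • b - j • b : Γ) : WithTop Γ) ≤ v (G.coeff j)) →
            ∃ (t : Γ) (δ : ℕ),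
              (∀ j < N + 1, ((t - j • b : Γ) : WithTop Γ) ≤ v (G.coeff j)) ∧
              v (G.coeff δ) = ((t - δ • b : Γ) : WithTop Γ) ∧
              ∀ j < N + 1, δ < j → ((t - j • b : Γ) : WithTop Γ) < v (G.coeff j) := by
          intro h
          refine ⟨γ + N • b, N, fun j hj => ?_, by rw [hγ, add_sub_cancel_right],
            fun j hj hj' => by omega⟩
          rcases Nat.lt_succ_iff_lt_or_eq.1 hj with hj | rfl
          · exact h j hj
          · rw [hγ, add_sub_cancel_right]
        rcases ih with h | ⟨t, δ, h1, h2, h3⟩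
        · exact new fun j hj => by rw [h j hj, v.map_zero]; exact le_top
        · rcases le_or_gt (γ + N • b) t with h | h
          · exact new fun j hj =>
              le_trans (WithTop.coe_le_coe.2 (sub_le_sub_right h _)) (h1 j hj)
          · have h' : t - N • b < γ := sub_lt_iff_lt_add.2 h
            refine ⟨t, δ, fun j hj => ?_, h2, fun j hj => ?_⟩ <;>
              rcases Nat.lt_succ_iff_lt_or_eq.1 hj with hj | rfl
            · exact h1 j hj
            · rw [hγ]; exact WithTop.coe_le_coe.2 h'.le
            · exact h3 j hj
            · intro _; rw [hγ]; exact WithTop.coe_lt_coe.2 h'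
  have hz : ∀ j, G.natDegree + 1 ≤ j → G.coeff j = 0 := fun j hj =>
    coeff_eq_zero_of_natDegree_lt hj
  rcases key (G.natDegree + 1) with h | ⟨t, δ, h1, h2, h3⟩
  · exact absurd (h G.natDegree (Nat.lt_succ_self _)) (by simpa using hG)
  · refine ⟨t, δ, fun j => ?_, h2, fun j => ?_⟩ <;>
      rcases lt_or_ge j (G.natDegree + 1) with hj | hj
    · exact h1 j hj
    · rw [hz j hj, v.map_zero]; exact le_top
    · exact h3 j hj
    · intro _; rw [hz j hj, v.map_zero]; exact WithTop.coe_lt_top _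

theorem WeightGT.eval (hG : WeightGT v b t G) {y : L} (hy : (b : WithTop Γ) ≤ v y) :
    (t : WithTop Γ) < v (G.eval y) := by
  rw [eval_eq_sum_range]
  refine v.map_lt_sum WithTop.coe_ne_top fun j _ => ?_
  have := lt_mul_of_lt_of_le (hG j) (le_pow j hy)
  rwa [sub_add_cancel] at this

theorem weightGE_zero : WeightGE v b t 0 := fun j => by simp
theorem weightGT_zero : WeightGT v b t 0 := fun j => by
  rw [coeff_zero, v.map_zero]; exact WithTop.coe_lt_top _

theorem WeightGE.add (hG : WeightGE v b t G) (hH : WeightGE v b t H) : WeightGE v b t (G + H) :=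
  fun j => by rw [coeff_add]; exact v.map_le_add (hG j) (hH j)

theorem WeightGT.add (hG : WeightGT v b t G) (hH : WeightGT v b t H) : WeightGT v b t (G + H) :=
  fun j => by rw [coeff_add]; exact v.map_lt_add (hG j) (hH j)

theorem WeightGT.neg (hG : WeightGT v b t G) : WeightGT v b t (-G) :=
  fun j => by rw [coeff_neg, v.map_neg]; exact hG j

theorem WeightGT.sub (hG : WeightGT v b t G) (hH : WeightGT v b t H) : WeightGT v b t (G - H) := by
  rw [sub_eq_add_neg]; exact hG.add hH.neg

theorem WeightGE.sum {ι : Type*} {S : Finset ι} {F : ι → L[X]}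
    (h : ∀ i ∈ S, WeightGE v b t (F i)) : WeightGE v b t (∑ i ∈ S, F i) := fun j => by
  rw [finsetSum_coeff]; exact v.map_le_sum fun i hi => h i hi j

theorem WeightGT.sum {ι : Type*} {S : Finset ι} {F : ι → L[X]}
    (h : ∀ i ∈ S, WeightGT v b t (F i)) : WeightGT v b t (∑ i ∈ S, F i) := fun j => by
  rw [finsetSum_coeff]; exact v.map_lt_sum WithTop.coe_ne_top fun i hi => h i hi j

theorem WeightGE.mul (hG : WeightGE v b t G) (hH : WeightGE v b s H) :
    WeightGE v b (t + s) (G * H) := fun j => by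
  rw [coeff_mul]
  refine v.map_le_sum fun ij hij => ?_
  have := mul_mem_atLeast v (hG ij.1) (hH ij.2)
  rw [Finset.HasAntidiagonal.mem_antidiagonal] at hij
  rw [← hij]
  refine le_trans (le_of_eq ?_) this
  rw [add_nsmul]; congr 1; abel

theorem WeightGT.mul_ge (hG : WeightGT v b t G) (hH : WeightGE v b s H) :
    WeightGT v b (t + s) (G * H) := fun j => by
  rw [coeff_mul]
  refine v.map_lt_sum WithTop.coe_ne_top fun ij hij => ?_
  have := lt_mul_of_lt_of_le (hG ij.1) (hH ij.2)
  rw [Finset.HasAntidiagonal.mem_antidiagonal] at hij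
  rw [← hij]
  refine lt_of_le_of_lt (le_of_eq ?_) this
  rw [add_nsmul]; congr 1; abel

theorem weightGE_C {a : L} (ha : (t : WithTop Γ) ≤ v a) : WeightGE v b t (C a) := fun j => by
  rw [coeff_C]
  split_ifs with h
  · subst h; simpa using ha
  · simp

theorem weightGT_C {a : L} (ha : (t : WithTop Γ) < v a) : WeightGT v b t (C a) := fun j => by
  rw [coeff_C]
  split_ifs with h
  · subst h; simpa using ha
  · rw [v.map_zero]; exact WithTop.coe_lt_top _

theorem weightGE_X : WeightGE v b b (X : L[X]) := fun j => by
  rw [coeff_X]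
  split_ifs with h
  · subst h; simp
  · simp

theorem weightGE_X_add_C {a : L} (ha : (b : WithTop Γ) ≤ v a) : WeightGE v b b (X + C a) :=
  weightGE_X.add (weightGE_C ha)

theorem WeightGE.pow (hG : WeightGE v b t G) (n : ℕ) : WeightGE v b (n • t) (G ^ n) := by
  induction n with
  | zero => simpa using weightGE_C (b := b) (t := 0) (v := v) (a := 1) (by simp)
  | succ n ih => rw [pow_succ, succ_nsmul]; exact ih.mul hG

theorem WeightGT.X_mul (hG : WeightGT v b t G) : WeightGT v b (t + b) (X * G) := by
  rw [mul_comm]; exact hG.mul_ge weightGE_X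

theorem WeightGE.C_mul (hG : WeightGE v b t G) {a : L} (ha : (s : WithTop Γ) ≤ v a) :
    WeightGE v b (s + t) (C a * G) := (weightGE_C ha).mul hG

theorem WeightGE.comp (hG : WeightGE v b t G) {y : L} (hy : (b : WithTop Γ) ≤ v y) :
    WeightGE v b t (G.comp (X + C y)) := by
  rw [comp_eq_sum_left, sum_def]
  refine WeightGE.sum fun j _ => ?_
  have := ((weightGE_X_add_C (v := v) hy).pow j).C_mul (hG j)
  rwa [sub_add_cancel] at this

theorem WeightGT.comp (hG : WeightGT v b t G) {y : L} (hy : (b : WithTop Γ) ≤ v y) :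
    WeightGT v b t (G.comp (X + C y)) := by
  rw [comp_eq_sum_left, sum_def]
  refine WeightGT.sum fun j _ => ?_
  have := (weightGT_C (b := b) (hG j)).mul_ge ((weightGE_X_add_C (v := v) hy).pow j)
  rwa [sub_add_cancel] at this

theorem comp_X_add_C_add (G : L[X]) (y z : L) :
    (G.comp (X + C y)).comp (X + C z) = G.comp (X + C (y + z)) := by
  rw [comp_assoc]; congr 1; simp only [add_comp, X_comp, C_comp, C_add]; ring

theorem comp_X_add_C_neg (G : L[X]) (y : L) :
    (G.comp (X + C y)).comp (X + C (-y)) = G := by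
  rw [comp_X_add_C_add]; simp

theorem WeightGE.hasseDeriv (hG : WeightGE v b t G) (k : ℕ) :
    WeightGE v b (t - k • b) (hasseDeriv k G) := fun j => by
  rw [hasseDeriv_coeff]
  refine le_nsmul_mul _ ?_
  have := hG (j + k)
  rwa [add_nsmul, add_comm, ← sub_sub] at this

theorem WeightGE.coeff_mono {c : Γ} (hG : WeightGE v b t G) (h : b ≤ c) : WeightGE v c t G :=
  fun j => le_trans (WithTop.coe_le_coe.2 (sub_le_sub_left (nsmul_le_nsmul_right h j) _)) (hG j)

end Weight

/-! ### Expansions in powers of a monic polynomial -/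

section Expansion

variable {K L : Type*} [Field K] [Field L] [Algebra K L] (x : L)

/-- This makes digits recursive: after the first, they are the digits of the quotient by `q`.
Statements about expansions then follow by induction along repeated division. -/
theorem divByMonic_pow_succ {q : K[X]} (hq : q.Monic) (h : K[X]) (j : ℕ) :
    h /ₘ q ^ (j + 1) = (h /ₘ q) /ₘ q ^ j := by
  refine (div_modByMonic_unique ((h /ₘ q) /ₘ q ^ j) (h %ₘ q + q * ((h /ₘ q) %ₘ q ^ j))
    (hq.pow _) ⟨?_, ?_⟩).1
  · have h1 := modByMonic_add_div h q
    have h2 := modByMonic_add_div (h /ₘ q) (q ^ j)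
    linear_combination h1 + q * h2
  · have h1 : ((h /ₘ q) %ₘ q ^ j).degree < (q ^ j).degree := degree_modByMonic_lt _ (hq.pow _)
    have h2 : (h %ₘ q).degree < q.degree := degree_modByMonic_lt _ hq
    have h3 : (q ^ (j + 1)).degree = q.degree + (q ^ j).degree := by rw [pow_succ', degree_mul]
    have hq0 : q.degree ≠ ⊥ := degree_ne_bot.2 hq.ne_zero
    have hp0 : (0 : WithBot ℕ) ≤ (q ^ j).degree := zero_le_degree_iff.2 (hq.pow _).ne_zero
    refine lt_of_le_of_lt (degree_add_le _ _) (max_lt ?_ ?_)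
    · rw [h3]; exact lt_of_lt_of_le h2 (le_add_of_nonneg_right hp0)
    · rw [h3, degree_mul]
      exact WithBot.add_lt_add_left hq0 h1

theorem digit_zero (q h : K[X]) : digit q h 0 = h %ₘ q := by simp [digit]

theorem digit_succ {q : K[X]} (hq : q.Monic) (h : K[X]) (j : ℕ) :
    digit q h (j + 1) = digit q (h /ₘ q) j := by
  rw [digit, digit, divByMonic_pow_succ hq]

theorem degree_digit_lt {q : K[X]} (hq : q.Monic) (h : K[X]) (j : ℕ) :
    (digit q h j).degree < q.degree := degree_modByMonic_lt _ hq

theorem digit_eq_zero {q : K[X]} (hq : q.Monic) {h : K[X]} {j : ℕ}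
    (hj : h.natDegree < j * q.natDegree) : digit q h j = 0 := by
  rw [digit, (divByMonic_eq_zero_iff (hq.pow j)).2, zero_modByMonic]
  apply degree_lt_degree
  rwa [hq.natDegree_pow]

theorem digit_eq_zero_of_natDegree_lt {q : K[X]} (hq : q.Monic) (hd : 0 < q.natDegree) {h : K[X]}
    {j : ℕ} (hj : h.natDegree < j) : digit q h j = 0 :=
  digit_eq_zero hq (lt_of_lt_of_le hj (Nat.le_mul_of_pos_right _ hd))

/-- The `q`-adic expansion of `h`, with coefficients evaluated at `x`. -/
def expand (q h : K[X]) : L[X] :=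
  ∑ j ∈ Finset.range (h.natDegree + 1), monomial j (aeval x (digit q h j))

variable {x} {q : K[X]}

theorem coeff_expand (hq : q.Monic) (hd : 0 < q.natDegree) (h : K[X]) (j : ℕ) :
    (expand x q h).coeff j = aeval x (digit q h j) := by
  rw [expand, finsetSum_coeff]
  simp only [coeff_monomial, Finset.sum_ite_eq', Finset.mem_range]
  split_ifs with hj
  · rfl
  · rw [digit_eq_zero_of_natDegree_lt hq hd (by omega), map_zero]

theorem div_mod_add_mul (hq : q.Monic) {e : K[X]} (he : e.degree < q.degree) (g : K[X]) :
    (e + q * g) /ₘ q = g ∧ (e + q * g) %ₘ q = e :=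
  div_modByMonic_unique g e hq ⟨rfl, he⟩

theorem expand_add_mul (hq : q.Monic) (hd : 0 < q.natDegree) {e : K[X]} (he : e.degree < q.degree)
    (g : K[X]) : expand x q (e + q * g) = C (aeval x e) + X * expand x q g := by
  ext j
  rw [coeff_add, coeff_expand hq hd]
  cases j with
  | zero => rw [digit_zero, (div_mod_add_mul hq he g).2]; simp
  | succ j =>
    rw [digit_succ hq, (div_mod_add_mul hq he g).1, coeff_X_mul, coeff_expand hq hd]
    simp

theorem expand_zero : expand x q 0 = 0 := by simp [expand, digit]

theorem expand_of_degree_lt (hq : q.Monic) (hd : 0 < q.natDegree) {e : K[X]}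
    (he : e.degree < q.degree) : expand x q e = C (aeval x e) := by
  have := expand_add_mul (x := x) hq hd he 0
  simpa [expand_zero] using this

theorem div_induction (hq : q.Monic) (hd : 0 < q.natDegree) {P : K[X] → Prop} (h0 : P 0)
    (hs : ∀ e g : K[X], e.degree < q.degree → P g → P (e + q * g)) (h : K[X]) : P h := by
  induction hn : h.natDegree using Nat.strong_induction_on generalizing h with
  | _ n ih =>
    have hdiv := modByMonic_add_div h q
    rw [← hdiv]
    refine hs _ _ (degree_modByMonic_lt _ hq) ?_
    by_cases hz : h.natDegree < q.natDegree
    · rw [(divByMonic_eq_zero_iff hq).2 (degree_lt_degree hz)]; exact h0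
    · refine ih _ ?_ _ rfl
      rw [natDegree_divByMonic _ hq]
      omega

theorem expand_add (hq : q.Monic) (hd : 0 < q.natDegree) (g h : K[X]) :
    expand x q (g + h) = expand x q g + expand x q h := by
  ext j
  rw [coeff_add]
  simp only [coeff_expand hq hd]
  induction j generalizing g h with
  | zero => simp only [digit_zero, add_modByMonic, map_add]
  | succ j ih =>
    simp only [digit_succ hq]
    rw [← ih]
    congr 2
    refine (div_modByMonic_unique (g /ₘ q + h /ₘ q) (g %ₘ q + h %ₘ q) hq ⟨?_, ?_⟩).1
    · have h1 := modByMonic_add_div h q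
      have h2 := modByMonic_add_div g q
      linear_combination h1 + h2
    · exact lt_of_le_of_lt (degree_add_le _ _)
        (max_lt (degree_modByMonic_lt _ hq) (degree_modByMonic_lt _ hq))

theorem expand_mul_self (hq : q.Monic) (hd : 0 < q.natDegree) (g : K[X]) :
    expand x q (q * g) = X * expand x q g := by
  have := expand_add_mul (x := x) hq hd (e := 0) (by
    rw [degree_zero]; exact bot_lt_iff_ne_bot.2 (degree_ne_bot.2 hq.ne_zero)) g
  simpa using this

theorem eval_expand (hq : q.Monic) (hd : 0 < q.natDegree) (h : K[X]) :
    (expand x q h).eval (aeval x q) = aeval x h := by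
  induction h using div_induction hq hd with
  | h0 => simp [expand_zero]
  | hs e g he ih => rw [expand_add_mul hq hd he]; simp [ih]

/-- The polynomial with the given `q`-adic digits. -/
theorem digit_sum (hq : q.Monic) (N : ℕ) {e : ℕ → K[X]}
    (he : ∀ j < N, (e j).degree < q.degree) (j : ℕ) :
    digit q (∑ i ∈ Finset.range N, e i * q ^ i) j = if j < N then e j else 0 := by
  induction N generalizing e j with
  | zero => simp [digit]
  | succ N ih =>
    have h1 : ∑ i ∈ Finset.range (N + 1), e i * q ^ i =
        e 0 + q * ∑ i ∈ Finset.range N, e (i + 1) * q ^ i := by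
      rw [Finset.sum_range_succ', Finset.mul_sum, add_comm]
      congr 1
      · simp
      · refine Finset.sum_congr rfl fun i _ => ?_
        rw [pow_succ]; ring
    have h2 := div_mod_add_mul hq (he 0 (Nat.succ_pos _)) (∑ i ∈ Finset.range N, e (i + 1) * q ^ i)
    rw [h1]
    cases j with
    | zero => rw [digit_zero, h2.2]; simp
    | succ j =>
      rw [digit_succ hq, h2.1, ih fun j hj => he _ (Nat.succ_lt_succ hj)]
      simp

theorem sum_digit (hq : q.Monic) (h : K[X]) {N : ℕ}
    (hN : h.natDegree < N * q.natDegree) :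
    ∑ i ∈ Finset.range N, digit q h i * q ^ i = h := by
  induction N generalizing h with
  | zero => simp at hN
  | succ N ih =>
    have h1 : ∑ i ∈ Finset.range (N + 1), digit q h i * q ^ i =
        h %ₘ q + q * ∑ i ∈ Finset.range N, digit q (h /ₘ q) i * q ^ i := by
      rw [Finset.sum_range_succ', Finset.mul_sum, add_comm]
      congr 1
      · simp [digit_zero]
      · refine Finset.sum_congr rfl fun i _ => ?_
        rw [digit_succ hq, pow_succ]; ring
    rw [h1]
    by_cases hz : h.natDegree < q.natDegree
    · rw [(divByMonic_eq_zero_iff hq).2 (degree_lt_degree hz)]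
      simp [digit, (modByMonic_eq_self_iff hq).2 (degree_lt_degree hz)]
    · rw [ih, modByMonic_add_div]
      rw [natDegree_divByMonic _ hq]
      rw [Nat.succ_mul] at hN
      omega

theorem digit_of_monic (hq : q.Monic) (hd : 0 < q.natDegree) {h : K[X]} (hh : h.Monic) {m : ℕ}
    (hm : h.natDegree = m * q.natDegree) : digit q h m = 1 := by
  have h1 : (h /ₘ q ^ m).Monic := by
    refine (leadingCoeff_divByMonic_of_monic (hq.pow m) ?_).trans hh
    rw [degree_eq_natDegree (hq.pow m).ne_zero, degree_eq_natDegree hh.ne_zero, hq.natDegree_pow, hm]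
  have h2 : (h /ₘ q ^ m).natDegree = 0 := by
    rw [natDegree_divByMonic _ (hq.pow m), hq.natDegree_pow, hm, Nat.sub_self]
  rw [digit, eq_one_of_monic_natDegree_zero h1 h2, modByMonic_eq_self_iff hq]
  apply degree_lt_degree
  simpa using hd

theorem digit_ne_zero_of_natDegree (hq : q.Monic) (hd : 0 < q.natDegree) {h : K[X]} (hh : h ≠ 0) :
    digit q h (h.natDegree / q.natDegree) ≠ 0 := by
  set m := h.natDegree / q.natDegree with hm
  have h1 : h /ₘ q ^ m ≠ 0 := by
    rw [Ne, divByMonic_eq_zero_iff (hq.pow m), not_lt, degree_eq_natDegree (hq.pow m).ne_zero,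
      degree_eq_natDegree hh, hq.natDegree_pow]
    exact_mod_cast Nat.div_mul_le_self _ _
  have h2 : (h /ₘ q ^ m).degree < q.degree := by
    apply degree_lt_degree
    rw [natDegree_divByMonic _ (hq.pow m), hq.natDegree_pow]
    have := Nat.lt_div_mul_add (a := h.natDegree) hd
    rw [← hm] at this
    omega
  rwa [digit, (modByMonic_eq_self_iff hq).2 h2]

theorem aeval_ne_zero [FiniteDimensional K L] {h : K[X]} (h0 : h ≠ 0)
    (hd : h.natDegree < (minpoly K x).natDegree) : aeval x h ≠ 0 := fun hz => by
  have := natDegree_le_natDegree (minpoly.degree_le_of_ne_zero K x h0 hz)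
  omega

theorem aeval_ne_zero_of_degree_lt [FiniteDimensional K L] {h : K[X]} (h0 : h ≠ 0)
    (hd : h.degree < q.degree) (hn : q.natDegree ≤ (minpoly K x).natDegree) : aeval x h ≠ 0 :=
  aeval_ne_zero h0 (lt_of_lt_of_le (natDegree_lt_natDegree h0 hd) hn)

/-- The top digit is a nonzero polynomial of degree less than that of the minimal polynomial, so it
survives evaluation at `x`, even when `h` itself does not. -/
theorem expand_ne_zero [FiniteDimensional K L] (hq : q.Monic) (hd : 0 < q.natDegree)
    (hn : q.natDegree ≤ (minpoly K x).natDegree) {h : K[X]} (hh : h ≠ 0) : expand x q h ≠ 0 := by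
  intro hz
  have := congrArg (fun G => G.coeff (h.natDegree / q.natDegree)) hz
  simp only [coeff_expand hq hd, coeff_zero] at this
  exact aeval_ne_zero_of_degree_lt (digit_ne_zero_of_natDegree hq hd hh) (degree_digit_lt hq _ _) hn
    this

end Expansion

/-! ### Abstract key polynomials -/

section Key

variable {K L Γ : Type*} [Field K] [Field L] [Algebra K L]
  [AddCommGroup Γ] [LinearOrder Γ] [IsOrderedAddMonoid Γ]
  {v : AddValuation L (WithTop Γ)} {x : L}

/-- The monic polynomial `q` is a key polynomial of weight `β ≤ v q`: in the division
`a b = c q + d` of a product of polynomials of degree less than `deg q`, the value of `c`, increased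
by `β`, is greater than that of `a b`. -/
structure IsKey (v : AddValuation L (WithTop Γ)) (x : L) (q : K[X]) (β : Γ) : Prop where
  monic : q.Monic
  natDegree_pos : 0 < q.natDegree
  natDegree_le : q.natDegree ≤ (minpoly K x).natDegree
  le_val : (β : WithTop Γ) ≤ v (aeval x q)
  carry : ∀ (a b : K[X]) (s t : Γ), a.degree < q.degree → b.degree < q.degree →
    (s : WithTop Γ) ≤ v (aeval x a) → (t : WithTop Γ) ≤ v (aeval x b) →
    ((s + t - β : Γ) : WithTop Γ) < v (aeval x ((a * b) /ₘ q))

variable {q : K[X]} {β b s t : Γ}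

/-- Only carries spoil linearity. A carry `c` enters at the next exponent and, through the
remainder, as `-q(x) c` at the present one; together this is `c (X - q(x))`, whose weight exceeds
the expected one by more than `b - β`. -/
theorem IsKey.expand_mul_of_degree_lt (hk : IsKey v x q β)
    (hb : (b : WithTop Γ) ≤ v (aeval x q)) {a : K[X]} (ha : a.degree < q.degree)
    (hs : (s : WithTop Γ) ≤ v (aeval x a)) (h : K[X]) (hh : WeightGE v b t (expand x q h)) :
    WeightGT v b (s + t + (b - β)) (expand x q (a * h) - C (aeval x a) * expand x q h) := by
  have hq := hk.monic
  have hd := hk.natDegree_pos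
  induction h using div_induction hq hd generalizing t with
  | h0 => simpa [expand_zero] using weightGT_zero
  | hs e g he ih =>
    rw [expand_add_mul hq hd he] at hh ⊢
    have he' : (t : WithTop Γ) ≤ v (aeval x e) := by simpa using hh 0
    have hg : WeightGE v b (t - b) (expand x q g) := fun j => by
      have := hh (j + 1)
      rw [coeff_add, coeff_X_mul, coeff_C_succ, zero_add, succ_nsmul', ← sub_sub] at this
      exact this
    have hc := hk.carry a e s t ha he hs he'
    set c := (a * e) /ₘ q with hcdef
    have hdiv := modByMonic_add_div (a * e) q
    have hcdeg : c.degree < q.degree := by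
      rcases eq_or_ne c 0 with h0 | h0
      · rw [h0, degree_zero]; exact bot_lt_iff_ne_bot.2 (degree_ne_bot.2 hq.ne_zero)
      · have ha0 : a ≠ 0 := by rintro rfl; simp [hcdef] at h0
        have he0 : e ≠ 0 := by rintro rfl; simp [hcdef] at h0
        have h1 := natDegree_lt_natDegree ha0 ha
        have h2 := natDegree_lt_natDegree he0 he
        apply degree_lt_degree
        rw [hcdef, natDegree_divByMonic _ hq, natDegree_mul ha0 he0]
        omega
    have e1 : expand x q (a * (e + q * g)) =
        C (aeval x ((a * e) %ₘ q)) + X * C (aeval x c) + X * expand x q (a * g) := by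
      have : a * (e + q * g) = ((a * e) %ₘ q + q * c) + q * (a * g) := by
        rw [hdiv]; ring
      rw [this, expand_add hq hd, expand_mul_self hq hd,
        expand_add_mul hq hd (degree_modByMonic_lt _ hq), expand_of_degree_lt hq hd hcdeg]
    have e2 : aeval x ((a * e) %ₘ q) = aeval x a * aeval x e - aeval x q * aeval x c := by
      have := congrArg (aeval x) hdiv
      rw [map_add, map_mul, map_mul] at this
      linear_combination this
    have e3 : expand x q (a * (e + q * g)) - C (aeval x a) * (C (aeval x e) + X * expand x q g) =
        C (aeval x c) * (X + C (-aeval x q)) +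
          X * (expand x q (a * g) - C (aeval x a) * expand x q g) := by
      rw [e1, e2]; simp only [map_sub, map_mul, map_neg]; ring
    rw [e3]
    refine WeightGT.add ?_ ?_
    · refine ((weightGT_C (b := b) hc).mul_ge
        (weightGE_X_add_C (by rwa [v.map_neg]))).mono (le_of_eq ?_)
      abel
    · refine (ih hg).X_mul.mono (le_of_eq ?_)
      abel

theorem IsKey.expand_mul (hk : IsKey v x q β)
    (hb : (b : WithTop Γ) ≤ v (aeval x q)) (g h : K[X]) (hg : WeightGE v b s (expand x q g))
    (hh : WeightGE v b t (expand x q h)) :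
    WeightGT v b (s + t + (b - β)) (expand x q (g * h) - expand x q g * expand x q h) := by
  have hq := hk.monic
  have hd := hk.natDegree_pos
  induction g using div_induction hq hd generalizing s with
  | h0 => simpa [expand_zero] using weightGT_zero
  | hs e g he ih =>
    rw [expand_add_mul hq hd he] at hg ⊢
    have he' : (s : WithTop Γ) ≤ v (aeval x e) := by simpa using hg 0
    have hg' : WeightGE v b (s - b) (expand x q g) := fun j => by
      have := hg (j + 1)
      rw [coeff_add, coeff_X_mul, coeff_C_succ, zero_add, succ_nsmul', ← sub_sub] at this
      exact this
    have e1 : expand x q ((e + q * g) * h) -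
        (C (aeval x e) + X * expand x q g) * expand x q h =
        (expand x q (e * h) - C (aeval x e) * expand x q h) +
          X * (expand x q (g * h) - expand x q g * expand x q h) := by
      have : (e + q * g) * h = e * h + q * (g * h) := by ring
      rw [this, expand_add hq hd, expand_mul_self hq hd]; ring
    rw [e1]
    refine (hk.expand_mul_of_degree_lt hb he he' h hh).add ?_
    refine (ih hg').X_mul.mono (le_of_eq ?_)
    abel

theorem IsKey.weightGE_expand_mul (hk : IsKey v x q β) (hβ : β ≤ b)
    (hb : (b : WithTop Γ) ≤ v (aeval x q)) (g h : K[X]) (hg : WeightGE v b s (expand x q g))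
    (hh : WeightGE v b t (expand x q h)) : WeightGE v b (s + t) (expand x q (g * h)) := by
  have h1 := (hk.expand_mul hb g h hg hh).ge.mono (s := s + t)
    (le_add_of_nonneg_right (sub_nonneg.2 hβ))
  simpa using h1.add (hg.mul hh)

/-- Adding to a key polynomial a polynomial of smaller degree and sufficiently large value gives a
key polynomial. -/
theorem IsKey.add (hk : IsKey v x q β) {z : K[X]} (hz : z.degree < q.degree)
    (hzv : (β : WithTop Γ) ≤ v (aeval x z)) : IsKey v x (q + z) β := by
  have hdeg : (q + z).degree = q.degree := degree_add_eq_left_of_degree_lt hz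
  have hnat : (q + z).natDegree = q.natDegree := natDegree_eq_of_degree_eq hdeg
  refine ⟨hk.monic.add_of_left hz, by rw [hnat]; exact hk.natDegree_pos,
    by rw [hnat]; exact hk.natDegree_le, ?_, ?_⟩
  · rw [map_add]; exact v.map_le_add hk.le_val hzv
  · intro a b s t ha hb has hbt
    rw [hdeg] at ha hb
    have hq := hk.monic
    have hq' : (q + z).Monic := hk.monic.add_of_left hz
    have hd := hk.natDegree_pos
    -- If `c` is the quotient of `h` by `q`, the quotient by `q + z` is `c` minus that of `c z`. The
    -- degree of `c z` is smaller, and the carry condition for `c` and `z` bounds its quotient by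
    -- `q`, so induction on the degree applies.
    have key : ∀ (n : ℕ) (h : K[X]) (τ : Γ), h.natDegree < n →
        h.natDegree < 2 * q.natDegree →
        ((τ - β : Γ) : WithTop Γ) < v (aeval x (h /ₘ q)) →
        ((τ - β : Γ) : WithTop Γ) < v (aeval x (h /ₘ (q + z))) := by
      intro n
      induction n with
      | zero => intro h τ h1; omega
      | succ n ih =>
        intro h τ h1 h1' h2
        by_cases hlt : h.natDegree < q.natDegree
        · rw [(divByMonic_eq_zero_iff hq').2 (by rw [hdeg]; exact degree_lt_degree hlt), map_zero,
            v.map_zero]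
          exact WithTop.coe_lt_top _
        set c := h /ₘ q with hc
        have hcn : c.natDegree = h.natDegree - q.natDegree := natDegree_divByMonic _ hq
        have hcd : c.degree < q.degree := degree_lt_degree (by omega)
        have hdiv := modByMonic_add_div h q
        -- the remaining carry comes from `c z`
        have hcz := hk.carry c z (τ - β) β hcd hz h2.le hzv
        have hczd : (c * z).natDegree < h.natDegree := by
          rcases eq_or_ne z 0 with rfl | hz0
          · simp; omega
          rcases eq_or_ne c 0 with h0 | h0
          · rw [h0]; simp; omega
          have := natDegree_lt_natDegree hz0 hz
          rw [natDegree_mul h0 hz0]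
          omega
        have h3 := ih (c * z) τ (by omega) (by omega) (by
          refine lt_of_le_of_lt (le_of_eq ?_) hcz
          congr 1; abel)
        have h4 : h /ₘ (q + z) = c - (c * z) /ₘ (q + z) := by
          refine (div_modByMonic_unique _ (h %ₘ q - (c * z) %ₘ (q + z)) hq' ⟨?_, ?_⟩).1
          · have h5 := modByMonic_add_div (c * z) (q + z)
            linear_combination hdiv - h5
          · refine lt_of_le_of_lt (degree_sub_le _ _) (max_lt ?_ (degree_modByMonic_lt _ hq'))
            rw [hdeg]; exact degree_modByMonic_lt _ hq
        rw [h4, map_sub, sub_eq_add_neg (aeval x c)]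
        exact v.map_lt_add h2 (by rwa [v.map_neg])
    rcases eq_or_ne a 0 with rfl | ha0
    · rw [zero_mul, zero_divByMonic, map_zero, v.map_zero]; exact WithTop.coe_lt_top _
    rcases eq_or_ne b 0 with rfl | hb0
    · rw [mul_zero, zero_divByMonic, map_zero, v.map_zero]; exact WithTop.coe_lt_top _
    refine key _ (a * b) (s + t) (Nat.lt_succ_self _) ?_ (hk.carry a b s t ha hb has hbt)
    have h1 := natDegree_lt_natDegree ha0 ha
    have h2 := natDegree_lt_natDegree hb0 hb
    rw [natDegree_mul ha0 hb0]
    omega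

/-- Comparison of the expansions in powers of `q` and of `q + z`. -/
theorem IsKey.expand_translate (hk : IsKey v x q β) {z : K[X]} (hz : z.degree < q.degree)
    (hβ : β ≤ b) (hb : (b : WithTop Γ) ≤ v (aeval x q)) (hbz : (b : WithTop Γ) ≤ v (aeval x z))
    (h : K[X]) (hh : WeightGE v b t (expand x (q + z) h)) :
    WeightGT v b (t + (b - β)) (expand x q h - (expand x (q + z) h).comp (X + C (aeval x z))) := by
  have hq := hk.monic
  have hd := hk.natDegree_pos
  have hβz : (β : WithTop Γ) ≤ v (aeval x z) := le_trans (WithTop.coe_le_coe.2 hβ) hbz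
  have hk' := hk.add hz hβz
  have hq' := hk'.monic
  have hd' := hk'.natDegree_pos
  have hdeg : (q + z).degree = q.degree := degree_add_eq_left_of_degree_lt hz
  induction h using div_induction hq' hd' generalizing t with
  | h0 => simpa [expand_zero] using weightGT_zero
  | hs e g he ih =>
    rw [expand_add_mul hq' hd' he] at hh ⊢
    have hg' : WeightGE v b (t - b) (expand x (q + z) g) := fun j => by
      have := hh (j + 1)
      rw [coeff_add, coeff_X_mul, coeff_C_succ, zero_add, succ_nsmul', ← sub_sub] at this
      exact this
    have h1 := ih hg'
    have h2 : WeightGE v b (t - b) (expand x q g) := by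
      have := (h1.ge.mono (s := t - b) (le_add_of_nonneg_right (sub_nonneg.2 hβ))).add
        (hg'.comp hbz)
      simpa using this
    have h3 := hk.expand_mul_of_degree_lt hb hz hbz g h2
    have e1 : expand x q (e + (q + z) * g) = C (aeval x e) + X * expand x q g +
        expand x q (z * g) := by
      have : e + (q + z) * g = (e + q * g) + z * g := by ring
      rw [this, expand_add hq hd, expand_add_mul hq hd (by rwa [← hdeg])]
    have e2 : expand x q (e + (q + z) * g) -
        (C (aeval x e) + X * expand x (q + z) g).comp (X + C (aeval x z)) =
        (expand x q (z * g) - C (aeval x z) * expand x q g) +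
        (X + C (aeval x z)) *
          (expand x q g - (expand x (q + z) g).comp (X + C (aeval x z))) := by
      rw [e1]; simp only [add_comp, C_comp, mul_comp, X_comp]; ring
    rw [e2]
    refine (h3.mono (le_of_eq (by abel))).add ?_
    rw [mul_comm]
    refine (h1.mul_ge (weightGE_X_add_C hbz)).mono (le_of_eq ?_)
    abel

theorem IsKey.mod_val (hk : IsKey v x q β) {a c : K[X]} (ha : a.degree < q.degree)
    (hc : c.degree < q.degree) (hs : (s : WithTop Γ) ≤ v (aeval x a))
    (ht : (t : WithTop Γ) ≤ v (aeval x c)) :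
    ((s + t : Γ) : WithTop Γ) < v (aeval x a * aeval x c - aeval x ((a * c) %ₘ q)) := by
  have h1 := hk.carry a c s t ha hc hs ht
  have hdiv := congrArg (aeval x) (modByMonic_add_div (a * c) q)
  rw [map_add, map_mul, map_mul] at hdiv
  have h2 := lt_mul_of_lt_of_le h1 hk.le_val
  rw [sub_add_cancel, mul_comm] at h2
  rwa [← hdiv, add_sub_cancel_left]

/-- A nonzero polynomial of degree less than that of a key polynomial has an inverse up to terms of
higher value. -/
theorem IsKey.exists_inverse [Nontrivial Γ] [FiniteDimensional K L] (hk : IsKey v x q β)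
    {a : K[X]} (ha : a.degree < q.degree) (ha0 : a ≠ 0) :
    ∃ c : K[X], c.degree < q.degree ∧ c ≠ 0 ∧ (a * c) %ₘ q = 1 ∧
      0 < v (aeval x a * aeval x c - 1) ∧ v (aeval x a) + v (aeval x c) = 0 := by
  have hq := hk.monic
  have hne : ∀ h : K[X], h ≠ 0 → h.degree < q.degree → aeval x h ≠ 0 := fun h h0 hd =>
    aeval_ne_zero_of_degree_lt h0 hd hk.natDegree_le
  -- A proper factorization `q = d * e` has quotient `1`, so the carry condition would give `v d + v
  -- e < β`, against `β ≤ v q`.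
  have hcop : IsCoprime a q := by
    classical
    rw [← EuclideanDomain.gcd_isUnit_iff]
    by_contra hu
    set d := EuclideanDomain.gcd a q with hd
    have hda : d ∣ a := EuclideanDomain.gcd_dvd_left _ _
    obtain ⟨e, he⟩ : d ∣ q := EuclideanDomain.gcd_dvd_right _ _
    have hd0 : d ≠ 0 := by rintro h0; rw [h0, zero_mul] at he; exact hq.ne_zero he
    have he0 : e ≠ 0 := by rintro h0; rw [h0, mul_zero] at he; exact hq.ne_zero he
    have hdd : d.degree < q.degree := lt_of_le_of_lt (degree_le_of_dvd hda ha0) ha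
    have hdpos : 0 < d.natDegree := by
      rw [Nat.pos_iff_ne_zero]
      intro h0
      apply hu
      rw [isUnit_iff_degree_eq_zero, degree_eq_natDegree hd0, h0]; rfl
    have hed : e.degree < q.degree := by
      apply degree_lt_degree
      rw [he, natDegree_mul hd0 he0]
      omega
    obtain ⟨s, hs⟩ := exists_coe_eq (v := v) (hne d hd0 hdd)
    obtain ⟨t, ht⟩ := exists_coe_eq (v := v) (hne e he0 hed)
    have h1 := hk.carry d e s t hdd hed hs.ge ht.ge
    rw [← he] at h1
    have h2 : q /ₘ q = 1 := by
      have := mul_divByMonic_cancel_left 1 hq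
      rwa [mul_one] at this
    rw [h2, map_one, v.map_one] at h1
    have h3 := hk.le_val
    rw [he, map_mul, map_mul_coe hs ht] at h3
    norm_cast at h1 h3
    grind
  obtain ⟨u, w, huw⟩ := hcop
  set c := u %ₘ q with hc
  have hcd : c.degree < q.degree := degree_modByMonic_lt _ hq
  have hmod : (a * c) %ₘ q = 1 := by
    have h1 : (1 : K[X]).degree < q.degree := degree_lt_degree (by simpa using hk.natDegree_pos)
    rw [← (modByMonic_eq_self_iff hq).2 h1]
    apply modByMonic_eq_of_dvd_sub hq
    have h2 := modByMonic_add_div u q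
    refine ⟨-(w + a * (u /ₘ q)), ?_⟩
    rw [← huw]
    have : c = u - q * (u /ₘ q) := by rw [hc]; linear_combination h2
    rw [this]; ring
  have hc0 : c ≠ 0 := by
    intro h0; rw [h0] at hmod; simp at hmod
  obtain ⟨s, hs⟩ := exists_coe_eq (v := v) (hne a ha0 ha)
  obtain ⟨t, ht⟩ := exists_coe_eq (v := v) (hne c hc0 hcd)
  have h1 := hk.mod_val ha hcd hs.ge ht.ge
  rw [hmod, map_one] at h1
  have h2 : v (1 : L) = ((s + t : Γ) : WithTop Γ) := by
    refine eq_of_lt_sub (map_mul_coe hs ht) ?_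
    rwa [v.map_sub_swap]
  rw [v.map_one] at h2
  have h3 : s + t = 0 := by exact_mod_cast h2.symm
  refine ⟨c, hcd, hc0, hmod, ?_, by rw [hs, ht]; exact_mod_cast h3⟩
  rw [h3] at h1
  exact_mod_cast h1

/-- Division by a polynomial with monic initial form does not decrease the Gauss value. -/
theorem IsKey.weightGE_div [Nontrivial Γ] [FiniteDimensional K L] (hk : IsKey v x q β)
    (hβ : β ≤ b) (hb : (b : WithTop Γ) ≤ v (aeval x q)) {Q : K[X]} (hQ : Q.Monic) {m : ℕ}
    (hm : Q.natDegree = m * q.natDegree) (hQw : WeightGE v b (m • b) (expand x q Q)) {h : K[X]}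
    (hh : WeightGE v b t (expand x q h)) :
    WeightGE v b (t - m • b) (expand x q (h /ₘ Q)) := by
  have hq := hk.monic
  have hd := hk.natDegree_pos
  rcases eq_or_ne (h /ₘ Q) 0 with h0 | h0
  · rw [h0, expand_zero]; exact weightGE_zero
  set c := h /ₘ Q with hc
  -- At the last exponent `δ` where the quotient attains its weight `γ`, the product with `Q` has at
  -- `δ + m` a coefficient of weight exactly `γ + m b`, as `Q` is monic. The remainder does not
  -- reach `δ + m`, so `h` would have weight less than `t` there.
  obtain ⟨γ, δ, hγ, hδ, hab⟩ := exists_weight_attained v b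
    (expand_ne_zero (x := x) hq hd hk.natDegree_le h0)
  by_contra hcon
  have hlt : γ + m • b < t := by
    by_contra hge
    exact hcon (hγ.mono (by grind))
  have h1 := hk.expand_mul hb c Q hγ hQw
  have h1' : WeightGT v b (γ + m • b) (expand x q (c * Q) - expand x q c * expand x q Q) :=
    h1.mono (le_add_of_nonneg_right (sub_nonneg.2 hβ))
  have hdiv := modByMonic_add_div h Q
  have hr : digit q (h %ₘ Q) (δ + m) = 0 := by
    rcases eq_or_ne (h %ₘ Q) 0 with hz | hz
    · rw [hz]; simp [digit]
    · apply digit_eq_zero hq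
      have := natDegree_lt_natDegree hz (degree_modByMonic_lt h hQ)
      rw [hm] at this
      rw [Nat.add_mul]; omega
  have e1 : (expand x q (c * Q)).coeff (δ + m) = (expand x q h).coeff (δ + m) := by
    have : expand x q h = expand x q (h %ₘ Q) + expand x q (c * Q) := by
      rw [← expand_add hq hd, mul_comm c Q, hc, hdiv]
    rw [this, coeff_add, coeff_expand hq hd (h %ₘ Q), hr, map_zero, zero_add]
  have h2 : ((γ + m • b - (δ + m) • b : Γ) : WithTop Γ) <
      v ((expand x q c * expand x q Q).coeff (δ + m)) := by
    have h3 := h1' (δ + m)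
    have h4 := hh (δ + m)
    rw [coeff_sub, e1] at h3
    have h5 : ((γ + m • b - (δ + m) • b : Γ) : WithTop Γ) < v ((expand x q h).coeff (δ + m)) :=
      lt_of_lt_of_le (WithTop.coe_lt_coe.2 (sub_lt_sub_right hlt _)) h4
    have := v.map_lt_add h5 (by rw [v.map_neg]; exact h3 :
      _ < v (-((expand x q h).coeff (δ + m) - (expand x q c * expand x q Q).coeff (δ + m))))
    simpa using this
  have hone : (expand x q Q).coeff m = 1 := by
    rw [coeff_expand hq hd, digit_of_monic hq hd hQ hm, map_one]
  have h3 : v ((expand x q c * expand x q Q).coeff (δ + m)) =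
      ((γ - δ • b : Γ) : WithTop Γ) := by
    refine eq_of_lt_sub hδ ?_
    rw [coeff_mul, ← Finset.add_sum_erase _ _
      (Finset.HasAntidiagonal.mem_antidiagonal.2 rfl : (δ, m) ∈ _)]
    simp only [hone, mul_one, add_sub_cancel_left]
    refine v.map_lt_sum WithTop.coe_ne_top fun ij hij => ?_
    rw [Finset.mem_erase, Finset.HasAntidiagonal.mem_antidiagonal] at hij
    rcases lt_trichotomy ij.1 δ with hi | hi | hi
    · have : (expand x q Q).coeff ij.2 = 0 := by
        rw [coeff_expand hq hd, digit_eq_zero hq, map_zero]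
        rw [hm]
        exact Nat.mul_lt_mul_of_pos_right (by omega) hd
      rw [this, mul_zero, v.map_zero]; exact WithTop.coe_lt_top _
    · exfalso
      apply hij.1
      ext
      · exact hi
      · simp; omega
    · have := lt_mul_of_lt_of_le (hab _ hi) (hQw ij.2)
      refine lt_of_le_of_lt (le_of_eq ?_) this
      have h6 := hij.2
      have h7 : ij.1 • b + ij.2 • b = δ • b + m • b := by rw [← add_nsmul, h6, add_nsmul]
      congr 1
      grind
  rw [h3, add_nsmul] at h2
  norm_cast at h2
  grind

end Key

/-! ### Classes in the graded algebra -/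

section InAt

variable {Γ : Type*} [AddCommGroup Γ] [LinearOrder Γ] [IsOrderedAddMonoid Γ]
variable {L : Type*} [Field L]

open Classical in
/-- The class of `y` in degree `γ`, if `v y` is at least `γ`. -/
def inAt (v : AddValuation L (WithTop Γ)) (γ : Γ) (y : L) : Gr v :=
  if h : (γ : WithTop Γ) ≤ v y then DirectSum.of (Component v) γ (cls v y h) else 0

variable {v : AddValuation L (WithTop Γ)} {γ δ b t s : Γ} {y z : L} {G H : L[X]}

theorem inAt_of_le (h : (γ : WithTop Γ) ≤ v y) :
    inAt v γ y = DirectSum.of (Component v) γ (cls v y h) := dif_pos h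

theorem cls_eq_zero_iff (h : (γ : WithTop Γ) ≤ v y) : cls v y h = 0 ↔ (γ : WithTop Γ) < v y :=
  QuotientAddGroup.eq_zero_iff _

theorem inAt_eq_zero_iff (h : (γ : WithTop Γ) ≤ v y) :
    inAt v γ y = 0 ↔ (γ : WithTop Γ) < v y := by
  rw [inAt_of_le h, ← cls_eq_zero_iff h,
    map_eq_zero_iff _ (DirectSum.of_injective (β := Component v) γ)]

theorem inAt_zero : inAt v γ 0 = 0 := by
  rw [inAt_eq_zero_iff] <;> simp

theorem inAt_add (hy : (γ : WithTop Γ) ≤ v y) (hz : (γ : WithTop Γ) ≤ v z) :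
    inAt v γ (y + z) = inAt v γ y + inAt v γ z := by
  rw [inAt_of_le hy, inAt_of_le hz, inAt_of_le (v.map_le_add hy hz), ← map_add]
  rfl

theorem inAt_neg (hy : (γ : WithTop Γ) ≤ v y) : inAt v γ (-y) = -inAt v γ y := by
  have h := inAt_add hy (z := -y) (by rwa [v.map_neg])
  rw [add_neg_cancel, inAt_zero] at h
  exact (neg_eq_of_add_eq_zero_right h.symm).symm

theorem inAt_sub (hy : (γ : WithTop Γ) ≤ v y) (hz : (γ : WithTop Γ) ≤ v z) :
    inAt v γ (y - z) = inAt v γ y - inAt v γ z := by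
  rw [sub_eq_add_neg, inAt_add hy (by rwa [v.map_neg]), inAt_neg hz, sub_eq_add_neg]

theorem inAt_eq_iff (hy : (γ : WithTop Γ) ≤ v y) (hz : (γ : WithTop Γ) ≤ v z) :
    inAt v γ y = inAt v γ z ↔ (γ : WithTop Γ) < v (y - z) := by
  rw [← sub_eq_zero, ← inAt_sub hy hz, inAt_eq_zero_iff (v.map_le_sub hy hz)]

theorem inAt_sum {ι : Type*} (S : Finset ι) {F : ι → L} (h : ∀ i ∈ S, (γ : WithTop Γ) ≤ v (F i)) :
    inAt v γ (∑ i ∈ S, F i) = ∑ i ∈ S, inAt v γ (F i) := by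
  classical
  induction S using Finset.induction_on with
  | empty => simp [inAt_zero]
  | insert i S hi ih =>
    rw [Finset.sum_insert hi, Finset.sum_insert hi, inAt_add (h i (Finset.mem_insert_self _ _))
      (v.map_le_sum fun j hj => h j (Finset.mem_insert_of_mem hj)),
      ih fun j hj => h j (Finset.mem_insert_of_mem hj)]

theorem inAt_mul (hy : (γ : WithTop Γ) ≤ v y) (hz : (δ : WithTop Γ) ≤ v z) :
    inAt v (γ + δ) (y * z) = inAt v γ y * inAt v δ z := by
  rw [inAt_of_le hy, inAt_of_le hz, inAt_of_le (mul_mem_atLeast v hy hz), DirectSum.of_mul_of]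
  rfl

theorem inAt_one : inAt v 0 1 = 1 := by
  rw [inAt_of_le (one_mem_atLeast v)]; rfl

theorem inAt_pow (hy : (γ : WithTop Γ) ≤ v y) (n : ℕ) :
    inAt v (n • γ) (y ^ n) = inAt v γ y ^ n := by
  induction n with
  | zero => simp [inAt_one]
  | succ n ih => rw [pow_succ, succ_nsmul, inAt_mul (le_pow n hy) hy, ih, pow_succ]

theorem initial_eq (h : v y = γ) : initial v y = inAt v γ y := by
  have h1 : v y ≠ ⊤ := by rw [h]; exact WithTop.coe_ne_top
  have h2 : (v y).untop h1 = γ := by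
    rw [← WithTop.coe_inj, WithTop.coe_untop, h]
  rw [initial, dif_neg h1]
  subst h2
  rw [inAt_of_le (by rw [WithTop.coe_untop])]

theorem initial_zero : initial v 0 = 0 := by
  rw [initial, dif_pos v.map_zero]

/-- The component of degree `γ` of a class in degree `γ'`. -/
theorem inAt_apply_of_ne (h : γ ≠ δ) : (inAt v γ y : Gr v) δ = 0 := by
  rw [inAt]
  split_ifs
  · exact DirectSum.of_eq_of_ne _ _ _ (Ne.symm h)
  · rfl

theorem inAt_apply_self (h : (γ : WithTop Γ) ≤ v y) : (inAt v γ y : Gr v) γ = cls v y h := by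
  rw [inAt_of_le h, DirectSum.of_eq_same]

theorem exists_inAt (c : Component v γ) :
    ∃ y : L, (γ : WithTop Γ) ≤ v y ∧ DirectSum.of (Component v) γ c = inAt v γ y := by
  obtain ⟨y, hy, rfl⟩ := exists_cls v c
  exact ⟨y, hy, (inAt_of_le hy).symm⟩

/-- The part of weight `t` of `G`, where the variable has weight `b`. -/
def grPoly (v : AddValuation L (WithTop Γ)) (b t : Γ) (G : L[X]) : (Gr v)[X] :=
  ∑ j ∈ G.support, monomial j (inAt v (t - j • b) (G.coeff j))

theorem coeff_grPoly (j : ℕ) : (grPoly v b t G).coeff j = inAt v (t - j • b) (G.coeff j) := by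
  classical
  rw [grPoly, finsetSum_coeff]
  simp only [coeff_monomial, Finset.sum_ite_eq', mem_support_iff]
  split_ifs with h
  · rfl
  · rw [not_not] at h
    rw [h, inAt_zero]

/-- The passage from identities between initial forms to strict inequalities between weights, in
which all later arguments are phrased. -/
theorem grPoly_eq_iff (hG : WeightGE v b t G) (hH : WeightGE v b t H) :
    grPoly v b t G = grPoly v b t H ↔ WeightGT v b t (G - H) := by
  rw [Polynomial.ext_iff]
  refine forall_congr' fun j => ?_
  rw [coeff_grPoly, coeff_grPoly, inAt_eq_iff (hG j) (hH j), coeff_sub]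

theorem grPoly_add (hG : WeightGE v b t G) (hH : WeightGE v b t H) :
    grPoly v b t (G + H) = grPoly v b t G + grPoly v b t H := by
  ext1 j
  rw [coeff_add, coeff_grPoly, coeff_grPoly, coeff_grPoly, coeff_add, inAt_add (hG j) (hH j)]

theorem grPoly_mul (hG : WeightGE v b t G) (hH : WeightGE v b s H) :
    grPoly v b (t + s) (G * H) = grPoly v b t G * grPoly v b s H := by
  ext1 j
  have key : ∀ ij ∈ Finset.HasAntidiagonal.antidiagonal j, t - ij.1 • b + (s - ij.2 • b) =
      t + s - j • b := by
    intro ij hij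
    rw [Finset.HasAntidiagonal.mem_antidiagonal] at hij
    rw [← hij, add_nsmul]; abel
  rw [coeff_grPoly, coeff_mul, coeff_mul, inAt_sum]
  · refine Finset.sum_congr rfl fun ij hij => ?_
    rw [coeff_grPoly, coeff_grPoly, ← key ij hij, inAt_mul (hG _) (hH _)]
  · intro ij hij
    rw [← key ij hij]
    exact mul_mem_atLeast v (hG _) (hH _)

theorem grPoly_C (y : L) : grPoly v b t (C y) = C (inAt v t y) := by
  ext1 j
  rw [coeff_grPoly, coeff_C, coeff_C]
  split_ifs with h
  · subst h; simp
  · rw [inAt_zero]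

theorem grPoly_X : grPoly v b b X = X := by
  ext1 j
  rw [coeff_grPoly, coeff_X, coeff_X]
  split_ifs with h
  · subst h; simp [inAt_one]
  · rw [inAt_zero]

theorem grPoly_X_add_C_pow (hy : (b : WithTop Γ) ≤ v y) (n : ℕ) :
    grPoly v b (n • b) ((X + C y) ^ n) = (X + C (inAt v b y)) ^ n := by
  induction n with
  | zero =>
    rw [pow_zero, pow_zero, zero_nsmul, ← C_1, grPoly_C, inAt_one, C_1]
  | succ n ih =>
    rw [pow_succ, succ_nsmul, grPoly_mul ((weightGE_X_add_C hy).pow n) (weightGE_X_add_C hy), ih,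
      grPoly_add weightGE_X (weightGE_C hy), grPoly_X, grPoly_C, pow_succ]

theorem grPoly_C_mul_X_add_C_pow (hy : (b : WithTop Γ) ≤ v y) (n : ℕ) {a : L}
    (ha : v a = ((t - n • b : Γ) : WithTop Γ)) :
    grPoly v b t (C a * (X + C y) ^ n) = C (initial v a) * (X + C (inAt v b y)) ^ n := by
  have h := grPoly_mul (b := b) (weightGE_C (b := b) ha.ge) ((weightGE_X_add_C hy).pow n)
  rw [sub_add_cancel, grPoly_C, grPoly_X_add_C_pow hy, ← initial_eq ha] at h
  exact h

theorem weightGE_C_mul_X_add_C_pow (hy : (b : WithTop Γ) ≤ v y) (n : ℕ) {a : L}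
    (ha : v a = ((t - n • b : Γ) : WithTop Γ)) :
    WeightGE v b t (C a * (X + C y) ^ n) := by
  have := ((weightGE_X_add_C hy).pow n).C_mul ha.ge
  rwa [sub_add_cancel] at this

theorem eval_grPoly (hG : WeightGE v b t G) (hy : (b : WithTop Γ) ≤ v y) :
    (grPoly v b t G).eval (inAt v b y) = inAt v t (G.eval y) := by
  have h1 : (grPoly v b t G).natDegree < G.natDegree + 1 := by
    rw [Nat.lt_succ_iff, natDegree_le_iff_coeff_eq_zero]
    intro N hN
    rw [coeff_grPoly, coeff_eq_zero_of_natDegree_lt hN, inAt_zero]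
  rw [eval_eq_sum_range' h1, eval_eq_sum_range, inAt_sum]
  · refine Finset.sum_congr rfl fun j _ => ?_
    rw [coeff_grPoly, ← inAt_pow hy, ← inAt_mul (hG j) (le_pow j hy), sub_add_cancel]
  · intro j _
    have := mul_mem_atLeast v (hG j) (le_pow j hy)
    rwa [sub_add_cancel] at this

/-- `t` is the minimal weight of the terms of `G` and `δ` is the largest exponent of a term of
weight `t`. -/
structure IsPivot (v : AddValuation L (WithTop Γ)) (b t : Γ) (δ : ℕ) (G : L[X]) : Prop where
  ge : WeightGE v b t G
  eq : v (G.coeff δ) = ((t - δ • b : Γ) : WithTop Γ)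
  gt : ∀ j, δ < j → ((t - j • b : Γ) : WithTop Γ) < v (G.coeff j)

theorem exists_isPivot [Nontrivial Γ] (v : AddValuation L (WithTop Γ)) (b : Γ) (hG : G ≠ 0) :
    ∃ t δ, IsPivot v b t δ G := by
  obtain ⟨t, δ, h1, h2, h3⟩ := exists_weight_attained v b hG
  exact ⟨t, δ, h1, h2, h3⟩

theorem IsPivot.natDegree_grPoly {n : ℕ} (h : IsPivot v b t n G) :
    (grPoly v b t G).natDegree = n := by
  refine natDegree_eq_of_le_of_coeff_ne_zero ?_ ?_
  · rw [natDegree_le_iff_coeff_eq_zero]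
    intro j hj
    rw [coeff_grPoly, inAt_eq_zero_iff (h.ge j)]
    exact h.gt j hj
  · rw [coeff_grPoly, Ne, inAt_eq_zero_iff (h.ge n), h.eq]
    exact lt_irrefl _

end InAt

/-! ### Newton polygons and initial forms read off from expansions. -/

section Newton

variable {K L Γ : Type*} [Field K] [Field L] [Algebra K L]
  [AddCommGroup Γ] [LinearOrder Γ] [IsOrderedAddMonoid Γ]
  {v : AddValuation L (WithTop Γ)} {x : L} {q : K[X]} {b t : Γ} {n : ℕ}

theorem coe_sub_nsmul_le_iff {j : ℕ} {w : WithTop Γ} :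
    ((t - j • b : Γ) : WithTop Γ) ≤ w ↔ (t : WithTop Γ) ≤ w + j • (b : WithTop Γ) := by
  cases w with
  | top => simp
  | coe w =>
    rw [← WithTop.coe_nsmul, ← WithTop.coe_add, WithTop.coe_le_coe, WithTop.coe_le_coe,
      sub_le_iff_le_add]

theorem coe_sub_nsmul_lt_iff {j : ℕ} {w : WithTop Γ} :
    ((t - j • b : Γ) : WithTop Γ) < w ↔ (t : WithTop Γ) < w + j • (b : WithTop Γ) := by
  cases w with
  | top =>
    rw [← WithTop.coe_nsmul, WithTop.top_add]
    exact ⟨fun _ => WithTop.coe_lt_top _, fun _ => WithTop.coe_lt_top _⟩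
  | coe w =>
    rw [← WithTop.coe_nsmul, ← WithTop.coe_add, WithTop.coe_lt_coe, WithTop.coe_lt_coe,
      sub_lt_iff_lt_add]

omit [LinearOrder Γ] [IsOrderedAddMonoid Γ] in
theorem coe_sub_nsmul_eq_iff {j : ℕ} {w : WithTop Γ} :
    w = ((t - j • b : Γ) : WithTop Γ) ↔ w + j • (b : WithTop Γ) = (t : WithTop Γ) := by
  cases w with
  | top =>
    rw [← WithTop.coe_nsmul, WithTop.top_add]
    simp only [WithTop.top_ne_coe]
  | coe w =>
    rw [← WithTop.coe_nsmul, ← WithTop.coe_add, WithTop.coe_inj, WithTop.coe_inj,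
      eq_sub_iff_add_eq]

theorem newtonVal_eq (hq : q.Monic) (hd : 0 < q.natDegree) {h : K[X]}
    (hp : IsPivot v b t n (expand x q h)) : newtonVal v x q b h = t := by
  have hge : ∀ j, (t : WithTop Γ) ≤ val v x (digit q h j) + j • (b : WithTop Γ) := fun j => by
    have := hp.ge j
    rwa [coeff_expand hq hd, coe_sub_nsmul_le_iff] at this
  refine le_antisymm ?_ (Finset.le_inf fun j _ => hge j)
  have hn : n ∈ Finset.range (h.natDegree + 1) := by
    rw [Finset.mem_range]
    by_contra hn
    have h1 := hp.eq
    rw [coeff_expand hq hd, digit_eq_zero_of_natDegree_lt hq hd (by omega), map_zero,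
      v.map_zero] at h1
    exact WithTop.coe_ne_top h1.symm
  refine le_trans (Finset.inf_le hn) (le_of_eq ?_)
  have h1 := hp.eq
  rwa [coeff_expand hq hd, coe_sub_nsmul_eq_iff] at h1

theorem initialForm_eq (hq : q.Monic) (hd : 0 < q.natDegree) {h : K[X]}
    (hp : IsPivot v b t n (expand x q h)) :
    initialForm v x q b h = grPoly v b t (expand x q h) := by
  classical
  ext1 j
  rw [initialForm, newtonVal_eq hq hd hp, finsetSum_coeff, coeff_grPoly]
  simp only [coeff_monomial, Finset.sum_ite_eq', Finset.mem_filter, Finset.mem_range]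
  have hge := hp.ge j
  split_ifs with hj
  · have h1 : v ((expand x q h).coeff j) = ((t - j • b : Γ) : WithTop Γ) := by
      rw [coe_sub_nsmul_eq_iff, coeff_expand hq hd]
      exact hj.2
    rw [← initial_eq h1, coeff_expand hq hd]
  · symm
    rw [inAt_eq_zero_iff hge]
    refine lt_of_le_of_ne hge fun heq => hj ⟨?_, ?_⟩
    · by_contra hlt
      rw [coeff_expand hq hd, digit_eq_zero_of_natDegree_lt hq hd (by omega), map_zero,
        v.map_zero] at heq
      exact WithTop.coe_ne_top heq
    · have h1 := heq.symm
      rwa [coe_sub_nsmul_eq_iff, coeff_expand hq hd] at h1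

theorem pivot_eq (hq : q.Monic) (hd : 0 < q.natDegree) {h : K[X]} (hb : v (aeval x q) = b)
    (hp : IsPivot v b t n (expand x q h)) : pivot v x q h = n := by
  rw [pivot, val, hb, initialForm_eq hq hd hp, hp.natDegree_grPoly]

end Newton

/-! ### Vertices of Newton polygons and the set `T` -/

section Vertex

variable {Γ : Type*} [AddCommGroup Γ] [LinearOrder Γ] [IsOrderedAddMonoid Γ]
variable {L : Type*} [Field L]
variable {v : AddValuation L (WithTop Γ)} {b c t s : Γ} {n : ℕ} {y : L} {G H : L[X]}

/-- The term of exponent `n` is the only term of `G` of minimal weight. -/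
structure IsVertex (v : AddValuation L (WithTop Γ)) (b t : Γ) (n : ℕ) (G : L[X]) : Prop where
  eq : v (G.coeff n) = ((t - n • b : Γ) : WithTop Γ)
  gt : ∀ j, j ≠ n → ((t - j • b : Γ) : WithTop Γ) < v (G.coeff j)

theorem IsVertex.isPivot (h : IsVertex v b t n G) : IsPivot v b t n G where
  ge j := by
    rcases eq_or_ne j n with rfl | hj
    exacts [h.eq.ge, (h.gt j hj).le]
  eq := h.eq
  gt j hj := h.gt j hj.ne'

theorem IsPivot.congr (h : IsPivot v b t n G) (hGH : WeightGT v b t (G - H)) :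
    IsPivot v b t n H := by
  have e : ∀ j, H.coeff j = G.coeff j - (G - H).coeff j := fun j => by rw [coeff_sub]; ring
  refine ⟨fun j => ?_, ?_, fun j hj => ?_⟩
  · rw [e]; exact v.map_le_sub (h.ge j) (hGH j).le
  · refine eq_of_lt_sub h.eq ?_
    have := hGH n
    rwa [coeff_sub, v.map_sub_swap] at this
  · rw [e]; exact lt_map_sub (h.gt j hj) (hGH j)

theorem IsVertex.congr (h : IsVertex v b t n G) (hGH : WeightGT v b t (G - H)) :
    IsVertex v b t n H := by
  refine ⟨(h.isPivot.congr hGH).eq, fun j hj => ?_⟩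
  have e : H.coeff j = G.coeff j - (G - H).coeff j := by rw [coeff_sub]; ring
  rw [e]; exact lt_map_sub (h.gt j hj) (hGH j)

theorem isVertex_iff_weightGT {a : L} (ha : v a = ((t - n • b : Γ) : WithTop Γ)) :
    WeightGT v b t (G - C a * X ^ n) → IsVertex v b t n G := by
  intro h
  have e : ∀ j, G.coeff j = (G - C a * X ^ n).coeff j + if j = n then a else 0 := fun j => by
    rw [coeff_sub, coeff_C_mul_X_pow]; ring
  refine ⟨?_, fun j hj => ?_⟩
  · refine eq_of_lt_sub ha ?_
    have := h n
    rwa [coeff_sub, coeff_C_mul_X_pow, if_pos rfl] at this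
  · rw [e, if_neg hj, add_zero]; exact h j

theorem IsVertex.weightGT (h : IsVertex v b t n G) :
    WeightGT v b t (G - C (G.coeff n) * X ^ n) := fun j => by
  rw [coeff_sub, coeff_C_mul_X_pow]
  split_ifs with hj
  · rw [hj, sub_self, v.map_zero]; exact WithTop.coe_lt_top _
  · rw [sub_zero]; exact h.gt j hj

theorem WeightGE.comp_sub_self (hG : WeightGE v b t G) (hy : (b : WithTop Γ) < v y) :
    WeightGT v b t (G.comp (X + C y) - G) := by
  have e : G.comp (X + C y) - G =
      ∑ j ∈ G.support, C (G.coeff j) * ((X + C y) ^ j - X ^ j) := by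
    simp only [mul_sub, Finset.sum_sub_distrib]
    congr 1
    · rw [comp_eq_sum_left, sum_def]
    · exact G.as_sum_support_C_mul_X_pow
  rw [e]
  refine WeightGT.sum fun j _ => ?_
  have h1 : ∀ j : ℕ, WeightGT v b (j • b) ((X + C y) ^ j - X ^ j : L[X]) := by
    intro j
    induction j with
    | zero => simpa using weightGT_zero
    | succ j ih =>
      have e1 : ((X + C y) ^ (j + 1) - X ^ (j + 1) : L[X]) =
          ((X + C y) ^ j - X ^ j) * X + C y * (X + C y) ^ j := by ring
      rw [e1, succ_nsmul]
      refine (ih.mul_ge weightGE_X).add ?_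
      rw [add_comm]
      exact (weightGT_C hy).mul_ge ((weightGE_X_add_C hy.le).pow j)
  have h2 := (h1 j).mul_ge (weightGE_C (b := b) (hG j))
  rw [mul_comm]
  exact h2.mono (le_of_eq (by abel))

theorem IsVertex.comp (h : IsVertex v b t n G) (hy : (b : WithTop Γ) < v y) :
    IsVertex v b t n (G.comp (X + C y)) := by
  refine h.congr ?_
  rw [← neg_sub]
  exact (h.isPivot.ge.comp_sub_self hy).neg

theorem natDegree_comp_X_add_C_le (G : L[X]) (y : L) :
    (G.comp (X + C y)).natDegree ≤ G.natDegree := by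
  refine natDegree_comp_le.trans ?_
  rw [natDegree_X_add_C, mul_one]

/-- Only the truncation of `G` to degrees at most `n` matters: a translation preserves its degree
bound and its coefficient at `n`, while the discarded terms have greater weight and keep it. -/
theorem IsPivot.comp (h : IsPivot v b t n G) (hy : (b : WithTop Γ) ≤ v y) :
    IsPivot v b t n (G.comp (X + C y)) := by
  set A : L[X] := ∑ j ∈ Finset.range (n + 1), monomial j (G.coeff j) with hA
  have hAc : ∀ j, A.coeff j = if j < n + 1 then G.coeff j else 0 := fun j => by
    rw [hA, finsetSum_coeff]
    simp only [coeff_monomial, Finset.sum_ite_eq', Finset.mem_range]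
  have hGA : WeightGT v b t (G - A) := fun j => by
    rw [coeff_sub, hAc]
    split_ifs with hj
    · rw [sub_self, v.map_zero]; exact WithTop.coe_lt_top _
    · rw [sub_zero]; exact h.gt j (by omega)
  have hAn : A.natDegree ≤ n := by
    rw [natDegree_le_iff_coeff_eq_zero]
    intro j hj
    rw [hAc, if_neg (by omega)]
  have hA0 : IsPivot v b t n A := h.congr hGA
  have hc : (A.comp (X + C y)).coeff n = A.coeff n := by
    have hd : (A.comp (X + C y)).natDegree = A.natDegree := by
      rw [natDegree_comp, natDegree_X_add_C, mul_one]
    rcases hAn.lt_or_eq with hlt | heq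
    · rw [coeff_eq_zero_of_natDegree_lt hlt, coeff_eq_zero_of_natDegree_lt (by rwa [hd])]
    · have := leadingCoeff_comp (p := A) (q := X + C y) (by rw [natDegree_X_add_C]; exact one_ne_zero)
      rwa [leadingCoeff, hd, leadingCoeff_X_add_C, one_pow, mul_one, leadingCoeff, heq] at this
  have h1 : IsPivot v b t n (A.comp (X + C y)) := by
    refine ⟨hA0.ge.comp hy, by rw [hc]; exact hA0.eq, fun j hj => ?_⟩
    rw [coeff_eq_zero_of_natDegree_lt
      (lt_of_le_of_lt ((natDegree_comp_X_add_C_le A y).trans hAn) hj), v.map_zero]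
    exact WithTop.coe_lt_top _
  refine h1.congr ?_
  rw [← sub_comp]
  refine WeightGT.comp ?_ hy
  rw [← neg_sub]
  exact hGA.neg

theorem IsVertex.val_eval (h : IsVertex v b t n G) (hy : v y = b) : v (G.eval y) = t := by
  have h1 := h.weightGT.eval hy.ge
  rw [eval_sub, eval_mul, eval_C, eval_pow, eval_X] at h1
  refine eq_of_lt_sub ?_ h1
  rw [map_mul_coe h.eq (map_pow_coe n hy), sub_add_cancel]

/-- A vertex which is the top term for the weight `b` and a vertex for the weight `d ≥ b` is a
vertex for all weights in between. -/
theorem IsPivot.isVertex_of_le {d : Γ} (h : IsPivot v b t n G) (hd : IsVertex v d s n G)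
    (hbc : b ≤ c) (hcd : c ≤ d) : IsVertex v c (t + n • (c - b)) n G := by
  have e1 : s - n • d = t - n • b := by
    have := hd.eq
    rw [h.eq] at this
    exact_mod_cast this.symm
  refine ⟨?_, fun j hj => ?_⟩
  · rw [h.eq, nsmul_sub]; congr 1; abel
  · rcases lt_or_gt_of_ne hj with hj | hj
    · refine lt_of_le_of_lt (WithTop.coe_le_coe.2 ?_) (hd.gt j hj.ne)
      obtain ⟨k, rfl⟩ := Nat.exists_eq_add_of_le hj.le
      have h2 := nsmul_le_nsmul_right hcd k
      simp only [add_nsmul, nsmul_sub] at e1 ⊢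
      grind
    · refine lt_of_le_of_lt (WithTop.coe_le_coe.2 ?_) (h.gt j hj)
      obtain ⟨k, rfl⟩ := Nat.exists_eq_add_of_le hj.le
      have h2 := nsmul_le_nsmul_right hbc k
      simp only [add_nsmul, nsmul_sub]
      grind

/-- When the weight of the variable grows from `b` to `c`, the terms above `n` fall further behind
the term `n`; only the lower ones need a hypothesis. -/
theorem IsPivot.isVertex_of_lower (h : IsPivot v b t n G) (hbc : b ≤ c)
    (hlow : ∀ j < n, ((t + n • (c - b) - j • c : Γ) : WithTop Γ) < v (G.coeff j)) :
    IsVertex v c (t + n • (c - b)) n G := by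
  refine ⟨?_, fun j hj => ?_⟩
  · rw [h.eq, nsmul_sub]; congr 1; abel
  · rcases lt_or_gt_of_ne hj with hj | hj
    · exact hlow j hj
    · refine lt_of_le_of_lt (WithTop.coe_le_coe.2 ?_) (h.gt j hj)
      obtain ⟨k, rfl⟩ := Nat.exists_eq_add_of_le hj.le
      have h2 := nsmul_le_nsmul_right hbc k
      simp only [add_nsmul, nsmul_sub]
      grind

end Vertex

/-! ### Effect of `q ↦ q + z` on pivots and vertices. -/

section Translate

variable {K L Γ : Type*} [Field K] [Field L] [Algebra K L]
  [AddCommGroup Γ] [LinearOrder Γ] [IsOrderedAddMonoid Γ]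
  {v : AddValuation L (WithTop Γ)} {x : L} {q z h : K[X]} {β b t : Γ} {n : ℕ}

theorem IsKey.expand_translate' (hk : IsKey v x q β) (hz : z.degree < q.degree)
    (hβ : β ≤ b) (hb : (b : WithTop Γ) ≤ v (aeval x q)) (hbz : (b : WithTop Γ) ≤ v (aeval x z))
    (hh : WeightGE v b t (expand x q h)) :
    WeightGT v b (t + (b - β))
      (expand x (q + z) h - (expand x q h).comp (X + C (-aeval x z))) := by
  have hk' := hk.add hz (le_trans (WithTop.coe_le_coe.2 hβ) hbz)
  have hdeg : (q + z).degree = q.degree := degree_add_eq_left_of_degree_lt hz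
  have h1 := hk'.expand_translate (b := b) (t := t) (z := -z) (by rwa [degree_neg, hdeg]) hβ
    (by rw [map_add]; exact v.map_le_add hb hbz) (by rwa [map_neg, v.map_neg]) h
    (by rwa [add_neg_cancel_right])
  rwa [add_neg_cancel_right, map_neg] at h1

theorem IsKey.isPivot_add (hk : IsKey v x q β) (hz : z.degree < q.degree)
    (hβ : β ≤ b) (hb : (b : WithTop Γ) ≤ v (aeval x q)) (hbz : (b : WithTop Γ) ≤ v (aeval x z))
    (hp : IsPivot v b t n (expand x q h)) : IsPivot v b t n (expand x (q + z) h) := by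
  have h1 := (hk.expand_translate' hz hβ hb hbz hp.ge).mono (s := t)
    (le_add_of_nonneg_right (sub_nonneg.2 hβ))
  refine (hp.comp (y := -aeval x z) (by rwa [v.map_neg])).congr ?_
  rw [← neg_sub]; exact h1.neg

theorem IsKey.isVertex_add (hk : IsKey v x q β) (hz : z.degree < q.degree)
    (hβ : β ≤ b) (hb : (b : WithTop Γ) ≤ v (aeval x q)) (hbz : (b : WithTop Γ) < v (aeval x z))
    (hp : IsVertex v b t n (expand x q h)) : IsVertex v b t n (expand x (q + z) h) := by
  have h1 := (hk.expand_translate' hz hβ hb hbz.le hp.isPivot.ge).mono (s := t)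
    (le_add_of_nonneg_right (sub_nonneg.2 hβ))
  refine (hp.comp (y := -aeval x z) (by rwa [v.map_neg])).congr ?_
  rw [← neg_sub]; exact h1.neg

theorem IsKey.weightGE_add (hk : IsKey v x q β) (hz : z.degree < q.degree)
    (hβ : β ≤ b) (hb : (b : WithTop Γ) ≤ v (aeval x q)) (hbz : (b : WithTop Γ) ≤ v (aeval x z))
    (hh : WeightGE v b t (expand x q h)) : WeightGE v b t (expand x (q + z) h) := by
  have h1 := (hk.expand_translate' hz hβ hb hbz hh).ge.mono (s := t)
    (le_add_of_nonneg_right (sub_nonneg.2 hβ))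
  simpa using h1.add (hh.comp (y := -aeval x z) (by rwa [v.map_neg]))

/-- The initial form of `h` with respect to `q` is a power of `X + in z` if and only if the Newton
polygon with respect to `q + z` has a vertex for the same weight. -/
theorem IsKey.isVertex_add_iff (hk : IsKey v x q β) (hz : z.degree < q.degree)
    (hβ : β ≤ b) (hb : (b : WithTop Γ) ≤ v (aeval x q)) (hbz : (b : WithTop Γ) ≤ v (aeval x z))
    (hp : IsPivot v b t n (expand x q h)) :
    IsVertex v b t n (expand x (q + z) h) ↔ initialForm v x q b h =
      C (initial v (aeval x (digit q h n))) * (X + C (inAt v b (aeval x z))) ^ n := by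
  have hq := hk.monic
  have hd := hk.natDegree_pos
  have hp' := hk.isPivot_add hz hβ hb hbz hp
  have ha := hp.eq
  rw [coeff_expand hq hd] at ha
  rw [initialForm_eq hq hd hp, ← grPoly_C_mul_X_add_C_pow hbz n ha,
    grPoly_eq_iff hp.ge (weightGE_C_mul_X_add_C_pow hbz n ha)]
  have htr := (hk.expand_translate' hz hβ hb hbz hp.ge).mono (s := t)
    (le_add_of_nonneg_right (sub_nonneg.2 hβ))
  have hzn : (b : WithTop Γ) ≤ v (-aeval x z) := by rwa [v.map_neg]
  constructor
  · intro hv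
    -- Translating back gives `a' (X + z)^n` as initial part of the `q`-adic expansion, with `a'`
    -- the coefficient for `q + z`. Comparison at exponent `n` then allows `a'` to be replaced by
    -- the digit with respect to `q`.
    have h1 := (hv.weightGT.sub htr).comp hbz
    set a' := (expand x (q + z) h).coeff n with ha'
    have e1 : (expand x (q + z) h - C a' * X ^ n - (expand x (q + z) h -
        (expand x q h).comp (X + C (-aeval x z)))).comp (X + C (aeval x z)) =
        expand x q h - C a' * (X + C (aeval x z)) ^ n := by
      have : ((expand x q h).comp (X + C (-aeval x z))).comp (X + C (aeval x z)) =
          expand x q h := by rw [comp_X_add_C_add]; simp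
      simp only [sub_comp, mul_comp, C_comp, pow_comp, X_comp, this]
      ring
    rw [e1] at h1
    have h2 := h1 n
    have hcn : (C a' * (X + C (aeval x z)) ^ n).coeff n = a' := by
      rw [coeff_C_mul]
      have := ((monic_X_add_C (aeval x z)).pow n).coeff_natDegree
      rw [(monic_X_add_C _).natDegree_pow, natDegree_X_add_C, mul_one] at this
      rw [this, mul_one]
    rw [coeff_sub, hcn, coeff_expand hq hd] at h2
    have h3 : expand x q h - C (aeval x (digit q h n)) * (X + C (aeval x z)) ^ n =
        (expand x q h - C a' * (X + C (aeval x z)) ^ n) -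
          C (aeval x (digit q h n) - a') * (X + C (aeval x z)) ^ n := by
      rw [C_sub]; ring
    rw [h3]
    refine h1.sub (((weightGT_C h2).mul_ge ((weightGE_X_add_C hbz).pow n)).mono (le_of_eq ?_))
    rw [sub_add_cancel]
  · intro hv
    have h1 := htr.add (hv.comp hzn)
    refine isVertex_iff_weightGT ha ?_
    have e1 : expand x (q + z) h - (expand x q h).comp (X + C (-aeval x z)) +
        (expand x q h - C (aeval x (digit q h n)) * (X + C (aeval x z)) ^ n).comp
          (X + C (-aeval x z)) =
        expand x (q + z) h - C (aeval x (digit q h n)) * X ^ n := by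
      simp only [sub_comp, mul_comp, C_comp, pow_comp, X_comp, add_comp, C_neg]
      ring
    rwa [e1] at h1

end Translate

/-! ### The set `T` in terms of vertices. -/

section MemT

variable {K L Γ : Type*} [Field K] [Field L] [Algebra K L]
  [AddCommGroup Γ] [LinearOrder Γ] [IsOrderedAddMonoid Γ]
  {v : AddValuation L (WithTop Γ)} {x : L} {q : K[X]} {β b c t : Γ} {n : ℕ}

/-- If the value of `q` were at most `c`, the exponent `n` would be a vertex at that value too. A
single dominant term cannot cancel, so `f(x)` would have finite value, whereas it is zero. -/
theorem IsKey.lt_val_of_isVertex [Nontrivial Γ] (hk : IsKey v x q β)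
    (hb : (b : WithTop Γ) ≤ v (aeval x q)) (hp : IsPivot v b t n (expand x q (minpoly K x)))
    {s : Γ} (hv : IsVertex v c s n (expand x q (minpoly K x))) : (c : WithTop Γ) < v (aeval x q) := by
  by_contra hlt
  rw [not_lt] at hlt
  obtain ⟨γ, hγ⟩ := exists_coe_eq (v := v) (ne_zero_of_le_coe hlt)
  rw [hγ] at hb hlt
  have h1 := (hp.isVertex_of_le hv (by exact_mod_cast hb) (by exact_mod_cast hlt)).val_eval hγ
  rw [eval_expand hk.monic hk.natDegree_pos, minpoly.aeval, v.map_zero] at h1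
  exact WithTop.coe_ne_top h1.symm

/-- A pivot at exponent zero has nothing below it, hence is a vertex for the weight `v(q)` itself,
which `f(x) = 0` excludes. -/
theorem IsKey.pivot_pos [Nontrivial Γ] (hk : IsKey v x q β)
    (hq : v (aeval x q) = b) (hp : IsPivot v b t n (expand x q (minpoly K x))) : 0 < n := by
  rw [Nat.pos_iff_ne_zero]
  rintro rfl
  have hv : IsVertex v b t 0 (expand x q (minpoly K x)) :=
    ⟨hp.eq, fun j hj => hp.gt j (Nat.pos_of_ne_zero hj)⟩
  have := hk.lt_val_of_isVertex hq.ge hp hv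
  rw [hq] at this
  exact lt_irrefl _ this

theorem partialSum_succ (q : K[X]) (z : ℕ → K[X]) (k : ℕ) :
    partialSum q z (k + 1) = partialSum q z k + z k := by
  rw [partialSum, partialSum, Finset.sum_range_succ, add_assoc]

theorem partialSum_zero (q : K[X]) (z : ℕ → K[X]) : partialSum q z 0 = q := by simp [partialSum]

theorem degree_sum_lt {ι : Type*} {q : K[X]} (hq : q ≠ 0) {S : Finset ι} {z : ι → K[X]}
    (h : ∀ i ∈ S, (z i).degree < q.degree) : (∑ i ∈ S, z i).degree < q.degree := by
  classical
  induction S using Finset.induction_on with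
  | empty => simpa using bot_lt_iff_ne_bot.2 (degree_ne_bot.2 hq)
  | insert i S hi ih =>
    rw [Finset.sum_insert hi]
    refine lt_of_le_of_lt (degree_add_le _ _) (max_lt (h i (Finset.mem_insert_self _ _)) ?_)
    exact ih fun j hj => h j (Finset.mem_insert_of_mem hj)

/-- The defining properties of the terms of an expression in the set `T`. -/
structure IsTail (v : AddValuation L (WithTop Γ)) (x : L) (q : K[X]) (z : ℕ → K[X]) (r : ℕ) :
    Prop where
  degree_lt : ∀ k ≤ r, (z k).degree < q.degree
  val_zero : val v x (z 0) = val v x q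
  val_lt : ∀ k < r, val v x (z k) < val v x (z (k + 1))

theorem IsTail.lt_of_lt {z : ℕ → K[X]} {r i j : ℕ} (h : IsTail v x q z r) (hij : i < j)
    (hj : j ≤ r) : val v x (z i) < val v x (z j) := by
  induction j with
  | zero => omega
  | succ j ih =>
    rcases Nat.lt_succ_iff_lt_or_eq.1 hij with hlt | rfl
    · exact (ih hlt (by omega)).trans (h.val_lt j (by omega))
    · exact h.val_lt i (by omega)

theorem IsTail.le_val {z : ℕ → K[X]} {r i : ℕ} (h : IsTail v x q z r) (hi : i ≤ r) :
    val v x q ≤ val v x (z i) := by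
  rw [← h.val_zero]
  rcases Nat.eq_zero_or_pos i with rfl | h0
  · exact le_rfl
  · exact (h.lt_of_lt h0 hi).le

theorem IsTail.degree_sum_lt {z : ℕ → K[X]} {r k : ℕ} (h : IsTail v x q z r) (hq : q ≠ 0)
    (hk : k ≤ r + 1) : (∑ i ∈ Finset.range k, z i).degree < q.degree :=
  KeyPolynomials.degree_sum_lt hq fun i hi => h.degree_lt i (by rw [Finset.mem_range] at hi; omega)

theorem IsTail.le_val_sum {z : ℕ → K[X]} {r k : ℕ} (h : IsTail v x q z r) (hk : k ≤ r + 1)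
    (hb : (b : WithTop Γ) ≤ v (aeval x q)) :
    (b : WithTop Γ) ≤ v (aeval x (∑ i ∈ Finset.range k, z i)) := by
  rw [map_sum]
  refine v.map_le_sum fun i hi => ?_
  rw [Finset.mem_range] at hi
  exact hb.trans (h.le_val (by omega))

theorem IsTail.isKey {z : ℕ → K[X]} {r k : ℕ} (h : IsTail v x q z r) (hk : IsKey v x q β)
    (hkr : k ≤ r + 1) : IsKey v x (partialSum q z k) β :=
  hk.add (h.degree_sum_lt hk.monic.ne_zero hkr) (h.le_val_sum hkr hk.le_val)

theorem IsTail.isPivot {z : ℕ → K[X]} {r k : ℕ} {h : K[X]} (hz : IsTail v x q z r)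
    (hk : IsKey v x q β) (hβ : β ≤ b)
    (hkr : k ≤ r + 1) (hq : v (aeval x q) = b) (hp : IsPivot v b t n (expand x q h)) :
    IsPivot v b t n (expand x (partialSum q z k) h) :=
  hk.isPivot_add (hz.degree_sum_lt hk.monic.ne_zero hkr) hβ hq.ge (hz.le_val_sum hkr hq.ge) hp

/-- Membership in the set `T` in terms of the last vertex alone. -/
theorem memT_iff [Nontrivial Γ] (hk : IsKey v x q β) (hβ : β ≤ b) (hq : v (aeval x q) = b)
    (hp : IsPivot v b t n (expand x q (minpoly K x))) (z : ℕ → K[X]) (r : ℕ) :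
    MemT v x q z r ↔ IsTail v x q z r ∧ ∃ c : Γ, val v x (z r) = c ∧
      IsVertex v c (t + n • (c - b)) n (expand x (partialSum q z (r + 1)) (minpoly K x)) := by
  have hn := hk.pivot_pos hq hp
  have hpiv : pivot v x q (minpoly K x) = n := pivot_eq hk.monic hk.natDegree_pos hq hp
  constructor
  · rintro ⟨h1, h2, h3, h4, -⟩
    rw [hpiv] at h4
    have ht : IsTail v x q z r := ⟨h1, h2, h3⟩
    refine ⟨ht, ?_⟩
    have hkr := ht.isKey hk le_rfl
    have hpr := ht.isPivot hk hβ le_rfl hq hp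
    -- A priori `z r` could vanish at `x`. As `n` is positive, the left side of (i) for `j = 0`
    -- would then be `⊤`, and the strict inequality would fail.
    have hfin : val v x (z r) ≠ ⊤ := by
      intro htop
      have := h4 0 hn
      rw [htop] at this
      obtain ⟨m, rfl⟩ := Nat.exists_eq_succ_of_ne_zero hn.ne'
      rw [succ_nsmul, WithTop.add_top, WithTop.add_top] at this
      exact not_top_lt this
    obtain ⟨c, hc⟩ := WithTop.ne_top_iff_exists.1 hfin
    have hbc : b ≤ c := by
      have := ht.le_val (i := r) le_rfl
      rw [← hc, val, hq] at this
      exact_mod_cast this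
    refine ⟨c, hc.symm, hpr.isVertex_of_lower hbc fun j hj => ?_⟩
    have := h4 j hj
    have hdig := hpr.eq
    rw [coeff_expand hkr.monic hkr.natDegree_pos] at hdig ⊢
    rw [coe_sub_nsmul_lt_iff]
    rw [← hc, val, hdig] at this
    refine lt_of_le_of_lt (le_of_eq ?_) this
    rw [← WithTop.coe_nsmul, ← WithTop.coe_add, nsmul_sub]
    congr 1; abel
  · rintro ⟨ht, c, hc, hv⟩
    have hkr := ht.isKey hk le_rfl
    have hpr := ht.isPivot hk hβ le_rfl hq hp
    have hbr : (b : WithTop Γ) ≤ v (aeval x (partialSum q z (r + 1))) := by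
      rw [partialSum, map_add]
      exact v.map_le_add hq.ge (ht.le_val_sum le_rfl hq.ge)
    have hQ := hkr.lt_val_of_isVertex hbr hpr hv
    refine ⟨ht.degree_lt, ht.val_zero, ht.val_lt, fun j hj => ?_, fun k hkr' => ?_⟩
    · rw [hpiv] at hj ⊢
      have h1 := hv.gt j hj.ne
      have h2 := hv.eq
      rw [coeff_expand hkr.monic hkr.natDegree_pos] at h1 h2
      rw [coe_sub_nsmul_lt_iff] at h1
      rw [coe_sub_nsmul_eq_iff] at h2
      rw [hc, val, val, h2]
      exact h1
    · rw [hpiv]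
      -- Condition (ii) is automatic. The vertex for the weight `c` is one for the intermediate
      -- weight `v(z k)`; removing the later terms, all of greater value, keeps it; and for `q + z_0
      -- + ⋯ + z_k` it says that the initial form one step earlier is a power.
      have hlt : val v x (z k) < c := by rw [← hc]; exact ht.lt_of_lt hkr' le_rfl
      obtain ⟨γ, hγ⟩ := exists_coe_eq (v := v) (ne_zero_of_le_coe hlt.le)
      have hγ' : val v x (z k) = γ := hγ
      rw [hγ'] at hlt
      have hγc : γ < c := by exact_mod_cast hlt
      have hbγ : b ≤ γ := by
        have := ht.le_val (i := k) hkr'.le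
        rw [hγ', val, hq] at this
        exact_mod_cast this
      have hv1 := hpr.isVertex_of_le hv hbγ hγc.le
      have hdeg : ∀ k ≤ r + 1, (partialSum q z k).degree = q.degree := fun k hk' =>
        degree_add_eq_left_of_degree_lt (ht.degree_sum_lt hk.monic.ne_zero hk')
      -- the remaining terms
      have hsum : partialSum q z (r + 1) + -∑ i ∈ Finset.Ico (k + 1) (r + 1), z i =
          partialSum q z (k + 1) := by
        rw [partialSum, partialSum, ← Finset.sum_range_add_sum_Ico z (by omega : k + 1 ≤ r + 1)]
        ring
      have hγ1 : (γ : WithTop Γ) < v (aeval x (-∑ i ∈ Finset.Ico (k + 1) (r + 1), z i)) := by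
        rw [map_neg, v.map_neg, map_sum]
        refine v.map_lt_sum WithTop.coe_ne_top fun i hi => ?_
        rw [Finset.mem_Ico] at hi
        rw [← hγ']
        exact ht.lt_of_lt (by omega) (by omega)
      have hv2 := hkr.isVertex_add (z := -∑ i ∈ Finset.Ico (k + 1) (r + 1), z i)
        (by
          rw [degree_neg, hdeg _ le_rfl]
          refine KeyPolynomials.degree_sum_lt hk.monic.ne_zero fun i hi => ht.degree_lt i ?_
          rw [Finset.mem_Ico] at hi
          omega)
        (hβ.trans hbγ) (hlt.trans hQ).le hγ1 hv1
      have hγ2 : (γ : WithTop Γ) < v (aeval x (partialSum q z (k + 1))) := by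
        rw [← hsum, map_add]
        exact v.map_lt_add (hlt.trans hQ) hγ1
      rw [hsum] at hv2
      have hkk := ht.isKey hk (k := k) (by omega)
      have hkk1 := ht.isKey hk (k := k + 1) (by omega)
      have hzd : (-z k).degree < (partialSum q z (k + 1)).degree := by
        rw [degree_neg, hdeg _ (by omega)]; exact ht.degree_lt k hkr'.le
      have hback : partialSum q z (k + 1) + -z k = partialSum q z k := by
        rw [partialSum_succ]; ring
      have hp1 := hkk1.isPivot_add hzd (hβ.trans hbγ) hγ2.le
        (by rw [map_neg, v.map_neg]; exact hγ.ge) hv2.isPivot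
      rw [hback] at hp1
      have hγ3 : (γ : WithTop Γ) ≤ v (aeval x (partialSum q z k)) := by
        rw [← hback, map_add]
        exact v.map_le_add hγ2.le (by rw [map_neg, v.map_neg]; exact hγ.ge)
      rw [partialSum_succ] at hv2
      have := (hkk.isVertex_add_iff (by rw [hdeg _ (by omega)]; exact ht.degree_lt k hkr'.le)
        (hβ.trans hbγ) hγ3 hγ.ge hp1).1 hv2
      rw [hγ', this, initial_eq hγ]

end MemT

/-! ### Sequences of key polynomials of constant degree -/

section Binomial

/-- By Lucas, modulo `p` the coefficient does not change when `i` is lowered by one, and for `i = 0`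
it is `m`. -/
theorem not_dvd_choose_pow_mul {p : ℕ} (hp : p.Prime) (i : ℕ) {m : ℕ} (hm : ¬ p ∣ m) :
    ¬ p ∣ (p ^ i * m).choose (p ^ i) := by
  have := Fact.mk hp
  induction i with
  | zero => simpa using hm
  | succ i ih =>
    intro h
    apply ih
    have h1 := Choose.choose_modEq_choose_mod_mul_choose_div_nat (n := p ^ (i + 1) * m)
      (k := p ^ (i + 1)) (p := p)
    have e1 : p ^ (i + 1) * m = p * (p ^ i * m) := by ring
    have e2 : p ^ (i + 1) = p * p ^ i := by ring
    rw [e1, e2, Nat.mul_mod_right, Nat.mul_mod_right, Nat.mul_div_cancel_left _ hp.pos,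
      Nat.mul_div_cancel_left _ hp.pos, Nat.choose_self, one_mul, ← e1, ← e2] at h1
    exact (Nat.modEq_zero_iff_dvd.1 (h1.symm.trans (Nat.modEq_zero_iff_dvd.2 h)))

/-- The arithmetic source of the powers of `p`: for `j` not a power of `p`, some intermediate
binomial coefficient is a unit in the residue field. The highest power of `p` dividing `j` serves as
`k`. -/
theorem exists_not_dvd_choose {p : ℕ} (hp : p.Prime) {j : ℕ} (hj : 0 < j)
    (hne : ¬ ∃ i, j = p ^ i) : ∃ k, 0 < k ∧ k < j ∧ ¬ p ∣ j.choose k := by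
  obtain ⟨i, m, hm, rfl⟩ := Nat.exists_eq_pow_mul_and_not_dvd hj.ne' p hp.ne_one
  have hpi : 0 < p ^ i := pow_pos hp.pos i
  refine ⟨p ^ i, hpi, ?_, not_dvd_choose_pow_mul hp i hm⟩
  have hm1 : m ≠ 1 := by rintro rfl; exact hne ⟨i, by simp⟩
  have hm0 : m ≠ 0 := by rintro rfl; simp at hj
  exact lt_mul_of_one_lt_right hpi (by omega)

end Binomial

/-! ### Binomial coefficients and the residue characteristic. -/

section ExpChar

variable {Γ : Type*} [AddCommGroup Γ] [LinearOrder Γ] [IsOrderedAddMonoid Γ]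
variable {L : Type*} [Field L]

/-- `p` is the characteristic exponent of the residue field of `v`. -/
structure IsResidueExpChar (v : AddValuation L (WithTop Γ)) (p : ℕ) : Prop where
  prime_or_one : p.Prime ∨ p = 1
  zero_of_one : p = 1 → ∀ m : ℕ, m ≠ 0 → v (m : L) = 0
  pos : p.Prime → 0 < v (p : L)
  zero_of_not_dvd : p.Prime → ∀ m : ℕ, ¬ p ∣ m → v (m : L) = 0

variable {v : AddValuation L (WithTop Γ)} {p : ℕ}

/-- In residue characteristic zero `k = 1` works, with coefficient `j`; not being a power of `p = 1`
only means `j ≠ 1` there. -/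
theorem IsResidueExpChar.exists_choose (h : IsResidueExpChar v p) {j : ℕ} (hj : 0 < j)
    (hne : ¬ ∃ i, j = p ^ i) : ∃ k, 0 < k ∧ k < j ∧ v ((j.choose k : ℕ) : L) = 0 := by
  rcases h.prime_or_one with hp | hp
  · obtain ⟨k, h1, h2, h3⟩ := exists_not_dvd_choose hp hj hne
    exact ⟨k, h1, h2, h.zero_of_not_dvd hp _ h3⟩
  · have hj1 : j ≠ 1 := fun h1 => hne ⟨0, by simp [h1]⟩
    exact ⟨1, one_pos, by omega, h.zero_of_one hp _ (by simpa using hj.ne')⟩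

theorem IsResidueExpChar.pos_choose_pow (h : IsResidueExpChar v p) {i k : ℕ} (hk : 0 < k)
    (hki : k < p ^ i) : 0 < v ((((p ^ i).choose k : ℕ)) : L) := by
  rcases h.prime_or_one with hp | hp
  · obtain ⟨m, hm⟩ := hp.dvd_choose_pow hk.ne' hki.ne
    rw [hm, Nat.cast_mul, v.map_mul]
    exact lt_of_lt_of_le (h.pos hp) (le_add_of_nonneg_right (zero_le_natCast v m))
  · rw [hp, one_pow] at hki
    omega

end ExpChar

/-! ### Bounded sequences in archimedean groups and common margins. -/

section Cauchy

variable {Γ : Type*} [AddCommGroup Γ] [LinearOrder Γ] [IsOrderedAddMonoid Γ]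

/-- A bounded increasing sequence in an archimedean group is a Cauchy sequence. -/
theorem exists_forall_nsmul_sub_lt [Archimedean Γ] {b : ℕ → Γ} (hb : Monotone b) {B : Γ}
    (hB : ∀ s, b s ≤ B) (m : ℕ) {g : Γ} (hg : 0 < g) (s₀ : ℕ) :
    ∃ s ≥ s₀, ∀ s', m • (b s' - b s) < g := by
  by_contra hcon
  push Not at hcon
  have key : ∀ N : ℕ, ∃ s ≥ s₀, N • g ≤ m • (b s - b s₀) := by
    intro N
    induction N with
    | zero => exact ⟨s₀, le_rfl, by simp⟩
    | succ N ih =>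
      obtain ⟨s, hs, h1⟩ := ih
      obtain ⟨s', h2⟩ := hcon s hs
      refine ⟨max s s', le_max_of_le_left hs, ?_⟩
      have h3 : b s' ≤ b (max s s') := hb (le_max_right _ _)
      have h4 := nsmul_le_nsmul_right h3 m
      rw [succ_nsmul]
      rw [nsmul_sub] at *
      grind
  obtain ⟨N, hN⟩ := Archimedean.arch (m • (B - b s₀) + g) hg
  obtain ⟨s, -, h1⟩ := key N
  have h2 := nsmul_le_nsmul_right (sub_le_sub_right (hB s) (b s₀)) m
  have h3 := hN.trans (h1.trans h2)
  grind

theorem exists_pos_le_of_forall [Nontrivial Γ] {P : ℕ → Γ → Prop}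
    (hP : ∀ j g g', g' ≤ g → P j g → P j g') (N : ℕ) (h : ∀ j < N, ∃ g > 0, P j g) :
    ∃ g > 0, ∀ j < N, P j g := by
  induction N with
  | zero => obtain ⟨g, hg⟩ := exists_gt (0 : Γ); exact ⟨g, hg, by simp⟩
  | succ N ih =>
    obtain ⟨g, hg, h1⟩ := ih fun j hj => h j (by omega)
    obtain ⟨g', hg', h2⟩ := h N (by omega)
    refine ⟨min g g', lt_min hg hg', fun j hj => ?_⟩
    rcases Nat.lt_succ_iff_lt_or_eq.1 hj with hj | rfl
    · exact hP j g _ (min_le_left _ _) (h1 j hj)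
    · exact hP j g' _ (min_le_right _ _) h2

theorem antitone_eventually_const {δ : ℕ → ℕ} (h : ∀ s, δ (s + 1) ≤ δ s) :
    ∃ s₀, ∀ s ≥ s₀, δ s = δ s₀ := by
  obtain ⟨s₀, hs₀⟩ : ∃ s₀, ∀ s, δ s₀ ≤ δ s := by
    have hne : (Set.range δ).Nonempty := ⟨_, 0, rfl⟩
    obtain ⟨s₀, h0⟩ := Nat.sInf_mem hne
    exact ⟨s₀, fun s => h0 ▸ Nat.sInf_le ⟨s, rfl⟩⟩
  exact ⟨s₀, fun s hs => le_antisymm (antitone_nat_of_succ_le h hs) (hs₀ s)⟩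

end Cauchy

/-! ### Sequences of key polynomials of constant degree: stability and pivots. -/

section KeySeq

variable {K L Γ : Type*} [Field K] [Field L] [Algebra K L]
  [AddCommGroup Γ] [LinearOrder Γ] [IsOrderedAddMonoid Γ]
  {v : AddValuation L (WithTop Γ)} {x : L} {Q : ℕ → K[X]} {b : ℕ → Γ}

/-- A sequence of key polynomials of the same degree and increasing values. -/
structure IsKeySeq (v : AddValuation L (WithTop Γ)) (x : L) (Q : ℕ → K[X]) (b : ℕ → Γ) :
    Prop where
  isKey : IsKey v x (Q 0) (b 0)
  val : ∀ s, v (aeval x (Q s)) = b s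
  strictMono : StrictMono b
  degree_sub : ∀ s, (Q s - Q 0).degree < (Q 0).degree

/-- The value of `h` is that of its expansion in powers of one of the key polynomials. -/
def IsStable (v : AddValuation L (WithTop Γ)) (x : L) (Q : ℕ → K[X]) (b : ℕ → Γ) (h : K[X]) :
    Prop :=
  ∃ s t, WeightGE v (b s) t (expand x (Q s) h) ∧ v (aeval x h) ≤ t

/-- All members are key polynomials for the single weight `b 0`, so at the index `s` the error terms
gain `b s - b 0`, which is bounded below by `b 1 - b 0` from the second member on. -/
theorem IsKeySeq.key (hQ : IsKeySeq v x Q b) (s : ℕ) : IsKey v x (Q s) (b 0) := by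
  have h := hQ.isKey.add (hQ.degree_sub s) (by
    rw [map_sub]
    exact v.map_le_sub (by rw [hQ.val]; exact_mod_cast hQ.strictMono.monotone (Nat.zero_le s))
      (hQ.val 0).ge)
  rwa [add_sub_cancel] at h

theorem IsKeySeq.degree_eq (hQ : IsKeySeq v x Q b) (s : ℕ) : (Q s).degree = (Q 0).degree := by
  have := degree_add_eq_left_of_degree_lt (hQ.degree_sub s)
  rwa [add_sub_cancel] at this

theorem IsKeySeq.natDegree_eq (hQ : IsKeySeq v x Q b) (s : ℕ) :
    (Q s).natDegree = (Q 0).natDegree := natDegree_eq_of_degree_eq (hQ.degree_eq s)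

theorem IsKeySeq.degree_sub_lt (hQ : IsKeySeq v x Q b) (s s' : ℕ) :
    (Q s' - Q s).degree < (Q s).degree := by
  have e : Q s' - Q s = (Q s' - Q 0) - (Q s - Q 0) := by ring
  rw [e, hQ.degree_eq]
  exact lt_of_le_of_lt (degree_sub_le _ _) (max_lt (hQ.degree_sub s') (hQ.degree_sub s))

theorem IsKeySeq.le_val_sub (hQ : IsKeySeq v x Q b) {s s' : ℕ} (h : s ≤ s') :
    (b s : WithTop Γ) ≤ v (aeval x (Q s' - Q s)) := by
  rw [map_sub]
  exact v.map_le_sub (by rw [hQ.val]; exact_mod_cast hQ.strictMono.monotone h) (hQ.val s).ge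

theorem IsKeySeq.weightGE_of_le (hQ : IsKeySeq v x Q b) {s s' : ℕ} (h : s ≤ s') {g : K[X]} {t : Γ}
    (hg : WeightGE v (b s) t (expand x (Q s) g)) : WeightGE v (b s') t (expand x (Q s') g) := by
  have h1 := (hQ.key s).weightGE_add (hQ.degree_sub_lt s s')
    (hQ.strictMono.monotone (Nat.zero_le s)) (hQ.val s).ge (hQ.le_val_sub h) hg
  rw [add_sub_cancel] at h1
  exact h1.coeff_mono (hQ.strictMono.monotone h)

theorem IsKeySeq.isPivot_of_le (hQ : IsKeySeq v x Q b) {s s' : ℕ} (h : s ≤ s') {g : K[X]} {t : Γ}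
    {n : ℕ} (hg : IsPivot v (b s) t n (expand x (Q s) g)) :
    IsPivot v (b s) t n (expand x (Q s') g) := by
  have h1 := (hQ.key s).isPivot_add (hQ.degree_sub_lt s s')
    (hQ.strictMono.monotone (Nat.zero_le s)) (hQ.val s).ge (hQ.le_val_sub h) hg
  rwa [add_sub_cancel] at h1

theorem IsStable.exists_ge (hQ : IsKeySeq v x Q b) {h : K[X]} (hh : IsStable v x Q b h) (s₀ : ℕ) :
    ∃ s ≥ s₀, ∃ t, WeightGE v (b s) t (expand x (Q s) h) ∧ v (aeval x h) ≤ t := by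
  obtain ⟨s, t, h1, h2⟩ := hh
  exact ⟨max s s₀, le_max_right _ _, t, hQ.weightGE_of_le (le_max_left _ _) h1, h2⟩

/-- Raising the weight of the variable penalizes high exponents more, so the pivot can only move
down. -/
theorem IsPivot.lt_of_weightGE {L : Type*} [Field L] {v : AddValuation L (WithTop Γ)} {b c t s : Γ}
    {n m : ℕ} {G : L[X]} (h : IsPivot v b t n G) (hc : IsPivot v c s m G) (hbc : b ≤ c) :
    m ≤ n := by
  by_contra hlt
  rw [not_le] at hlt
  have h1 := h.gt m hlt
  have h2 := hc.ge n
  rw [hc.eq] at h1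
  rw [h.eq] at h2
  norm_cast at h1 h2
  obtain ⟨k, rfl⟩ := Nat.exists_eq_add_of_le hlt.le
  have h3 := nsmul_le_nsmul_right hbc k
  rw [add_nsmul, add_nsmul] at h1
  grind

variable [Nontrivial Γ] [FiniteDimensional K L]

/-- The pivots of an unstable polynomial are eventually constant and positive. -/
theorem IsKeySeq.exists_pivot (hQ : IsKeySeq v x Q b) {h : K[X]} (h0 : h ≠ 0)
    (hh : ¬ IsStable v x Q b h) :
    ∃ (μ : ℕ) (s₀ : ℕ) (α : Γ), 0 < μ ∧ μ * (Q 0).natDegree ≤ h.natDegree ∧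
      (∀ s, ((α + μ • b s : Γ) : WithTop Γ) < v (aeval x h)) ∧
      ∀ s ≥ s₀, IsPivot v (b s) (α + μ • b s) μ (expand x (Q s) h) := by
  have hex : ∀ s, ∃ t δ, IsPivot v (b s) t δ (expand x (Q s) h) := fun s =>
    exists_isPivot v (b s) (expand_ne_zero (hQ.key s).monic (hQ.key s).natDegree_pos
      (hQ.key s).natDegree_le h0)
  choose t δ hp using hex
  have hstep : ∀ s, IsPivot v (b s) (t s) (δ s) (expand x (Q (s + 1)) h) := fun s =>
    hQ.isPivot_of_le (Nat.le_succ s) (hp s)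
  obtain ⟨s₀, hs₀⟩ := antitone_eventually_const (δ := δ) fun s =>
    (hstep s).lt_of_weightGE (hp (s + 1)) (hQ.strictMono.monotone (Nat.le_succ s))
  set μ := δ s₀ with hμ
  -- The pivot at `b s` is also the pivot, for the same weight, of the expansion in `Q (s + 1)`.
  -- Once the exponent is constant, this forces the pivotal coefficients of consecutive expansions
  -- to have the same value.
  have hα : ∀ s ≥ s₀, t s = t s₀ - μ • b s₀ + μ • b s := by
    intro s hs
    induction s, hs using Nat.le_induction with
    | base => abel
    | succ s hs ih =>
      have e1 := (hstep s).eq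
      have e2 := (hp (s + 1)).eq
      rw [hs₀ s hs] at e1
      rw [hs₀ (s + 1) (by omega), e1] at e2
      norm_cast at e2
      grind
  have hpiv : ∀ s ≥ s₀, IsPivot v (b s) (t s₀ - μ • b s₀ + μ • b s) μ (expand x (Q s) h) := by
    intro s hs
    have := hp s
    rwa [hα s hs, hs₀ s hs] at this
  have hlt : ∀ s ≥ s₀, ((t s₀ - μ • b s₀ + μ • b s : Γ) : WithTop Γ) < v (aeval x h) := by
    intro s hs
    by_contra hcon
    exact hh ⟨s, _, (hpiv s hs).ge, not_lt.1 hcon⟩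
  refine ⟨μ, s₀, t s₀ - μ • b s₀, ?_, ?_, ?_, hpiv⟩
  · rw [Nat.pos_iff_ne_zero]
    intro hz
    have h1 := hpiv s₀ le_rfl
    rw [hz] at h1
    have h2 := (IsVertex.mk h1.eq fun j hj => h1.gt j (Nat.pos_of_ne_zero hj)).val_eval (hQ.val s₀)
    rw [eval_expand (hQ.key s₀).monic (hQ.key s₀).natDegree_pos] at h2
    have h3 := hlt s₀ le_rfl
    rw [hz, h2] at h3
    exact lt_irrefl _ h3
  · by_contra hcon
    rw [not_le, ← hQ.natDegree_eq s₀] at hcon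
    have h1 := (hpiv s₀ le_rfl).eq
    rw [coeff_expand (hQ.key s₀).monic (hQ.key s₀).natDegree_pos,
      digit_eq_zero (hQ.key s₀).monic hcon, map_zero, v.map_zero] at h1
    exact WithTop.coe_ne_top h1.symm
  · intro s
    refine lt_of_le_of_lt (WithTop.coe_le_coe.2 ?_) (hlt (max s s₀) (le_max_right _ _))
    exact add_le_add_right
      (nsmul_le_nsmul_right (hQ.strictMono.monotone (le_max_left _ _)) μ) _

theorem monic_sum_digits {q : K[X]} (hq : q.Monic) {m : ℕ} {e : ℕ → K[X]}
    (he : ∀ j < m, (e j).degree < q.degree) (hm : e m = 1) :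
    (∑ j ∈ Finset.range (m + 1), e j * q ^ j).Monic ∧
      (∑ j ∈ Finset.range (m + 1), e j * q ^ j).natDegree = m * q.natDegree := by
  have hlow : (∑ j ∈ Finset.range m, e j * q ^ j).degree < (q ^ m).degree := by
    refine degree_sum_lt (hq.pow m).ne_zero fun j hj => ?_
    rw [Finset.mem_range] at hj
    rcases eq_or_ne (e j) 0 with h0 | h0
    · rw [h0, zero_mul]; simpa using bot_lt_iff_ne_bot.2 (degree_ne_bot.2 (hq.pow m).ne_zero)
    · apply degree_lt_degree
      rw [natDegree_mul h0 (hq.pow j).ne_zero, hq.natDegree_pow, hq.natDegree_pow]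
      have h1 := natDegree_lt_natDegree h0 (he j hj)
      calc (e j).natDegree + j * q.natDegree < q.natDegree + j * q.natDegree := by omega
        _ = (j + 1) * q.natDegree := by ring
        _ ≤ m * q.natDegree := Nat.mul_le_mul_right _ hj
  rw [Finset.sum_range_succ, hm, one_mul, add_comm]
  refine ⟨(hq.pow m).add_of_left hlow, ?_⟩
  rw [natDegree_eq_of_degree_eq (degree_add_eq_left_of_degree_lt hlow), hq.natDegree_pow]

/-- From an unstable polynomial one gets a monic one whose degree is given by the pivot. -/
theorem IsKeySeq.exists_monic [Archimedean Γ] (hQ : IsKeySeq v x Q b) {B : Γ} (hB : ∀ s, b s ≤ B)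
    {h : K[X]} (h0 : h ≠ 0) (hh : ¬ IsStable v x Q b h) :
    ∃ (μ s₀ : ℕ) (α : Γ) (g : K[X]), 0 < μ ∧ μ * (Q 0).natDegree ≤ h.natDegree ∧
      (∀ s ≥ s₀, IsPivot v (b s) (α + μ • b s) μ (expand x (Q s) h)) ∧
      g.Monic ∧ g.natDegree = μ * (Q 0).natDegree ∧
      ∀ s, ((μ • b s : Γ) : WithTop Γ) < v (aeval x g) := by
  obtain ⟨μ, s₀, α, hμ, hdeg, hlt, hpiv⟩ := hQ.exists_pivot h0 hh
  set S := max s₀ 1 with hS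
  have hS0 : s₀ ≤ S := le_max_left _ _
  have hbS : b 0 < b S := hQ.strictMono (lt_of_lt_of_le one_pos (le_max_right _ _))
  -- the terms above the pivot at the index `S`
  obtain ⟨g, hg, hab⟩ : ∃ g > 0, ∀ s ≥ S, ∀ j, μ < j →
      ((α + μ • b s + g - j • b s : Γ) : WithTop Γ) ≤ v ((expand x (Q s) h).coeff j) := by
    set G := expand x (Q S) h with hG
    set A : L[X] := ∑ j ∈ Finset.range (μ + 1), monomial j (G.coeff j) with hA
    have hAc : ∀ j, A.coeff j = if j < μ + 1 then G.coeff j else 0 := fun j => by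
      rw [hA, finsetSum_coeff]
      simp only [coeff_monomial, Finset.sum_ite_eq', Finset.mem_range]
    have hp := hpiv S hS0
    have hGA : WeightGT v (b S) (α + μ • b S) (G - A) := fun j => by
      rw [coeff_sub, hAc]
      split_ifs with hj
      · rw [sub_self, v.map_zero]; exact WithTop.coe_lt_top _
      · rw [sub_zero]; exact hp.gt j (by omega)
    have hAn : A.natDegree ≤ μ := by
      rw [natDegree_le_iff_coeff_eq_zero]
      intro j hj
      rw [hAc, if_neg (by omega)]
    obtain ⟨t', ht', hGA'⟩ := hGA.exists_ge
    refine ⟨min (t' - (α + μ • b S)) (b S - b 0), lt_min (sub_pos.2 ht') (sub_pos.2 hbS),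
      fun s hs j hj => ?_⟩
    have hy : (b S : WithTop Γ) ≤ v (-aeval x (Q s - Q S)) := by
      rw [v.map_neg]; exact hQ.le_val_sub hs
    have h1 := (hQ.key S).expand_translate' (hQ.degree_sub_lt S s) hbS.le (hQ.val S).ge
      (hQ.le_val_sub hs) hp.ge
    rw [add_sub_cancel] at h1
    have h2 := (hGA'.comp hy).mono (s := α + μ • b S + min (t' - (α + μ • b S)) (b S - b 0))
      (by have := min_le_left (t' - (α + μ • b S)) (b S - b 0); grind)
    have h3 := h1.ge.mono (s := α + μ • b S + min (t' - (α + μ • b S)) (b S - b 0))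
      (by have := min_le_right (t' - (α + μ • b S)) (b S - b 0); grind)
    have h4 := (h3.add h2) j
    have e1 : (expand x (Q s) h - G.comp (X + C (-aeval x (Q s - Q S))) +
        (G - A).comp (X + C (-aeval x (Q s - Q S)))).coeff j = (expand x (Q s) h).coeff j := by
      rw [sub_comp, sub_add_sub_cancel, coeff_sub, coeff_eq_zero_of_natDegree_lt
        (lt_of_le_of_lt ((natDegree_comp_X_add_C_le A _).trans hAn) hj), sub_zero]
    rw [e1] at h4
    refine le_trans (WithTop.coe_le_coe.2 ?_) h4
    obtain ⟨k, rfl⟩ := Nat.exists_eq_add_of_le hj.le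
    have h5 := nsmul_le_nsmul_right (hQ.strictMono.monotone hs) k
    rw [add_nsmul, add_nsmul]
    grind
  have hg' : 0 < min g (b 1 - b 0) := lt_min hg (sub_pos.2 (hQ.strictMono one_pos))
  -- From `s₁` on, `μ b s` grows by less than the margin. An error of weight `μ b s₁` plus the
  -- margin is then larger than every later `μ b s`.
  obtain ⟨s₁, hs₁, hc⟩ := exists_forall_nsmul_sub_lt hQ.strictMono.monotone hB μ hg' S
  have hk := hQ.key s₁
  have hq := hk.monic
  have hd := hk.natDegree_pos
  have hp := hpiv s₁ (hS0.trans hs₁)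
  set e := fun j => digit (Q s₁) h j with he
  have hed : ∀ j, (e j).degree < (Q s₁).degree := fun j => degree_digit_lt hq _ _
  have hα : v (aeval x (e μ)) = α := by
    have := hp.eq
    rwa [coeff_expand hq hd, add_sub_cancel_right] at this
  have hem : e μ ≠ 0 := fun hz => by
    rw [hz, map_zero, v.map_zero] at hα; exact WithTop.coe_ne_top hα.symm
  obtain ⟨c, hcd, hc0, hmod, -, hval⟩ := hk.exists_inverse (hed μ) hem
  have hcv : v (aeval x c) = ((-α : Γ) : WithTop Γ) := by
    obtain ⟨γ, hγ⟩ := exists_coe_eq (v := v)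
      (aeval_ne_zero_of_degree_lt (x := x) hc0 hcd hk.natDegree_le)
    rw [hα, hγ] at hval
    rw [hγ]
    norm_cast at hval ⊢
    exact eq_neg_of_add_eq_zero_right hval
  set e' := fun j => (e j * c) %ₘ Q s₁ with he'
  have he'd : ∀ j, (e' j).degree < (Q s₁).degree := fun j => degree_modByMonic_lt _ hq
  set g' := ∑ j ∈ Finset.range (μ + 1), e' j * Q s₁ ^ j with hg'def
  obtain ⟨hmon, hnat⟩ := monic_sum_digits hq (fun j _ => he'd j) (hmod : e' μ = 1)
  refine ⟨μ, s₀, α, g', hμ, hdeg, hpiv, hmon, by rw [hnat, hQ.natDegree_eq], ?_⟩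
  have hcoef : ∀ j, (expand x (Q s₁) g').coeff j = if j < μ + 1 then aeval x (e' j) else 0 := by
    intro j
    rw [coeff_expand hq hd, hg'def, digit_sum hq _ (fun j _ => he'd j)]
    split_ifs <;> simp
  -- Passing from `c h` to `g'` has two costs: terms above the pivot are dropped, with margin `g`,
  -- and products are reduced modulo `Q s₁`, where the carry gains `b s₁ - b 0 ≥ b 1 - b 0`. The
  -- approximate inverse `c` of the pivotal digit makes `g'` monic.
  have hE : WeightGE v (b s₁) (μ • b s₁ + min g (b 1 - b 0))
      (C (aeval x c) * expand x (Q s₁) h - expand x (Q s₁) g') := by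
    intro j
    rw [coeff_sub, coeff_C_mul, hcoef, coeff_expand hq hd]
    split_ifs with hj
    · have h1 := hp.ge j
      rw [coeff_expand hq hd] at h1
      have h2 := hk.carry (e j) c _ _ (hed j) hcd h1 hcv.ge
      have h3 := lt_mul_of_lt_of_le h2 (hQ.val s₁).ge
      have hdiv := congrArg (aeval x) (modByMonic_add_div (e j * c) (Q s₁))
      rw [map_add, map_mul, map_mul] at hdiv
      have e1 : aeval x c * aeval x (digit (Q s₁) h j) - aeval x (e' j) =
          aeval x ((e j * c) /ₘ Q s₁) * aeval x (Q s₁) := by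
        rw [he', he] at *
        linear_combination -hdiv
      rw [e1]
      refine le_trans (WithTop.coe_le_coe.2 ?_) h3.le
      have h4 := min_le_right g (b 1 - b 0)
      have h5 : b 1 ≤ b s₁ := hQ.strictMono.monotone ((le_max_right s₀ 1).trans hs₁)
      grind
    · rw [sub_zero]
      have h1 := hab s₁ hs₁ j (by omega)
      rw [coeff_expand hq hd] at h1
      have h2 := mul_mem_atLeast v hcv.ge h1
      refine le_trans (WithTop.coe_le_coe.2 ?_) h2
      have h4 := min_le_left g (b 1 - b 0)
      grind
  have hEe := hE.eval (hQ.val s₁).ge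
  rw [eval_sub, eval_mul, eval_C, eval_expand hq hd, eval_expand hq hd] at hEe
  intro s
  have e1 : aeval x g' = aeval x c * aeval x h - (aeval x c * aeval x h - aeval x g') := by ring
  rw [e1]
  refine lt_map_sub ?_ ?_
  · have := lt_mul_of_lt_of_le (hlt s) hcv.ge
    rw [mul_comm]
    refine lt_of_le_of_lt (le_of_eq ?_) this
    congr 1; abel
  · refine lt_of_lt_of_le (WithTop.coe_lt_coe.2 ?_) hEe
    have := hc s
    rw [nsmul_sub] at this
    grind

end KeySeq

/-! ### Limits of sequences of key polynomials -/

section Limit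

theorem hasseDeriv_comp_X_add_C {L : Type*} [Field L] (G : L[X]) (k : ℕ) (y : L) :
    hasseDeriv k (G.comp (X + C y)) = (hasseDeriv k G).comp (X + C y) := by
  rw [← taylor_apply, ← taylor_apply]
  ext i
  rw [hasseDeriv_coeff, taylor_coeff, taylor_coeff, ← LinearMap.comp_apply (hasseDeriv i),
    hasseDeriv_comp, LinearMap.smul_apply, eval_smul, nsmul_eq_mul, Nat.choose_symm_add]

variable {K L Γ : Type*} [Field K] [Field L] [Algebra K L]
  [AddCommGroup Γ] [LinearOrder Γ] [IsOrderedAddMonoid Γ]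
  {v : AddValuation L (WithTop Γ)} {x : L} {Q : ℕ → K[X]} {b : ℕ → Γ} {p μ : ℕ}

/-- `g` is a monic polynomial of degree `μ` in the key polynomials whose value exceeds that of the
`μ`-th powers of all the key polynomials. -/
structure IsLimit (v : AddValuation L (WithTop Γ)) (x : L) (Q : ℕ → K[X]) (b : ℕ → Γ) (μ : ℕ)
    (g : K[X]) : Prop where
  monic : g.Monic
  natDegree_eq : g.natDegree = μ * (Q 0).natDegree
  lt_val : ∀ s, ((μ • b s : Γ) : WithTop Γ) < v (aeval x g)

/-- Recentred at `Q_s(x)`, the expansion is nearly independent of `s`: the translation by `Q s' - Q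
s` is absorbed by the change of centre, and only the carries remain. -/
theorem IsKeySeq.expand_error (hQ : IsKeySeq v x Q b) {s s' : ℕ} (hs : s ≤ s') {t : Γ} {g : K[X]}
    (hg : WeightGE v (b s) t (expand x (Q s) g)) :
    WeightGE v (b s) (t + (b s - b 0)) ((expand x (Q s') g).comp (X + C (aeval x (Q s'))) -
      (expand x (Q s) g).comp (X + C (aeval x (Q s)))) := by
  have h1 := (hQ.key s).expand_translate' (hQ.degree_sub_lt s s')
    (hQ.strictMono.monotone (Nat.zero_le s)) (hQ.val s).ge (hQ.le_val_sub hs) hg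
  rw [add_sub_cancel] at h1
  have hy : (b s : WithTop Γ) ≤ v (aeval x (Q s')) := by
    rw [hQ.val]; exact_mod_cast hQ.strictMono.monotone hs
  have h2 := h1.ge.comp hy
  rw [sub_comp, comp_X_add_C_add] at h2
  have e1 : -aeval x (Q s' - Q s) + aeval x (Q s') = aeval x (Q s) := by rw [map_sub]; ring
  rwa [e1] at h2

variable [Nontrivial Γ] [FiniteDimensional K L] [Archimedean Γ]

/-- An unstable polynomial would produce, by `IsKeySeq.exists_monic`, a limit of degree at most its
own, below the minimal one. -/
theorem IsKeySeq.isStable_of_natDegree_lt (hQ : IsKeySeq v x Q b) {B : Γ} (hB : ∀ s, b s ≤ B)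
    (hmin : ∀ μ' g, 0 < μ' → IsLimit v x Q b μ' g → μ ≤ μ') {h : K[X]} (h0 : h ≠ 0)
    (hd : h.natDegree < μ * (Q 0).natDegree) : IsStable v x Q b h := by
  by_contra hh
  obtain ⟨μ', -, -, g, hμ', h1, -, h2, h3, h4⟩ := hQ.exists_monic hB h0 hh
  have h5 := hmin μ' g hμ' ⟨h2, h3, h4⟩
  have := Nat.mul_le_mul_right (Q 0).natDegree h5
  omega

/-- The digit `1` at `μ` keeps every weight at or below `μ b s`, which is less than the value, so
`g` is unstable. Its pivot is the degree of another limit, hence equals `μ` by minimality. -/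
theorem IsLimit.eventually_isPivot (hQ : IsKeySeq v x Q b) {B : Γ} (hB : ∀ s, b s ≤ B)
    (hμ : 0 < μ) (hmin : ∀ μ' g, 0 < μ' → IsLimit v x Q b μ' g → μ ≤ μ') {g : K[X]}
    (hg : IsLimit v x Q b μ g) :
    ∃ s₀, ∀ s ≥ s₀, IsPivot v (b s) (μ • b s) μ (expand x (Q s) g) := by
  have hone : ∀ s, (expand x (Q s) g).coeff μ = 1 := fun s => by
    rw [coeff_expand (hQ.key s).monic (hQ.key s).natDegree_pos, digit_of_monic (hQ.key s).monic
      (hQ.key s).natDegree_pos hg.monic (by rw [hg.natDegree_eq, hQ.natDegree_eq s]), map_one]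
  have hun : ¬ IsStable v x Q b g := by
    rintro ⟨s, t, h1, h2⟩
    have h3 := h1 μ
    rw [hone, v.map_one] at h3
    have h4 := lt_of_lt_of_le (hg.lt_val s) h2
    norm_cast at h3 h4
    grind
  obtain ⟨μ', s₀, α, g', hμ', h1, h2, h3, h4, h5⟩ := hQ.exists_monic hB hg.monic.ne_zero hun
  have h6 := hmin μ' g' hμ' ⟨h3, h4, h5⟩
  rw [hg.natDegree_eq] at h1
  have h7 := le_of_mul_le_mul_right h1 hQ.isKey.natDegree_pos
  obtain rfl : μ' = μ := le_antisymm h7 h6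
  have hα : α = 0 := by
    have := (h2 s₀ le_rfl).eq
    rw [hone, v.map_one, add_sub_cancel_right] at this
    exact_mod_cast this.symm
  refine ⟨s₀, fun s hs => ?_⟩
  have := h2 s hs
  rwa [hα, zero_add] at this

/-- The minimal degree of a limit is a power of the residue characteristic exponent, and it is
attained by a limit with a weakly affine expansion. -/
theorem IsKeySeq.exists_isWeaklyAffine (hQ : IsKeySeq v x Q b) {B : Γ} (hB : ∀ s, b s ≤ B)
    (hp : IsResidueExpChar v p) (hμ : 0 < μ)
    (hmin : ∀ μ' g, 0 < μ' → IsLimit v x Q b μ' g → μ ≤ μ') {g : K[X]}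
    (hg : IsLimit v x Q b μ g) :
    ∃ e t h, μ = p ^ e ∧ IsWeaklyAffine p (Q t) e h ∧ IsLimit v x Q b μ h := by
  have hone : ∀ s, (expand x (Q s) g).coeff μ = 1 := fun s => by
    rw [coeff_expand (hQ.key s).monic (hQ.key s).natDegree_pos, digit_of_monic (hQ.key s).monic
      (hQ.key s).natDegree_pos hg.monic (by rw [hg.natDegree_eq, hQ.natDegree_eq s]), map_one]
  have hdeg : ∀ s, (expand x (Q s) g).natDegree ≤ μ := fun s => by
    rw [natDegree_le_iff_coeff_eq_zero]
    intro j hj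
    rw [coeff_expand (hQ.key s).monic (hQ.key s).natDegree_pos, digit_eq_zero (hQ.key s).monic,
      map_zero]
    rw [hg.natDegree_eq, hQ.natDegree_eq s]
    exact Nat.mul_lt_mul_of_pos_right hj hQ.isKey.natDegree_pos
  obtain ⟨s₀, hpiv⟩ := hg.eventually_isPivot hQ hB hμ hmin
  have hmono := hQ.strictMono.monotone
  obtain ⟨s₁, hs₁, hc₁⟩ := exists_forall_nsmul_sub_lt hmono hB μ
    (sub_pos.2 (hQ.strictMono one_pos)) (max s₀ 1)
  have hs₁' : s₀ ≤ s₁ := (le_max_left _ _).trans hs₁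
  have hε : b 1 - b 0 ≤ b s₁ - b 0 := sub_le_sub_right (hmono ((le_max_right _ _).trans hs₁)) _
  have hk := hQ.key s₁
  have hq := hk.monic
  have hd := hk.natDegree_pos
  set H := expand x (Q s₁) g with hH
  -- The coefficients of `G` are Taylor coefficients of the expansion at `Q_{s₁}(x)`. Unlike the
  -- digits they hardly depend on the index, so they can be compared with all the `b s`
  -- simultaneously.
  set G := H.comp (X + C (aeval x (Q s₁))) with hG
  have hGμ : G.coeff μ = 1 := by
    have h1 : H.natDegree = μ := by
      refine le_antisymm (hdeg s₁) (le_natDegree_of_ne_zero ?_)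
      rw [hone]; exact one_ne_zero
    have h2 := coeff_taylor_natDegree (aeval x (Q s₁)) H
    rwa [taylor_apply, leadingCoeff, h1, hone] at h2
  have hGdeg : G.natDegree ≤ μ := (natDegree_comp_X_add_C_le _ _).trans (hdeg s₁)
  -- lower bounds for the Taylor coefficients of `H`
  have hA : ∀ l s, l ≤ μ → ((μ • b s - l • b s : Γ) : WithTop Γ) ≤ v (G.coeff l) := by
    have main : ∀ l s, s₁ ≤ s → l ≤ μ → ((μ • b s - l • b s : Γ) : WithTop Γ) ≤ v (G.coeff l) := by
      intro l s hs hl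
      have h1 := hQ.expand_error hs (hpiv s₁ hs₁').ge l
      have h2 := (hpiv s (hs₁'.trans hs)).ge.comp (hQ.val s).ge l
      rw [coeff_sub] at h1
      have e1 : G.coeff l = ((expand x (Q s) g).comp (X + C (aeval x (Q s)))).coeff l -
          (((expand x (Q s) g).comp (X + C (aeval x (Q s)))).coeff l - G.coeff l) := by ring
      rw [e1]
      refine v.map_le_sub h2 (le_trans (WithTop.coe_le_coe.2 ?_) h1)
      have h3 := hc₁ s
      have h4 := nsmul_le_nsmul_right (hmono hs) l
      rw [nsmul_sub] at h3
      grind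
    intro l s hl
    rcases le_total s₁ s with hs | hs
    · exact main l s hs hl
    · refine le_trans (WithTop.coe_le_coe.2 ?_) (main l s₁ le_rfl hl)
      obtain ⟨k, rfl⟩ := Nat.exists_eq_add_of_le hl
      have h4 := nsmul_le_nsmul_right (hmono hs) k
      rw [add_nsmul, add_nsmul]
      grind
  -- improved bounds
  have hBk : ∀ j k, 0 < k → k < j → j ≤ μ → v ((j.choose k : ℕ) : L) = 0 →
      ∃ s ≥ s₁, ∀ s', ((μ • b s' - k • b s' - (j • b s - k • b s) : Γ) : WithTop Γ) ≤
        v (G.coeff j) := by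
    intro j k hk0 hkj hjμ hval
    -- `D` has as expansion the `k`-th Hasse derivative of `H`. Its degree is below the critical
    -- one, so it is stable, and `D(x)` is the `k`-th coefficient of `G`. The bound on that value,
    -- valid for every `s'`, thus passes to the expansion of `D` for one fixed weight `b s`, and
    -- from there to the coefficient `j` of `G`, the binomial factor being a unit.
    set D : K[X] := ∑ i ∈ Finset.range μ,
      (((i + k).choose k : ℕ) : K[X]) * digit (Q s₁) g (i + k) * Q s₁ ^ i with hD
    have hdd : ∀ i, ((((i + k).choose k : ℕ) : K[X]) * digit (Q s₁) g (i + k)).degree <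
        (Q s₁).degree := by
      intro i
      rw [← C_eq_natCast, ← smul_eq_C_mul]
      exact lt_of_le_of_lt (degree_smul_le _ _) (degree_digit_lt hq _ _)
    have hDexp : expand x (Q s₁) D = hasseDeriv k H := by
      ext i
      rw [coeff_expand hq hd, hD, digit_sum hq _ (fun i _ => hdd i), hasseDeriv_coeff]
      split_ifs with hi
      · rw [map_mul, map_natCast, coeff_expand hq hd]
      · rw [map_zero, coeff_eq_zero_of_natDegree_lt (lt_of_le_of_lt (hdeg s₁) (by omega)),
          mul_zero]
    have hDx : aeval x D = G.coeff k := by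
      rw [← eval_expand (x := x) hq hd D, hDexp, ← taylor_coeff, taylor_apply]
    have hGk : hasseDeriv k G = (expand x (Q s₁) D).comp (X + C (aeval x (Q s₁))) := by
      rw [hDexp, hG, hasseDeriv_comp_X_add_C]
    have hGj : v (G.coeff j) = v ((hasseDeriv k G).coeff (j - k)) := by
      rw [hasseDeriv_coeff, Nat.sub_add_cancel hkj.le, v.map_mul, hval, zero_add]
    rcases eq_or_ne D 0 with hD0 | hD0
    · refine ⟨s₁, le_rfl, fun s' => ?_⟩
      rw [hGj, hGk, hD0, expand_zero, zero_comp, coeff_zero, v.map_zero]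
      exact le_top
    have hDdeg : D.natDegree < μ * (Q 0).natDegree := by
      rw [← hQ.natDegree_eq s₁, ← hq.natDegree_pow]
      refine natDegree_lt_natDegree hD0 (degree_sum_lt (hq.pow μ).ne_zero fun i hi => ?_)
      rw [Finset.mem_range] at hi
      rcases eq_or_ne ((((i + k).choose k : ℕ) : K[X]) * digit (Q s₁) g (i + k)) 0 with hz | hz
      · rw [hz, zero_mul]; simpa using bot_lt_iff_ne_bot.2 (degree_ne_bot.2 (hq.pow μ).ne_zero)
      · apply degree_lt_degree
        rw [natDegree_mul hz (hq.pow i).ne_zero, hq.natDegree_pow, hq.natDegree_pow]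
        have h1 := natDegree_lt_natDegree hz (hdd i)
        calc _ < (Q s₁).natDegree + i * (Q s₁).natDegree := Nat.add_lt_add_right h1 _
          _ = (i + 1) * (Q s₁).natDegree := by ring
          _ ≤ μ * (Q s₁).natDegree := Nat.mul_le_mul_right _ hi
    obtain ⟨s, hs, t, ht1, ht2⟩ :=
      (hQ.isStable_of_natDegree_lt hB hmin hD0 hDdeg).exists_ge hQ s₁
    refine ⟨s, hs, fun s' => ?_⟩
    have h1 : ((μ • b s' - k • b s' : Γ) : WithTop Γ) ≤ t := by
      rw [hDx] at ht2
      exact (hA k s' (by omega)).trans ht2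
    have h2 := (ht1.mono (by exact_mod_cast h1)).comp (hQ.val s).ge (j - k)
    have h3 : WeightGE v (b s₁) (μ • b s₁ - k • b s₁) (expand x (Q s₁) D) := by
      rw [hDexp]; exact (hpiv s₁ hs₁').ge.hasseDeriv k
    have h4 := hQ.expand_error hs h3 (j - k)
    rw [← hGk, coeff_sub] at h4
    have e1 : (hasseDeriv k G).coeff (j - k) =
        ((expand x (Q s) D).comp (X + C (aeval x (Q s)))).coeff (j - k) -
        (((expand x (Q s) D).comp (X + C (aeval x (Q s)))).coeff (j - k) -
          (hasseDeriv k G).coeff (j - k)) := by ring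
    rw [hGj, e1]
    obtain ⟨i, rfl⟩ := Nat.exists_eq_add_of_le hkj.le
    obtain ⟨m, rfl⟩ := Nat.exists_eq_add_of_le hjμ
    rw [Nat.add_sub_cancel_left] at *
    refine v.map_le_sub (le_trans (WithTop.coe_le_coe.2 ?_) h2)
      (le_trans (WithTop.coe_le_coe.2 ?_) h4)
    · simp only [add_nsmul]; grind
    · have h5 := hc₁ s'
      have h6 := nsmul_le_nsmul_right (hmono hs) i
      have h7 : k • b s₁ ≤ k • b (max s₁ s') := nsmul_le_nsmul_right (hmono (le_max_left _ _)) k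
      have h8 := hc₁ (max s₁ s')
      have h9 : i • b s' ≤ i • b (max s₁ s') := nsmul_le_nsmul_right (hmono (le_max_right _ _)) i
      have h10 : m • b s' ≤ m • b (max s₁ s') := nsmul_le_nsmul_right (hmono (le_max_right _ _)) m
      simp only [add_nsmul, nsmul_sub] at *
      grind
  -- `μ` is a power of `p`
  have hpow : ∃ e, μ = p ^ e := by
    by_contra hne
    obtain ⟨k, hk0, hkμ, hval⟩ := hp.exists_choose hμ hne
    obtain ⟨s, -, h1⟩ := hBk μ k hk0 hkμ le_rfl hval
    -- The leading coefficient of `G` is `1`, so the improved bound would make `(μ - k) b s'` at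
    -- most `(μ - k) b s` for all `s'`.
    have h2 := h1 (s + 1)
    rw [hGμ, v.map_one] at h2
    norm_cast at h2
    obtain ⟨i, rfl⟩ := Nat.exists_eq_add_of_lt hkμ
    have h3 := nsmul_lt_nsmul_right (n := i + 1) (by omega) (hQ.strictMono (Nat.lt_succ_self s))
    simp only [add_nsmul, Nat.succ_eq_add_one] at h2 h3
    clear hpiv hc₁ hA hBk hmin
    grind
  obtain ⟨e, he⟩ := hpow
  -- a uniform improvement
  have hη : ∃ η > (0 : Γ), ∀ j < μ, 0 < j → ((¬ ∃ i, j = p ^ i) → ∀ s,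
      ((μ • b s - j • b s + η : Γ) : WithTop Γ) ≤ v (G.coeff j)) ∧
      ∀ l, (∃ i, l = p ^ i) → j < l → l ≤ μ → (η : WithTop Γ) ≤ v ((l.choose j : ℕ) : L) := by
    have hP : ∀ (j : ℕ) (g g' : Γ), g' ≤ g → (0 < j → ((¬ ∃ i, j = p ^ i) → ∀ s,
      ((μ • b s - j • b s + g : Γ) : WithTop Γ) ≤ v (G.coeff j)) ∧
      ∀ l, (∃ i, l = p ^ i) → j < l → l ≤ μ → (g : WithTop Γ) ≤ v ((l.choose j : ℕ) : L)) →
      (0 < j → ((¬ ∃ i, j = p ^ i) → ∀ s,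
      ((μ • b s - j • b s + g' : Γ) : WithTop Γ) ≤ v (G.coeff j)) ∧
      ∀ l, (∃ i, l = p ^ i) → j < l → l ≤ μ → (g' : WithTop Γ) ≤ v ((l.choose j : ℕ) : L)) := by
      intro j g g' hg h hj
      refine ⟨fun h1 s => le_trans (WithTop.coe_le_coe.2 (add_le_add_right hg _)) ((h hj).1 h1 s),
        fun l h1 h2 h3 => le_trans (WithTop.coe_le_coe.2 hg) ((h hj).2 l h1 h2 h3)⟩
    refine exists_pos_le_of_forall hP μ fun j hj => ?_
    have h1 : ∃ g > (0 : Γ), (0 < j → (¬ ∃ i, j = p ^ i) → ∀ s,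
        ((μ • b s - j • b s + g : Γ) : WithTop Γ) ≤ v (G.coeff j)) := by
      by_cases hjp : 0 < j ∧ ¬ ∃ i, j = p ^ i
      · obtain ⟨k, hk0, hkj, hval⟩ := hp.exists_choose hjp.1 hjp.2
        obtain ⟨s, -, h1⟩ := hBk j k hk0 hkj hj.le hval
        -- With `B = b (max s' (s + 1))`, the improved bound exceeds `(μ - j) B` by `(j - k)(B - b
        -- s)`, which is at least `b (s + 1) - b s` because `k < j`.
        refine ⟨b (s + 1) - b s, sub_pos.2 (hQ.strictMono (Nat.lt_succ_self s)), fun _ _ s' => ?_⟩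
        refine le_trans (WithTop.coe_le_coe.2 ?_) (h1 (max s' (s + 1)))
        obtain ⟨i, rfl⟩ := Nat.exists_eq_add_of_lt hkj
        obtain ⟨m, rfl⟩ := Nat.exists_eq_add_of_le hj.le
        have h2 := nsmul_le_nsmul_right (hmono (le_max_left s' (s + 1))) m
        have h3 := nsmul_le_nsmul_right (hmono (le_max_right s' (s + 1))) i
        have h4 := nsmul_le_nsmul_right (hmono (Nat.le_succ s)) i
        have h5 := hmono (le_max_right s' (s + 1))
        simp only [add_nsmul, one_nsmul]
        grind
      · obtain ⟨g, hg⟩ := exists_gt (0 : Γ)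
        exact ⟨g, hg, fun h1 h2 => absurd ⟨h1, h2⟩ hjp⟩
    have h2 : ∃ g > (0 : Γ), ∀ l < μ + 1, (0 < j → (∃ i, l = p ^ i) → j < l →
        (g : WithTop Γ) ≤ v ((l.choose j : ℕ) : L)) := by
      refine exists_pos_le_of_forall (P := fun l (g : Γ) => 0 < j → (∃ i, l = p ^ i) → j < l →
        (g : WithTop Γ) ≤ v ((l.choose j : ℕ) : L)) (fun l g g' hg h h1 h2 h3 =>
        le_trans (WithTop.coe_le_coe.2 hg) (h h1 h2 h3)) (μ + 1) fun l hl => ?_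
      by_cases hcon : 0 < j ∧ (∃ i, l = p ^ i) ∧ j < l
      · obtain ⟨hj0, ⟨i, rfl⟩, hjl⟩ := hcon
        have h3 := hp.pos_choose_pow hj0 hjl
        cases hv : v (((p ^ i).choose j : ℕ) : L) with
        | top =>
          obtain ⟨g, hg⟩ := exists_gt (0 : Γ)
          exact ⟨g, hg, fun _ _ _ => le_top⟩
        | coe γ =>
          rw [hv] at h3
          exact ⟨γ, by exact_mod_cast h3, fun _ _ _ => le_rfl⟩
      · obtain ⟨g, hg⟩ := exists_gt (0 : Γ)
        exact ⟨g, hg, fun h1 h2 h3 => absurd ⟨h1, h2, h3⟩ hcon⟩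
    obtain ⟨g₁, hg₁, h1⟩ := h1
    obtain ⟨g₂, hg₂, h2⟩ := h2
    refine ⟨min g₁ g₂, lt_min hg₁ hg₂, fun hj0 => ⟨fun h3 s => ?_, fun l h3 h4 h5 => ?_⟩⟩
    · exact le_trans (WithTop.coe_le_coe.2 (add_le_add_right (min_le_left _ _) _)) (h1 hj0 h3 s)
    · exact le_trans (WithTop.coe_le_coe.2 (min_le_right _ _)) (h2 l (by omega) hj0 h3 h4)
  obtain ⟨η, hη0, hη⟩ := hη
  -- After `s₂` the values `μ b s` rise by less than `η`, so a gain of `η` at `s₂` beats them all.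
  obtain ⟨s₂, hs₂, hc₂⟩ := exists_forall_nsmul_sub_lt hmono hB μ hη0 s₁
  have hk2 := hQ.key s₂
  have hq2 := hk2.monic
  have hd2 := hk2.natDegree_pos
  -- the digits whose index is not a power of `p` can be dropped
  have hdrop : ∀ j, 0 < j → j < μ → (¬ ∃ i, j = p ^ i) → ∀ s,
      ((μ • b s - j • b s₂ : Γ) : WithTop Γ) ≤ v ((expand x (Q s₂) g).coeff j) := by
    intro j hj0 hj hjp
    have main : ∀ s, s₂ ≤ s →
        ((μ • b s - j • b s₂ : Γ) : WithTop Γ) ≤ v ((expand x (Q s₂) g).coeff j) := by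
      intro s hs
      have h1 := (hQ.expand_error hs₂ (hpiv s₁ hs₁').ge).comp (y := -aeval x (Q s₂)) (by
        rw [v.map_neg, hQ.val]; exact_mod_cast hmono hs₂) j
      rw [sub_comp, comp_X_add_C_neg, coeff_sub] at h1
      -- In the expansion of this coefficient, the term of index `i + j` gains `η` in either case:
      -- from the binomial coefficient if `i + j` is a power of `p`, and from the coefficient of `G`
      -- otherwise. As `j` is not a power of `p`, the first case has `i > 0`.
      have h2 : ((μ • b s₂ - j • b s₂ + η : Γ) : WithTop Γ) ≤
          v ((G.comp (X + C (-aeval x (Q s₂)))).coeff j) := by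
        rw [← taylor_apply, taylor_coeff, eval_eq_sum_range]
        refine v.map_le_sum fun i _ => ?_
        rw [hasseDeriv_coeff]
        rcases lt_or_ge μ (i + j) with hi | hi
        · rw [coeff_eq_zero_of_natDegree_lt (lt_of_le_of_lt hGdeg hi)]
          simp
        have hy : ((i • b s₂ : Γ) : WithTop Γ) ≤ v ((-aeval x (Q s₂)) ^ i) :=
          le_pow i (by rw [v.map_neg]; exact (hQ.val s₂).ge)
        by_cases hpw : ∃ m, i + j = p ^ m
        · have hij : j < i + j := by
            rcases Nat.eq_zero_or_pos i with rfl | h0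
            · rw [zero_add] at hpw; exact absurd hpw hjp
            · omega
          have h3 := (hη j hj hj0).2 _ hpw hij hi
          have h4 := hA (i + j) s₂ hi
          have h5 := mul_mem_atLeast v (mul_mem_atLeast v h3 h4) hy
          refine le_trans (WithTop.coe_le_coe.2 ?_) h5
          rw [add_nsmul]; grind
        · have hlt : i + j < μ := lt_of_le_of_ne hi fun h => hpw ⟨e, by rw [h, he]⟩
          have h3 := (hη (i + j) hlt (by omega)).1 hpw s₂
          have h5 := mul_mem_atLeast v (le_nsmul_mul ((i + j).choose j) h3) hy
          refine le_trans (WithTop.coe_le_coe.2 ?_) h5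
          rw [add_nsmul]; grind
      have e1 : (expand x (Q s₂) g).coeff j = (G.comp (X + C (-aeval x (Q s₂)))).coeff j +
          ((expand x (Q s₂) g).coeff j - (G.comp (X + C (-aeval x (Q s₂)))).coeff j) := by ring
      rw [e1]
      refine v.map_le_add (le_trans (WithTop.coe_le_coe.2 ?_) h2)
        (le_trans (WithTop.coe_le_coe.2 ?_) h1)
      · have := hc₂ s
        rw [nsmul_sub] at this
        grind
      · have h3 := hc₁ s
        have h4 := nsmul_le_nsmul_right (hmono hs₂) j
        rw [nsmul_sub] at h3
        grind
    intro s
    refine le_trans (WithTop.coe_le_coe.2 ?_) (main (max s s₂) (le_max_right _ _))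
    exact sub_le_sub_right (nsmul_le_nsmul_right (hmono (le_max_left _ _)) μ) _
  classical
  set d := fun j => if 0 < j ∧ ¬ ∃ i, j = p ^ i then (0 : K[X]) else digit (Q s₂) g j with hddef
  have hdd : ∀ j, (d j).degree < (Q s₂).degree := fun j => by
    rw [hddef]; dsimp only
    split_ifs
    · simpa using bot_lt_iff_ne_bot.2 (degree_ne_bot.2 hq2.ne_zero)
    · exact degree_digit_lt hq2 _ _
  have hdμ : d μ = 1 := by
    rw [hddef]; dsimp only
    rw [if_neg (fun h => h.2 ⟨e, he⟩), digit_of_monic hq2 hd2 hg.monic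
      (by rw [hg.natDegree_eq, hQ.natDegree_eq s₂])]
  obtain ⟨hmon, hnat⟩ := monic_sum_digits hq2 (fun j _ => hdd j) hdμ
  set h := ∑ j ∈ Finset.range (μ + 1), d j * Q s₂ ^ j with hh
  have hdig : ∀ j, digit (Q s₂) h j = if j < μ + 1 then d j else 0 :=
    digit_sum hq2 _ fun j _ => hdd j
  refine ⟨e, s₂, h, he, ⟨hmon, by rw [hnat, he], fun j hj hne => ?_⟩, hmon,
    by rw [hnat, hQ.natDegree_eq], fun s => ?_⟩
  · by_contra hjp
    apply hne
    rw [hdig, hddef]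
    simp only [hj, hjp, not_false_iff, and_self, if_true, ite_self]
  · have hE : WeightGE v (b s₂) (μ • b (s + 1)) (expand x (Q s₂) g - expand x (Q s₂) h) := by
      intro j
      rw [coeff_sub, coeff_expand hq2 hd2 h, hdig, hddef]
      dsimp only
      split_ifs with h1 h2
      · rw [map_zero, sub_zero]
        have hjμ : j ≠ μ := by rintro rfl; exact h2.2 ⟨e, he⟩
        exact hdrop j h2.1 (by omega) h2.2 (s + 1)
      · rw [coeff_expand hq2 hd2, sub_self, v.map_zero]; exact le_top
      · rw [coeff_eq_zero_of_natDegree_lt (lt_of_le_of_lt (hdeg s₂) (by omega)), map_zero,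
          sub_zero, v.map_zero]; exact le_top
    have h1 := hE.eval (hQ.val s₂).ge
    rw [eval_sub, eval_expand hq2 hd2, eval_expand hq2 hd2] at h1
    have e1 : aeval x h = aeval x g - (aeval x g - aeval x h) := by ring
    rw [e1]
    refine lt_map_sub (hg.lt_val s) (lt_of_lt_of_le (WithTop.coe_lt_coe.2 ?_) h1)
    exact nsmul_lt_nsmul_right hμ.ne' (hQ.strictMono (Nat.lt_succ_self s))

/-- A bounded sequence of key polynomials has a limit of minimal degree. -/
theorem IsKeySeq.exists_minimal_limit (hQ : IsKeySeq v x Q b) {B : Γ} (hB : ∀ s, b s ≤ B) :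
    ∃ μ g, 0 < μ ∧ μ * (Q 0).natDegree ≤ (minpoly K x).natDegree ∧ IsLimit v x Q b μ g ∧
      ∀ μ' g', 0 < μ' → IsLimit v x Q b μ' g' → μ ≤ μ' := by
  classical
  have hx : IsIntegral K x := IsIntegral.of_finite K x
  -- The minimal polynomial vanishes at `x`, so its value `⊤` exceeds every weight; this is what
  -- starts the search for a limit.
  have hun : ¬ IsStable v x Q b (minpoly K x) := by
    rintro ⟨s, t, -, h⟩
    rw [minpoly.aeval, v.map_zero, top_le_iff] at h
    exact WithTop.coe_ne_top h
  obtain ⟨μ₀, -, -, g₀, h1, h2, -, h3, h4, h5⟩ := hQ.exists_monic hB (minpoly.ne_zero hx) hun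
  have hex : ∃ μ, 0 < μ ∧ ∃ g, IsLimit v x Q b μ g := ⟨μ₀, h1, g₀, h3, h4, h5⟩
  obtain ⟨h6, g, h7⟩ := Nat.find_spec hex
  refine ⟨Nat.find hex, g, h6, ?_, h7, fun μ' g' h8 h9 => Nat.find_min' hex ⟨h8, g', h9⟩⟩
  exact (Nat.mul_le_mul_right _ (Nat.find_min' hex ⟨h1, g₀, h3, h4, h5⟩)).trans h2

end Limit

/-! ### The subalgebra of initial forms of polynomials of small degree -/

section ClassGroup

variable {K L Γ : Type*} [Field K] [Field L] [Algebra K L]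
  [AddCommGroup Γ] [LinearOrder Γ] [IsOrderedAddMonoid Γ]
  {v : AddValuation L (WithTop Γ)} {x : L} {q : K[X]} {β b γ δ s t : Γ}

/-- The group generated by the classes of the elements `z(x)`, `deg z < deg q`. -/
def classGroup (v : AddValuation L (WithTop Γ)) (x : L) (q : K[X]) : AddSubgroup (Gr v) :=
  AddSubgroup.closure {y | ∃ (γ : Γ) (z : K[X]), z.degree < q.degree ∧
    (γ : WithTop Γ) ≤ v (aeval x z) ∧ y = inAt v γ (aeval x z)}

theorem inAt_mem_classGroup {z : K[X]} (hz : z.degree < q.degree)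
    (hγ : (γ : WithTop Γ) ≤ v (aeval x z)) : inAt v γ (aeval x z) ∈ classGroup v x q :=
  AddSubgroup.subset_closure ⟨γ, z, hz, hγ, rfl⟩

theorem of_inAt {y : L} (hδ : (δ : WithTop Γ) ≤ v y) :
    DirectSum.of (Component v) δ ((inAt v δ y : Gr v) δ) = inAt v δ y := by
  rw [inAt_apply_self hδ, inAt_of_le hδ]

theorem degree_zero_lt {q : K[X]} (hq : q ≠ 0) : (0 : K[X]).degree < q.degree := by
  rw [degree_zero]; exact bot_lt_iff_ne_bot.2 (degree_ne_bot.2 hq)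

/-- Polynomials of degree less than `deg q` are closed under addition, so each homogeneous component
of a sum of classes is the class of a single one. -/
theorem exists_component_of_mem_classGroup (hq : q ≠ 0) {y : Gr v} (hy : y ∈ classGroup v x q)
    (γ : Γ) : ∃ z : K[X], z.degree < q.degree ∧ (γ : WithTop Γ) ≤ v (aeval x z) ∧
      DirectSum.of (Component v) γ (y γ) = inAt v γ (aeval x z) := by
  induction hy using AddSubgroup.closure_induction with
  | mem y hy =>
    obtain ⟨δ, z, hz, hδ, rfl⟩ := hy
    by_cases h : δ = γ
    · subst h
      exact ⟨z, hz, hδ, of_inAt hδ⟩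
    · refine ⟨0, degree_zero_lt hq, by rw [map_zero, v.map_zero]; exact le_top, ?_⟩
      rw [inAt_apply_of_ne h, map_zero, map_zero, inAt_zero]
  | zero =>
    refine ⟨0, degree_zero_lt hq, by rw [map_zero, v.map_zero]; exact le_top, ?_⟩
    rw [map_zero, inAt_zero, DirectSum.zero_apply, map_zero]
  | add y y' _ _ h h' =>
    obtain ⟨z, h1, h2, h3⟩ := h
    obtain ⟨z', h1', h2', h3'⟩ := h'
    refine ⟨z + z', lt_of_le_of_lt (degree_add_le _ _) (max_lt h1 h1'), ?_, ?_⟩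
    · rw [map_add]; exact v.map_le_add h2 h2'
    · rw [DirectSum.add_apply, map_add, h3, h3', map_add, inAt_add h2 h2']
  | neg y _ h =>
    obtain ⟨z, h1, h2, h3⟩ := h
    refine ⟨-z, by rwa [degree_neg], by rwa [map_neg, v.map_neg], ?_⟩
    rw [show (-y) γ = -(y γ) from rfl, map_neg, h3, map_neg, inAt_neg h2]

theorem one_mem_classGroup (hd : 0 < q.natDegree) : (1 : Gr v) ∈ classGroup v x q := by
  have h1 : (1 : K[X]).degree < q.degree := by
    rw [degree_one]; exact natDegree_pos_iff_degree_pos.1 hd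
  have := inAt_mem_classGroup (v := v) (x := x) (γ := 0) h1 (by rw [map_one, v.map_one]; rfl)
  rwa [map_one, inAt_one] at this

theorem IsKey.inAt_mul_eq (hk : IsKey v x q β) {a c : K[X]} (ha : a.degree < q.degree)
    (hc : c.degree < q.degree) (hs : (s : WithTop Γ) ≤ v (aeval x a))
    (ht : (t : WithTop Γ) ≤ v (aeval x c)) :
    ((s + t : Γ) : WithTop Γ) ≤ v (aeval x ((a * c) %ₘ q)) ∧
      inAt v s (aeval x a) * inAt v t (aeval x c) = inAt v (s + t) (aeval x ((a * c) %ₘ q)) := by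
  have h1 := hk.mod_val ha hc hs ht
  have h2 := mul_mem_atLeast v hs ht
  have h3 : ((s + t : Γ) : WithTop Γ) ≤ v (aeval x ((a * c) %ₘ q)) := by
    have e : aeval x ((a * c) %ₘ q) =
      aeval x a * aeval x c - (aeval x a * aeval x c - aeval x ((a * c) %ₘ q)) := by ring
    rw [e]; exact v.map_le_sub h2 h1.le
  exact ⟨h3, by rw [← inAt_mul hs ht, inAt_eq_iff h2 h3]; exact h1⟩

theorem IsKey.mul_mem_classGroup (hk : IsKey v x q β) {y y' : Gr v} (hy : y ∈ classGroup v x q)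
    (hy' : y' ∈ classGroup v x q) : y * y' ∈ classGroup v x q := by
  induction hy using AddSubgroup.closure_induction with
  | mem y hy =>
    obtain ⟨s, a, ha, hs, rfl⟩ := hy
    induction hy' using AddSubgroup.closure_induction with
    | mem y' hy' =>
      obtain ⟨t, c, hc, ht, rfl⟩ := hy'
      obtain ⟨h1, h2⟩ := hk.inAt_mul_eq ha hc hs ht
      rw [h2]
      exact inAt_mem_classGroup (degree_modByMonic_lt _ hk.monic) h1
    | zero => rw [mul_zero]; exact zero_mem _
    | add y y' _ _ h h' => rw [mul_add]; exact add_mem h h'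
    | neg y _ h => rw [mul_neg]; exact neg_mem h
  | zero => rw [zero_mul]; exact zero_mem _
  | add y y' _ _ h h' => rw [add_mul]; exact add_mem h h'
  | neg y _ h => rw [neg_mul]; exact neg_mem h

theorem grMap_inAt {c : K} (hc : (γ : WithTop Γ) ≤ v (algebraMap K L c)) :
    grMap (algebraMap K L) v (inAt (v.comap (algebraMap K L)) γ c) =
      inAt v γ (algebraMap K L c) := by
  have hc' : (γ : WithTop Γ) ≤ (v.comap (algebraMap K L)) c := hc
  rw [inAt_of_le hc', inAt_of_le hc]
  exact DirectSum.toSemiring_of _ _ _ _ _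

variable [Nontrivial Γ]

theorem initial_mul (y z : L) : initial v (y * z) = initial v y * initial v z := by
  rcases eq_or_ne y 0 with rfl | hy
  · rw [zero_mul, initial_zero, zero_mul]
  rcases eq_or_ne z 0 with rfl | hz
  · rw [mul_zero, initial_zero, mul_zero]
  obtain ⟨γ, hγ⟩ := exists_coe_eq (v := v) hy
  obtain ⟨δ, hδ⟩ := exists_coe_eq (v := v) hz
  rw [initial_eq hγ, initial_eq hδ, initial_eq (map_mul_coe hγ hδ), inAt_mul hγ.ge hδ.ge]

variable (v) in
/-- The initial form, as a multiplicative map. -/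
def initialHom : L →* Gr v where
  toFun := initial v
  map_one' := by rw [initial_eq (γ := 0) (by rw [v.map_one]; rfl), inAt_one]
  map_mul' := initial_mul

/-- The group generated by the monomials of value at least `β`. -/
def monomialGroup (K : Type*) [Field K] [Algebra K L] (v : AddValuation L (WithTop Γ))
    {I : Type*} (u : I → L) (β : Γ) : AddSubgroup L :=
  AddSubgroup.closure (monomialsAtLeast K v u β)

omit [Nontrivial Γ] in
theorem le_val_of_mem_monomialGroup {I : Type*} {u : I → L} {y : L}
    (hy : y ∈ monomialGroup K v u β) : (β : WithTop Γ) ≤ v y := by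
  have : monomialGroup K v u β ≤ atLeast v β := by
    rw [monomialGroup, AddSubgroup.closure_le]
    rintro y ⟨c, γ, rfl, h⟩
    exact h
  exact this hy

theorem initial_mem_gradedAdjoin {I : Type*} {u : I → L} (c : K) (m : I →₀ ℕ) :
    initial v (algebraMap K L c * m.prod fun i n => u i ^ n) ∈
      gradedAdjoin K v (Set.range u) := by
  have h1 : initial v (algebraMap K L c) ∈ gradedAdjoin K v (Set.range u) := by
    rcases eq_or_ne (algebraMap K L c) 0 with h | h
    · rw [h, initial_zero]; exact zero_mem _
    · obtain ⟨γ, hγ⟩ := exists_coe_eq (v := v) h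
      rw [initial_eq hγ, ← grMap_inAt hγ.ge]
      exact Subring.subset_closure (Or.inl ⟨_, rfl⟩)
  rw [initial_mul]
  refine mul_mem h1 ?_
  change initialHom v (m.prod fun i n => u i ^ n) ∈ _
  rw [map_finsuppProd, Finsupp.prod]
  refine prod_mem fun i _ => ?_
  rw [map_pow]
  have h2 : initialHom v (u i) ∈ gradedAdjoin K v (Set.range u) :=
    Subring.subset_closure (Or.inr ⟨u i, ⟨i, rfl⟩, rfl⟩)
  exact pow_mem h2 _

/-- Classes in degree `β` kill the monomials of greater value; on the others they are initial forms,
which are products of generators. -/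
theorem inAt_mem_gradedAdjoin {I : Type*} {u : I → L} {y : L}
    (hy : y ∈ monomialGroup K v u β) : inAt v β y ∈ gradedAdjoin K v (Set.range u) := by
  have : y ∈ monomialGroup K v u β ∧ inAt v β y ∈ gradedAdjoin K v (Set.range u) := by
    induction hy using AddSubgroup.closure_induction with
    | mem y hy =>
      refine ⟨AddSubgroup.subset_closure hy, ?_⟩
      obtain ⟨c, m, rfl, h⟩ := hy
      rcases h.eq_or_lt with h | h
      · rw [← initial_eq h.symm]; exact initial_mem_gradedAdjoin c m
      · rw [(inAt_eq_zero_iff h.le).2 h]; exact zero_mem _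
    | zero => exact ⟨zero_mem _, by rw [inAt_zero]; exact zero_mem _⟩
    | add y y' _ _ h h' =>
      refine ⟨add_mem h.1 h'.1, ?_⟩
      rw [inAt_add (le_val_of_mem_monomialGroup h.1) (le_val_of_mem_monomialGroup h'.1)]
      exact add_mem h.2 h'.2
    | neg y _ h =>
      refine ⟨neg_mem h.1, ?_⟩
      rw [inAt_neg (le_val_of_mem_monomialGroup h.1)]
      exact neg_mem h.2
  exact this.2

/-- The algebra of fractions of `G_ν[in u]` consists of the classes of the polynomials of degree
less than `deg q`, if these polynomials are combinations of monomials in the `u i`, and the `u i`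
are congruent to such polynomials. -/
theorem IsKey.saturation_eq_classGroup [FiniteDimensional K L] (hk : IsKey v x q β)
    {I : Type*} {u : I → L}
    (hcomp : ∀ (h : K[X]) (γ : Γ), h.degree < q.degree → (γ : WithTop Γ) ≤ v (aeval x h) →
      aeval x h ∈ monomialGroup K v u γ)
    (hin : ∀ i, ∃ z : K[X], z.degree < q.degree ∧ v (u i) < v (u i - aeval x z)) :
    saturation (gradedAdjoin K v (Set.range u)) = classGroup v x q := by
  have hsub : (gradedAdjoin K v (Set.range u) : Set (Gr v)) ⊆ classGroup v x q := by
    intro y hy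
    induction hy using Subring.closure_induction with
    | mem y hy =>
      rcases hy with ⟨w, rfl⟩ | ⟨_, ⟨i, rfl⟩, rfl⟩
      · induction w using DirectSum.induction_on with
        | zero => rw [map_zero]; exact zero_mem _
        | add y y' h h' => rw [map_add]; exact add_mem h h'
        | of γ c =>
          obtain ⟨a, ha, h1⟩ := exists_inAt c
          rw [h1, grMap_inAt ha]
          have h2 : (C a : K[X]).degree < q.degree :=
            lt_of_le_of_lt degree_C_le (natDegree_pos_iff_degree_pos.1 hk.natDegree_pos)
          have := inAt_mem_classGroup (v := v) (x := x) (γ := γ) h2 (by rw [aeval_C]; exact ha)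
          rwa [aeval_C] at this
      · rcases eq_or_ne (u i) 0 with h0 | h0
        · rw [h0, initial_zero]; exact zero_mem _
        obtain ⟨γ, hγ⟩ := exists_coe_eq (v := v) h0
        obtain ⟨z, hz, h1⟩ := hin i
        rw [hγ] at h1
        have h2 : v (aeval x z) = γ := by
          refine eq_of_lt_sub hγ ?_
          rwa [v.map_sub_swap]
        rw [initial_eq hγ, (inAt_eq_iff hγ.ge h2.ge).2 h1]
        exact inAt_mem_classGroup hz h2.ge
    | zero => exact zero_mem _
    | one => exact one_mem_classGroup hk.natDegree_pos
    | add y y' _ _ h h' => exact add_mem h h'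
    | neg y _ h => exact neg_mem h
    | mul y y' _ _ h h' => exact hk.mul_mem_classGroup h h'
  apply Set.Subset.antisymm
  · rintro y ⟨h, hh, ⟨γ, c, rfl⟩, h0, hy⟩
    obtain ⟨z, hz, h1, h2⟩ := exists_component_of_mem_classGroup hk.monic.ne_zero (hsub hh) γ
    rw [DirectSum.of_eq_same] at h2
    have hz0 : z ≠ 0 := by
      rintro rfl
      exact h0 (by rw [h2, map_zero, inAt_zero])
    have hzγ : v (aeval x z) = γ := by
      rcases h1.eq_or_lt with h | h
      · exact h.symm
      · exact absurd (by rw [h2, (inAt_eq_zero_iff h1).2 h]) h0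
    -- A homogeneous nonzero denominator is the class of a polynomial of degree less than `deg q`.
    -- The class of its approximate inverse is a true inverse in the graded algebra, so no new
    -- fractions arise.
    obtain ⟨a, ha, -, -, h3, h4⟩ := hk.exists_inverse hz hz0
    have haγ : v (aeval x a) = ((-γ : Γ) : WithTop Γ) := by
      rw [hzγ] at h4
      cases hva : v (aeval x a) with
      | top => rw [hva, WithTop.add_top] at h4; exact absurd h4 WithTop.top_ne_zero
      | coe α =>
        rw [hva] at h4
        norm_cast at h4 ⊢
        exact eq_neg_of_add_eq_zero_right h4
    have h5 : inAt v (-γ) (aeval x a) * DirectSum.of (Component v) γ c = 1 := by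
      rw [h2, ← inAt_mul haγ.ge h1, neg_add_cancel, ← inAt_one, inAt_eq_iff, mul_comm]
      · exact h3
      · have := mul_mem_atLeast v haγ.ge h1
        rwa [neg_add_cancel] at this
      · rw [v.map_one]; rfl
    have h6 : y = inAt v (-γ) (aeval x a) * (DirectSum.of (Component v) γ c * y) := by
      rw [← mul_assoc, h5, one_mul]
    rw [h6]
    exact hk.mul_mem_classGroup (inAt_mem_classGroup ha haγ.ge) (hsub hy)
  · intro y hy
    refine ⟨1, one_mem _, ⟨0, cls v 1 (one_mem_atLeast v), rfl⟩, ?_, ?_⟩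
    · rw [← inAt_one, Ne, inAt_eq_zero_iff (one_mem_atLeast v), v.map_one]
      exact lt_irrefl _
    · rw [one_mul]
      have : classGroup v x q ≤ (gradedAdjoin K v (Set.range u)).toAddSubgroup := by
        rw [classGroup, AddSubgroup.closure_le]
        rintro y ⟨γ, z, hz, h1, rfl⟩
        exact inAt_mem_gradedAdjoin (hcomp z γ hz h1)
      exact this hy

end ClassGroup

/-! ### Minimal relations -/

section Relation

variable {K L Γ : Type*} [Field K] [Field L] [Algebra K L]
  [AddCommGroup Γ] [LinearOrder Γ] [IsOrderedAddMonoid Γ]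
  {v : AddValuation L (WithTop Γ)} {x : L} {q Q : K[X]} {β b γ δ s t : Γ} {n α : ℕ}

theorem of_mul_inAt_apply (y : Gr v) {w : L} (hw : (δ : WithTop Γ) ≤ v w) (s : Γ) :
    DirectSum.of (Component v) s ((y * inAt v δ w) s) =
      DirectSum.of (Component v) (s - δ) (y (s - δ)) * inAt v δ w := by
  induction y using DirectSum.induction_on with
  | zero => simp
  | add y y' h h' =>
    rw [add_mul, DirectSum.add_apply, map_add, h, h', DirectSum.add_apply, map_add, add_mul]
  | of γ c =>
    obtain ⟨a, ha, h1⟩ := exists_inAt c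
    rw [h1, ← inAt_mul ha hw]
    have h2 := mul_mem_atLeast v ha hw
    by_cases h : γ + δ = s
    · subst h
      rw [of_inAt h2, add_sub_cancel_right, of_inAt ha, inAt_mul ha hw]
    · rw [inAt_apply_of_ne h, map_zero, inAt_apply_of_ne (fun h' => h (by rw [h']; abel)),
        map_zero, zero_mul]

/-- The part of weight `s` of a relation is a relation. -/
theorem sum_component_eq_zero {g : (Gr v)[X]} {w : L} (hw : (b : WithTop Γ) ≤ v w)
    (hg : g.eval (inAt v b w) = 0) (s : Γ) :
    ∑ j ∈ Finset.range (g.natDegree + 1),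
      DirectSum.of (Component v) (s - j • b) (g.coeff j (s - j • b)) * inAt v (j • b) (w ^ j)
        = 0 := by
  have h1 := congrArg (fun y : Gr v => DirectSum.of (Component v) s (y s)) hg
  rw [eval_eq_sum_range, DirectSum.zero_apply, map_zero] at h1
  rw [← h1]
  rw [DFinsupp.finsetSum_apply, map_sum]
  refine Finset.sum_congr rfl fun j _ => ?_
  rw [← inAt_pow hw, of_mul_inAt_apply _ (le_pow j hw)]

/-- `Q` is monic of degree `α` in `q`, of value greater than its weight, and such polynomials in
`q` of smaller degree have a value equal to their weight. -/
structure IsLift (v : AddValuation L (WithTop Γ)) (x : L) (q : K[X]) (b : Γ) (α : ℕ) (Q : K[X]) :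
    Prop where
  pos : 0 < α
  monic : Q.Monic
  natDegree_eq : Q.natDegree = α * q.natDegree
  weight : WeightGE v b (α • b) (expand x q Q)
  lt_val : ((α • b : Γ) : WithTop Γ) < v (aeval x Q)
  weightGT : ∀ (h : K[X]) (t : Γ), h.natDegree < α * q.natDegree →
    WeightGE v b t (expand x q h) → (t : WithTop Γ) < v (aeval x h) → WeightGT v b t (expand x q h)


/-- If some term had weight exactly `t`, the part of weight `t` would be a nonzero relation for `in
q` of degree less than that of `g`. -/
theorem IsKey.weightGT_of_minimal [Nontrivial Γ] [FiniteDimensional K L] (hk : IsKey v x q β)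
    (hb : (b : WithTop Γ) ≤ v (aeval x q)) {g : (Gr v)[X]}
    (hg : IsMinimalRelation (classGroup v x q : Set (Gr v)) (inAt v b (aeval x q)) g) (h : K[X])
    (t : Γ) (hd : h.natDegree < g.natDegree * q.natDegree) (ht : WeightGE v b t (expand x q h))
    (hlt : (t : WithTop Γ) < v (aeval x h)) : WeightGT v b t (expand x q h) := by
  by_contra hne
  have hq := hk.monic
  have hd0 := hk.natDegree_pos
  have h0 : grPoly v b t (expand x q h) ≠ 0 := by
    intro h0
    have h1 : grPoly v b t (0 : L[X]) = 0 := by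
      ext1 j; rw [coeff_grPoly, coeff_zero, inAt_zero, coeff_zero]
    rw [← h1, grPoly_eq_iff ht weightGE_zero, sub_zero] at h0
    exact hne h0
  have hmem : ∀ j, (grPoly v b t (expand x q h)).coeff j ∈ classGroup v x q := fun j => by
    have h1 := ht j
    rw [coeff_expand hq hd0] at h1
    rw [coeff_grPoly, coeff_expand hq hd0]
    exact inAt_mem_classGroup (degree_digit_lt hq _ _) h1
  have heval : (grPoly v b t (expand x q h)).eval (inAt v b (aeval x q)) = 0 := by
    rw [eval_grPoly ht hb, eval_expand hq hd0, inAt_eq_zero_iff hlt.le]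
    exact hlt
  have h1 := hg.2.2.2 _ h0 hmem heval
  apply leadingCoeff_ne_zero.2 h0
  rw [leadingCoeff, coeff_grPoly, coeff_expand hq hd0, digit_eq_zero hq, map_zero, inAt_zero]
  exact lt_of_lt_of_le hd (Nat.mul_le_mul_right _ h1)

theorem one_apply_ne_zero (h : γ ≠ 0) : (1 : Gr v) γ = 0 := by
  rw [← inAt_one, inAt_apply_of_ne h.symm]

/-- The relation `g` is lifted to `Q`. -/
theorem IsKey.isLift_of_minimal [Nontrivial Γ] [FiniteDimensional K L] (hk : IsKey v x q β)
    (hb : v (aeval x q) = b) {g : (Gr v)[X]} {d : ℕ → K[X]}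
    (hg : IsMinimalRelation (classGroup v x q : Set (Gr v)) (inAt v b (aeval x q)) g)
    (hd : ∀ j < g.natDegree, (d j).degree < q.degree ∧ initial v (aeval x (d j)) = g.coeff j) :
    IsLift v x q b g.natDegree
      (q ^ g.natDegree + ∑ j ∈ Finset.range g.natDegree, d j * q ^ j) := by
  have hq := hk.monic
  have hd0 := hk.natDegree_pos
  have hge := fun h t => hk.weightGT_of_minimal hb.ge hg h t
  obtain ⟨hmon, hmem, heval, hmin⟩ := hg
  set m := g.natDegree with hm
  have hgm : g.coeff m = 1 := hmon
  have hone : (1 : Gr v) ≠ 0 := by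
    rw [← inAt_one, Ne, inAt_eq_zero_iff (one_mem_atLeast v), v.map_one]
    exact lt_irrefl _
  have hm0 : 0 < m := by
    rw [Nat.pos_iff_ne_zero]
    intro h0
    rw [hmon.natDegree_eq_zero.1 (hm ▸ h0), eval_one] at heval
    exact hone heval
  have hcomp := sum_component_eq_zero hb.ge heval
  rw [← hm] at hcomp
  -- the values of the coefficients
  have hval : ∀ j < m, ((m • b - j • b : Γ) : WithTop Γ) ≤ v (aeval x (d j)) := by
    intro j hj
    by_contra! hlt
    obtain ⟨γ, hγ⟩ := exists_coe_eq (v := v) (ne_zero_of_le_coe hlt.le)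
    rw [hγ] at hlt
    norm_cast at hlt
    -- The relation is not assumed homogeneous. If the value at `j` is too small, the part of weight
    -- `s` is a nonzero relation in which the leading coefficient `1`, of degree zero, has no
    -- component since `s ≠ m b`; its degree is therefore smaller than `m`.
    set s := γ + j • b with hs
    have hs' : s - m • b ≠ 0 := by grind
    set G : (Gr v)[X] := ∑ i ∈ Finset.range m,
      monomial i (DirectSum.of (Component v) (s - i • b) (g.coeff i (s - i • b))) with hG
    have hcoeff : ∀ i, G.coeff i = if i < m then
        DirectSum.of (Component v) (s - i • b) (g.coeff i (s - i • b)) else 0 := by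
      intro i
      rw [hG, finsetSum_coeff]
      simp only [coeff_monomial]
      rw [Finset.sum_ite_eq']
      simp only [Finset.mem_range]
    have hGj : G.coeff j ≠ 0 := by
      rw [hcoeff, if_pos hj, ← (hd j hj).2, initial_eq hγ, hs, add_sub_cancel_right,
        of_inAt hγ.ge, Ne, inAt_eq_zero_iff hγ.ge, hγ]
      exact lt_irrefl _
    have h1 : m ≤ G.natDegree := by
      refine hmin G (fun h => hGj (by rw [h, coeff_zero])) (fun i => ?_) ?_
      · rw [hcoeff]
        split_ifs with hi
        · obtain ⟨z, hz, h1, h2⟩ :=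
            exists_component_of_mem_classGroup hq.ne_zero (hmem i) (s - i • b)
          rw [h2]
          exact inAt_mem_classGroup hz h1
        · exact zero_mem _
      · have h2 := hcomp s
        rw [Finset.sum_range_succ, hgm, one_apply_ne_zero hs', map_zero, zero_mul, add_zero] at h2
        rw [hG, eval_finsetSum, ← h2]
        refine Finset.sum_congr rfl fun i _ => ?_
        rw [eval_monomial, ← inAt_pow hb.ge]
    have h2 : G.natDegree < m := by
      by_contra h
      have h3 := hcoeff G.natDegree
      rw [if_neg h] at h3
      exact hGj (by rw [leadingCoeff_eq_zero.1 h3, coeff_zero])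
    omega
  set e : ℕ → K[X] := fun j => if j < m then d j else 1 with he
  have hem : e m = 1 := by simp [he]
  have hed : ∀ j, (e j).degree < q.degree := by
    intro j
    simp only [he]
    split_ifs with h
    · exact (hd j h).1
    · rw [degree_one]; exact natDegree_pos_iff_degree_pos.1 hd0
  have hQ : q ^ m + ∑ j ∈ Finset.range m, d j * q ^ j =
      ∑ j ∈ Finset.range (m + 1), e j * q ^ j := by
    rw [Finset.sum_range_succ, hem, one_mul, add_comm]
    congr 1
    refine Finset.sum_congr rfl fun j hj => ?_
    simp only [he]
    rw [if_pos (Finset.mem_range.1 hj)]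
  have hev : ∀ j ≤ m, ((m • b - j • b : Γ) : WithTop Γ) ≤ v (aeval x (e j)) := by
    intro j hj
    rcases hj.lt_or_eq with h | rfl
    · simp only [he]; rw [if_pos h]; exact hval j h
    · rw [hem, map_one, v.map_one, sub_self]; rfl
  have hec : ∀ j ≤ m, DirectSum.of (Component v) (m • b - j • b) (g.coeff j (m • b - j • b)) =
      inAt v (m • b - j • b) (aeval x (e j)) := by
    intro j hj
    rcases hj.lt_or_eq with h | rfl
    · simp only [he]; rw [if_pos h, ← (hd j h).2]
      rcases (hval j h).eq_or_lt with h1 | h1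
      · rw [initial_eq h1.symm, of_inAt h1.le]
      · rw [(inAt_eq_zero_iff h1.le).2 h1]
        rcases eq_or_ne (aeval x (d j)) 0 with h2 | h2
        · rw [h2, initial_zero, DirectSum.zero_apply, map_zero]
        · obtain ⟨γ, hγ⟩ := exists_coe_eq (v := v) h2
          rw [initial_eq hγ, inAt_apply_of_ne, map_zero]
          rintro rfl
          rw [hγ] at h1
          exact lt_irrefl _ h1
    · rw [hem, map_one, hgm, sub_self, ← inAt_one, of_inAt (one_mem_atLeast v)]
  obtain ⟨h1, h2⟩ := monic_sum_digits hq (m := m) (fun j _ => hed j) hem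
  rw [hQ]
  refine ⟨hm0, h1, h2, fun j => ?_, ?_, hge⟩
  · rw [coeff_expand hq hd0, digit_sum hq _ fun j _ => hed j]
    split_ifs with hj
    · exact hev j (by omega)
    · rw [map_zero, v.map_zero]; exact le_top
  · have hle : ∀ j ∈ Finset.range (m + 1), ((m • b : Γ) : WithTop Γ) ≤
        v (aeval x (e j) * aeval x q ^ j) := by
      intro j hj
      have := mul_mem_atLeast v (hev j (by simpa [Nat.lt_succ_iff] using hj)) (le_pow j hb.ge)
      rwa [sub_add_cancel] at this
    rw [map_sum]
    simp only [map_mul, map_pow]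
    rw [← inAt_eq_zero_iff (v.map_le_sum hle), inAt_sum _ hle, ← hcomp (m • b)]
    refine Finset.sum_congr rfl fun j hj => ?_
    have hj' : j ≤ m := by simpa [Nat.lt_succ_iff] using hj
    rw [hec j hj', ← inAt_mul (hev j hj') (le_pow j hb.ge), sub_add_cancel]

/-- Existence of a minimal relation and of a lifting. -/
theorem IsKey.exists_minimal [Nontrivial Γ] [FiniteDimensional K L] (hk : IsKey v x q β)
    (hb : v (aeval x q) = b) : ∃ (g : (Gr v)[X]) (d : ℕ → K[X]),
      IsMinimalRelation (classGroup v x q : Set (Gr v)) (inAt v b (aeval x q)) g ∧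
      ∀ j < g.natDegree, (d j).degree < q.degree ∧ initial v (aeval x (d j)) = g.coeff j := by
  classical
  have hq := hk.monic
  have hd0 := hk.natDegree_pos
  have hx : IsIntegral K x := IsIntegral.of_finite K x
  have hex : ∃ m : ℕ, ∃ g : (Gr v)[X], g ≠ 0 ∧ (∀ j, g.coeff j ∈ classGroup v x q) ∧
      g.eval (inAt v b (aeval x q)) = 0 ∧ g.natDegree = m := by
    -- Some relation exists: the initial form of the minimal polynomial of `x`, which vanishes at
    -- `in q`.
    obtain ⟨t, n, hp⟩ := exists_isPivot v b (expand_ne_zero (x := x) hq hd0 hk.natDegree_le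
      (minpoly.ne_zero hx))
    refine ⟨_, grPoly v b t (expand x q (minpoly K x)), ?_, fun j => ?_, ?_, rfl⟩
    · intro h
      have h1 := congrArg (fun g => g.coeff n) h
      rw [coeff_grPoly, coeff_zero, inAt_eq_zero_iff hp.eq.ge, hp.eq] at h1
      exact lt_irrefl _ h1
    · have h1 := hp.ge j
      rw [coeff_expand hq hd0] at h1
      rw [coeff_grPoly, coeff_expand hq hd0]
      exact inAt_mem_classGroup (degree_digit_lt hq _ _) h1
    · rw [eval_grPoly hp.ge hb.ge, eval_expand hq hd0, minpoly.aeval, inAt_zero]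
  obtain ⟨g', hg0, hmem, heval, hm⟩ := Nat.find_spec hex
  have hmin : ∀ g : (Gr v)[X], g ≠ 0 → (∀ j, g.coeff j ∈ classGroup v x q) →
      g.eval (inAt v b (aeval x q)) = 0 → Nat.find hex ≤ g.natDegree := fun g h1 h2 h3 =>
    Nat.find_min' hex ⟨g, h1, h2, h3, rfl⟩
  set m := Nat.find hex
  have hlead : g'.coeff m ≠ 0 := by
    rw [← hm]; exact leadingCoeff_ne_zero.2 hg0
  -- A relation of least degree need be neither homogeneous nor monic. A part in which the leading
  -- coefficient does not vanish is kept, and multiplied by the class of an approximate inverse of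
  -- that coefficient.
  obtain ⟨γ, hγ⟩ : ∃ γ, g'.coeff m γ ≠ 0 := by
    by_contra! h
    exact hlead (DFinsupp.ext h)
  set s := γ + m • b with hs
  choose z hz hzv hzc using fun j =>
    exists_component_of_mem_classGroup hq.ne_zero (hmem j) (s - j • b)
  have hsm : s - m • b = γ := by rw [hs, add_sub_cancel_right]
  have hzm : v (aeval x (z m)) = γ := by
    have h1 := hzv m
    have h2 := hzc m
    rw [hsm] at h1 h2
    rcases h1.eq_or_lt with h | h
    · exact h.symm
    · rw [(inAt_eq_zero_iff h1).2 h] at h2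
      exact absurd (DirectSum.of_injective _ (h2.trans (map_zero _).symm)) hγ
  have hzm0 : z m ≠ 0 := by
    intro h
    rw [h, map_zero, v.map_zero] at hzm
    exact WithTop.top_ne_coe hzm
  obtain ⟨a, ha, -, hza, -, h4⟩ := hk.exists_inverse (hz m) hzm0
  have haγ : v (aeval x a) = ((-γ : Γ) : WithTop Γ) := by
    rw [hzm] at h4
    cases hva : v (aeval x a) with
    | top => rw [hva, WithTop.add_top] at h4; exact absurd h4 WithTop.top_ne_zero
    | coe α =>
      rw [hva] at h4
      norm_cast at h4 ⊢
      exact eq_neg_of_add_eq_zero_right h4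
  set e : ℕ → K[X] := fun j => (z j * a) %ₘ q with he
  have hed : ∀ j, (e j).degree < q.degree := fun j => degree_modByMonic_lt _ hq
  have hem : e m = 1 := hza
  have hes : ∀ j : ℕ, s - j • b + -γ = m • b - j • b := fun j => by rw [hs]; abel
  have hev : ∀ j, ((m • b - j • b : Γ) : WithTop Γ) ≤ v (aeval x (e j)) ∧
      inAt v (s - j • b) (aeval x (z j)) * inAt v (-γ) (aeval x a) =
        inAt v (m • b - j • b) (aeval x (e j)) := fun j => by
    have := hk.inAt_mul_eq (hz j) ha (hzv j) haγ.ge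
    rwa [hes] at this
  obtain ⟨hQm, hQd⟩ := monic_sum_digits hq (m := m) (fun j _ => hed j) hem
  set Q := ∑ j ∈ Finset.range (m + 1), e j * q ^ j with hQ
  have hcoeff : ∀ j, (expand x q Q).coeff j = if j < m + 1 then aeval x (e j) else 0 := by
    intro j
    rw [coeff_expand hq hd0, hQ, digit_sum hq _ fun j _ => hed j]
    split_ifs
    · rfl
    · exact map_zero _
  have hQw : WeightGE v b (m • b) (expand x q Q) := by
    intro j
    rw [hcoeff]
    split_ifs
    · exact (hev j).1
    · rw [v.map_zero]; exact le_top
  set g := grPoly v b (m • b) (expand x q Q) with hg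
  have hgc : ∀ j, g.coeff j = if j < m + 1 then inAt v (m • b - j • b) (aeval x (e j)) else 0 := by
    intro j
    rw [hg, coeff_grPoly, hcoeff]
    split_ifs
    · rfl
    · exact inAt_zero
  have hgm : g.coeff m = 1 := by
    rw [hgc, if_pos (Nat.lt_succ_self m), hem, map_one, sub_self, inAt_one]
  have hgd : g.natDegree ≤ m := by
    rw [natDegree_le_iff_coeff_eq_zero]
    intro j hj
    rw [hgc, if_neg (by omega)]
  have hmon : g.Monic := monic_of_natDegree_le_of_coeff_eq_one m hgd hgm
  have hone : (1 : Gr v) ≠ 0 := by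
    rw [← inAt_one, Ne, inAt_eq_zero_iff (one_mem_atLeast v), v.map_one]
    exact lt_irrefl _
  have hgdeg : g.natDegree = m :=
    le_antisymm hgd (le_natDegree_of_ne_zero (by rw [hgm]; exact hone))
  -- The coefficient of `g` is a class in a prescribed degree. When `e j` has greater value this
  -- class is zero although `initial` of `e j` may not be, so `e j` is replaced by zero.
  refine ⟨g, fun j => if v (aeval x (e j)) = ((m • b - j • b : Γ) : WithTop Γ) then e j else 0,
    ⟨hmon, fun j => ?_, ?_, fun g'' h1 h2 h3 => ?_⟩, fun j hj => ?_⟩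
  · rw [hgc]
    split_ifs
    · exact inAt_mem_classGroup (hed j) (hev j).1
    · exact zero_mem _
  · have h1 := sum_component_eq_zero hb.ge heval s
    rw [hm] at h1
    rw [eval_eq_sum_range, hgdeg, ← zero_mul (inAt v (-γ) (aeval x a)), ← h1, Finset.sum_mul]
    refine Finset.sum_congr rfl fun j hj => ?_
    rw [hgc, if_pos (Finset.mem_range.1 hj), hzc j, ← (hev j).2, inAt_pow hb.ge]
    ring
  · rw [hgdeg]; exact hmin g'' h1 h2 h3
  · rw [hgdeg] at hj
    rw [hgc, if_pos (by omega)]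
    dsimp only
    split_ifs with h
    · exact ⟨hed j, initial_eq h⟩
    · refine ⟨degree_zero_lt hq.ne_zero, ?_⟩
      rw [map_zero, initial_zero, (inAt_eq_zero_iff (hev j).1).2]
      exact lt_of_le_of_ne (hev j).1 (Ne.symm h)

end Relation

/-! ### Combinations of monomials -/

section Monomials

variable {K L Γ : Type*} [Field K] [Field L] [Algebra K L]
  [AddCommGroup Γ] [LinearOrder Γ] [IsOrderedAddMonoid Γ]
  {v : AddValuation L (WithTop Γ)} {x : L} {q : K[X]} {β b γ δ s t : Γ}
  {I J : Type*} {u : I → L}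

theorem monomialGroup_le_of_comp {u' : J → L} (f : I → J) (hf : ∀ i, u' (f i) = u i) :
    monomialGroup K v u γ ≤ monomialGroup K v u' γ := by
  rw [monomialGroup, AddSubgroup.closure_le]
  rintro y ⟨c, m, rfl, h⟩
  refine AddSubgroup.subset_closure ⟨c, m.mapDomain f, ?_, h⟩
  rw [Finsupp.prod_mapDomain_index (fun _ => pow_zero _) (fun _ _ _ => pow_add _ _ _)]
  simp only [hf]

theorem mul_mem_monomialGroup {y z : L} (hy : y ∈ monomialGroup K v u γ)
    (hz : z ∈ monomialGroup K v u δ) : y * z ∈ monomialGroup K v u (γ + δ) := by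
  induction hy using AddSubgroup.closure_induction with
  | mem y hy =>
    obtain ⟨a, m, rfl, h⟩ := hy
    induction hz using AddSubgroup.closure_induction with
    | mem z hz =>
      obtain ⟨c, n, rfl, h'⟩ := hz
      refine AddSubgroup.subset_closure ⟨a * c, m + n, ?_, mul_mem_atLeast v h h'⟩
      rw [Finsupp.prod_add_index' (fun _ => pow_zero _) (fun _ _ _ => pow_add _ _ _), map_mul]
      ring
    | zero => rw [mul_zero]; exact zero_mem _
    | add y y' _ _ h h' => rw [mul_add]; exact add_mem h h'
    | neg y _ h => rw [mul_neg]; exact neg_mem h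
  | zero => rw [zero_mul]; exact zero_mem _
  | add y y' _ _ h h' => rw [add_mul]; exact add_mem h h'
  | neg y _ h => rw [neg_mul]; exact neg_mem h

theorem pow_mem_monomialGroup (i : I) (hi : (b : WithTop Γ) ≤ v (u i)) (n : ℕ) :
    u i ^ n ∈ monomialGroup K v u (n • b) := by
  refine AddSubgroup.subset_closure ⟨1, Finsupp.single i n, ?_, le_pow n hi⟩
  rw [Finsupp.prod_single_index (h := fun i n => u i ^ n) (pow_zero _), map_one, one_mul]

theorem algebraMap_mem_monomialGroup {c : K} (hc : (γ : WithTop Γ) ≤ v (algebraMap K L c)) :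
    algebraMap K L c ∈ monomialGroup K v u γ := by
  refine AddSubgroup.subset_closure ⟨c, 0, ?_, hc⟩
  rw [Finsupp.prod_zero_index, mul_one]

/-- If the digits of `h` are combinations of monomials and `q(x)` is one of the `u i`, then `h(x)`
is a combination of monomials of value at least the weight of `h`. -/
theorem mem_monomialGroup_of_weightGE (hq : q.Monic) (hd : 0 < q.natDegree)
    (hcomp : ∀ (h : K[X]) (γ : Γ), h.degree < q.degree → (γ : WithTop Γ) ≤ v (aeval x h) →
      aeval x h ∈ monomialGroup K v u γ) (i : I) (hi : u i = aeval x q)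
    (hb : (b : WithTop Γ) ≤ v (aeval x q)) {h : K[X]} (hh : WeightGE v b γ (expand x q h)) :
    aeval x h ∈ monomialGroup K v u γ := by
  have h1 : h.natDegree < (h.natDegree + 1) * q.natDegree :=
    lt_of_lt_of_le (Nat.lt_succ_self _) (Nat.le_mul_of_pos_right _ hd)
  rw [← sum_digit hq h h1, map_sum]
  refine sum_mem fun j _ => ?_
  have h2 := hh j
  rw [coeff_expand hq hd] at h2
  have h3 := mul_mem_monomialGroup (hcomp _ _ (degree_digit_lt hq h j) h2)
    (pow_mem_monomialGroup (K := K) i (hi ▸ hb) j)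
  rwa [sub_add_cancel, hi, ← map_pow, ← map_mul] at h3

end Monomials

/-! ### Liftings of minimal relations -/

section Lift

variable {K L Γ : Type*} [Field K] [Field L] [Algebra K L]
  [AddCommGroup Γ] [LinearOrder Γ] [IsOrderedAddMonoid Γ]
  {v : AddValuation L (WithTop Γ)} {x : L} {q Q z : K[X]} {β b c γ s t : Γ} {n α : ℕ}

theorem IsKey.mono (hk : IsKey v x q β) (hb : β ≤ b) (hq : (b : WithTop Γ) ≤ v (aeval x q)) :
    IsKey v x q b where
  monic := hk.monic
  natDegree_pos := hk.natDegree_pos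
  natDegree_le := hk.natDegree_le
  le_val := hq
  carry a c s t ha hc hs ht :=
    lt_of_le_of_lt (WithTop.coe_le_coe.2 (sub_le_sub_left hb _)) (hk.carry a c s t ha hc hs ht)

/-- A lower term tying with `n` at the weight `b` would be strictly lighter at `c`, where `n` is
still a pivot. -/
theorem IsPivot.isVertex_of_lt {G : L[X]} (h : IsPivot v b t n G) (hc : IsPivot v c s n G)
    (hbc : b < c) : IsVertex v b t n G := by
  refine ⟨h.eq, fun j hj => ?_⟩
  rcases lt_or_gt_of_ne hj with hj | hj
  · refine lt_of_lt_of_le (WithTop.coe_lt_coe.2 ?_) (hc.ge j)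
    have h1 := h.eq.symm.trans hc.eq
    norm_cast at h1
    obtain ⟨i, rfl⟩ := Nat.exists_eq_add_of_lt hj
    have h2 := nsmul_lt_nsmul_right (n := i + 1) (by omega) hbc
    simp only [add_nsmul] at h1 h2
    grind
  · exact h.gt j hj

theorem natDegree_lt_of_degree_lt {h : K[X]} (hQ : 0 < Q.natDegree) (hh : h.degree < Q.degree) :
    h.natDegree < Q.natDegree := by
  rcases eq_or_ne h 0 with rfl | h0
  · rwa [natDegree_zero]
  · exact natDegree_lt_natDegree h0 hh

variable [Nontrivial Γ] [FiniteDimensional K L]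

/-- Below the degree of `Q` there is no cancellation: if the value exceeded the minimal weight,
`weightGT` would deny that this weight is attained. -/
theorem IsLift.weightGE (hl : IsLift v x q b α Q) (hk : IsKey v x q β) {h : K[X]}
    (hd : h.natDegree < α * q.natDegree) (hs : (s : WithTop Γ) ≤ v (aeval x h)) :
    WeightGE v b s (expand x q h) := by
  rcases eq_or_ne h 0 with rfl | h0
  · rw [expand_zero]; exact weightGE_zero
  obtain ⟨t, n, hp⟩ := exists_isPivot v b
    (expand_ne_zero (x := x) hk.monic hk.natDegree_pos hk.natDegree_le h0)
  by_contra hne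
  have hlt : t < s := by
    by_contra! hts
    exact hne (hp.ge.mono hts)
  have h1 := hl.weightGT h t hd hp.ge (lt_of_lt_of_le (WithTop.coe_lt_coe.2 hlt) hs) n
  rw [hp.eq] at h1
  exact lt_irrefl _ h1

/-- The minimal polynomial vanishes at `x`, so its value exceeds its weight, which is impossible
below the degree of `Q`. -/
theorem IsLift.natDegree_le (hl : IsLift v x q b α Q) (hk : IsKey v x q β) :
    Q.natDegree ≤ (minpoly K x).natDegree := by
  by_contra! h
  rw [hl.natDegree_eq] at h
  obtain ⟨t, n, hp⟩ := exists_isPivot v b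
    (expand_ne_zero (x := x) hk.monic hk.natDegree_pos hk.natDegree_le
      (minpoly.ne_zero (IsIntegral.of_finite K x)))
  have h1 := hl.weightGT _ t h hp.ge (by rw [minpoly.aeval, v.map_zero]; exact WithTop.coe_lt_top _) n
  rw [hp.eq] at h1
  exact lt_irrefl _ h1

/-- A product of two polynomials of small degree has `q`-weight at least `s + t`; dividing by `Q`
lowers the weight by at most `α b`, which is less than `c`. -/
theorem IsLift.isKey (hl : IsLift v x q b α Q) (hk : IsKey v x q β) (hβ : β ≤ b)
    (hb : (b : WithTop Γ) ≤ v (aeval x q)) (hc : α • b < c) (hQ : (c : WithTop Γ) ≤ v (aeval x Q)) :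
    IsKey v x Q c where
  monic := hl.monic
  natDegree_pos := by rw [hl.natDegree_eq]; exact Nat.mul_pos hl.pos hk.natDegree_pos
  natDegree_le := hl.natDegree_le hk
  le_val := hQ
  carry a d s t ha hd hs ht := by
    have hpos : 0 < α * q.natDegree := Nat.mul_pos hl.pos hk.natDegree_pos
    have key : ∀ (a : K[X]) (s : Γ), a.degree < Q.degree → (s : WithTop Γ) ≤ v (aeval x a) →
        WeightGE v b s (expand x q a) := fun a s ha hs => by
      refine hl.weightGE hk ?_ hs
      rw [← hl.natDegree_eq] at hpos ⊢
      exact natDegree_lt_of_degree_lt hpos ha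
    have h1 := hk.weightGE_expand_mul hβ hb a d (key a s ha hs) (key d t hd ht)
    have h2 := hk.weightGE_div hβ hb hl.monic hl.natDegree_eq hl.weight h1
    have h3 := h2.eval hb
    rw [eval_expand hk.monic hk.natDegree_pos] at h3
    exact lt_of_lt_of_le (WithTop.coe_lt_coe.2 (sub_lt_sub_left hc _)) h3

omit [Nontrivial Γ] [FiniteDimensional K L] in
/-- The special case in terms of polynomials. -/
theorem IsKey.special_iff (hk : IsKey v x q β) (hβ : β ≤ b) (hb : v (aeval x q) = b)
    (hp : IsPivot v b t n (expand x q (minpoly K x))) :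
    (∃ g : (Gr v)[X], IsMinimalRelation (classGroup v x q : Set (Gr v)) (inAt v b (aeval x q)) g ∧
      g.natDegree = 1 ∧ initialForm v x q b (minpoly K x) =
        C (initial v (aeval x (digit q (minpoly K x) n))) * g ^ n) ↔
    ∃ z : K[X], z.degree < q.degree ∧ (b : WithTop Γ) < v (aeval x (q + z)) ∧
      IsVertex v b t n (expand x (q + z) (minpoly K x)) := by
  have hone : (1 : Gr v) ≠ 0 := by
    rw [← inAt_one, Ne, inAt_eq_zero_iff (one_mem_atLeast v), v.map_one]
    exact lt_irrefl _
  constructor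
  · rintro ⟨g, ⟨hmon, hmem, heval, -⟩, hg1, hinit⟩
    have hg : g = X + C (g.coeff 0) := by
      have h1 : g.coeff 1 = 1 := by rw [← hg1]; exact hmon
      have h2 := eq_X_add_C_of_natDegree_le_one hg1.le
      rw [h1, C_1, one_mul] at h2
      exact h2
    have h0 : g.coeff 0 = -inAt v b (aeval x q) := by
      rw [hg, eval_add, eval_X, eval_C] at heval
      exact eq_neg_of_add_eq_zero_right heval
    obtain ⟨z, hz, hzb, hzc⟩ := exists_component_of_mem_classGroup hk.monic.ne_zero (hmem 0) b
    have h1 : g.coeff 0 = inAt v b (aeval x z) := by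
      rw [← hzc, h0, ← inAt_neg hb.ge, of_inAt]
      rw [v.map_neg]; exact hb.ge
    refine ⟨z, hz, ?_, ?_⟩
    · rw [map_add, ← inAt_eq_zero_iff (v.map_le_add hb.ge hzb), inAt_add hb.ge hzb, ← h1, h0,
        add_neg_cancel]
    · rw [hk.isVertex_add_iff hz hβ hb.ge hzb hp, ← h1, ← hg]
      exact hinit
  · rintro ⟨z, hz, hlt, hver⟩
    have hzb : (b : WithTop Γ) ≤ v (aeval x z) := by
      have e : aeval x z = aeval x (q + z) - aeval x q := by rw [map_add]; ring
      rw [e]; exact v.map_le_sub hlt.le hb.ge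
    have hcoeff : ∀ j, (X + C (inAt v b (aeval x z)) : (Gr v)[X]).coeff j ∈ classGroup v x q := by
      intro j
      rw [coeff_add, coeff_X, coeff_C]
      refine add_mem ?_ ?_
      · split_ifs
        · exact one_mem_classGroup hk.natDegree_pos
        · exact zero_mem _
      · split_ifs
        · exact inAt_mem_classGroup hz hzb
        · exact zero_mem _
    have : Nontrivial (Gr v) := ⟨1, 0, hone⟩
    refine ⟨X + C (inAt v b (aeval x z)), ⟨monic_X_add_C _, hcoeff, ?_, fun g' h1 _ h3 => ?_⟩,
      natDegree_X_add_C _, ?_⟩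
    · rw [eval_add, eval_X, eval_C, ← inAt_add hb.ge hzb, ← map_add, inAt_eq_zero_iff hlt.le]
      exact hlt
    · rw [natDegree_X_add_C]
      by_contra! h
      have h4 := eq_C_of_natDegree_eq_zero (Nat.lt_one_iff.1 h)
      rw [h4, eval_C] at h3
      rw [h3, C_0] at h4
      exact h1 h4
    · exact (hk.isVertex_add_iff hz hβ hb.ge hzb hp).1 hver

end Lift

/-! ### Sequences of polynomials produced by the construction -/

section State

variable {K L Γ : Type*} [Field K] [Field L] [Algebra K L]
  [AddCommGroup Γ] [LinearOrder Γ] [IsOrderedAddMonoid Γ]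
  {v : AddValuation L (WithTop Γ)} {x : L} {Q : Ordinal.{0} → K[X]} {l l' : Ordinal.{0}}
  {q s : K[X]} {z : ℕ → K[X]} {β b c γ t : Γ} {n r p : ℕ}

/-- `Q l` is a key polynomial, the polynomials of smaller degree are combinations of monomials in
the preceding `Q i`, and the preceding `Q i` have smaller value and are congruent to polynomials of
smaller degree. -/
structure IsState (v : AddValuation L (WithTop Γ)) (x : L) (Q : Ordinal.{0} → K[X])
    (l : Ordinal.{0}) : Prop where
  key : ∃ β, IsKey v x (Q l) β
  comp : ∀ (h : K[X]) (γ : Γ), h.degree < (Q l).degree → (γ : WithTop Γ) ≤ v (aeval x h) →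
    aeval x h ∈ monomialGroup K v (fun i : Set.Iio l => aeval x (Q i)) γ
  approx : ∀ i < l, v (aeval x (Q i)) < v (aeval x (Q l)) ∧ ∃ z : K[X],
    z.degree < (Q l).degree ∧ v (aeval x (Q i)) < v (aeval x (Q i) - aeval x z)
  pos : 0 < v (aeval x (Q l))

theorem IsState.isKey (h : IsState v x Q l) (hb : v (aeval x (Q l)) = b) : IsKey v x (Q l) b := by
  obtain ⟨β, hβ⟩ := h.key
  have h1 := hβ.le_val
  rw [hb] at h1
  exact hβ.mono (by exact_mod_cast h1) hb.ge

theorem IsState.monic (h : IsState v x Q l) : (Q l).Monic := h.key.choose_spec.monic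

theorem IsState.natDegree_pos (h : IsState v x Q l) : 0 < (Q l).natDegree :=
  h.key.choose_spec.natDegree_pos

theorem IsState.natDegree_le (h : IsState v x Q l) :
    (Q l).natDegree ≤ (minpoly K x).natDegree := h.key.choose_spec.natDegree_le

/-- Downward from the last term: subtracting `z (k + 1)` from a sum of greater value leaves an
element of the value of `z (k + 1)`, which is greater than that of `z k`. -/
theorem IsTail.lt_val_partialSum (h : IsTail v x q z r)
    (hr : val v x (z r) < val v x (partialSum q z (r + 1))) {k : ℕ} (hk : k ≤ r) :
    val v x (z k) < val v x (partialSum q z (k + 1)) := by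
  induction hk using Nat.decreasingInduction with
  | self => exact hr
  | of_succ k hk ih =>
    have h1 := h.val_lt k hk
    have h2 : val v x (partialSum q z (k + 1)) = val v x (z (k + 1)) := by
      rw [partialSum_succ] at ih
      have e : aeval x (partialSum q z (k + 1)) =
        aeval x (partialSum q z (k + 1) + z (k + 1)) - aeval x (z (k + 1)) := by
        rw [map_add]; ring
      unfold val at ih ⊢
      rw [e, v.map_sub_eq_of_lt_right ih]
    rwa [h2]

theorem IsTail.val_partialSum (h : IsTail v x q z r)
    (hr : val v x (z r) < val v x (partialSum q z (r + 1))) {k : ℕ} (hk : k ≤ r) :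
    val v x (partialSum q z k) = val v x (z k) := by
  have ih := h.lt_val_partialSum hr hk
  rw [partialSum_succ] at ih
  have e : aeval x (partialSum q z k) =
    aeval x (partialSum q z k + z k) - aeval x (z k) := by
    rw [map_add]; ring
  unfold val at ih ⊢
  rw [e, v.map_sub_eq_of_lt_right ih]

theorem degree_partialSum (h : IsTail v x q z r) (hq : q ≠ 0) {k : ℕ} (hk : k ≤ r + 1) :
    (partialSum q z k).degree = q.degree :=
  degree_add_eq_left_of_degree_lt (h.degree_sum_lt hq hk)

/-- Two monic polynomials of the same degree differ by a polynomial of smaller degree. -/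
theorem degree_sub_lt_of_monic {g h : K[X]} (hg : g.Monic) (hh : h.Monic)
    (hd : g.degree = h.degree) : (g - h).degree < h.degree := by
  rw [← hd]
  exact degree_sub_lt_left hd hg.ne_zero (by rw [hg.leadingCoeff, hh.leadingCoeff])

variable [Nontrivial Γ]

theorem IsKey.lt_val_of_memT (hk : IsKey v x q b) (hb : v (aeval x q) = b)
    (hp : IsPivot v b t n (expand x q (minpoly K x))) (hT : MemT v x q z r) :
    IsTail v x q z r ∧ val v x (z r) < val v x (partialSum q z (r + 1)) := by
  obtain ⟨h1, c, hc, hv⟩ := (memT_iff hk le_rfl hb hp z r).1 hT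
  have hk' := h1.isKey hk le_rfl
  refine ⟨h1, ?_⟩
  rw [hc]
  exact hk'.lt_val_of_isVertex hk'.le_val (h1.isPivot hk le_rfl le_rfl hb hp) hv

omit [Nontrivial Γ] in
/-- If the side of the Newton polygon is special, then every polynomial of the form `q + s` of
greater value than `q` belongs to `T`. -/
theorem IsKey.isVertex_of_special (hk : IsKey v x q b)
    (hsp : ∃ z : K[X], z.degree < q.degree ∧ (b : WithTop Γ) < v (aeval x (q + z)) ∧
      IsVertex v b t n (expand x (q + z) (minpoly K x)))
    (hs : s.degree < q.degree) (hlt : (b : WithTop Γ) < v (aeval x (q + s))) :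
    IsVertex v b t n (expand x (q + s) (minpoly K x)) := by
  obtain ⟨z, hz, hzlt, hver⟩ := hsp
  have hzb : (b : WithTop Γ) ≤ v (aeval x z) := by
    have e : aeval x z = aeval x (q + z) - aeval x q := by rw [map_add]; ring
    rw [e]; exact v.map_le_sub hzlt.le hk.le_val
  have hk' := hk.add hz hzb
  have hdeg : (q + z).degree = q.degree := degree_add_eq_left_of_degree_lt hz
  have h1 : (s - z).degree < (q + z).degree := by
    rw [hdeg]; exact lt_of_le_of_lt (degree_sub_le _ _) (max_lt hs hz)
  have h2 : (b : WithTop Γ) < v (aeval x (s - z)) := by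
    have e : aeval x (s - z) = aeval x (q + s) - aeval x (q + z) := by
      rw [map_add, map_add, map_sub]; ring
    rw [e]; exact lt_map_sub hlt hzlt
  have h3 := hk'.isVertex_add h1 le_rfl hk'.le_val h2 hver
  rwa [show q + z + (s - z) = q + s by ring] at h3

theorem IsKey.memT_const (hk : IsKey v x q b) (hb : v (aeval x q) = b)
    (hp : IsPivot v b t n (expand x q (minpoly K x)))
    (hsp : ∃ z : K[X], z.degree < q.degree ∧ (b : WithTop Γ) < v (aeval x (q + z)) ∧
      IsVertex v b t n (expand x (q + z) (minpoly K x)))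
    (hs : s.degree < q.degree) (hlt : (b : WithTop Γ) < v (aeval x (q + s))) :
    MemT v x q (fun _ => s) 0 := by
  have hsb : v (aeval x s) = b := by
    have e : aeval x s = aeval x (q + s) - aeval x q := by rw [map_add]; ring
    rw [← hb] at hlt ⊢
    rw [e, v.map_sub_eq_of_lt_right hlt]
  rw [memT_iff hk le_rfl hb hp]
  refine ⟨⟨fun _ _ => hs, hsb.trans hb.symm, fun k hk => absurd hk (Nat.not_lt_zero k)⟩, b, hsb, ?_⟩
  have h1 := hk.isVertex_of_special hsp hs hlt
  rw [partialSum_succ, partialSum_zero, sub_self, nsmul_zero, add_zero]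
  exact h1

variable [FiniteDimensional K L]

theorem exists_isPivot_minpoly (hk : IsKey v x q β) (b : Γ) :
    ∃ t n, IsPivot v b t n (expand x q (minpoly K x)) :=
  exists_isPivot v b (expand_ne_zero (x := x) hk.monic hk.natDegree_pos hk.natDegree_le
    (minpoly.ne_zero (IsIntegral.of_finite K x)))

theorem IsState.gradedBelow_eq (h : IsState v x Q l) :
    gradedBelow v x Q l = (classGroup v x (Q l) : Set (Gr v)) := by
  obtain ⟨β, hβ⟩ := h.key
  rw [gradedBelow, Set.image_eq_range]
  exact hβ.saturation_eq_classGroup h.comp fun i => by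
    obtain ⟨-, z, hz, h1⟩ := h.approx i i.2
    exact ⟨z, hz, h1⟩

theorem IsState.special_iff (h : IsState v x Q l) (hb : v (aeval x (Q l)) = b)
    (hp : IsPivot v b t n (expand x (Q l) (minpoly K x))) :
    Special v x Q l ↔ ∃ z : K[X], z.degree < (Q l).degree ∧
      (b : WithTop Γ) < v (aeval x (Q l + z)) ∧
      IsVertex v b t n (expand x (Q l + z) (minpoly K x)) := by
  have hk := h.isKey hb
  rw [← hk.special_iff le_rfl hb hp, Special, h.gradedBelow_eq, initial_eq hb,
    pivot_eq hk.monic hk.natDegree_pos hb hp]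
  unfold val
  rw [hb]

/-! #### The first key polynomial -/

omit [Nontrivial Γ] in
-- Polynomials of degree less than `deg X` are constants, so no carry occurs and they are monomials
-- already. Any element of `Γ` bounding `v x` from below serves as weight, since `v x` may be `⊤`.
theorem isState_zero (h0 : Q 0 = X) (hx : 0 < v x) : IsState v x Q 0 := by
  have hint : IsIntegral K x := IsIntegral.of_finite K x
  have hconst : ∀ h : K[X], h.degree < (X : K[X]).degree → ∃ a, h = C a := fun h hh => by
    have h1 := natDegree_lt_of_degree_lt (by rw [natDegree_X]; exact one_pos) hh
    rw [natDegree_X] at h1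
    exact ⟨_, eq_C_of_natDegree_eq_zero (Nat.lt_one_iff.1 h1)⟩
  constructor
  · obtain ⟨β, hβ⟩ : ∃ β : Γ, (β : WithTop Γ) ≤ v x := by
      cases h : v x with
      | top => exact ⟨0, le_top⟩
      | coe γ => exact ⟨γ, le_rfl⟩
    rw [h0]
    refine ⟨β, monic_X, by rw [natDegree_X]; exact one_pos, ?_, by rwa [aeval_X], ?_⟩
    · rw [natDegree_X]; exact minpoly.natDegree_pos hint
    · intro a c s t ha hc _ _
      obtain ⟨a, rfl⟩ := hconst a ha
      obtain ⟨c, rfl⟩ := hconst c hc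
      rw [← C_mul, (divByMonic_eq_zero_iff monic_X).2, map_zero, v.map_zero]
      · exact WithTop.coe_lt_top _
      · exact lt_of_le_of_lt degree_C_le (by rw [degree_X]; exact zero_lt_one)
  · intro h γ hh hγ
    rw [h0] at hh
    obtain ⟨a, rfl⟩ := hconst h hh
    rw [aeval_C] at hγ ⊢
    exact algebraMap_mem_monomialGroup hγ
  · intro i hi
    exact absurd hi not_lt_bot
  · rwa [h0, aeval_X]

/-! #### Lifting a minimal relation -/

omit [Nontrivial Γ] [FiniteDimensional K L] in
theorem IsState.comp_of_weightGE (h : IsState v x Q l) (hl : l < l')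
    (hb : (b : WithTop Γ) ≤ v (aeval x (Q l))) {g : K[X]} (hg : WeightGE v b γ (expand x (Q l) g)) :
    aeval x g ∈ monomialGroup K v (fun i : Set.Iio l' => aeval x (Q i)) γ :=
  mem_monomialGroup_of_weightGE h.monic h.natDegree_pos
    (fun g γ h1 h2 => monomialGroup_le_of_comp (u' := fun i : Set.Iio l' => aeval x (Q i))
      (fun i : Set.Iio l => ⟨i.1, i.2.trans hl⟩) (fun _ => rfl) (h.comp g γ h1 h2))
    ⟨l, hl⟩ rfl hb hg

theorem IsState.lift (h : IsState v x Q l) (hb : v (aeval x (Q l)) = b)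
    (hlift : LiftStep v x Q l) :
    IsState v x Q (l + 1) ∧ ∃ α, IsLift v x (Q l) b α (Q (l + 1)) := by
  obtain ⟨g, d, hg, hd, hQ⟩ := hlift
  have hk := h.isKey hb
  rw [h.gradedBelow_eq, initial_eq hb] at hg
  have hl := hk.isLift_of_minimal hb hg hd
  rw [← hQ] at hl
  have hb0 : 0 < b := by
    have := h.pos
    rw [hb] at this
    exact_mod_cast this
  have hαb : b ≤ g.natDegree • b := by
    conv_lhs => rw [← one_nsmul b]
    exact nsmul_le_nsmul_left hb0.le hl.pos
  have hlt : v (aeval x (Q l)) < v (aeval x (Q (l + 1))) := by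
    rw [hb]; exact lt_of_le_of_lt (WithTop.coe_le_coe.2 hαb) hl.lt_val
  -- `Q (l + 1)` may vanish at `x`; any sufficiently large finite weight then replaces its value.
  obtain ⟨c, hc, hcQ⟩ : ∃ c : Γ, g.natDegree • b < c ∧ (c : WithTop Γ) ≤ v (aeval x (Q (l + 1))) := by
    have h1 := hl.lt_val
    cases hv : v (aeval x (Q (l + 1))) with
    | top =>
      obtain ⟨c, hc⟩ := exists_gt (g.natDegree • b)
      exact ⟨c, hc, le_top⟩
    | coe γ =>
      rw [hv] at h1
      exact ⟨γ, WithTop.coe_lt_coe.1 h1, le_rfl⟩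
  have hk' := hl.isKey hk le_rfl hb.ge hc hcQ
  have hdeg : (Q l).degree ≤ (Q (l + 1)).degree := by
    rw [degree_eq_natDegree hk.monic.ne_zero, degree_eq_natDegree hk'.monic.ne_zero, hl.natDegree_eq]
    exact_mod_cast Nat.le_mul_of_pos_left _ hl.pos
  refine ⟨⟨⟨c, hk'⟩, fun a γ ha hγ => ?_, fun i hi => ?_, h.pos.trans hlt⟩, _, hl⟩
  · refine h.comp_of_weightGE (lt_add_one l) hb.ge (hl.weightGE hk ?_ hγ)
    rw [← hl.natDegree_eq]
    exact natDegree_lt_of_degree_lt hk'.natDegree_pos ha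
  · rcases (Order.lt_add_one_iff.1 hi).lt_or_eq with hi | rfl
    · obtain ⟨h1, z, hz, h2⟩ := h.approx i hi
      exact ⟨h1.trans hlt, z, lt_of_lt_of_le hz hdeg, h2⟩
    · refine ⟨hlt, ?_⟩
      rcases hdeg.lt_or_eq with h1 | h1
      · exact ⟨Q i, h1, by rw [sub_self, v.map_zero, hb]; exact WithTop.coe_lt_top _⟩
      -- For a linear relation the degree does not increase and `Q i` is no longer of smaller
      -- degree; it is congruent to its difference with the next polynomial, which has greater
      -- value.
      · refine ⟨Q i - Q (i + 1), degree_sub_lt_of_monic hk.monic hk'.monic h1, ?_⟩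
        rw [map_sub (aeval (R := K) x), sub_sub_cancel]
        exact hlt

/-! #### Blocks -/

theorem exists_lt_add_natCast {l i : Ordinal.{0}} {m : ℕ} (hi : l ≤ i) (him : i < l + (m : Ordinal.{0})) :
    ∃ k < m, i = l + (k : Ordinal.{0}) := by
  obtain ⟨a, rfl⟩ : ∃ a, i = l + a := ⟨i - l, (Ordinal.add_sub_cancel_of_le hi).symm⟩
  rw [add_lt_add_iff_left] at him
  obtain ⟨k, rfl⟩ := Ordinal.lt_omega0.1 (him.trans (Ordinal.natCast_lt_omega0 m))
  exact ⟨k, by exact_mod_cast him, rfl⟩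

omit [Nontrivial Γ] [FiniteDimensional K L] in
-- With the degree unchanged there are no new polynomials to express. Each intermediate `Q i` is
-- congruent to `Q i - Q l'`, of smaller degree, because `Q l'` has greater value.
theorem IsState.of_degree_eq (h : IsState v x Q l) (hl : l ≤ l') (hm : (Q l').Monic)
    (hd : (Q l').degree = (Q l).degree) (hle : ∀ i, l ≤ i → i < l' →
      (Q i).Monic ∧ (Q i).degree = (Q l).degree ∧ v (aeval x (Q i)) < v (aeval x (Q l'))) :
    IsState v x Q l' := by
  rcases hl.eq_or_lt with rfl | hl
  · exact h
  have hlt := (hle l le_rfl hl).2.2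
  have hz : (Q l' - Q l).degree < (Q l).degree := degree_sub_lt_of_monic hm h.monic hd
  refine ⟨?_, fun g γ hg hγ => ?_, fun i hi => ?_, h.pos.trans hlt⟩
  · obtain ⟨β, hβ⟩ := h.key
    refine ⟨β, ?_⟩
    have := hβ.add hz (by
      rw [map_sub]; exact v.map_le_sub (hβ.le_val.trans hlt.le) hβ.le_val)
    rwa [add_sub_cancel] at this
  · rw [hd] at hg
    exact monomialGroup_le_of_comp (u' := fun i : Set.Iio l' => aeval x (Q i))
      (fun i : Set.Iio l => ⟨i.1, i.2.trans hl⟩) (fun _ => rfl) (h.comp g γ hg hγ)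
  · rcases lt_or_ge i l with hil | hil
    · obtain ⟨h1, z, hz, h2⟩ := h.approx i hil
      exact ⟨h1.trans hlt, z, by rwa [hd], h2⟩
    · obtain ⟨h1, h2, h3⟩ := hle i hil hi
      refine ⟨h3, Q i - Q l', degree_sub_lt_of_monic h1 hm (h2.trans hd.symm), ?_⟩
      rwa [map_sub (aeval (R := K) x), sub_sub_cancel]

/-- The polynomials `Q_{l+k}`, `k ≤ r + 1`, of a block. -/
theorem IsState.block (h : IsState v x Q l) (hb : v (aeval x (Q l)) = b) (hT : MemT v x (Q l) z r)
    (hQ : ∀ k ≤ r + 1, Q (l + (k : Ordinal.{0})) = partialSum (Q l) z k) {m : ℕ} (hm : m ≤ r + 1) :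
    IsState v x Q (l + (m : Ordinal.{0})) ∧ (Q (l + (m : Ordinal.{0}))).degree = (Q l).degree ∧
      (m ≤ r → v (aeval x (Q (l + (m : Ordinal.{0})))) = val v x (z m)) ∧
      (0 < m → v (aeval x (Q l)) < v (aeval x (Q (l + (m : Ordinal.{0}))))) := by
  have hk := h.isKey hb
  obtain ⟨t, n, hp⟩ := exists_isPivot_minpoly hk b
  obtain ⟨htail, hlast⟩ := hk.lt_val_of_memT hb hp hT
  have hmon : ∀ k ≤ r + 1, (Q (l + (k : Ordinal.{0}))).Monic := fun k hk' => by
    rw [hQ k hk']; exact (htail.isKey hk hk').monic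
  have hdeg : ∀ k ≤ r + 1, (Q (l + (k : Ordinal.{0}))).degree = (Q l).degree := fun k hk' => by
    rw [hQ k hk', degree_partialSum htail hk.monic.ne_zero hk']
  have hval : ∀ k ≤ r, v (aeval x (Q (l + (k : Ordinal.{0})))) = val v x (z k) := fun k hk' => by
    rw [hQ k (by omega)]; exact htail.val_partialSum hlast hk'
  have hlt : ∀ k < m, v (aeval x (Q (l + (k : Ordinal.{0})))) <
      v (aeval x (Q (l + (m : Ordinal.{0})))) := fun k hk' => by
    rw [hval k (by omega)]
    rcases hm.lt_or_eq with h1 | rfl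
    · rw [hval m (by omega)]
      exact htail.lt_of_lt hk' (by omega)
    · rw [hQ _ le_rfl]
      refine lt_of_le_of_lt ?_ hlast
      rcases (Nat.lt_succ_iff.1 hk').lt_or_eq with h2 | rfl
      · exact (htail.lt_of_lt h2 le_rfl).le
      · exact le_rfl
  refine ⟨h.of_degree_eq le_self_add (hmon m hm) (hdeg m hm) fun i hi him => ?_,
    hdeg m hm, hval m, fun h0 => ?_⟩
  · obtain ⟨k, hkm, rfl⟩ := exists_lt_add_natCast hi him
    exact ⟨hmon k (by omega), hdeg k (by omega), hlt k hkm⟩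
  · have := hlt 0 h0
    rwa [Nat.cast_zero, add_zero] at this

end State

/-! ### Limit key polynomials -/

section LimitKey

variable {K L Γ : Type*} [Field K] [Field L] [Algebra K L]
  [AddCommGroup Γ] [LinearOrder Γ] [IsOrderedAddMonoid Γ] [Nontrivial Γ]
  [FiniteDimensional K L]
  {v : AddValuation L (WithTop Γ)} {x : L} {Q : ℕ → K[X]} {b : ℕ → Γ} {p μ : ℕ} {c γ : Γ}
  {g h : K[X]}

omit [Nontrivial Γ] [FiniteDimensional K L] in
theorem IsStable.exists_weightGE (hQ : IsKeySeq v x Q b) (hh : IsStable v x Q b h)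
    (hγ : (γ : WithTop Γ) ≤ v (aeval x h)) (s₀ : ℕ) :
    ∃ s ≥ s₀, WeightGE v (b s) γ (expand x (Q s) h) := by
  obtain ⟨s, hs, t, h1, h2⟩ := hh.exists_ge hQ s₀
  exact ⟨s, hs, h1.mono (WithTop.coe_le_coe.1 (hγ.trans h2))⟩

variable [Archimedean Γ]

theorem IsKeySeq.exists_weightGE_of_natDegree_lt (hQ : IsKeySeq v x Q b) {B : Γ}
    (hB : ∀ s, b s ≤ B) (hmin : ∀ μ' g, 0 < μ' → IsLimit v x Q b μ' g → μ ≤ μ')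
    (hd : h.natDegree < μ * (Q 0).natDegree) (hγ : (γ : WithTop Γ) ≤ v (aeval x h)) (s₀ : ℕ) :
    ∃ s ≥ s₀, WeightGE v (b s) γ (expand x (Q s) h) := by
  rcases eq_or_ne h 0 with rfl | h0
  · exact ⟨s₀, le_rfl, by rw [expand_zero]; exact weightGE_zero⟩
  · exact (hQ.isStable_of_natDegree_lt hB hmin h0 hd).exists_weightGE hQ hγ s₀

/-- As for liftings, with the weight `b s` for a late `s`: both factors are stable, so their product
has weight at least the sum of the bounds, and division by the limit costs `μ b s < c`. -/
theorem IsLimit.isKey (hQ : IsKeySeq v x Q b) {B : Γ} (hB : ∀ s, b s ≤ B) (hμ : 0 < μ)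
    (hmin : ∀ μ' g, 0 < μ' → IsLimit v x Q b μ' g → μ ≤ μ') (hg : IsLimit v x Q b μ g)
    (hn : μ * (Q 0).natDegree ≤ (minpoly K x).natDegree) (hc : ∀ s, μ • b s < c)
    (hcg : (c : WithTop Γ) ≤ v (aeval x g)) : IsKey v x g c where
  monic := hg.monic
  natDegree_pos := by rw [hg.natDegree_eq]; exact Nat.mul_pos hμ hQ.isKey.natDegree_pos
  natDegree_le := by rwa [hg.natDegree_eq]
  le_val := hcg
  carry a d s t ha hd hs ht := by
    have hpos : 0 < g.natDegree := by
      rw [hg.natDegree_eq]; exact Nat.mul_pos hμ hQ.isKey.natDegree_pos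
    have ha' := natDegree_lt_of_degree_lt hpos ha
    have hd' := natDegree_lt_of_degree_lt hpos hd
    rw [hg.natDegree_eq] at ha' hd'
    obtain ⟨s₀, hpiv⟩ := hg.eventually_isPivot hQ hB hμ hmin
    obtain ⟨s₁, h1, h2⟩ := hQ.exists_weightGE_of_natDegree_lt hB hmin ha' hs s₀
    obtain ⟨s₂, h3, h4⟩ := hQ.exists_weightGE_of_natDegree_lt hB hmin hd' ht s₁
    have h5 := hQ.weightGE_of_le h3 h2
    have hb : b 0 ≤ b s₂ := hQ.strictMono.monotone (Nat.zero_le _)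
    have h6 := (hQ.key s₂).weightGE_expand_mul hb (hQ.val s₂).ge a d h5 h4
    have h7 := (hQ.key s₂).weightGE_div hb (hQ.val s₂).ge hg.monic (m := μ)
      (by rw [hg.natDegree_eq, hQ.natDegree_eq s₂]) (hpiv s₂ (h1.le.trans h3)).ge h6
    have h8 := h7.eval (hQ.val s₂).ge
    rw [eval_expand (hQ.key s₂).monic (hQ.key s₂).natDegree_pos] at h8
    exact lt_of_lt_of_le (WithTop.coe_lt_coe.2 (sub_lt_sub_left (hc s₂) _)) h8

/-- If there is no limit of the same degree, the limits of minimal degree have degree a positive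
power of the residue characteristic, and there is a weakly affine one. -/
theorem IsKeySeq.exists_pow_limit (hQ : IsKeySeq v x Q b) {B : Γ} (hB : ∀ s, b s ≤ B)
    (hp : IsResidueExpChar v p) (hone : ∀ g, ¬ IsLimit v x Q b 1 g) :
    ∃ e t g, 1 ≤ e ∧ p ≠ 1 ∧ IsWeaklyAffine p (Q t) e g ∧ IsLimit v x Q b (p ^ e) g ∧
      p ^ e * (Q 0).natDegree ≤ (minpoly K x).natDegree ∧
      ∀ μ' g', 0 < μ' → IsLimit v x Q b μ' g' → p ^ e ≤ μ' := by
  obtain ⟨μ, g, hμ, hn, hg, hmin⟩ := hQ.exists_minimal_limit hB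
  obtain ⟨e, t, h, rfl, h1, h2⟩ := hQ.exists_isWeaklyAffine hB hp hμ hmin hg
  refine ⟨e, t, h, ?_, ?_, h1, h2, hn, hmin⟩
  · rw [Nat.one_le_iff_ne_zero]
    rintro rfl
    rw [pow_zero] at h2
    exact hone _ h2
  · rintro rfl
    rw [one_pow] at h2
    exact hone _ h2

end LimitKey

/-! ### Infinite blocks -/

section InfiniteBlock

variable {K L Γ : Type*} [Field K] [Field L] [Algebra K L]
  [AddCommGroup Γ] [LinearOrder Γ] [IsOrderedAddMonoid Γ] [Nontrivial Γ]
  [FiniteDimensional K L]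
  {v : AddValuation L (WithTop Γ)} {x : L} {Q : Ordinal.{0} → K[X]} {l l' : Ordinal.{0}}
  {p : ℕ} {b : Γ}

theorem InfiniteBlock.exists_isKeySeq (hI : InfiniteBlock v x p Q l) (h : IsState v x Q l)
    (hb : v (aeval x (Q l)) = b) :
    ∃ bs : ℕ → Γ, IsKeySeq v x (fun s : ℕ => Q (l + (s : Ordinal.{0}))) bs := by
  obtain ⟨-, -, z, hT, hQ, -⟩ := hI
  have hk := h.isKey hb
  obtain ⟨t, n, hp⟩ := exists_isPivot_minpoly hk b
  have htail := fun r => (hk.lt_val_of_memT hb hp (hT r)).1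
  have hval : ∀ s : ℕ, v (aeval x (Q (l + (s : Ordinal.{0})))) = val v x (z s) := fun s =>
    (h.block hb (hT s) (fun k _ => hQ k) (m := s) (Nat.le_succ s)).2.2.1 le_rfl
  have hlt : ∀ s : ℕ, v (aeval x (Q (l + (s : Ordinal.{0})))) <
      v (aeval x (Q (l + ((s + 1 : ℕ) : Ordinal.{0})))) := fun s => by
    rw [hval, hval]; exact (htail (s + 1)).val_lt s (Nat.lt_succ_self s)
  have hex : ∀ s : ℕ, ∃ γ : Γ, v (aeval x (Q (l + (s : Ordinal.{0})))) = γ := fun s => by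
    obtain ⟨γ, hγ⟩ := WithTop.ne_top_iff_exists.1 (hlt s).ne_top
    exact ⟨γ, hγ.symm⟩
  choose bs hbs using hex
  refine ⟨bs, ?_, hbs, strictMono_nat_of_lt_succ fun s => ?_, fun s => ?_⟩
  · have h0 := hbs 0
    rw [Nat.cast_zero, add_zero] at h0 ⊢
    exact h.isKey h0
  · have := hlt s
    rw [hbs, hbs] at this
    exact WithTop.coe_lt_coe.1 this
  · rw [Nat.cast_zero, add_zero, hQ s, partialSum, add_sub_cancel_left]
    exact (htail s).degree_sum_lt hk.monic.ne_zero (Nat.le_succ s)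

/-- Such a limit would be `Q l + s` with value above the whole sequence. In the special case it
belongs to `T`, against cofinality. -/
theorem InfiniteBlock.not_isLimit_one (hI : InfiniteBlock v x p Q l) (h : IsState v x Q l)
    (hb : v (aeval x (Q l)) = b) (hS : Special v x Q l) {bs : ℕ → Γ}
    (hs : IsKeySeq v x (fun s : ℕ => Q (l + (s : Ordinal.{0}))) bs) (g : K[X]) :
    ¬ IsLimit v x (fun s : ℕ => Q (l + (s : Ordinal.{0}))) bs 1 g := by
  intro hg
  obtain ⟨-, -, z, hT, hQ, hcof⟩ := hI
  have hk := h.isKey hb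
  obtain ⟨t, n, hp⟩ := exists_isPivot_minpoly hk b
  have hsp := (h.special_iff hb hp).1 hS
  have hd := hg.natDegree_eq
  rw [one_mul, Nat.cast_zero, add_zero] at hd
  have hdeg : (g - Q l).degree < (Q l).degree := degree_sub_lt_of_monic hg.monic hk.monic (by
    rw [degree_eq_natDegree hg.monic.ne_zero, degree_eq_natDegree hk.monic.ne_zero, hd])
  have h0 := hg.lt_val 0
  have hb0 := hs.val 0
  rw [Nat.cast_zero, add_zero, hb] at hb0
  rw [one_nsmul, ← hb0] at h0
  obtain ⟨s, hs'⟩ := hcof _ _ (hk.memT_const hb hp hsp hdeg (by rwa [add_sub_cancel]))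
  rw [partialSum_succ, partialSum_zero, add_sub_cancel] at hs'
  have h1 := hg.lt_val s
  rw [one_nsmul, ← hs.val s] at h1
  exact absurd hs' (not_le.2 h1)

variable [Archimedean Γ]

omit [Nontrivial Γ] [FiniteDimensional K L] [Archimedean Γ] in
theorem IsLimitPolynomial.isLimit {bs : ℕ → Γ} {e : ℕ} {g : K[X]}
    (hs : IsKeySeq v x (fun s : ℕ => Q (l + (s : Ordinal.{0}))) bs)
    (hg : IsLimitPolynomial v x p Q l e g) :
    IsLimit v x (fun s : ℕ => Q (l + (s : Ordinal.{0}))) bs (p ^ e) g := by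
  obtain ⟨-, ⟨t, h1, h2, -⟩, h3⟩ := hg
  refine ⟨h1, ?_, fun s => ?_⟩
  · rw [h2, ← hs.natDegree_eq t]
  · have := h3 s
    unfold val at this
    rw [hs.val s] at this
    exact_mod_cast this

theorem IsState.limit (hp : IsResidueExpChar v p) (h : IsState v x Q l)
    (hb : v (aeval x (Q l)) = b) (hS : Special v x Q l) (hI : InfiniteBlock v x p Q l)
    (hL : LimitStep v x p Q l) : IsState v x Q (l + Ordinal.omega0) ∧
      (Q l).natDegree < (Q (l + Ordinal.omega0)).natDegree := by
  obtain ⟨bs, hs⟩ := hI.exists_isKeySeq h hb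
  have hone := hI.not_isLimit_one h hb hS hs
  obtain ⟨hp1, ⟨B, hB⟩, e, hlim, hmin'⟩ := hL
  have hB' : ∀ s, bs s ≤ B := fun s => by
    have := hB s
    unfold val at this
    rw [hs.val s] at this
    exact_mod_cast this
  obtain ⟨e', t, g', he', -, h1, h2, hn, hmin⟩ := hs.exists_pow_limit hB' hp hone
  have hg := hlim.isLimit hs
  have hp2 : 1 < p := (hp.prime_or_one.resolve_right hp1).one_lt
  -- The rule minimizes `e` over weakly affine limits of positive exponent, whereas the theory needs
  -- a limit of least degree among all. The two agree, since the least degree is attained by a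
  -- weakly affine one.
  have hee : e = e' := by
    refine le_antisymm (hmin' e' g' ⟨he', ⟨t, h1⟩, fun s => ?_⟩)
      ((Nat.pow_le_pow_iff_right hp2).1 (hmin _ _ (pow_pos (by omega) e) hg))
    have := h2.lt_val s
    unfold val
    rw [hs.val s]
    exact_mod_cast this
  subst hee
  set μ := p ^ e with hμ
  have hμ0 : 0 < μ := pow_pos (by omega) e
  have hμ1 : 1 < μ := Nat.one_lt_pow (by omega) hp2
  set g := Q (l + Ordinal.omega0) with hgdef
  obtain ⟨c, hc, hcg⟩ : ∃ c : Γ, (∀ s, μ • bs s < c) ∧ (c : WithTop Γ) ≤ v (aeval x g) := by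
    cases hv : v (aeval x g) with
    | top =>
      obtain ⟨c, hc⟩ := exists_gt (μ • B)
      exact ⟨c, fun s => lt_of_le_of_lt (nsmul_le_nsmul_right (hB' s) μ) hc, le_top⟩
    | coe γ =>
      refine ⟨γ, fun s => ?_, le_rfl⟩
      have := hg.lt_val s
      rw [hv] at this
      exact WithTop.coe_lt_coe.1 this
  have hkey := hg.isKey hs hB' hμ0 hmin hn hc hcg
  have hb0 := hs.val 0
  rw [Nat.cast_zero, add_zero] at hb0
  have hpos : 0 < bs 0 := by
    have := h.pos
    rw [hb0] at this
    exact_mod_cast this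
  have hlt : ∀ s : ℕ, v (aeval x (Q (l + (s : Ordinal.{0})))) < v (aeval x g) := fun s => by
    rw [hs.val s]
    refine lt_of_le_of_lt (WithTop.coe_le_coe.2 ?_) (hg.lt_val s)
    conv_lhs => rw [← one_nsmul (bs s)]
    exact nsmul_le_nsmul_left (hpos.le.trans (hs.strictMono.monotone (Nat.zero_le s))) hμ0
  have hdegs : ∀ s : ℕ, (Q (l + (s : Ordinal.{0}))).natDegree < g.natDegree := fun s => by
    rw [hg.natDegree_eq, ← hs.natDegree_eq s]
    exact lt_mul_of_one_lt_left (hs.key s).natDegree_pos hμ1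
  have hdeg : ∀ s : ℕ, (Q (l + (s : Ordinal.{0}))).degree < g.degree := fun s =>
    degree_lt_degree (hdegs s)
  have h0 : ∀ {P : Ordinal.{0} → Prop}, P (l + ((0 : ℕ) : Ordinal.{0})) → P l := fun {P} hP => by
    rwa [Nat.cast_zero, add_zero] at hP
  refine ⟨⟨⟨c, hkey⟩, fun a γ ha hγ => ?_, fun i hi => ?_,
    h.pos.trans (h0 (P := fun i => v (aeval x (Q i)) < v (aeval x g)) (hlt 0))⟩,
    h0 (P := fun i => (Q i).natDegree < g.natDegree) (hdegs 0)⟩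
  · have ha' := natDegree_lt_of_degree_lt hkey.natDegree_pos ha
    rw [hg.natDegree_eq] at ha'
    -- Polynomials below the degree of the limit are stable, so expansion in one `Q (l + s)`
    -- exhibits them as sums of monomials without loss of value.
    obtain ⟨s, -, h3⟩ := hs.exists_weightGE_of_natDegree_lt hB' hmin ha' hγ 0
    refine mem_monomialGroup_of_weightGE (hs.key s).monic (hs.key s).natDegree_pos
      (fun a γ h4 h5 => ?_) ⟨l + (s : Ordinal.{0}), ?_⟩ rfl (hs.val s).ge h3
    · rw [hs.degree_eq s] at h4
      rw [Nat.cast_zero, add_zero] at h4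
      exact monomialGroup_le_of_comp
        (u' := fun i : Set.Iio (l + Ordinal.omega0) => aeval x (Q i))
        (fun i : Set.Iio l => ⟨i.1, lt_of_lt_of_le (Set.mem_Iio.1 i.2) le_self_add⟩)
        (fun _ => rfl) (h.comp a γ h4 h5)
    · exact add_lt_add_right (Ordinal.natCast_lt_omega0 s) l
  · rcases lt_or_ge i l with hil | hil
    · obtain ⟨h3, z, hz, h4⟩ := h.approx i hil
      have h5 := h0 (P := fun i => v (aeval x (Q i)) < v (aeval x g)) (hlt 0)
      have h6 := h0 (P := fun i => (Q i).degree < g.degree) (hdeg 0)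
      exact ⟨h3.trans h5, z, hz.trans h6, h4⟩
    · obtain ⟨a, rfl⟩ : ∃ a, i = l + a := ⟨i - l, (Ordinal.add_sub_cancel_of_le hil).symm⟩
      rw [add_lt_add_iff_left] at hi
      obtain ⟨s, rfl⟩ := Ordinal.lt_omega0.1 hi
      refine ⟨hlt s, _, hdeg s, ?_⟩
      rw [sub_self, v.map_zero, hs.val s]
      exact WithTop.coe_lt_top _

end InfiniteBlock

/-! ### The steps of the construction -/

section Step

variable {K L Γ : Type*} [Field K] [Field L] [Algebra K L]
  [AddCommGroup Γ] [LinearOrder Γ] [IsOrderedAddMonoid Γ] [Nontrivial Γ]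
  [FiniteDimensional K L] [Archimedean Γ]
  {v : AddValuation L (WithTop Γ)} {x : L} {Q : Ordinal.{0} → K[X]} {l l' : Ordinal.{0}}
  {p n m : ℕ} {b t : Γ}

omit [Nontrivial Γ] [FiniteDimensional K L] [Archimedean Γ] in
theorem FiniteBlock.exists_memT (hF : FiniteBlock v x p Q l m) :
    ∃ z r, m = r + 1 ∧ (∀ k ≤ r + 1, Q (l + (k : Ordinal.{0})) = partialSum (Q l) z k) ∧
      MemT v x (Q l) z r := by
  obtain ⟨z, r, rfl, hQ, h | h⟩ := hF
  · obtain ⟨-, M, u, φ, w, -, -, -, -, -, -, -, -, -, hT, -⟩ := h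
    exact ⟨z, r, rfl, hQ, hT⟩
  · exact ⟨z, r, rfl, hQ, h.2.1⟩

theorem Step.isState (hp : IsResidueExpChar v p) (h : IsState v x Q l)
    (hs : Step v x p Q l l') : IsState v x Q l' ∧ l < l' ∧
      (Q l).natDegree ≤ (Q l').natDegree := by
  cases hs with
  | lift h0 _ hl =>
    obtain ⟨b, hb⟩ := exists_coe_eq (v := v) h0
    obtain ⟨h1, α, h2⟩ := h.lift hb hl
    exact ⟨h1, lt_add_one l, by rw [h2.natDegree_eq]; exact Nat.le_mul_of_pos_left _ h2.pos⟩
  | block m h0 _ hF =>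
    obtain ⟨b, hb⟩ := exists_coe_eq (v := v) h0
    obtain ⟨z, r, rfl, hQ, hT⟩ := hF.exists_memT
    obtain ⟨h1, h2, -⟩ := h.block hb hT hQ le_rfl
    refine ⟨h1, lt_add_of_pos_right _ (by exact_mod_cast Nat.succ_pos r), ?_⟩
    exact (natDegree_eq_of_degree_eq h2).ge
  | limit h0 hS hI hL =>
    obtain ⟨b, hb⟩ := exists_coe_eq (v := v) h0
    obtain ⟨h1, h2⟩ := h.limit hp hb hS hI hL
    exact ⟨h1, lt_add_of_pos_right _ Ordinal.omega0_pos, h2.le⟩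

theorem isState_of_reflTransGen (hp : IsResidueExpChar v p) (h : IsState v x Q l)
    (hs : Relation.ReflTransGen (Step v x p Q) l l') : IsState v x Q l' := by
  induction hs with
  | refl => exact h
  | tail _ hs ih => exact (hs.isState hp ih).1

end Step

/-! ### Complete sets -/

section Completeness

variable {K L Γ : Type*} [Field K] [Field L] [Algebra K L]
  [AddCommGroup Γ] [LinearOrder Γ] [IsOrderedAddMonoid Γ]
  {v v' : AddValuation L (WithTop Γ)} {ν : AddValuation K (WithTop Γ)}
  {I : Type*} {u : I → L}

theorem isComplete_of_monomialGroup (hext : ∀ a : K, v (algebraMap K L a) = ν a)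
    (h : ∀ (y : L) (γ : Γ), (γ : WithTop Γ) ≤ v y → y ∈ monomialGroup K v u γ) :
    IsComplete ν v u := by
  intro β
  apply Set.Subset.antisymm
  · intro y hy
    induction hy using Submodule.span_induction with
    | mem y hy => obtain ⟨c, m, rfl, h⟩ := hy; exact h
    | zero => exact zero_mem _
    | add y z _ _ hy hz => exact add_mem hy hz
    | smul a y _ hy =>
      change (β : WithTop Γ) ≤ v (a • y)
      have h1 : (0 : WithTop Γ) ≤ v (algebraMap K L a) := by
        rw [hext]; exact a.2
      rw [Subring.smul_def, Algebra.smul_def, v.map_mul]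
      calc (β : WithTop Γ) = 0 + β := (zero_add _).symm
        _ ≤ _ := add_le_add h1 hy
  · intro y hy
    have h1 : monomialGroup K v u β ≤
        (Submodule.span (ringOf ν) (monomialsAtLeast K v u β)).toAddSubgroup := by
      rw [monomialGroup, AddSubgroup.closure_le]
      exact Submodule.subset_span
    exact h1 (h y β hy)

/-- The algebra generated is already all of `G_{ν'}`, without denominators, and nonzero homogeneous
elements are units because `L` is a field; quotients therefore exist and are unique. -/
theorem isGradedComplete_of_monomialGroup [Nontrivial Γ]
    (h : ∀ (y : L) (γ : Γ), (γ : WithTop Γ) ≤ v y → y ∈ monomialGroup K v u γ) :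
    IsGradedComplete K v u := by
  have htop : ∀ y, y ∈ gradedAdjoin K v (Set.range u) := fun y => by
    induction y using DirectSum.induction_on with
    | zero => exact zero_mem _
    | add y z hy hz => exact add_mem hy hz
    | of γ c =>
      obtain ⟨a, ha, h1⟩ := exists_inAt c
      rw [h1]
      exact inAt_mem_gradedAdjoin (h a γ ha)
  constructor
  · refine Set.eq_univ_of_forall fun y => ⟨1, one_mem _, ⟨0, cls v 1 (one_mem_atLeast v), rfl⟩, ?_,
      htop _⟩
    rw [← inAt_one, Ne, inAt_eq_zero_iff (one_mem_atLeast v), v.map_one]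
    exact lt_irrefl _
  · rintro g - w - ⟨β, c, rfl⟩ h0
    obtain ⟨a, ha, h1⟩ := exists_inAt c
    rw [h1] at h0 ⊢
    have haβ : v a = β := by
      rcases ha.eq_or_lt with h2 | h2
      · exact h2.symm
      · exact absurd ((inAt_eq_zero_iff ha).2 h2) h0
    have ha0 : a ≠ 0 := ne_zero_of_le_coe haβ.le
    have h2 : inAt v (-β) a⁻¹ * inAt v β a = 1 := by
      rw [← inAt_mul (map_inv_coe haβ).ge ha, inv_mul_cancel₀ ha0, neg_add_cancel, inAt_one]
    refine ⟨inAt v (-β) a⁻¹ * g, ?_, fun y hy => ?_⟩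
    · dsimp only
      rw [mul_left_comm, ← mul_assoc, h2, one_mul]
    · dsimp only at hy
      rw [← hy, ← mul_assoc, h2, one_mul]

/-- Both valuations agree on monomials, so `v'` is at least `v` everywhere; the same inequality for
inverses gives equality. -/
theorem eq_of_monomialGroup [Nontrivial Γ] (hext : ∀ a : K, v' (algebraMap K L a) = v (algebraMap K L a))
    (hu : ∀ i, v' (u i) = v (u i))
    (h : ∀ (y : L) (γ : Γ), (γ : WithTop Γ) ≤ v y → y ∈ monomialGroup K v u γ) : v' = v := by
  have hle : ∀ (y : L) (γ : Γ), (γ : WithTop Γ) ≤ v y → (γ : WithTop Γ) ≤ v' y := by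
    intro y γ hy
    have h1 : monomialGroup K v u γ ≤ atLeast v' γ := by
      rw [monomialGroup, AddSubgroup.closure_le]
      rintro _ ⟨c, m, rfl, h⟩
      change (γ : WithTop Γ) ≤ v' _
      have h2 : v' (m.prod fun i n => u i ^ n) = v (m.prod fun i n => u i ^ n) :=
        Finset.prod_induction _ (fun y => v' y = v y)
          (fun a b ha hb => by rw [v'.map_mul, v.map_mul, ha, hb])
          (by rw [v'.map_one, v.map_one]) fun i _ => by rw [v'.map_pow, v.map_pow, hu]
      rwa [v'.map_mul, hext, h2, ← v.map_mul]
    exact h1 (h y γ hy)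
  apply AddValuation.ext
  intro y
  rcases eq_or_ne y 0 with rfl | hy
  · rw [v'.map_zero, v.map_zero]
  · obtain ⟨γ, hγ⟩ := exists_coe_eq (v := v) hy
    obtain ⟨γ', hγ'⟩ := exists_coe_eq (v := v') hy
    have h1 := hle y γ hγ.ge
    have h2 := hle y⁻¹ (-γ) (map_inv_coe hγ).ge
    rw [hγ'] at h1
    rw [map_inv_coe hγ'] at h2
    norm_cast at h1 h2
    rw [hγ, hγ', le_antisymm (neg_le_neg_iff.1 h2) h1]

variable {x : L} {Q : Ordinal.{0} → K[X]} {l lam : Ordinal.{0}} {γ : Γ}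

theorem exists_degree_lt_aeval_eq (hx : Algebra.adjoin K {x} = ⊤) {q : K[X]} (hq : q.Monic)
    (h0 : aeval x q = 0) (y : L) : ∃ h : K[X], h.degree < q.degree ∧ aeval x h = y := by
  have hy : y ∈ Algebra.adjoin K {x} := by rw [hx]; trivial
  rw [Algebra.adjoin_singleton_eq_range_aeval] at hy
  obtain ⟨h, rfl⟩ := hy
  refine ⟨h %ₘ q, degree_modByMonic_lt _ hq, ?_⟩
  exact aeval_modByMonic_eq_self_of_root h0

theorem IsState.mem_of_terminal (h : IsState v x Q l) (hx : Algebra.adjoin K {x} = ⊤)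
    (h0 : aeval x (Q l) = 0) {y : L} (hy : (γ : WithTop Γ) ≤ v y) :
    y ∈ monomialGroup K v (fun i : Set.Iio (l + 1) => aeval x (Q i)) γ := by
  obtain ⟨g, hg, rfl⟩ := exists_degree_lt_aeval_eq hx h.monic h0 y
  exact monomialGroup_le_of_comp (u' := fun i : Set.Iio (l + 1) => aeval x (Q i))
    (fun i : Set.Iio l => ⟨i.1, i.2.trans (lt_add_one l)⟩) (fun _ => rfl) (h.comp g γ hg hy)

variable [Nontrivial Γ]

/-- If there are `Q_i` of the same degree and of arbitrarily large value, then every element is a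
combination of monomials. -/
theorem IsState.mem_of_unbounded (h : IsState v x Q l) (hl : l < lam)
    (hx : Algebra.adjoin K {x} = ⊤)
    (hunb : ∀ b : Γ, ∃ i < lam, (b : WithTop Γ) < v (aeval x (Q i)) ∧ (Q i).Monic ∧
      (Q i).degree = (Q l).degree) {y : L} (hy : (γ : WithTop Γ) ≤ v y) :
    y ∈ monomialGroup K v (fun i : Set.Iio lam => aeval x (Q i)) γ := by
  obtain ⟨β, hk⟩ := h.key
  have hy' : y ∈ Algebra.adjoin K {x} := by rw [hx]; trivial
  rw [Algebra.adjoin_singleton_eq_range_aeval] at hy'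
  obtain ⟨g, rfl⟩ := hy'
  change (γ : WithTop Γ) ≤ v (aeval x g) at hy
  change aeval x g ∈ _
  obtain ⟨t, ht⟩ := exists_weightGE v β (expand x (Q l) g)
  -- The weight `t` for `β` persists in all these expansions. Once the value of `Q i` is at least `β
  -- + (γ - t)`, every term containing `Q i` has value at least `γ`.
  obtain ⟨i, hi, hci, hmon, hdeg⟩ := hunb (max β (β + (γ - t)))
  obtain ⟨c, hc, hcQ⟩ : ∃ c : Γ, max β (β + (γ - t)) ≤ c ∧ (c : WithTop Γ) ≤ v (aeval x (Q i)) :=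
    ⟨_, le_rfl, hci.le⟩
  have hβc : β ≤ c := (le_max_left _ _).trans hc
  have hz : (Q i - Q l).degree < (Q l).degree := degree_sub_lt_of_monic hmon h.monic hdeg
  have hβi : (β : WithTop Γ) ≤ v (aeval x (Q i)) := (WithTop.coe_le_coe.2 hβc).trans hcQ
  have hzv : (β : WithTop Γ) ≤ v (aeval x (Q i - Q l)) := by
    rw [map_sub]; exact v.map_le_sub hβi hk.le_val
  have hki := hk.add hz hzv
  have h1 := hk.weightGE_add hz le_rfl hk.le_val hzv ht
  rw [add_sub_cancel] at hki h1
  have hq := hki.monic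
  have hd := hki.natDegree_pos
  -- the coefficients of positive index contribute large values
  have h2 : ∀ j, 1 ≤ j → ((γ - j • c : Γ) : WithTop Γ) ≤ v ((expand x (Q i) g).coeff j) := by
    intro j hj
    refine le_trans (WithTop.coe_le_coe.2 ?_) (h1 j)
    have h3 : j • β + (c - β) ≤ j • c := by
      obtain ⟨k, rfl⟩ := Nat.exists_eq_add_of_le' hj
      have := nsmul_le_nsmul_right hβc k
      simp only [add_nsmul, one_nsmul]
      grind
    have h4 := (le_max_right _ _).trans hc
    grind
  have h3 : WeightGE v c γ (expand x (Q i) g) := by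
    intro j
    rcases Nat.eq_zero_or_pos j with rfl | hj
    · have h4 : (expand x (Q i) g).coeff 0 = aeval x g -
          (X * divX (expand x (Q i) g)).eval (aeval x (Q i)) := by
        conv_rhs => rw [← eval_expand (x := x) hq hd g]
        have h5 := congrArg (Polynomial.eval (aeval x (Q i))) (X_mul_divX_add (expand x (Q i) g))
        rw [eval_add, eval_C] at h5
        rw [← h5]; ring
      rw [zero_nsmul, sub_zero, h4]
      refine v.map_le_sub hy ?_
      have h5 : WeightGE v c γ (X * divX (expand x (Q i) g)) := by
        intro j
        rcases Nat.eq_zero_or_pos j with rfl | hj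
        · rw [mul_coeff_zero, coeff_X_zero, zero_mul, v.map_zero]; exact le_top
        · obtain ⟨k, rfl⟩ := Nat.exists_eq_add_of_le' hj
          rw [coeff_X_mul, coeff_divX]
          exact h2 _ hj
      exact h5.eval hcQ
    · exact h2 j hj
  refine mem_monomialGroup_of_weightGE hq hd (fun a γ h4 h5 => ?_) ⟨i, hi⟩ rfl hcQ h3
  rw [hdeg] at h4
  exact monomialGroup_le_of_comp (u' := fun i : Set.Iio lam => aeval x (Q i))
    (fun i : Set.Iio l => ⟨i.1, i.2.trans hl⟩) (fun _ => rfl) (h.comp a γ h4 h5)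

end Completeness

/-! ### Residue characteristic zero -/

section Above

variable {Γ : Type*} [AddCommGroup Γ] [LinearOrder Γ] [IsOrderedAddMonoid Γ]
variable {L : Type*} [Field L] {v : AddValuation L (WithTop Γ)} {b c t s η : Γ} {n : ℕ} {y : L}
  {G H : L[X]}

/-- The terms of `G` above degree `n` have weight at least `s`. -/
def AboveGE (v : AddValuation L (WithTop Γ)) (b s : Γ) (n : ℕ) (G : L[X]) : Prop :=
  ∀ j, n < j → ((s - j • b : Γ) : WithTop Γ) ≤ v (G.coeff j)

theorem IsPivot.exists_aboveGE [Nontrivial Γ] (h : IsPivot v b t n G) :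
    ∃ η > 0, AboveGE v b (t + η) n G := by
  obtain ⟨η, hη, h1⟩ := exists_pos_le_of_forall
    (P := fun j (g : Γ) => n < j → ((t + g - j • b : Γ) : WithTop Γ) ≤ v (G.coeff j))
    (fun j g g' hg h1 h2 => le_trans (WithTop.coe_le_coe.2
      (sub_le_sub_right (add_le_add_right hg t) _)) (h1 h2)) (G.natDegree + 1) fun j _ => by
      by_cases hj : n < j
      · have h1 := h.gt j hj
        cases hv : v (G.coeff j) with
        | top =>
          obtain ⟨g, hg⟩ := exists_gt (0 : Γ)
          exact ⟨g, hg, fun _ => le_top⟩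
        | coe γ =>
          rw [hv] at h1
          refine ⟨γ - (t - j • b), sub_pos.2 (WithTop.coe_lt_coe.1 h1), fun _ => ?_⟩
          rw [WithTop.coe_le_coe]
          exact le_of_eq (by abel)
      · obtain ⟨g, hg⟩ := exists_gt (0 : Γ)
        exact ⟨g, hg, fun h => absurd h hj⟩
  refine ⟨η, hη, fun j hj => ?_⟩
  rcases lt_or_ge j (G.natDegree + 1) with h2 | h2
  · exact h1 j h2 hj
  · rw [coeff_eq_zero_of_natDegree_lt (by omega), v.map_zero]; exact le_top

theorem AboveGE.mono (h : AboveGE v b s n G) (hst : t ≤ s) : AboveGE v b t n G := fun j hj =>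
  le_trans (WithTop.coe_le_coe.2 (sub_le_sub_right hst _)) (h j hj)

/-- The effect of a translation on the coefficients of index at least `n - 1`. -/
theorem AboveGE.comp (h : AboveGE v b s n G) (hy : (b : WithTop Γ) ≤ v y) :
    AboveGE v b s n (G.comp (X + C y)) ∧ (0 < n → ((s - (n - 1) • b : Γ) : WithTop Γ) ≤
      v ((G.comp (X + C y)).coeff (n - 1) - (G.coeff (n - 1) + n * G.coeff n * y))) := by
  set P : L[X] := ∑ j ∈ Finset.range (n + 1), monomial j (G.coeff j) with hP
  have hPc : ∀ j, P.coeff j = if j < n + 1 then G.coeff j else 0 := by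
    intro j
    rw [hP, finsetSum_coeff]
    simp only [coeff_monomial]
    rw [Finset.sum_ite_eq']
    simp only [Finset.mem_range]
  have h1 : WeightGE v b s (G - P) := by
    intro j
    rw [coeff_sub, hPc]
    split_ifs with hj
    · rw [sub_self, v.map_zero]; exact le_top
    · rw [sub_zero]; exact h j (by omega)
  have h2 := h1.comp hy
  rw [sub_comp] at h2
  have hPd : P.natDegree ≤ n := by
    rw [natDegree_le_iff_coeff_eq_zero]
    intro j hj
    rw [hPc, if_neg (by omega)]
  constructor
  · intro j hj
    have h3 := h2 j
    rwa [coeff_sub, coeff_eq_zero_of_natDegree_lt (p := P.comp (X + C y))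
      (lt_of_le_of_lt ((natDegree_comp_X_add_C_le _ _).trans hPd) hj), sub_zero] at h3
  · intro hn
    have h3 := h2 (n - 1)
    have h4 : (P.comp (X + C y)).coeff (n - 1) = G.coeff (n - 1) + n * G.coeff n * y := by
      obtain ⟨m, rfl⟩ := Nat.exists_eq_add_of_le' hn
      have h5 : (hasseDeriv m P).natDegree < 2 := by
        have := natDegree_hasseDeriv_le P m
        omega
      rw [Nat.add_sub_cancel, ← taylor_apply, taylor_coeff, eval_eq_sum_range' h5,
        Finset.sum_range_succ, Finset.sum_range_one, hasseDeriv_coeff, hasseDeriv_coeff, zero_add,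
        Nat.choose_self, hPc, hPc, if_pos (by omega), if_pos (by omega), add_comm 1 m,
        Nat.choose_succ_self_right]
      push_cast
      ring
    rwa [coeff_sub, h4] at h3

end Above

/-! ### The gain in value from the Tschirnhaus transformation. -/

section Tschirnhaus

variable {K L Γ : Type*} [Field K] [Field L] [Algebra K L]
  [AddCommGroup Γ] [LinearOrder Γ] [IsOrderedAddMonoid Γ]
  {v : AddValuation L (WithTop Γ)} {x : L} {q s : K[X]} {z : ℕ → K[X]} {β b c η t T : Γ}
  {n r : ℕ}

theorem le_valAbove (hq : q.Monic) (hd : 0 < q.natDegree) (hb : v (aeval x q) = b) {h : K[X]}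
    (hp : IsPivot v b t n (expand x q h)) (ha : AboveGE v b (t + η) n (expand x q h)) :
    ((t + η : Γ) : WithTop Γ) ≤ valAbove v x q h := by
  rw [valAbove, pivot_eq hq hd hb hp]
  refine Finset.le_inf fun j hj => ?_
  have h1 := ha j (Finset.mem_Ioc.1 hj).1
  rw [coeff_expand hq hd, coe_sub_nsmul_le_iff] at h1
  unfold val
  rwa [hb]

/-- Since `β + η ≤ b`, carries weigh at least `t + η`, as do the terms above `n`. Up to that weight,
`f` behaves like a polynomial of degree `n`, whose coefficient at `n - 1` changes by `- n a_n s`. -/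
theorem IsKey.aboveGE_add (hk : IsKey v x q β) (hβ : β + η ≤ b) (hη : 0 < η)
    (hb : v (aeval x q) = b) (hp : IsPivot v b t n (expand x q (minpoly K x)))
    (ha : AboveGE v b (t + η) n (expand x q (minpoly K x))) (hs : s.degree < q.degree)
    (hsb : (b : WithTop Γ) ≤ v (aeval x s)) :
    AboveGE v b (t + η) n (expand x (q + s) (minpoly K x)) ∧
      (0 < n → ((t + η - (n - 1) • b : Γ) : WithTop Γ) ≤
        v ((expand x (q + s) (minpoly K x)).coeff (n - 1) -
          ((expand x q (minpoly K x)).coeff (n - 1) -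
            n * (expand x q (minpoly K x)).coeff n * aeval x s))) := by
  have h1 := hk.expand_translate' hs (by grind) hb.ge hsb hp.ge
  have h1' : WeightGE v b (t + η) _ := h1.ge.mono (by grind)
  have hy : (b : WithTop Γ) ≤ v (-aeval x s) := by rwa [v.map_neg]
  obtain ⟨h2, h3⟩ := ha.comp hy
  constructor
  · intro j hj
    have h4 := v.map_le_add (h1' j) (h2 j hj)
    rwa [coeff_sub, sub_add_cancel] at h4
  · intro hn
    have h4 := v.map_le_add (h1' (n - 1)) (h3 hn)
    rw [coeff_sub] at h4
    convert h4 using 2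
    ring

/-- Raising the weight of the variable widens the gap between the term `n` and those above it, so
the margin `η` is never lost. -/
theorem AboveGE.of_le {G : L[X]} (h : AboveGE v b (t + η) n G) (hp : IsPivot v b t n G)
    (hc : IsPivot v c T n G) (hbc : b ≤ c) : AboveGE v c (T + η) n G := by
  intro j hj
  refine le_trans (WithTop.coe_le_coe.2 ?_) (h j hj)
  have h1 := hp.eq.symm.trans hc.eq
  norm_cast at h1
  obtain ⟨i, rfl⟩ := Nat.exists_eq_add_of_lt hj
  have h2 := nsmul_le_nsmul_right hbc (i + 1)
  simp only [add_nsmul] at *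
  grind

variable [Nontrivial Γ] [FiniteDimensional K L]

omit [FiniteDimensional K L] in
/-- In residue characteristic zero, the value increases by a fixed amount as long as the degree and
the pivotal ordinate do not change. -/
theorem TschirnhausBlock.add_le (hz : TschirnhausBlock v x q z r)
    (h0 : ∀ m : ℕ, m ≠ 0 → v (m : L) = 0) (hk : IsKey v x q β) (hβ : β + η ≤ b) (hη : 0 < η)
    (hb : v (aeval x q) = b) (hp : IsPivot v b t n (expand x q (minpoly K x)))
    (ha : AboveGE v b (t + η) n (expand x q (minpoly K x)))
    (hc : v (aeval x (partialSum q z (r + 1))) = c)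
    (hpc : IsPivot v c T n (expand x (partialSum q z (r + 1)) (minpoly K x)))
    (hsp : ∃ s : K[X], s.degree < q.degree ∧
      (c : WithTop Γ) < v (aeval x (partialSum q z (r + 1) + s)) ∧
      IsVertex v c T n (expand x (partialSum q z (r + 1) + s) (minpoly K x))) :
    b + η ≤ c ∧ AboveGE v c (T + η) n (expand x (partialSum q z (r + 1)) (minpoly K x)) := by
  obtain ⟨M, u, φ, W, hrM, hu, hdeg, -, hinc, -, hdec, hφ, hW, hT, hmax⟩ := hz
  have hβb : β ≤ b := by grind
  obtain ⟨htail, hlast⟩ := (hk.mono hβb hb.ge).lt_val_of_memT hb hp hT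
  have hq0 := hk.monic.ne_zero
  have hn := hk.pivot_pos hb hp
  have hsum := htail.degree_sum_lt hq0 (le_refl (r + 1))
  have hsumv := htail.le_val_sum (le_refl (r + 1)) hb.ge
  have hkQ : IsKey v x (partialSum q z (r + 1)) b := htail.isKey (hk.mono hβb hb.ge) le_rfl
  have hbc : b ≤ c := by
    have := hkQ.le_val
    rw [hc] at this
    exact_mod_cast this
  have hpQ := htail.isPivot (hk.mono hβb hb.ge) le_rfl (le_refl (r + 1)) hb hp
  refine ⟨?_, AboveGE.of_le (hk.aboveGE_add hβ hη hb hp ha hsum hsumv).1 hpQ hpc hbc⟩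
  -- Suppose `c < b + η`. The vertex for `q + S + s` makes the coefficient at `n - 1` small, so `u`
  -- agrees with `S + s` beyond `c`. In the decomposition of `u`, `φ` and `w (q + u)` also lie
  -- beyond `c`; as `q + S` has value `c`, the next term `z (r + 1)` must cancel it and itself has
  -- value `c`. Then adding `z (r + 1)` gives an element of `T`, against the choice of `r`.
  by_contra! hlt
  obtain ⟨s, hs, hsc, hver⟩ := hsp
  set S := ∑ i ∈ Finset.range (r + 1), z i with hS
  have hQS : partialSum q z (r + 1) = q + S := rfl
  have hsc' : (c : WithTop Γ) ≤ v (aeval x s) := by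
    have e : aeval x s =
        aeval x (partialSum q z (r + 1) + s) - aeval x (partialSum q z (r + 1)) := by
      rw [map_add]; ring
    rw [e]; exact v.map_le_sub hsc.le hc.ge
  have hSs : (S + s).degree < q.degree := lt_of_le_of_lt (degree_add_le _ _) (max_lt hsum hs)
  have hSsv : (b : WithTop Γ) ≤ v (aeval x (S + s)) := by
    rw [map_add]; exact v.map_le_add hsumv (le_trans (WithTop.coe_le_coe.2 hbc) hsc')
  rw [hQS, add_assoc] at hsc hver
  have h1 := (hk.aboveGE_add hβ hη hb hp ha hSs hSsv).2 hn
  have h2 := (hk.mono hβb hb.ge).isPivot_add hSs le_rfl hb.ge hSsv hp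
  set G := expand x q (minpoly K x) with hG
  set H := expand x (q + (S + s)) (minpoly K x) with hH
  have hTt : T - n • c = t - n • b := by
    have := hver.eq.symm.trans h2.eq
    exact_mod_cast this
  -- `u` is close to `S + s`
  have hb' : (n - 1) • b + b = n • b := by
    rw [← succ_nsmul, Nat.sub_add_cancel hn]
  have hc' : (n - 1) • c + c = n • c := by
    rw [← succ_nsmul, Nat.sub_add_cancel hn]
  have h3 : ((t - n • b + c : Γ) : WithTop Γ) <
      v (G.coeff (n - 1) - n * G.coeff n * aeval x (S + s)) := by
    have h4 := hver.gt (n - 1) (by omega)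
    have e : G.coeff (n - 1) - n * G.coeff n * aeval x (S + s) = H.coeff (n - 1) -
      (H.coeff (n - 1) - (G.coeff (n - 1) - n * G.coeff n * aeval x (S + s))) := by ring
    rw [e]
    refine lt_map_sub (lt_of_le_of_lt (WithTop.coe_le_coe.2 ?_) h4)
      (lt_of_lt_of_le (WithTop.coe_lt_coe.2 ?_) h1)
    · grind
    · grind
  have hd0 : v ((n : L) * G.coeff n) = ((t - n • b : Γ) : WithTop Γ) := by
    rw [v.map_mul, h0 n hn.ne', zero_add, hp.eq]
  have hd : (n : L) * G.coeff n ≠ 0 := ne_zero_of_le_coe hd0.le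
  rw [pivot_eq hk.monic hk.natDegree_pos hb hp, ← coeff_expand hk.monic hk.natDegree_pos,
    ← coeff_expand hk.monic hk.natDegree_pos, ← hG] at hu
  have h4 : (c : WithTop Γ) < v (u - aeval x (S + s)) := by
    have e : u - aeval x (S + s) = (G.coeff (n - 1) - n * G.coeff n * aeval x (S + s)) *
        ((n : L) * G.coeff n)⁻¹ := by
      rw [hu, sub_mul, div_eq_mul_inv, mul_right_comm _ _ (_ : L)⁻¹, mul_inv_cancel₀ hd, one_mul]
    rw [e]
    have := lt_mul_of_lt_of_le h3 (map_inv_coe hd0).ge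
    rwa [show t - n • b + c + -(t - n • b) = c by abel] at this
  have h5 : (c : WithTop Γ) < v (aeval x q + u) := by
    have e : aeval x q + u = aeval x (q + (S + s)) + (u - aeval x (S + s)) := by
      rw [map_add]; ring
    rw [e]; exact v.map_lt_add hsc h4
  -- the remaining terms
  have hφc : (c : WithTop Γ) < v φ := by
    have h6 := (le_valAbove hk.monic hk.natDegree_pos hb hp ha)
    have h7 : v (aeval x q) = b := hb
    unfold val at hφ
    rw [hb, newtonVal_eq hk.monic hk.natDegree_pos hp] at hφ
    have h8 := (add_le_add_left h6 (b : WithTop Γ)).trans hφ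
    cases hv : v φ with
    | top => exact WithTop.coe_lt_top _
    | coe γ =>
      rw [hv] at h8
      norm_cast at h8 ⊢
      grind
  have hWc : (c : WithTop Γ) < v (W * (aeval x q + u)) := by
    have := lt_mul_of_lt_of_le (s := c) (t := 0) h5 hW.le
    rwa [add_zero, mul_comm] at this
  obtain ⟨m, rfl⟩ := Nat.exists_eq_add_of_lt hrM
  set R := ∑ k ∈ Finset.range m, aeval x (z (r + 1 + k)) with hR
  have hsplit : ∑ k ∈ Finset.range (r + m + 1), aeval x (z k) = aeval x S + R := by
    rw [show r + m + 1 = r + 1 + m by omega, Finset.sum_range_add, hS, map_sum]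
  have h6 : (c : WithTop Γ) < v (aeval x (q + S) + R) := by
    have e : aeval x (q + S) + R = (aeval x q + u) - φ - W * (aeval x q + u) := by
      rw [hsplit] at hdec
      rw [map_add]
      linear_combination -hdec
    rw [e]; exact lt_map_sub (lt_map_sub h5 hφc) hWc
  rw [hQS] at hc
  have hRv : v R = c := by
    have e : R = aeval x (q + S) + R - aeval x (q + S) := by ring
    rw [e, v.map_sub_eq_of_lt_right (by rwa [hc]), hc]
  rcases Nat.eq_zero_or_pos m with rfl | hm
  · rw [hR, Finset.range_zero, Finset.sum_empty, v.map_zero] at hRv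
    exact WithTop.top_ne_coe hRv
  obtain ⟨i, rfl⟩ := Nat.exists_eq_add_of_le' hm
  set R' := ∑ k ∈ Finset.range i, aeval x (z (r + 1 + (k + 1))) with hR'
  have hRR : R = aeval x (z (r + 1)) + R' := by
    rw [hR, Finset.sum_range_succ', add_zero, add_comm]
  have hmono : ∀ k < i, v (aeval x (z (r + 1))) < v (aeval x (z (r + 1 + (k + 1)))) := by
    intro k hk
    induction k with
    | zero => exact hinc (r + 1) (by omega)
    | succ k ih => exact (ih (by omega)).trans (hinc (r + 1 + (k + 1)) (by omega))
  have hzR : v (aeval x (z (r + 1))) = c ∧ (c : WithTop Γ) < v R' := by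
    have hlt' : v (aeval x (z (r + 1))) ≠ ⊤ → v (aeval x (z (r + 1))) < v R' := fun hne =>
      v.map_lt_sum hne fun k hk => hmono k (Finset.mem_range.1 hk)
    by_cases hne : v (aeval x (z (r + 1))) = ⊤
    · rcases Nat.eq_zero_or_pos i with rfl | hi
      · rw [hRR, hR', Finset.range_zero, Finset.sum_empty, add_zero, hne] at hRv
        exact absurd hRv WithTop.top_ne_coe
      · exact absurd (hmono 0 hi) (by rw [hne]; exact not_top_lt)
    · have h7 := hlt' hne
      have h8 : v R = v (aeval x (z (r + 1))) := by rw [hRR, v.map_add_eq_of_lt_left h7]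
      rw [← hRv, h8]
      exact ⟨rfl, h7⟩
  refine hmax (r + 1) (Nat.lt_succ_self r) (by omega) ?_
  rw [memT_iff (hk.mono hβb hb.ge) le_rfl hb hp]
  refine ⟨⟨fun k hk => hdeg k (by omega), htail.val_zero, fun k hk => hinc k (by omega)⟩, c, hzR.1, ?_⟩
  have h7 : (z (r + 1)).degree < (q + S).degree := by
    rw [degree_add_eq_left_of_degree_lt hsum]; exact hdeg _ (by omega)
  have hkc : IsKey v x (q + S) c := hkQ.mono hbc hc.ge
  have h8 := hkc.isVertex_of_special (s := z (r + 1)) (t := T) (n := n)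
    ⟨s, by rwa [degree_add_eq_left_of_degree_lt hsum], by rwa [add_assoc], by rwa [add_assoc]⟩ h7 (by
      have e : aeval x (q + S + z (r + 1)) = aeval x (q + S) + R - R' := by
        rw [hRR, map_add _ (q + S)]; ring
      rw [e]; exact lt_map_sub h6 hzR.2)
  rw [partialSum_succ, hQS]
  convert h8 using 1
  rw [nsmul_sub]
  grind

end Tschirnhaus

/-! ### Infinite sequences of steps -/

section Sequences

variable {K L Γ : Type*} [Field K] [Field L] [Algebra K L]
  [AddCommGroup Γ] [LinearOrder Γ] [IsOrderedAddMonoid Γ] [Nontrivial Γ]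
  [FiniteDimensional K L]
  {v : AddValuation L (WithTop Γ)} {x : L} {Q : Ordinal.{0} → K[X]} {l l' lam : Ordinal.{0}}
  {q : K[X]} {z : ℕ → K[X]} {p n n' r : ℕ} {b b' c t t' T γ : Γ}

omit [Nontrivial Γ] [FiniteDimensional K L] in
theorem IsState.degree_eq (h : IsState v x Q l) (h' : IsState v x Q l')
    (hd : (Q l').natDegree = (Q l).natDegree) : (Q l').degree = (Q l).degree := by
  rw [degree_eq_natDegree h.monic.ne_zero, degree_eq_natDegree h'.monic.ne_zero, hd]

/-- As long as the degree does not change, the pivotal ordinate does not increase, and it can only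
remain the same in the special case. -/
theorem IsState.pivot_le (h : IsState v x Q l) (h' : IsState v x Q l') (hl : l < l')
    (hd : (Q l').natDegree = (Q l).natDegree) (hb : v (aeval x (Q l)) = b)
    (hb' : v (aeval x (Q l')) = b') (hp : IsPivot v b t n (expand x (Q l) (minpoly K x)))
    (hp' : IsPivot v b' t' n' (expand x (Q l') (minpoly K x))) :
    n' ≤ n ∧ (n' = n → Special v x Q l) := by
  have hk := h.isKey hb
  have hlt := (h'.approx l hl).1
  have hs : (Q l' - Q l).degree < (Q l).degree :=
    degree_sub_lt_of_monic h'.monic h.monic (h.degree_eq h' hd)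
  have hsb : (b : WithTop Γ) ≤ v (aeval x (Q l' - Q l)) := by
    rw [map_sub]; rw [hb] at hlt; exact v.map_le_sub hlt.le hb.ge
  have h1 := hk.isPivot_add hs le_rfl hb.ge hsb hp
  rw [add_sub_cancel] at h1
  rw [hb, hb'] at hlt
  have hbb := WithTop.coe_lt_coe.1 hlt
  refine ⟨h1.lt_of_weightGE hp' hbb.le, ?_⟩
  rintro rfl
  rw [h.special_iff hb hp]
  refine ⟨Q l' - Q l, hs, ?_, ?_⟩
  · rwa [add_sub_cancel, hb']
  · rw [add_sub_cancel]; exact h1.isVertex_of_lt hp' hbb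

omit [FiniteDimensional K L] in
/-- After a maximal element of `T`, either the pivotal ordinate drops or the special case does not
occur. -/
theorem MaximalT.not_isVertex (hz : MaximalT v x q z r) (hk : IsKey v x q b)
    (hb : v (aeval x q) = b) (hp : IsPivot v b t n (expand x q (minpoly K x)))
    (hc : v (aeval x (partialSum q z (r + 1))) = c)
    (hpc : IsPivot v c T n (expand x (partialSum q z (r + 1)) (minpoly K x))) :
    ¬ ∃ s : K[X], s.degree < q.degree ∧
      (c : WithTop Γ) < v (aeval x (partialSum q z (r + 1) + s)) ∧
      IsVertex v c T n (expand x (partialSum q z (r + 1) + s) (minpoly K x)) := by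
  rintro ⟨s, hs, hlt, hver⟩
  obtain ⟨hT, hmax⟩ := hz
  obtain ⟨htail, hlast⟩ := hk.lt_val_of_memT hb hp hT
  have hsc : v (aeval x s) = c := by
    have e : aeval x s =
        aeval x (partialSum q z (r + 1) + s) - aeval x (partialSum q z (r + 1)) := by
      rw [map_add]; ring
    rw [← hc] at hlt ⊢
    rw [e, v.map_sub_eq_of_lt_right hlt]
  have hpQ := htail.isPivot hk le_rfl (le_refl (r + 1)) hb hp
  set z' : ℕ → K[X] := fun k => if k ≤ r then z k else s with hz'
  have hz1 : ∀ k ≤ r, z' k = z k := fun k hk => if_pos hk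
  have hz2 : z' (r + 1) = s := if_neg (by omega)
  have hsum : partialSum q z' (r + 1) = partialSum q z (r + 1) := by
    unfold partialSum
    congr 1
    exact Finset.sum_congr rfl fun k hk => hz1 k (by have := Finset.mem_range.1 hk; omega)
  refine hmax z' (r + 1) (Nat.lt_succ_self r) hz1 ?_
  rw [memT_iff hk le_rfl hb hp]
  refine ⟨⟨fun k hk => ?_, ?_, fun k hk => ?_⟩, c, by rw [hz2]; exact hsc, ?_⟩
  · simp only [hz']
    split_ifs with h
    · exact htail.degree_lt k h
    · exact hs
  · rw [hz1 0 (Nat.zero_le r)]; exact htail.val_zero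
  · rcases (Nat.lt_succ_iff.1 hk).lt_or_eq with h | rfl
    · rw [hz1 k h.le, hz1 (k + 1) h]; exact htail.val_lt k h
    · rw [hz1 k le_rfl, hz2]
      unfold val at hlast ⊢
      rwa [hsc, ← hc]
  · rw [partialSum_succ, hsum, hz2]
    convert hver using 1
    have h1 := hpQ.eq.symm.trans hpc.eq
    norm_cast at h1
    rw [nsmul_sub]
    grind

variable [Archimedean Γ]

/-- An infinite sequence of steps is only possible in residue characteristic zero, and the values
then tend to infinity. -/
theorem unbounded_of_steps (hchar : IsResidueExpChar v p) {c : ℕ → Ordinal.{0}}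
    (hst : ∀ k, IsState v x Q (c k)) (hstep : ∀ k, Step v x p Q (c k) (c (k + 1))) :
    p = 1 ∧ ∀ B : Γ, ∃ k, (B : WithTop Γ) < v (aeval x (Q (c k))) := by
  have hlt : ∀ k, c k < c (k + 1) := fun k => ((hstep k).isState hchar (hst k)).2.1
  have hdeg : ∀ k, (Q (c k)).natDegree ≤ (Q (c (k + 1))).natDegree := fun k =>
    ((hstep k).isState hchar (hst k)).2.2
  have hex : ∀ k, ∃ (b t : Γ) (n : ℕ), v (aeval x (Q (c k))) = b ∧
      IsPivot v b t n (expand x (Q (c k)) (minpoly K x)) := fun k => by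
    have hne : aeval x (Q (c k)) ≠ 0 := by
      obtain ⟨l', hl'⟩ : ∃ l', Step v x p Q (c k) l' := ⟨_, hstep k⟩
      cases hl' with
      | lift h0 _ _ => exact h0
      | block m h0 _ _ => exact h0
      | limit h0 _ _ _ => exact h0
    obtain ⟨b, hb⟩ := exists_coe_eq (v := v) hne
    obtain ⟨t, n, hp⟩ := exists_isPivot_minpoly ((hst k).isKey hb) b
    exact ⟨b, t, n, hb, hp⟩
  choose b t n hb hp using hex
  -- Degrees increase and are bounded by that of the minimal polynomial, so they stabilize; the
  -- differences are used because they decrease.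
  obtain ⟨k₀, hk₀⟩ := antitone_eventually_const
    (δ := fun k => (minpoly K x).natDegree - (Q (c k)).natDegree) fun k =>
      Nat.sub_le_sub_left (hdeg k) _
  have hdc : ∀ k ≥ k₀, (Q (c k)).natDegree = (Q (c k₀)).natDegree := fun k hk => by
    have h1 := hk₀ k hk
    have h2 := (hst k).natDegree_le
    have h3 := (hst k₀).natDegree_le
    omega
  have hpl : ∀ k ≥ k₀, n (k + 1) ≤ n k ∧ (n (k + 1) = n k → Special v x Q (c k)) := fun k hk =>
    (hst k).pivot_le (hst (k + 1)) (hlt k) ((hdc _ (by omega)).trans (hdc k hk).symm) (hb k)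
      (hb (k + 1)) (hp k) (hp (k + 1))
  obtain ⟨k₁', hk₁'⟩ := antitone_eventually_const (δ := fun k => n (k₀ + k)) fun k =>
    (hpl (k₀ + k) (by omega)).1
  set k₁ := k₀ + k₁' with hk₁
  have hn : ∀ k ≥ k₁, n k = n k₁ := fun k hk => by
    obtain ⟨i, rfl⟩ := Nat.exists_eq_add_of_le hk
    have := hk₁' (k₁' + i) (by omega)
    rwa [← add_assoc] at this
  have hS : ∀ k ≥ k₁, Special v x Q (c k) := fun k hk =>
    (hpl k (by omega)).2 ((hn (k + 1) (by omega)).trans (hn k hk).symm)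
  have hmono : StrictMono c := strictMono_nat_of_lt_succ hlt
  have hbmono : ∀ i j, i < j → b i < b j := fun i j hij => by
    have := ((hst j).approx _ (hmono hij)).1
    rw [hb, hb] at this
    exact_mod_cast this
  obtain ⟨β, hβ⟩ := (hst k₁).key
  have hβb : β ≤ b k₁ := by
    have := hβ.le_val
    rw [hb] at this
    exact_mod_cast this
  have hkey : ∀ k ≥ k₁, IsKey v x (Q (c k)) β := fun k hk => by
    have hd := (hst k₁).degree_eq (hst k) ((hdc k (by omega)).trans (hdc k₁ (by omega)).symm)
    have hβk : (β : WithTop Γ) ≤ v (aeval x (Q (c k))) := by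
      rw [hb]
      rcases hk.eq_or_lt with h | h
      · exact_mod_cast (h ▸ hβb)
      · exact_mod_cast hβb.trans (hbmono _ _ h).le
    have := hβ.add (z := Q (c k) - Q (c k₁))
      (degree_sub_lt_of_monic (hst k).monic (hst k₁).monic hd)
      (by rw [map_sub]; exact v.map_le_sub hβk hβ.le_val)
    rwa [add_sub_cancel] at this
  -- The margin is taken one step after `k₁`: the common weight `β` may equal `b k₁`, and room for
  -- `β + η ≤ b` exists only from `k₁ + 1` on.
  obtain ⟨η', hη', hab⟩ := (hp (k₁ + 1)).exists_aboveGE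
  set η := min η' (b (k₁ + 1) - b k₁) with hη
  have hη0 : 0 < η := lt_min hη' (sub_pos.2 (hbmono _ _ (Nat.lt_succ_self _)))
  have hβη : β + η ≤ b (k₁ + 1) := by
    have : η ≤ b (k₁ + 1) - b k₁ := min_le_right _ _
    grind
  -- With degree and pivot constant every index is special. This excludes liftings; a limit step
  -- would raise the degree, and a maximal element of `T` would be followed by a non-special index
  -- or a smaller pivot.
  have hT : ∀ k ≥ k₁, p = 1 ∧ ∃ z r, TschirnhausBlock v x (Q (c k)) z r ∧
      Q (c (k + 1)) = partialSum (Q (c k)) z (r + 1) := by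
    intro k hk
    have hnk : n (k + 1) = n k := (hn (k + 1) (by omega)).trans (hn k (by omega)).symm
    have hstk := hstep k
    have hsp' := ((hst (k + 1)).special_iff (hb (k + 1)) (hp (k + 1))).1 (hS (k + 1) (by omega))
    have hp' := hp (k + 1)
    have hb' := hb (k + 1)
    have hnd := (hdc (k + 1) (by omega)).trans (hdc k (by omega)).symm
    have hdd := (hst k).degree_eq (hst (k + 1)) hnd
    rw [hnk] at hsp' hp'
    generalize c (k + 1) = l' at *
    cases hstk with
    | lift _ hns _ => exact absurd (hS k (by omega)) hns
    | limit _ _ hI hL =>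
      exact absurd hnd ((hst k).limit hchar (hb k) (hS k (by omega)) hI hL).2.ne'
    | block m _ _ hF =>
      obtain ⟨z, r, rfl, hQ, h⟩ := hF
      have hQ' := hQ (r + 1) le_rfl
      rcases h with ⟨hp1, h⟩ | ⟨-, h⟩
      · exact ⟨hp1, z, r, h, hQ'⟩
      · rw [hdd] at hsp'
        rw [hQ'] at hsp' hp' hb'
        exact absurd hsp' (h.not_isVertex ((hst k).isKey (hb k)) (hb k) (hp k) hb' hp')
  have hp1 := (hT k₁ le_rfl).1
  refine ⟨hp1, fun B => ?_⟩
  have main : ∀ i, AboveGE v (b (k₁ + 1 + i)) (t (k₁ + 1 + i) + η) (n (k₁ + 1 + i))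
      (expand x (Q (c (k₁ + 1 + i))) (minpoly K x)) ∧ b (k₁ + 1) + i • η ≤ b (k₁ + 1 + i) := by
    intro i
    induction i with
    | zero =>
      refine ⟨hab.mono (add_le_add_right (min_le_left _ _) _), ?_⟩
      rw [zero_nsmul, add_zero, add_zero]
    | succ i ih =>
      set k := k₁ + 1 + i with hk
      have hkk : k₁ + 1 + (i + 1) = k + 1 := by omega
      rw [hkk]
      have hnk : n (k + 1) = n k := (hn (k + 1) (by omega)).trans (hn k (by omega)).symm
      have hsp' := ((hst (k + 1)).special_iff (hb (k + 1)) (hp (k + 1))).1 (hS (k + 1) (by omega))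
      have hp' := hp (k + 1)
      have hb' := hb (k + 1)
      have hdd := (hst k).degree_eq (hst (k + 1))
        ((hdc (k + 1) (by omega)).trans (hdc k (by omega)).symm)
      obtain ⟨-, z, r, h, hQ'⟩ := hT k (by omega)
      rw [hnk, hdd] at hsp'
      rw [hnk] at hp' ⊢
      rw [hQ'] at hsp' hp' hb' ⊢
      have hβk : β + η ≤ b k := by
        have h2 := ih.2
        have := nsmul_nonneg hη0.le i
        grind
      obtain ⟨h1, h2⟩ := h.add_le (hchar.zero_of_one hp1) (hkey k (by omega)) hβk hη0 (hb k) (hp k)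
        ih.1 hb' hp' hsp'
      refine ⟨h2, ?_⟩
      rw [succ_nsmul]
      have := ih.2
      grind
  obtain ⟨m, hm⟩ := Archimedean.arch (B - b (k₁ + 1)) hη0
  refine ⟨k₁ + 1 + (m + 1), ?_⟩
  rw [hb, WithTop.coe_lt_coe]
  refine lt_of_lt_of_le ?_ (main (m + 1)).2
  rw [succ_nsmul]
  grind

/-- Every element is a combination of monomials in the members of a system of key polynomials. -/
theorem IsKeyPolynomialSystem.mem_monomialGroup (hp : IsResidueExpChar v p)
    (hx : Algebra.adjoin K {x} = ⊤) (hx0 : 0 < v x) (hQ : IsKeyPolynomialSystem v x p lam Q)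
    {y : L} (hy : (γ : WithTop Γ) ≤ v y) :
    y ∈ monomialGroup K v (fun i : Set.Iio lam => aeval x (Q i)) γ := by
  obtain ⟨hQ0, h⟩ := hQ
  have hst0 := isState_zero hQ0 hx0
  rcases h with ⟨l, hl, h0, rfl⟩ | ⟨l, hl, h0, hS, hI, rfl, hp1⟩ | ⟨c, hc, hstep, hlub, hp1⟩
  · exact (isState_of_reflTransGen hp hst0 hl).mem_of_terminal hx h0 hy
  · have hst := isState_of_reflTransGen hp hst0 hl
    obtain ⟨b, hb⟩ := exists_coe_eq (v := v) h0
    obtain ⟨bs, hbs⟩ := hI.exists_isKeySeq hst hb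
    have hlω : l < l + Ordinal.omega0 := lt_add_of_pos_right _ Ordinal.omega0_pos
    have hunb : ∀ B, ∃ s, B < bs s := by
      by_contra! hcon
      obtain ⟨B, hB⟩ := hcon
      rcases hp1 with rfl | hunb
      -- A bounded sequence without a limit of its own degree forces `p ≠ 1`.
      · obtain ⟨e, t, g, -, h1, -⟩ := hbs.exists_pow_limit hB hp (hI.not_isLimit_one hst hb hS hbs)
        exact h1 rfl
      · obtain ⟨i, hi, hBi⟩ := hunb B
        unfold val at hBi
        rcases lt_or_ge i l with hil | hil
        · have h1 := (hst.approx i hil).1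
          have h2 := hbs.val 0
          rw [Nat.cast_zero, add_zero] at h2
          rw [h2] at h1
          have h3 := hBi.trans h1
          exact absurd (hB 0) (not_le.2 (WithTop.coe_lt_coe.1 h3))
        · obtain ⟨a, rfl⟩ : ∃ a, i = l + a := ⟨i - l, (Ordinal.add_sub_cancel_of_le hil).symm⟩
          rw [add_lt_add_iff_left] at hi
          obtain ⟨s, rfl⟩ := Ordinal.lt_omega0.1 hi
          rw [hbs.val s] at hBi
          exact absurd (hB s) (not_le.2 (WithTop.coe_lt_coe.1 hBi))
    refine hst.mem_of_unbounded hlω hx (fun B => ?_) hy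
    obtain ⟨s, hs⟩ := hunb B
    refine ⟨l + (s : Ordinal.{0}), add_lt_add_right (Ordinal.natCast_lt_omega0 s) l, ?_,
      (hbs.key s).monic, ?_⟩
    · rw [hbs.val s]; exact_mod_cast hs
    · have := hbs.degree_eq s
      rwa [Nat.cast_zero, add_zero] at this
  · have hst : ∀ k, IsState v x Q (c k) := fun k => by
      induction k with
      | zero => exact isState_of_reflTransGen hp hst0 hc
      | succ k ih => exact ((hstep k).isState hp ih).1
    have hlt : ∀ k, c k < c (k + 1) := fun k => ((hstep k).isState hp (hst k)).2.1
    have hdeg : ∀ k, (Q (c k)).natDegree ≤ (Q (c (k + 1))).natDegree := fun k =>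
      ((hstep k).isState hp (hst k)).2.2
    have hmono : StrictMono c := strictMono_nat_of_lt_succ hlt
    have hclam : ∀ k, c k < lam := fun k => (hlt k).trans_le (hlub.1 ⟨k + 1, rfl⟩)
    have hunb : ∀ B : Γ, ∃ k, (B : WithTop Γ) < v (aeval x (Q (c k))) := fun B => by
      rcases hp1 with rfl | hunb
      · exact (unbounded_of_steps hp hst hstep).2 B
      · obtain ⟨i, hi, hBi⟩ := hunb B
        obtain ⟨_, ⟨k, rfl⟩, hik⟩ := (lt_isLUB_iff hlub).1 hi
        exact ⟨k, lt_trans hBi ((hst k).approx i hik).1⟩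
    obtain ⟨k₀, hk₀⟩ := antitone_eventually_const
      (δ := fun k => (minpoly K x).natDegree - (Q (c k)).natDegree) fun k =>
        Nat.sub_le_sub_left (hdeg k) _
    refine (hst k₀).mem_of_unbounded (hclam k₀) hx (fun B => ?_) hy
    obtain ⟨k, hk⟩ := hunb B
    refine ⟨c (max k k₀), hclam _, ?_, (hst _).monic, (hst k₀).degree_eq (hst _) ?_⟩
    · rcases le_total k k₀ with h | h
      · rw [max_eq_right h]
        rcases h.eq_or_lt with rfl | h
        · exact hk
        · exact hk.trans ((hst k₀).approx _ (hmono h)).1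
      · rwa [max_eq_left h]
    · have h1 := hk₀ (max k k₀) (le_max_right _ _)
      have h2 := (hst (max k k₀)).natDegree_le
      have h3 := (hst k₀).natDegree_le
      omega

end Sequences

/-! ### Cofinal sequences -/

section Cofinal

/-- A nonempty subset of an archimedean group without a largest element has a cofinal strictly
increasing sequence. -/
theorem exists_strictMono_cofinal {Γ : Type*} [AddCommGroup Γ] [LinearOrder Γ]
    [IsOrderedAddMonoid Γ] [Archimedean Γ] {W : Set Γ} (hW : W.Nonempty)
    (hmax : ∀ w ∈ W, ∃ w' ∈ W, w < w') :
    ∃ u : ℕ → Γ, StrictMono u ∧ (∀ n, u n ∈ W) ∧ ∀ w ∈ W, ∃ n, w < u n := by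
  -- By Hölder's theorem `Γ` embeds in the reals. The arctangent makes the image bounded, so its
  -- supremum exists even when `W` is unbounded, and a sequence converging to it is cofinal.
  obtain ⟨f, hf⟩ := Archimedean.exists_orderAddMonoidHom_real_injective Γ
  have hfm : StrictMono f := f.monotone'.strictMono_of_injective hf
  set g : Γ → ℝ := fun w => Real.arctan (f w) with hg
  have hgm : StrictMono g := Real.arctan_strictMono.comp hfm
  have hne : (g '' W).Nonempty := hW.image g
  have hbdd : BddAbove (g '' W) := ⟨Real.pi / 2, by
    rintro _ ⟨w, -, rfl⟩
    exact (Real.arctan_lt_pi_div_two _).le⟩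
  have hlub := isLUB_csSup hne hbdd
  have hlt : ∀ w ∈ W, g w < sSup (g '' W) := fun w hw => by
    obtain ⟨w', hw', h⟩ := hmax w hw
    exact (hgm h).trans_le (hlub.1 ⟨w', hw', rfl⟩)
  have hnot : sSup (g '' W) ∉ g '' W := by
    rintro ⟨w, hw, h⟩
    exact (hlt w hw).ne h
  obtain ⟨a, ha, -, hlim, hmem⟩ := hlub.exists_seq_strictMono_tendsto_of_notMem hnot hne
  choose u hu hua using hmem
  refine ⟨u, fun i j hij => hgm.lt_iff_lt.1 ?_, hu, fun w hw => ?_⟩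
  · rw [hua, hua]; exact ha hij
  · obtain ⟨n, hn⟩ := (hlim.eventually (lt_mem_nhds (hlt w hw))).exists
    exact ⟨n, hgm.lt_iff_lt.1 (by rw [hua]; exact hn)⟩

variable {K L Γ : Type*} [Field K] [Field L] [Algebra K L]
  [AddCommGroup Γ] [LinearOrder Γ] [IsOrderedAddMonoid Γ] [Nontrivial Γ] [Archimedean Γ]
  {v : AddValuation L (WithTop Γ)} {x : L} {q : K[X]} {b : Γ}

omit [Nontrivial Γ] in
/-- If there is no largest value among the `q + s`, `deg s < deg q`, there is a cofinal sequence. -/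
theorem IsKey.exists_isKeySeq (hk : IsKey v x q b)
    (hne : ∃ s : K[X], s.degree < q.degree ∧ (b : WithTop Γ) < v (aeval x (q + s)))
    (hmax : ∀ s : K[X], s.degree < q.degree → (b : WithTop Γ) < v (aeval x (q + s)) →
      ∃ s' : K[X], s'.degree < q.degree ∧ v (aeval x (q + s)) < v (aeval x (q + s'))) :
    ∃ (s : ℕ → K[X]) (w : ℕ → Γ), (∀ k, (s k).degree < q.degree) ∧ b < w 0 ∧
      IsKeySeq v x (fun k => q + s k) w ∧
      (∀ s' : K[X], s'.degree < q.degree → ∃ k, v (aeval x (q + s')) < w k) ∧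
      ∀ g, ¬ IsLimit v x (fun k => q + s k) w 1 g := by
  have hq0 := hk.monic.ne_zero
  -- All values in play are finite, since each is exceeded by another one.
  obtain ⟨u, hum, hu, hcof⟩ := exists_strictMono_cofinal (W := {w : Γ | b < w ∧
      ∃ s : K[X], s.degree < q.degree ∧ v (aeval x (q + s)) = w}) (by
    obtain ⟨s, hs, hlt⟩ := hne
    obtain ⟨s', -, hlt'⟩ := hmax s hs hlt
    obtain ⟨w, hw⟩ := WithTop.ne_top_iff_exists.1 hlt'.ne_top
    exact ⟨w, by rw [← hw] at hlt; exact WithTop.coe_lt_coe.1 hlt, s, hs, hw.symm⟩) (by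
    rintro w ⟨hbw, s, hs, hw⟩
    have hlt : (b : WithTop Γ) < v (aeval x (q + s)) := by rw [hw]; exact_mod_cast hbw
    obtain ⟨s', hs', h1⟩ := hmax s hs hlt
    obtain ⟨s'', -, h2⟩ := hmax s' hs' (hlt.trans h1)
    obtain ⟨w', hw'⟩ := WithTop.ne_top_iff_exists.1 h2.ne_top
    rw [hw, ← hw'] at h1
    have h3 := WithTop.coe_lt_coe.1 h1
    exact ⟨w', ⟨hbw.trans h3, s', hs', hw'.symm⟩, h3⟩)
  choose hbu s hs hsu using hu
  have hcof' : ∀ s' : K[X], s'.degree < q.degree → ∃ k, v (aeval x (q + s')) < u k := by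
    intro s' hs'
    rcases lt_or_ge (b : WithTop Γ) (v (aeval x (q + s'))) with h | h
    · obtain ⟨s'', -, h1⟩ := hmax s' hs' h
      obtain ⟨w, hw⟩ := WithTop.ne_top_iff_exists.1 h1.ne_top
      rw [← hw] at h ⊢
      obtain ⟨k, hk⟩ := hcof w ⟨WithTop.coe_lt_coe.1 h, s', hs', hw.symm⟩
      exact ⟨k, WithTop.coe_lt_coe.2 hk⟩
    · exact ⟨0, lt_of_le_of_lt h (WithTop.coe_lt_coe.2 (hbu 0))⟩
  have hsv : (b : WithTop Γ) ≤ v (aeval x (s 0)) := by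
    have e : aeval x (s 0) = aeval x (q + s 0) - aeval x q := by rw [map_add]; ring
    rw [e, ]
    exact v.map_le_sub (by rw [hsu]; exact_mod_cast (hbu 0).le) hk.le_val
  have hdeg : (q + s 0).degree = q.degree := degree_add_eq_left_of_degree_lt (hs 0)
  have hseq : IsKeySeq v x (fun k => q + s k) u := by
    refine ⟨(hk.add (hs 0) hsv).mono (hbu 0).le (hsu 0).ge, hsu, hum, fun k => ?_⟩
    rw [add_sub_add_left_eq_sub, hdeg]
    exact lt_of_le_of_lt (degree_sub_le _ _) (max_lt (hs k) (hs 0))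
  refine ⟨s, u, hs, hbu 0, hseq, hcof', fun g hg => ?_⟩
  have hd := hg.natDegree_eq
  rw [one_mul] at hd
  have hdg : (g - q).degree < q.degree := degree_sub_lt_of_monic hg.monic hk.monic (by
    rw [← hdeg, degree_eq_natDegree hg.monic.ne_zero, hd,
      degree_eq_natDegree (hk.add (hs 0) hsv).monic.ne_zero])
  obtain ⟨k, hk'⟩ := hcof' _ hdg
  rw [add_sub_cancel] at hk'
  have := hg.lt_val k
  rw [one_nsmul] at this
  exact lt_asymm this hk'

end Cofinal

/-! ### Existence of an infinite block -/

section ExistsInfiniteBlock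

variable {K L Γ : Type*} [Field K] [Field L] [Algebra K L]
  [AddCommGroup Γ] [LinearOrder Γ] [IsOrderedAddMonoid Γ] [Nontrivial Γ] [Archimedean Γ]
  {v : AddValuation L (WithTop Γ)} {x : L} {q : K[X]} {b t : Γ} {n : ℕ}

/-- If `T` has no maximal element, there is a cofinal sequence of elements of `T`. -/
theorem IsKey.exists_memT_seq (hk : IsKey v x q b) (hb : v (aeval x q) = b)
    (hp : IsPivot v b t n (expand x q (minpoly K x)))
    (hsp : ∃ z : K[X], z.degree < q.degree ∧ (b : WithTop Γ) < v (aeval x (q + z)) ∧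
      IsVertex v b t n (expand x (q + z) (minpoly K x)))
    (hmax : ¬ ∃ z r, MaximalT v x q z r) :
    ∃ z : ℕ → K[X], (∀ r, MemT v x q z r) ∧ ∀ z' r', MemT v x q z' r' →
      ∃ k : ℕ, val v x (partialSum q z' (r' + 1)) ≤ val v x (partialSum q z k) := by
  have hq0 := hk.monic.ne_zero
  -- `q + s` is a one-term element of `T`, and by hypothesis not maximal. The last vertex of a
  -- longer element gives one for the weight `w = v(q + s)`, with a translate of value greater than
  -- `w`.
  have hext : ∀ s : K[X], s.degree < q.degree → (b : WithTop Γ) < v (aeval x (q + s)) →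
      ∃ (w : Γ) (s' : K[X]), v (aeval x (q + s)) = w ∧ s'.degree < q.degree ∧
        (w : WithTop Γ) < v (aeval x (q + s')) ∧
        IsVertex v w (t + n • (w - b)) n (expand x (q + s') (minpoly K x)) := by
    intro s hs hlt
    have hT := hk.memT_const hb hp hsp hs hlt
    have hnot : ¬ MaximalT v x q (fun _ => s) 0 := fun h => hmax ⟨_, _, h⟩
    rw [MaximalT, not_and] at hnot
    have h1 := hnot hT
    push Not at h1
    obtain ⟨z', r', hr', hz', hT'⟩ := h1
    obtain ⟨htail, c, hc, hver⟩ := (memT_iff hk le_rfl hb hp z' r').1 hT'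
    obtain ⟨-, hlast⟩ := hk.lt_val_of_memT hb hp hT'
    have h2 : val v x (q + s) = val v x (z' 1) := by
      rw [← htail.val_partialSum hlast (show 1 ≤ r' by omega), partialSum_succ, partialSum_zero,
        hz' 0 le_rfl]
    have h3 : val v x (z' 1) ≤ val v x (z' r') := by
      rcases (show 1 ≤ r' by omega).eq_or_lt with h | h
      · rw [h]
      · exact (htail.lt_of_lt h le_rfl).le
    obtain ⟨w, hw⟩ : ∃ w : Γ, v (aeval x (q + s)) = w := by
      obtain ⟨w, hw⟩ := WithTop.ne_top_iff_exists.1 (h2.trans_lt (h3.trans_lt hlast)).ne_top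
      exact ⟨w, hw.symm⟩
    have hwc : w ≤ c := by
      have := h2.symm.le
      rw [← h2, hc, val, hw] at h3
      exact WithTop.coe_le_coe.1 h3
    have hbw : b ≤ w := by rw [hw] at hlt; exact (WithTop.coe_lt_coe.1 hlt).le
    refine ⟨w, ∑ i ∈ Finset.range (r' + 1), z' i, hw, htail.degree_sum_lt hq0 le_rfl, ?_, ?_⟩
    · rw [hc] at hlast
      exact lt_of_le_of_lt (WithTop.coe_le_coe.2 hwc) hlast
    · exact (htail.isPivot hk le_rfl le_rfl hb hp).isVertex_of_le hver hbw hwc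
  obtain ⟨s, w, hs, hbw, hseq, hcof, -⟩ := hk.exists_isKeySeq
    (by obtain ⟨z, h1, h2, -⟩ := hsp; exact ⟨z, h1, h2⟩)
    (fun s hs hlt => by
      obtain ⟨w, s', hw, hs', h1, -⟩ := hext s hs hlt
      exact ⟨s', hs', by rw [hw]; exact h1⟩)
  have hsw : ∀ k, v (aeval x (q + s k)) = w k := hseq.val
  have hbw' : ∀ k, b < w k := fun k => hbw.trans_le (hseq.strictMono.monotone (Nat.zero_le k))
  -- Successive differences: the partial sums are the `q + s k`, the first term has value `b` and
  -- the term `k + 1` has value `w k`.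
  set z : ℕ → K[X] := fun k => Nat.casesOn k (s 0) fun i => s (i + 1) - s i with hz
  have hz0 : z 0 = s 0 := rfl
  have hzs : ∀ k, z (k + 1) = s (k + 1) - s k := fun _ => rfl
  have hsum : ∀ k, partialSum q z (k + 1) = q + s k := by
    intro k
    induction k with
    | zero => rw [partialSum_succ, partialSum_zero, hz0]
    | succ k ih => rw [partialSum_succ, ih, hzs]; ring
  have hzv0 : v (aeval x (z 0)) = b := by
    have e : aeval x (s 0) = aeval x (q + s 0) - aeval x q := by rw [map_add]; ring
    rw [hz0, e, v.map_sub_eq_of_lt_right, hb]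
    rw [hb, hsw]; exact_mod_cast hbw
  have hzv : ∀ k, v (aeval x (z (k + 1))) = w k := fun k => by
    have e : aeval x (z (k + 1)) = aeval x (q + s (k + 1)) - aeval x (q + s k) := by
      rw [hzs, map_sub, map_add, map_add]; ring
    have h1 : w k < w (k + 1) := hseq.strictMono (Nat.lt_succ_self k)
    rw [e, v.map_sub_eq_of_lt_right, hsw]
    rw [hsw, hsw]; exact_mod_cast h1
  refine ⟨z, fun r => ?_, fun z' r' hT => ?_⟩
  · rw [memT_iff hk le_rfl hb hp]
    refine ⟨⟨fun k _ => ?_, hzv0.trans hb.symm, fun k _ => ?_⟩, ?_⟩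
    · cases k with
      | zero => exact hs 0
      | succ k => exact lt_of_le_of_lt (degree_sub_le _ _) (max_lt (hs _) (hs _))
    · unfold val
      rw [hzv]
      cases k with
      | zero => rw [hzv0]; exact_mod_cast hbw
      | succ k => rw [hzv]; exact_mod_cast hseq.strictMono (Nat.lt_succ_self k)
    · rw [hsum]
      cases r with
      | zero =>
        refine ⟨b, hzv0, ?_⟩
        rw [sub_self, nsmul_zero, add_zero]
        exact hk.isVertex_of_special hsp (hs 0) (by rw [hsw]; exact_mod_cast hbw)
      | succ r =>
        refine ⟨w r, hzv r, ?_⟩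
        obtain ⟨w', s', hw', hs', hlt, hver⟩ := hext (s r) (hs r)
          (by rw [hsw]; exact_mod_cast hbw' r)
        obtain rfl : w r = w' := by rw [hsw] at hw'; exact_mod_cast hw'
        have hs'v : (b : WithTop Γ) ≤ v (aeval x s') := by
          have e : aeval x s' = aeval x (q + s') - aeval x q := by rw [map_add]; ring
          rw [e]
          exact v.map_le_sub ((WithTop.coe_le_coe.2 (hbw' r).le).trans hlt.le) hk.le_val
        have hk' := hk.add hs' hs'v
        have hd' : (q + s').degree = q.degree := degree_add_eq_left_of_degree_lt hs'
        have h1 := hk'.isVertex_add (z := s (r + 1) - s') (b := w r)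
          (by rw [hd']; exact lt_of_le_of_lt (degree_sub_le _ _) (max_lt (hs _) hs'))
          (hbw' r).le hlt.le (by
            have e : aeval x (s (r + 1) - s') = aeval x (q + s (r + 1)) - aeval x (q + s') := by
              rw [map_sub, map_add, map_add]; ring
            rw [e]
            refine lt_map_sub ?_ hlt
            rw [hsw]; exact_mod_cast hseq.strictMono (Nat.lt_succ_self r)) hver
        rwa [show q + s' + (s (r + 1) - s') = q + s (r + 1) by ring] at h1
  · obtain ⟨htail, -⟩ := hk.lt_val_of_memT hb hp hT
    obtain ⟨k, hk'⟩ := hcof _ (htail.degree_sum_lt hq0 (le_refl (r' + 1)))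
    refine ⟨k + 1, ?_⟩
    rw [hsum]
    unfold val
    rw [hsw]
    exact hk'.le

end ExistsInfiniteBlock

/-! ### Existence of a block in residue characteristic zero -/

section ExistsTschirnhaus

variable {K L Γ : Type*} [Field K] [Field L] [Algebra K L] [FiniteDimensional K L]
  [AddCommGroup Γ] [LinearOrder Γ] [IsOrderedAddMonoid Γ] [Nontrivial Γ]
  {v : AddValuation L (WithTop Γ)} {x : L} {q : K[X]} {b t d γ : Γ} {n : ℕ}

/-- An approximation of a quotient of polynomials of degree less than that of a key polynomial `q`
can be improved, unless its precision exceeds the value of `q`. -/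
theorem IsKey.exists_closer (hk : IsKey v x q b) {A D z : K[X]} (hA : A.degree < q.degree)
    (hD : D.degree < q.degree) (hz : z.degree < q.degree) (hd : v (aeval x D) = d)
    (hb : (b : WithTop Γ) ≤ v (aeval x z)) (hγ : v (aeval x A / aeval x D - aeval x z) = γ)
    (hγq : (γ : WithTop Γ) ≤ v (aeval x q)) :
    ∃ y : K[X], y.degree < q.degree ∧ (γ : WithTop Γ) ≤ v (aeval x y) ∧
      (γ : WithTop Γ) < v (aeval x A / aeval x D - aeval x (z + y)) := by
  have hD0 : aeval x D ≠ 0 := ne_zero_of_le_coe hd.le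
  obtain ⟨e, he, -, -, he1, hed⟩ := hk.exists_inverse hD (by
    rintro rfl; exact hD0 (map_zero _))
  have hev : v (aeval x e) = ((-d : Γ) : WithTop Γ) := by
    rw [hd] at hed
    cases hv : v (aeval x e) with
    | top => rw [hv, WithTop.add_top] at hed; exact absurd hed WithTop.top_ne_zero
    | coe δ =>
      rw [hv] at hed
      norm_cast at hed ⊢
      exact (neg_eq_of_add_eq_zero_right hed).symm
  set c := (D * z) /ₘ q with hc
  set ρ := A - (D * z) %ₘ q with hρ
  have hρd : ρ.degree < q.degree :=
    lt_of_le_of_lt (degree_sub_le _ _) (max_lt hA (degree_modByMonic_lt _ hk.monic))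
  have hcv := hk.carry D z d b hD hz hd.ge hb
  rw [add_sub_cancel_right, ← hc] at hcv
  have hcq := lt_mul_of_lt_of_le hcv hγq
  have e1 : aeval x A - aeval x D * aeval x z = aeval x ρ - aeval x c * aeval x q := by
    have := congrArg (aeval x) (modByMonic_add_div (D * z) q)
    rw [map_add, map_mul, map_mul] at this
    rw [hρ, hc, map_sub, ← this]
    ring
  have e2 : v (aeval x A - aeval x D * aeval x z) = ((d + γ : Γ) : WithTop Γ) := by
    rw [← map_mul_coe hd hγ]
    congr 1
    field_simp
  have hρv : ((d + γ : Γ) : WithTop Γ) ≤ v (aeval x ρ) := by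
    rw [← sub_add_cancel (aeval x ρ) (aeval x c * aeval x q), ← e1]
    exact v.map_le_add e2.ge hcq.le
  have hy := hk.mod_val hρd he hρv hev.ge
  rw [show d + γ + -d = γ by abel] at hy
  refine ⟨(ρ * e) %ₘ q, degree_modByMonic_lt _ hk.monic, ?_, ?_⟩
  · rw [← sub_sub_cancel (aeval x ρ * aeval x e) (aeval x ((ρ * e) %ₘ q))]
    refine v.map_le_sub ?_ hy.le
    have := add_le_add hρv hev.ge
    rwa [← WithTop.coe_add, ← v.map_mul, show d + γ + -d = γ by abel] at this
  · have e3 : aeval x A / aeval x D - aeval x (z + (ρ * e) %ₘ q) =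
        (-(aeval x ρ * (aeval x D * aeval x e - 1)) - aeval x c * aeval x q) * (aeval x D)⁻¹ +
        (aeval x ρ * aeval x e - aeval x ((ρ * e) %ₘ q)) := by
      rw [map_add]
      field_simp
      linear_combination e1
    rw [e3]
    refine v.map_lt_add ?_ hy
    have h1 : ((d + γ : Γ) : WithTop Γ) < v (aeval x ρ * (aeval x D * aeval x e - 1)) := by
      have := lt_mul_of_lt_of_le (s := 0) he1 hρv
      rwa [zero_add, mul_comm] at this
    have h2 := lt_mul_of_lt_of_le (lt_map_sub (by rwa [v.map_neg]) hcq) (map_inv_coe hd).ge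
    rwa [show d + γ + -d = γ by abel] at h2

variable [Archimedean Γ]

/-- In residue characteristic zero the special case admits a block of length one, if there are terms
above the pivotal vertex. -/
theorem IsKey.exists_tschirnhausBlock (hk : IsKey v x q b) (h1 : IsResidueExpChar v 1)
    (hb : v (aeval x q) = b) (hp : IsPivot v b t n (expand x q (minpoly K x)))
    (hsp : ∃ z : K[X], z.degree < q.degree ∧ (b : WithTop Γ) < v (aeval x (q + z)) ∧
      IsVertex v b t n (expand x (q + z) (minpoly K x)))
    (habove : valAbove v x q (minpoly K x) ≠ ⊤) :
    ∃ z, TschirnhausBlock v x q z 0 := by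
  have hn := hk.pivot_pos hb hp
  obtain ⟨V, hV⟩ := WithTop.ne_top_iff_exists.1 habove
  obtain ⟨η, hη, ha⟩ := hp.exists_aboveGE
  have htV : t < V := by
    have h2 := le_valAbove hk.monic hk.natDegree_pos hb hp ha
    rw [← hV, WithTop.coe_le_coe] at h2
    exact lt_of_lt_of_le (lt_add_of_pos_right t hη) h2
  set f := minpoly K x with hf
  set A := digit q f (n - 1) with hA
  set D := (n : K[X]) * digit q f n with hD
  have hAd : A.degree < q.degree := degree_digit_lt hk.monic _ _
  have hDd : D.degree < q.degree := by
    rw [hD, ← nsmul_eq_mul]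
    exact lt_of_le_of_lt (degree_smul_le _ _) (degree_digit_lt hk.monic _ _)
  have hDx : aeval x D = n * (expand x q f).coeff n := by
    rw [hD, map_mul, map_natCast, coeff_expand hk.monic hk.natDegree_pos]
  have hDv : v (aeval x D) = ((t - n • b : Γ) : WithTop Γ) := by
    rw [hDx, v.map_mul, h1.zero_of_one rfl n hn.ne', zero_add, hp.eq]
  have hD0 : aeval x D ≠ 0 := ne_zero_of_le_coe hDv.le
  set u := aeval x A / aeval x D with hu
  -- In the special case `q + z` has a vertex, so its coefficient at `n - 1`, which is `A - D z` up
  -- to higher weight, is small. Division by `D`, where `n` is a unit, compares `z` with `u`.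
  have hclose : ∀ z : K[X], z.degree < q.degree → (b : WithTop Γ) < v (aeval x (q + z)) →
      v (aeval x z) = b ∧ (b : WithTop Γ) < v (u - aeval x z) := by
    intro z hz hlt
    have hzb : v (aeval x z) = b := by
      have e : aeval x z = aeval x (q + z) - aeval x q := by rw [map_add]; ring
      rw [e, v.map_sub_eq_of_lt_right (by rwa [hb]), hb]
    refine ⟨hzb, ?_⟩
    have hver := hk.isVertex_of_special hsp hz hlt
    have h2 := hk.expand_translate' hz le_rfl hb.ge hzb.ge hp.ge
    rw [sub_self, add_zero] at h2
    have h3 := (ha.comp (y := -aeval x z) (by rw [v.map_neg]; exact hzb.ge)).2 hn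
    have h4 := hver.gt (n - 1) (by omega)
    have h5 : ((t - (n - 1) • b : Γ) : WithTop Γ) < v (aeval x A - aeval x D * aeval x z) := by
      have e : aeval x A - aeval x D * aeval x z = (expand x (q + z) f).coeff (n - 1) -
          (expand x (q + z) f - (expand x q f).comp (X + C (-aeval x z))).coeff (n - 1) -
          (((expand x q f).comp (X + C (-aeval x z))).coeff (n - 1) -
            ((expand x q f).coeff (n - 1) + n * (expand x q f).coeff n * -aeval x z)) := by
        rw [coeff_sub, hDx, hA, coeff_expand hk.monic hk.natDegree_pos f (n - 1)]
        ring
      rw [e]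
      refine lt_map_sub (lt_map_sub h4 (h2 _)) (lt_of_lt_of_le (WithTop.coe_lt_coe.2 ?_) h3)
      grind
    have e : u - aeval x z = (aeval x A - aeval x D * aeval x z) * (aeval x D)⁻¹ := by
      rw [hu]; field_simp
    rw [e]
    have h6 := lt_mul_of_lt_of_le h5 (map_inv_coe hDv).ge
    have hb' : (n - 1) • b + b = n • b := by
      rw [← succ_nsmul, Nat.sub_add_cancel hn]
    rwa [← hb', show t - (n - 1) • b + -(t - ((n - 1) • b + b)) = b by abel] at h6
  -- a single term suffices if it is close enough to `u`
  have hblock : ∀ (z : K[X]) (φ w : L), z.degree < q.degree →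
      (b : WithTop Γ) < v (aeval x (q + z)) → u = aeval x z + φ + w * (aeval x q + u) →
      ((V + b - t : Γ) : WithTop Γ) ≤ v φ → 0 < v w → TschirnhausBlock v x q (fun _ => z) 0 := by
    intro z φ w hz hlt hsum hφ hw
    obtain ⟨hzb, hcl⟩ := hclose z hz hlt
    have hub : v u = b := eq_of_lt_sub hzb hcl
    refine ⟨1, u, φ, w, Nat.one_pos, ?_, fun _ _ => hz, ?_, fun k hk' => by omega, fun k _ => ?_,
      ?_, ?_, hw, hk.memT_const hb hp hsp hz hlt, fun k h2 h3 => by omega⟩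
    · rw [pivot_eq hk.monic hk.natDegree_pos hb hp, hu, hDx,
        coeff_expand hk.monic hk.natDegree_pos]
    · exact hzb.trans hub.symm
    · unfold val
      rw [hb, newtonVal_eq hk.monic hk.natDegree_pos hp, hzb, ← hV]
      norm_cast
      rw [add_comm]
      exact add_lt_add_left htV b
    · rwa [Finset.sum_range_one]
    · unfold val
      rw [hb, newtonVal_eq hk.monic hk.natDegree_pos hp, ← hV]
      refine le_trans (le_of_eq ?_) (add_le_add_right hφ (t : WithTop Γ))
      norm_cast
      abel
  by_contra! hno
  -- If no block exists, `u - z` can be absorbed neither in `φ` nor in `w (q + u)`; this bounds its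
  -- value in two ways.
  have hval : ∀ z : K[X], z.degree < q.degree → (b : WithTop Γ) < v (aeval x (q + z)) →
      v (u - aeval x z) < ((V + b - t : Γ) : WithTop Γ) ∧
      v (u - aeval x z) ≤ v (aeval x q + u) := by
    intro z hz hlt
    constructor
    · by_contra! h
      exact hno _ (hblock z (u - aeval x z) 0 hz hlt (by ring) h (by
        rw [v.map_zero]; exact WithTop.coe_lt_top _))
    · by_contra! h
      have h2 : aeval x q + u ≠ 0 := by
        intro h2; rw [h2, v.map_zero] at h; exact not_top_lt h
      refine hno _ (hblock z 0 ((u - aeval x z) / (aeval x q + u)) hz hlt (by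
        field_simp; ring) (by rw [v.map_zero]; exact le_top) ?_)
      obtain ⟨ε, hε⟩ := exists_coe_eq (v := v) h2
      rw [hε] at h
      have h3 := lt_mul_of_lt_of_le h (map_inv_coe hε).ge
      rwa [add_neg_cancel, ← div_eq_mul_inv] at h3
  have himp : ∀ z : K[X], z.degree < q.degree → (b : WithTop Γ) < v (aeval x (q + z)) →
      ∃ z' : K[X], z'.degree < q.degree ∧ (b : WithTop Γ) < v (aeval x (q + z')) ∧
        v (u - aeval x z) < v (u - aeval x z') := by
    intro z hz hlt
    obtain ⟨hzb, hcl⟩ := hclose z hz hlt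
    obtain ⟨h2, h3⟩ := hval z hz hlt
    obtain ⟨γ, hγ⟩ := WithTop.ne_top_iff_exists.1 h2.ne_top
    have hdeg : (q + z).degree = q.degree := degree_add_eq_left_of_degree_lt hz
    have h4 : (γ : WithTop Γ) ≤ v (aeval x (q + z)) := by
      have e : aeval x (q + z) = aeval x q + u - (u - aeval x z) := by rw [map_add]; ring
      rw [e]
      exact v.map_le_sub (hγ.le.trans h3) hγ.le
    obtain ⟨y, hy, hyv, hyc⟩ := (hk.add hz hzb.ge).exists_closer (A := A) (D := D) (z := z)
      (by rwa [hdeg]) (by rwa [hdeg]) (by rwa [hdeg]) hDv hzb.ge hγ.symm h4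
    rw [hdeg] at hy
    refine ⟨z + y, lt_of_le_of_lt (degree_add_le _ _) (max_lt hz hy), ?_, hγ ▸ hyc⟩
    rw [← add_assoc, map_add]
    exact v.map_lt_add hlt (lt_of_lt_of_le (hγ ▸ hcl) hyv)
  -- Since `z` can always be improved, `q + u` lies beyond `u - z`, so `q + z` and `u - z` have the
  -- same value. Improving the approximation thus raises the value of the key polynomial.
  have hqz : ∀ z : K[X], z.degree < q.degree → (b : WithTop Γ) < v (aeval x (q + z)) →
      v (aeval x (q + z)) = v (u - aeval x z) := by
    intro z hz hlt
    obtain ⟨z', hz', hlt', h2⟩ := himp z hz hlt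
    have h3 := h2.trans_le (hval z' hz' hlt').2
    have e : aeval x (q + z) = aeval x q + u - (u - aeval x z) := by rw [map_add]; ring
    rw [e, v.map_sub_swap, v.map_sub_eq_of_lt_left h3]
  obtain ⟨s, w, hs, hbw, hseq, -, hlim⟩ := hk.exists_isKeySeq
    (by obtain ⟨z, h2, h3, -⟩ := hsp; exact ⟨z, h2, h3⟩)
    (fun z hz hlt => by
      obtain ⟨z', hz', hlt', h2⟩ := himp z hz hlt
      exact ⟨z', hz', by rwa [hqz z hz hlt, hqz z' hz' hlt']⟩)
  -- The values are bounded by `V + b - t` and there is no limit of the same degree, which is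
  -- possible only if the residue characteristic is positive.
  obtain ⟨-, -, -, -, hne, -⟩ := hseq.exists_pow_limit (B := V + b - t) (fun k => by
    have hlt : (b : WithTop Γ) < v (aeval x (q + s k)) := by
      rw [hseq.val k]
      exact WithTop.coe_lt_coe.2 (hbw.trans_le (hseq.strictMono.monotone (Nat.zero_le k)))
    have h2 := (hval (s k) (hs k) hlt).1
    rw [← hqz _ (hs k) hlt, hseq.val k] at h2
    exact (WithTop.coe_lt_coe.1 h2).le) h1 hlim
  exact hne rfl

end ExistsTschirnhaus

/-! ### Existence of systems of key polynomials -/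

section Congr

variable {K L Γ : Type*} [Field K] [Field L] [Algebra K L]
  [AddCommGroup Γ] [LinearOrder Γ] [IsOrderedAddMonoid Γ]
  {v : AddValuation L (WithTop Γ)} {x : L} {p : ℕ} {Q Q' : Ordinal.{0} → K[X]} {l l' : Ordinal.{0}}

theorem Step.le (h : Step v x p Q l l') : l ≤ l' := by
  cases h <;> exact le_self_add

theorem gradedBelow_congr (h : ∀ i < l, Q' i = Q i) :
    gradedBelow v x Q' l = gradedBelow v x Q l := by
  unfold gradedBelow
  rw [Set.image_congr fun i (hi : i ∈ Set.Iio l) => by rw [h i hi]]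

theorem Special.congr (h : ∀ i ≤ l, Q' i = Q i) (hs : Special v x Q l) : Special v x Q' l := by
  unfold Special at hs ⊢
  rwa [gradedBelow_congr fun i hi => h i hi.le, h l le_rfl]

theorem special_congr (h : ∀ i ≤ l, Q' i = Q i) : Special v x Q' l ↔ Special v x Q l :=
  ⟨Special.congr fun i hi => (h i hi).symm, Special.congr h⟩

theorem LiftStep.congr (h : ∀ i ≤ l + 1, Q' i = Q i) (hs : LiftStep v x Q l) :
    LiftStep v x Q' l := by
  have hl : l ≤ l + 1 := le_self_add
  unfold LiftStep at hs ⊢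
  rwa [gradedBelow_congr fun i hi => h i (hi.le.trans hl), h l hl, h _ le_rfl]

theorem FiniteBlock.congr {m : ℕ} (h : ∀ i ≤ l + (m : Ordinal.{0}), Q' i = Q i)
    (hs : FiniteBlock v x p Q l m) : FiniteBlock v x p Q' l m := by
  obtain ⟨z, r, hm, hQ, h1⟩ := hs
  have hl : Q' l = Q l := h l le_self_add
  refine ⟨z, r, hm, fun k hk => ?_, by rwa [hl]⟩
  rw [hl, ← hQ k hk, h]
  exact add_le_add_right (by exact_mod_cast hk) l

theorem InfiniteBlock.congr (h : ∀ t : ℕ, Q' (l + (t : Ordinal.{0})) = Q (l + (t : Ordinal.{0})))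
    (hs : InfiniteBlock v x p Q l) : InfiniteBlock v x p Q' l := by
  have hl : Q' l = Q l := by simpa using h 0
  unfold InfiniteBlock at hs ⊢
  simpa only [h, hl] using hs

theorem isLimitPolynomial_congr
    (h : ∀ t : ℕ, Q' (l + (t : Ordinal.{0})) = Q (l + (t : Ordinal.{0}))) {e : ℕ} {g : K[X]} :
    IsLimitPolynomial v x p Q' l e g ↔ IsLimitPolynomial v x p Q l e g := by
  simp only [IsLimitPolynomial, h]

theorem LimitStep.congr (h : ∀ t : ℕ, Q' (l + (t : Ordinal.{0})) = Q (l + (t : Ordinal.{0})))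
    (hω : Q' (l + Ordinal.omega0) = Q (l + Ordinal.omega0)) (hs : LimitStep v x p Q l) :
    LimitStep v x p Q' l := by
  unfold LimitStep at hs ⊢
  simpa only [h, hω, isLimitPolynomial_congr h] using hs

/-- A step reads the family only up to its final index, so the family may be redefined beyond it;
this allows the construction to be built piece by piece. -/
theorem Step.congr (h : ∀ i ≤ l', Q' i = Q i) (hs : Step v x p Q l l') : Step v x p Q' l l' := by
  have hl : ∀ i ≤ l, Q' i = Q i := fun i hi => h i (hi.trans hs.le)
  cases hs with
  | lift h0 h1 h2 =>
    exact .lift l (by rwa [hl l le_rfl]) (by rwa [special_congr hl]) (h2.congr h)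
  | block m h0 h1 h2 => exact .block l m (by rwa [hl l le_rfl]) (h1.congr hl) (h2.congr h)
  | limit h0 h1 h2 h3 =>
    have ht : ∀ t : ℕ, Q' (l + (t : Ordinal.{0})) = Q (l + (t : Ordinal.{0})) := fun t =>
      h _ (add_le_add_right (Ordinal.natCast_lt_omega0 t).le l)
    exact .limit l (by rwa [hl l le_rfl]) (h1.congr hl) (h2.congr ht) (h3.congr ht (h _ le_rfl))

theorem reflTransGen_step_congr (h : ∀ i ≤ l', Q' i = Q i)
    (hs : Relation.ReflTransGen (Step v x p Q) l l') :
    Relation.ReflTransGen (Step v x p Q') l l' := by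
  induction hs with
  | refl => exact .refl
  | tail _ hs ih => exact (ih fun i hi => h i (hi.trans hs.le)).tail (hs.congr h)

theorem exists_extension (Q : Ordinal.{0} → K[X]) (l : Ordinal.{0}) (F : ℕ → K[X])
    (hF : F 0 = Q l) : ∃ Q' : Ordinal.{0} → K[X], (∀ i ≤ l, Q' i = Q i) ∧
      ∀ k : ℕ, Q' (l + (k : Ordinal.{0})) = F k := by
  have hinj : Function.Injective fun k : ℕ => l + (k : Ordinal.{0}) := fun i j hij => by
    exact_mod_cast (add_right_injective l) hij
  have hk : ∀ k : ℕ, Function.extend (fun k : ℕ => l + (k : Ordinal.{0})) F Q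
      (l + (k : Ordinal.{0})) = F k := fun k => hinj.extend_apply F Q k
  refine ⟨_, fun i hi => ?_, hk⟩
  rcases hi.eq_or_lt with rfl | hi
  · have := hk 0
    rwa [Nat.cast_zero, add_zero, hF] at this
  · refine Function.extend_apply' _ _ _ ?_
    rintro ⟨k, rfl⟩
    exact absurd hi (not_lt.2 le_self_add)

end Congr

/-! ### Continuing the construction and assembling a system. -/

section Existence

variable {K L Γ : Type*} [Field K] [Field L] [Algebra K L] [FiniteDimensional K L]
  [AddCommGroup Γ] [LinearOrder Γ] [IsOrderedAddMonoid Γ] [Nontrivial Γ] [Archimedean Γ]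
  {v : AddValuation L (WithTop Γ)} {x : L} {p : ℕ} {Q : Ordinal.{0} → K[X]} {l : Ordinal.{0}}

omit [Archimedean Γ] in
theorem IsState.exists_liftStep (h : IsState v x Q l) (h0 : aeval x (Q l) ≠ 0)
    (hS : ¬ Special v x Q l) : ∃ (Q' : Ordinal.{0} → K[X]) (l' : Ordinal.{0}),
      (∀ i ≤ l, Q' i = Q i) ∧ Step v x p Q' l l' := by
  obtain ⟨b, hb⟩ := exists_coe_eq (v := v) h0
  obtain ⟨g, d, hg, hd⟩ := (h.isKey hb).exists_minimal hb
  have hQ : ∀ i ≤ l, Function.update Q (l + 1)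
      (Q l ^ g.natDegree + ∑ j ∈ Finset.range g.natDegree, d j * Q l ^ j) i = Q i := fun i hi =>
    Function.update_of_ne (hi.trans_lt (lt_add_one l)).ne _ _
  refine ⟨_, l + 1, hQ, .lift l (by rwa [hQ l le_rfl]) (by rwa [special_congr hQ]) ⟨g, d, ?_⟩⟩
  rw [gradedBelow_congr fun i hi => hQ i hi.le, hQ l le_rfl, h.gradedBelow_eq, initial_eq hb]
  exact ⟨hg, hd, Function.update_self _ _ _⟩

omit [FiniteDimensional K L] [Nontrivial Γ] [Archimedean Γ] in
theorem exists_finiteBlock (h0 : aeval x (Q l) ≠ 0) (hS : Special v x Q l) {z : ℕ → K[X]} {r : ℕ}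
    (hz : (p = 1 ∧ TschirnhausBlock v x (Q l) z r) ∨
      (UsesT v x p (Q l) ∧ MaximalT v x (Q l) z r)) :
    ∃ (Q' : Ordinal.{0} → K[X]) (l' : Ordinal.{0}), (∀ i ≤ l, Q' i = Q i) ∧ Step v x p Q' l l' := by
  obtain ⟨Q', hQ, hk⟩ := exists_extension Q l (partialSum (Q l) z) (partialSum_zero _ _)
  refine ⟨Q', _, hQ, .block l (r + 1) (by rwa [hQ l le_rfl]) (hS.congr hQ)
    ⟨z, r, rfl, fun k _ => ?_, by rwa [hQ l le_rfl]⟩⟩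
  rw [hk, hQ l le_rfl]

/-- The case in which `T` has no maximal element. -/
theorem exists_infiniteBlock (hp : IsResidueExpChar v p) (hx : 0 < v x)
    (hQ0 : Q 0 = X) (hl : Relation.ReflTransGen (Step v x p Q) 0 l) (h0 : aeval x (Q l) ≠ 0)
    (hS : Special v x Q l) (hU : UsesT v x p (Q l)) (hmax : ¬ ∃ z r, MaximalT v x (Q l) z r) :
    (∃ (Q' : Ordinal.{0} → K[X]) (l' : Ordinal.{0}), (∀ i ≤ l, Q' i = Q i) ∧ Step v x p Q' l l') ∨
      ∃ (lam : Ordinal.{0}) (Q' : Ordinal.{0} → K[X]), IsKeyPolynomialSystem v x p lam Q' := by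
  have h := isState_of_reflTransGen hp (isState_zero hQ0 hx) hl
  obtain ⟨b, hb⟩ := exists_coe_eq (v := v) h0
  have hk := h.isKey hb
  obtain ⟨t, n, hpiv⟩ := exists_isPivot_minpoly hk b
  obtain ⟨z, hT, hcof⟩ := hk.exists_memT_seq hb hpiv ((h.special_iff hb hpiv).1 hS) hmax
  obtain ⟨Q', hQ, hQk⟩ := exists_extension Q l (partialSum (Q l) z) (partialSum_zero _ _)
  have hQl : Q' l = Q l := hQ l le_rfl
  have h0' : aeval x (Q' l) ≠ 0 := by rwa [hQl]
  have hS' := hS.congr hQ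
  have hI : InfiniteBlock v x p Q' l := by
    refine ⟨by rwa [hQl], by rwa [hQl], z, by rwa [hQl], fun t => by rw [hQk, hQl], ?_⟩
    rw [hQl]
    simpa only [hQk] using hcof
  have hl' := reflTransGen_step_congr hQ hl
  have hQ0' : Q' 0 = X := by rw [hQ 0 bot_le, hQ0]
  -- Either the infinite block ends the system or its values are bounded with `p ≠ 1`, and a limit
  -- polynomial of least exponent exists.
  by_cases hend : p = 1 ∨ Unbounded v x Q' (l + Ordinal.omega0)
  · exact .inr ⟨_, Q', hQ0', .inr (.inl ⟨l, hl', h0', hS', hI, rfl, hend⟩)⟩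
  left
  push Not at hend
  obtain ⟨hp1, hbdd⟩ := hend
  unfold Unbounded at hbdd
  push Not at hbdd
  obtain ⟨B, hB⟩ := hbdd
  have hB' : ∀ t : ℕ, v (aeval x (Q' (l + (t : Ordinal.{0})))) ≤ B := fun t =>
    hB _ ((add_lt_add_iff_left l).2 (Ordinal.natCast_lt_omega0 t))
  have hst : IsState v x Q' l := isState_of_reflTransGen hp (isState_zero hQ0' hx) hl'
  obtain ⟨bs, hs⟩ := hI.exists_isKeySeq hst (by rwa [hQl])
  obtain ⟨e, s, g, he, -, haff, hlim, -⟩ := hs.exists_pow_limit (B := B) (fun t => by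
    have := hB' t
    rw [hs.val t] at this
    exact_mod_cast this) hp (hI.not_isLimit_one hst (by rwa [hQl]) hS' hs)
  have hex : ∃ e g, IsLimitPolynomial v x p Q' l e g := by
    refine ⟨e, g, he, ⟨s, haff⟩, fun s => ?_⟩
    have := hlim.lt_val s
    unfold val
    rwa [hs.val s]
  classical
  obtain ⟨g, hg⟩ := Nat.find_spec hex
  have hlt : ∀ i < l + Ordinal.omega0, Function.update Q' (l + Ordinal.omega0) g i = Q' i :=
    fun i hi => Function.update_of_ne hi.ne _ _
  have hle : ∀ i ≤ l, Function.update Q' (l + Ordinal.omega0) g i = Q' i := fun i hi =>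
    hlt i (hi.trans_lt (lt_add_of_pos_right l Ordinal.omega0_pos))
  have ht : ∀ t : ℕ, Function.update Q' (l + Ordinal.omega0) g (l + (t : Ordinal.{0})) =
      Q' (l + (t : Ordinal.{0})) := fun t =>
    hlt _ ((add_lt_add_iff_left l).2 (Ordinal.natCast_lt_omega0 t))
  refine ⟨_, _, fun i hi => (hle i hi).trans (hQ i hi), .limit l (by rwa [hle l le_rfl])
    (hS'.congr hle) (hI.congr ht) ⟨hp1, ⟨B, fun t => by rw [ht]; exact hB' t⟩, Nat.find hex, ?_⟩⟩
  simp only [isLimitPolynomial_congr ht]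
  rw [Function.update_self]
  exact ⟨hg, fun e' h' he' => Nat.find_min' hex ⟨h', he'⟩⟩

theorem exists_step (hp : IsResidueExpChar v p) (hx : 0 < v x) (hQ0 : Q 0 = X)
    (hl : Relation.ReflTransGen (Step v x p Q) 0 l) (h0 : aeval x (Q l) ≠ 0) :
    (∃ (Q' : Ordinal.{0} → K[X]) (l' : Ordinal.{0}), (∀ i ≤ l, Q' i = Q i) ∧ Step v x p Q' l l') ∨
      ∃ (lam : Ordinal.{0}) (Q' : Ordinal.{0} → K[X]), IsKeyPolynomialSystem v x p lam Q' := by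
  have h := isState_of_reflTransGen hp (isState_zero hQ0 hx) hl
  by_cases hS : Special v x Q l
  swap
  · exact .inl (h.exists_liftStep h0 hS)
  by_cases hU : UsesT v x p (Q l)
  · by_cases hmax : ∃ z r, MaximalT v x (Q l) z r
    · obtain ⟨z, r, hz⟩ := hmax
      exact .inl (exists_finiteBlock h0 hS (.inr ⟨hU, hz⟩))
    · exact exists_infiniteBlock hp hx hQ0 hl h0 hS hU hmax
  · unfold UsesT at hU
    push Not at hU
    obtain ⟨rfl, habove⟩ := hU
    obtain ⟨b, hb⟩ := exists_coe_eq (v := v) h0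
    have hk := h.isKey hb
    obtain ⟨t, n, hpiv⟩ := exists_isPivot_minpoly hk b
    obtain ⟨z, hz⟩ := hk.exists_tschirnhausBlock hp hb hpiv ((h.special_iff hb hpiv).1 hS) habove
    exact .inl (exists_finiteBlock h0 hS (.inl ⟨rfl, hz⟩))

theorem exists_isKeyPolynomialSystem (hp : IsResidueExpChar v p) (hx : 0 < v x) :
    ∃ (lam : Ordinal.{0}) (Q : Ordinal.{0} → K[X]), IsKeyPolynomialSystem v x p lam Q := by
  by_contra hno
  let S := {s : (Ordinal.{0} → K[X]) × Ordinal.{0} //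
    s.1 0 = X ∧ Relation.ReflTransGen (Step v x p s.1) 0 s.2}
  have hnext : ∀ s : S, ∃ s' : S, (∀ i ≤ s.1.2, s'.1.1 i = s.1.1 i) ∧
      Step v x p s'.1.1 s.1.2 s'.1.2 := by
    rintro ⟨⟨Q, l⟩, hQ0, hl⟩
    have h0 : aeval x (Q l) ≠ 0 := fun h0 => hno ⟨_, Q, hQ0, .inl ⟨l, hl, h0, rfl⟩⟩
    obtain ⟨Q', l', hQ, hs⟩ := (exists_step hp hx hQ0 hl h0).resolve_right hno
    exact ⟨⟨(Q', l'), (hQ 0 bot_le).trans hQ0, (reflTransGen_step_congr hQ hl).tail hs⟩, hQ, hs⟩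
  choose next hagree hstep using hnext
  let s : ℕ → S := fun k => next^[k] ⟨(fun _ => X, 0), rfl, .refl⟩
  have hs : ∀ k, s (k + 1) = next (s k) := fun k => Function.iterate_succ_apply' _ _ _
  set c : ℕ → Ordinal.{0} := fun k => (s k).1.2 with hc
  have hstep' : ∀ k, Step v x p (s (k + 1)).1.1 (c k) (c (k + 1)) := fun k => by
    have := hstep (s k)
    rwa [← hs] at this
  have hmono : Monotone c := monotone_nat_of_le_succ fun k => (hstep' k).le
  have hag : ∀ k j, k ≤ j → ∀ i ≤ c k, (s j).1.1 i = (s k).1.1 i := by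
    intro k j hkj
    induction j, hkj using Nat.le_induction with
    | base => exact fun _ _ => rfl
    | succ j hkj ih =>
      intro i hi
      rw [hs, hagree (s j) i (hi.trans (hmono hkj)), ih i hi]
  classical
  -- The families of the successive stages agree on their common initial segments and are glued,
  -- each index being read at the first stage that reaches it.
  set Q : Ordinal.{0} → K[X] := fun i =>
    if h : ∃ k, i ≤ c k then (s (Nat.find h)).1.1 i else X with hQ
  have hQc : ∀ k, ∀ i ≤ c k, Q i = (s k).1.1 i := by
    intro k i hi
    have h : ∃ k, i ≤ c k := ⟨k, hi⟩
    rw [hQ]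
    simp only [dif_pos h]
    exact (hag _ k (Nat.find_min' h hi) i (Nat.find_spec h)).symm
  have hreach : ∀ k, Relation.ReflTransGen (Step v x p Q) 0 (c k) := fun k =>
    reflTransGen_step_congr (hQc k) (s k).2.2
  have hQ0 : Q 0 = X := (hQc 0 0 bot_le).trans (s 0).2.1
  have hstepQ : ∀ k, Step v x p Q (c k) (c (k + 1)) := fun k => (hstep' k).congr (hQc (k + 1))
  -- Infinitely many steps force `p = 1`, and then the glued family is a system, against the
  -- assumption that there is none.
  have h1 := (unbounded_of_steps hp
    (fun k => isState_of_reflTransGen hp (isState_zero hQ0 hx) (hreach k)) hstepQ).1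
  exact hno ⟨⨆ k, c k, Q, hQ0, .inr (.inr ⟨c, hreach 0, hstepQ,
    isLUB_ciSup (Ordinal.bddAbove_of_small), .inl h1⟩)⟩

end Existence

/-! ### The residue characteristic -/

section ResidueChar

variable {K L Γ : Type*} [Field K] [Field L] [Algebra K L]
  [AddCommGroup Γ] [LinearOrder Γ] [IsOrderedAddMonoid Γ]
  {ν : AddValuation K (WithTop Γ)} {v : AddValuation L (WithTop Γ)} {x : L}

theorem natCast_residueField_eq_zero_iff [Nontrivial Γ] (m : ℕ) :
    (m : IsLocalRing.ResidueField (AddValuation.toValuation ν).valuationSubring) = 0 ↔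
      0 < ν (m : K) := by
  rw [← map_natCast (IsLocalRing.residue (AddValuation.toValuation ν).valuationSubring) m,
    IsLocalRing.residue_eq_zero_iff, ← ValuationSubring.coe_mem_nonunits_iff,
    ValuationSubring.mem_nonunits_iff_or]
  have h1 : ∀ y : K, y ∈ (AddValuation.toValuation ν).valuationSubring ↔ 0 ≤ ν y :=
    fun y => Iff.rfl
  rw [h1]
  push_cast
  by_cases hm : (m : K) = 0
  · simp only [hm, true_or, true_iff, ν.map_zero]
    exact WithTop.coe_lt_top _
  · obtain ⟨γ, hγ⟩ := exists_coe_eq (v := ν) hm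
    rw [map_inv_coe hγ, hγ]
    simp only [hm, false_or, not_le]
    norm_cast
    exact neg_lt_zero

theorem isResidueExpChar_residueExpChar [Nontrivial Γ]
    (hext : ∀ a : K, v (algebraMap K L a) = ν a) : IsResidueExpChar v (residueExpChar ν) := by
  have hv : ∀ m : ℕ, v (m : L) = 0 ↔
      ¬ (m : IsLocalRing.ResidueField (AddValuation.toValuation ν).valuationSubring) = 0 := by
    intro m
    rw [natCast_residueField_eq_zero_iff, ← map_natCast (algebraMap K L), hext,
      (zero_le_natCast ν m).not_lt_iff_eq, eq_comm]
  have hexp : ExpChar (IsLocalRing.ResidueField (AddValuation.toValuation ν).valuationSubring)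
      (residueExpChar ν) := ringExpChar.expChar _
  generalize residueExpChar ν = p at hexp ⊢
  cases hexp with
  | zero =>
    refine ⟨.inr rfl, fun _ m hm => ?_, fun h => absurd h Nat.not_prime_one,
      fun h => absurd h Nat.not_prime_one⟩
    rw [hv]
    exact_mod_cast hm
  | prime hp =>
    refine ⟨.inl hp, fun h => absurd h hp.ne_one, fun _ => ?_, fun _ m hm => ?_⟩
    · refine lt_of_le_of_ne (zero_le_natCast v p) fun h => ?_
      exact (hv p).1 h.symm (CharP.cast_eq_zero _ p)
    · rw [hv, CharP.cast_eq_zero_iff _ p]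
      exact hm

/-- If `v x ≤ 0`, every lower term of the minimal equation has value greater than that of `x^n`, so
they could not cancel. -/
theorem zero_lt_of_coeff [FiniteDimensional K L] (hext : ∀ a : K, v (algebraMap K L a) = ν a)
    (h : ∀ i < (minpoly K x).natDegree, 0 < ν ((minpoly K x).coeff i)) : 0 < v x := by
  have hint : IsIntegral K x := IsIntegral.of_finite K x
  by_contra! hx
  obtain ⟨γ, hγ⟩ := WithTop.ne_top_iff_exists.1 (hx.trans_lt (WithTop.coe_lt_top (0 : Γ))).ne
  rw [← hγ] at hx
  have hγ0 : γ ≤ 0 := by exact_mod_cast hx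
  set n := (minpoly K x).natDegree with hn
  have h0 := minpoly.aeval K x
  rw [aeval_eq_sum_range, Finset.sum_range_succ, ← hn, (minpoly.monic hint).coeff_natDegree,
    one_smul, add_eq_zero_iff_eq_neg] at h0
  have h1 : ((n • γ : Γ) : WithTop Γ) <
      v (∑ i ∈ Finset.range n, (minpoly K x).coeff i • x ^ i) := by
    refine v.map_lt_sum WithTop.coe_ne_top fun i hi => ?_
    rw [Algebra.smul_def]
    have hi' := Finset.mem_range.1 hi
    have h2 : ((0 : Γ) : WithTop Γ) < v (algebraMap K L ((minpoly K x).coeff i)) := by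
      rw [hext]; exact h i hi'
    have h3 := lt_mul_of_lt_of_le h2 (map_pow_coe i hγ.symm).ge
    refine lt_of_le_of_lt (WithTop.coe_le_coe.2 ?_) h3
    rw [zero_add]
    exact nsmul_le_nsmul_left_of_nonpos hγ0 hi'.le
  rw [h0, v.map_neg, map_pow_coe n hγ.symm] at h1
  exact lt_irrefl _ h1

end ResidueChar

end KeyPolynomials

end

theorem mainTheorem1 {K L Γ : Type*} [Field K] [Field L] [Algebra K L] [FiniteDimensional K L]
    [Algebra.IsSeparable K L] [AddCommGroup Γ] [LinearOrder Γ] [IsOrderedAddMonoid Γ]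
    [Archimedean Γ] (ν : AddValuation K (WithTop Γ)) (hν : ∃ a : K, a ≠ 0 ∧ ν a ≠ 0)
    (ν' : AddValuation L (WithTop Γ)) (hext : ∀ a : K, ν' (algebraMap K L a) = ν a)
    (x : L) (hx : Algebra.adjoin K {x} = ⊤)
    (hnorm : ∀ i < (minpoly K x).natDegree, 0 < ν ((minpoly K x).coeff i)) :
    (∃ (lam : Ordinal.{0}) (Q : Ordinal.{0} → K[X]),
      KeyPolynomials.IsKeyPolynomialSystem ν' x (KeyPolynomials.residueExpChar ν) lam Q) ∧
    ∀ (lam : Ordinal.{0}) (Q : Ordinal.{0} → K[X]),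
      KeyPolynomials.IsKeyPolynomialSystem ν' x (KeyPolynomials.residueExpChar ν) lam Q →
      KeyPolynomials.IsComplete ν ν' (fun i : Set.Iio lam => aeval x (Q i)) ∧
      KeyPolynomials.IsGradedComplete K ν' (fun i : Set.Iio lam => aeval x (Q i)) ∧
      ∀ ν'' : AddValuation L (WithTop Γ), (∀ a : K, ν'' (algebraMap K L a) = ν a) →
        (∀ i < lam, ν'' (aeval x (Q i)) = ν' (aeval x (Q i))) → ν'' = ν' := by
  -- In a trivial group the only values are `0` and `⊤`, and `⊤` is not taken at a unit.
  have : Nontrivial Γ := by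
    obtain ⟨a, ha, hνa⟩ := hν
    by_contra h
    rw [not_nontrivial_iff_subsingleton] at h
    cases hv : ν a with
    | top =>
      have h1 : ν (a * a⁻¹) = 0 := by rw [mul_inv_cancel₀ ha, ν.map_one]
      rw [ν.map_mul, hv, top_add] at h1
      exact WithTop.top_ne_zero h1
    | coe γ => exact hνa (by rw [hv, Subsingleton.elim γ 0, WithTop.coe_zero])
  have hp := KeyPolynomials.isResidueExpChar_residueExpChar hext
  have hx0 := KeyPolynomials.zero_lt_of_coeff hext hnorm
  refine ⟨KeyPolynomials.exists_isKeyPolynomialSystem hp hx0, fun lam Q hQ => ?_⟩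
  have hmem : ∀ (y : L) (γ : Γ), (γ : WithTop Γ) ≤ ν' y →
      y ∈ KeyPolynomials.monomialGroup K ν' (fun i : Set.Iio lam => aeval x (Q i)) γ :=
    fun _ _ hy => hQ.mem_monomialGroup hp hx hx0 hy
  exact ⟨KeyPolynomials.isComplete_of_monomialGroup hext hmem,
    KeyPolynomials.isGradedComplete_of_monomialGroup hmem, fun ν'' hν'' hQ'' =>
      KeyPolynomials.eq_of_monomialGroup (fun a => (hν'' a).trans (hext a).symm)
        (fun i : Set.Iio lam => hQ'' i.1 i.2) hmem⟩
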